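/- **Setting.** Let $n\ge 2$, $N\ge 6$, $0\le\lambda_1\le\dots\le\lambda_n<\tfrac12$ and $Q(z,\bar z)=\sum_j\big(|z_j|^2+\lambda_j(z_j^2+\bar z_j^2)\big)$ on $\mathbb C^n$. Let $M\subset\mathbb C^{n+1}$ be the graph $w=G(z,\bar z)+iE(z,\bar z)$ over an open neighbourhood $U$ of $0\in\mathbb C^n$, where $G,E$ are real-valued of class $C^N$, $G=Q+O(|z|^3)$ and $E=o(|z|^N)$ as $z\to0$. Assume that every CR point $q$ of $M$ (a point at which $M$ has CR dimension $n-1$) is non-minimal: there is a CR submanifold of CR dimension $n-1$ and of dimension smaller than $2n=\dim M$ that passes through $q$ and is contained in $M$. Put $A_{(k)}=\partial G/\partial z_k-i\,\partial E/\partial z_k$, and let $L_{j,k}$ be the $(1,0)$ vector field tangent to $M$ whose projection to $\mathbb C^n$ is $A_{(k)}\partial/\partial z_j-A_{(j)}\partial/\partial z_k$. Let $\mathcal E$ be the real distribution on a punctured neighbourhood of $0\in\mathbb C^n$ spanned by the projections of all $\mathrm{Re}\,L_{j,k}$, $\mathrm{Im}\,L_{j,k}$, $\mathrm{Im}[L_{j,k},\overline{L_{j,k}}]$;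 its leaves are the projections of the CR orbits of $M$. Fix a sufficiently small ball $B$ about $0$. For small $r>0$ let $S^0_r=\{z\in B: G(z)=r^2\}$ (model orbit), let $p_0=(0,\dots,0,(1+2\lambda_n)^{-1/2})$, let $r_a>0$ be the number with $r_ap_0\in S^0_r$, and let $S_r$ be the leaf of $\mathcal E$ in $B\setminus\{0\}$ through $r_ap_0$ (actual orbit). Let $\Omega^0_r$ and $\Omega_r$ be the domains enclosed by $S^0_r$ and $S_r$ (the union of the bounded components of the complement), and for $r^*>0$ put $$\widehat{M}^0_{r^*}=\{(z,u)\in\mathbb C^n\times\mathbb R: z\in\overline{\Omega^0_r},\ 0<u=r^2<{r^*}^2\}\cup\{0\},\qquad \widehat{M}^a_{r^*}=\{(z,u)\in\mathbb C^n\times\mathbb R: z\in\overline{\Omega_r},\ 0<u=r^2<{r^*}^2\}\cup\{0\}.$$ **Proposition 2.2.** For all sufficiently small $r^*>0$ the following holds. 1. For $0<r<r^*$ the number $r_a$ exists and is unique, for each $z\in S^0_r$ the ray from $0$ through $z$ meets $S_r$ in exactly one point $F_0(z)$, and $F_0:S^0_r\to S_r$ is onto. 2. The map $(z,u)\mapsto(F_0(z),u)$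 on $\{(z,u): z\in S^0_r,\ 0<u=r^2<{r^*}^2\}$ extends to a $C^{N-2}$ diffeomorphism $F$, preserving the coordinate $u$, from $\widehat{M}^0_{r^*}\setminus\{0\}$ onto $\widehat{M}^a_{r^*}\setminus\{0\}$ (both up to the boundary lying in $0<u<{r^*}^2$), such that for all $\alpha,\beta$ with $|\alpha|+|\beta|\le N-2$ $$D^\alpha_zD^\beta_u\big(F(z,u)-\mathrm{Id}\big)=o\big(u^{\frac{N-1-|\alpha|-2|\beta|}{2}}\big)\quad\text{as } (z,u)\to0 \text{ in } \widehat{M}^0_{r^*}\setminus\{0\}.$$ Here $\alpha$ ranges over the multi-indices of derivatives in $z$ and $\bar z$. 3. $\widehat{M}^a_{r^*}$ is a $C^{[(N-1)/2]}$-smooth domain with boundary, also at the origin: each of its points is an interior point or has a neighbourhood in $\mathbb C^n\times\mathbb R$ in which $\widehat{M}^a_{r^*}$ is $\{f\le0\}$ for a function $f$ of class $C^{[(N-1)/2]}$ with nowhere vanishing differential. -/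

import Mathlib

open Set Filter Topology Asymptotics

noncomputable section

/-- Complex Euclidean space `ℂⁿ` with its Euclidean norm. -/
abbrev Cn (n : ℕ) : Type := EuclideanSpace ℂ (Fin n)

/-! ### Submanifolds of a complex vector space and their CR structure -/

section CR

variable {V : Type*} [NormedAddCommGroup V] [NormedSpace ℂ V] [NormedSpace ℝ V]
  [IsScalarTower ℝ ℂ V]

/-- `S` is near `x` a `C¹` submanifold of real codimension `c`: the zero set of a `C¹` submersion
into `ℝᶜ`. -/
def IsC1SubmanifoldAt (S : Set V) (c : ℕ) (x : V) : Prop :=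
  ∃ W : Set V, IsOpen W ∧ x ∈ W ∧ ∃ f : V → (Fin c → ℝ), ContDiffOn ℝ 1 f W ∧
    S ∩ W = {y ∈ W | f y = 0} ∧ ∀ y ∈ S ∩ W, Function.Surjective (fderiv ℝ f y)

/-- The real tangent space of a submanifold `S` at `x`. -/
def realTangentSpace (S : Set V) (x : V) : Submodule ℝ V :=
  Submodule.span ℝ (tangentConeAt ℝ S x)

/-- The complex tangent space `T_x S ∩ i T_x S`, written as `{v ∈ T_x S | i v ∈ T_x S}`. -/
def complexTangentSpace (S : Set V) (x : V) : Submodule ℂ V where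
  carrier := {v | v ∈ realTangentSpace S x ∧ Complex.I • v ∈ realTangentSpace S x}
  add_mem' := by
    rintro v w ⟨hv, hv'⟩ ⟨hw, hw'⟩
    exact ⟨add_mem hv hw, by rw [smul_add]; exact add_mem hv' hw'⟩
  zero_mem' := by simp
  smul_mem' := by
    have key : ∀ (c : ℂ) (v : V), c • v = c.re • v + c.im • (Complex.I • v) := by
      intro c v
      rw [← algebraMap_smul ℂ c.re v, ← algebraMap_smul ℂ c.im (Complex.I • v), smul_smul,
        ← add_smul]
      simp [Complex.re_add_im]
    rintro c v ⟨hv, hv'⟩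
    refine ⟨?_, ?_⟩
    · rw [key c v]
      exact add_mem (Submodule.smul_mem _ _ hv) (Submodule.smul_mem _ _ hv')
    · rw [smul_smul, key (Complex.I * c) v]
      exact add_mem (Submodule.smul_mem _ _ hv) (Submodule.smul_mem _ _ hv')

/-- The CR dimension of `S` at `x`. -/
def crDim (S : Set V) (x : V) : ℕ := Module.finrank ℂ (complexTangentSpace S x)

/-- `S` is a (`C¹`) CR submanifold of real codimension `c` and CR dimension `d`. -/
def IsCRSubmanifold (S : Set V) (c d : ℕ) : Prop :=
  ∀ x ∈ S, IsC1SubmanifoldAt S c x ∧ crDim S x = d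

end CR

variable {n : ℕ}

/-- The graph `w = G(z) + i E(z)`, `z ∈ U`, in `ℂⁿ × ℂ = ℂⁿ⁺¹`; it has real dimension `2n`. -/
def graphManifold (U : Set (Cn n)) (G E : Cn n → ℝ) : Set (Cn n × ℂ) :=
  {q | q.1 ∈ U ∧ q.2 = (G q.1 : ℂ) + Complex.I * (E q.1 : ℂ)}

/-- For a submanifold `M ⊂ ℂⁿ⁺¹` of real codimension two, `q ∈ M` is a CR point if the CR dimension
of `M` at `q` is `n - 1`; at the remaining (CR singular) points it is `n`. -/
def IsCRPoint (M : Set (Cn n × ℂ)) (q : Cn n × ℂ) : Prop :=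
  q ∈ M ∧ crDim M q = n - 1

/-- The real codimension two submanifold `M ⊂ ℂⁿ⁺¹` is non-minimal at `q`: some CR submanifold of
smaller dimension than `M` (real codimension `c > 2` in `ℂⁿ⁺¹`) and of CR dimension `n - 1` passes
through `q` and is contained in `M`. -/
def IsNonMinimalAt (M : Set (Cn n × ℂ)) (q : Cn n × ℂ) : Prop :=
  ∃ S : Set (Cn n × ℂ), q ∈ S ∧ S ⊆ M ∧ ∃ c : ℕ, 2 < c ∧ IsCRSubmanifold S c (n - 1)

/-! ### The quadratic model -/

/-- `Q(z, z̄) = ∑ (|z_j|² + λ_j (z_j² + z̄_j²))`; note `z² + z̄² = 2 Re z²`. -/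
def quadModel (lam : Fin n → ℝ) (z : Cn n) : ℝ :=
  ∑ j, (‖z j‖ ^ 2 + lam j * (2 * ((z j) ^ 2).re))

/-- The point `p₀ = (0, …, 0, (1 + 2 λ_n)^{-1/2})` of the ellipsoid `Q = 1`. -/
def basePoint (hn : 0 < n) (lam : Fin n → ℝ) : Cn n :=
  EuclideanSpace.single ⟨n - 1, by omega⟩
    (((Real.sqrt (1 + 2 * lam ⟨n - 1, by omega⟩))⁻¹ : ℝ) : ℂ)

/-! ### The distribution of the CR orbits, projected to `ℂⁿ` -/

/-- The Wirtinger derivative `∂f/∂z_k`. -/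
def wirtinger (f : Cn n → ℂ) (k : Fin n) (z : Cn n) : ℂ :=
  (fderiv ℝ f z (EuclideanSpace.single k 1)
    - Complex.I * fderiv ℝ f z (EuclideanSpace.single k Complex.I)) / 2

/-- `A_(k) = ∂G/∂z_k - i ∂E/∂z_k`. -/
def coeffA (G E : Cn n → ℝ) (k : Fin n) (z : Cn n) : ℂ :=
  wirtinger (fun x => (G x : ℂ)) k z - Complex.I * wirtinger (fun x => (E x : ℂ)) k z

/-- The coefficient vector `a = (a_1, …, a_n)` of the projection to `ℂⁿ`,
`∑ a_i ∂/∂z_i = A_(k) ∂/∂z_j - A_(j) ∂/∂z_k`, of the `(1,0)` field `L_{j,k}` tangent to the graph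
`w = G + i E`. -/
def fieldL (G E : Cn n → ℝ) (j k : Fin n) (z : Cn n) : Cn n :=
  EuclideanSpace.single j (coeffA G E k z) - EuclideanSpace.single k (coeffA G E j z)

/-- `Re L_{j,k}`, projected to `ℂⁿ`; a real vector field `∑ (α_i ∂/∂x_i + β_i ∂/∂y_i)` is identified
with `(α_i + i β_i)_i`, so that `Re (∑ a_i ∂/∂z_i)` becomes `a / 2`. -/
def reL (G E : Cn n → ℝ) (j k : Fin n) (z : Cn n) : Cn n :=
  (1 / 2 : ℂ) • fieldL G E j k z

/-- `Im L_{j,k}`, projected to `ℂⁿ`: `Im (∑ a_i ∂/∂z_i)` becomes `-i a / 2`. -/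
def imL (G E : Cn n → ℝ) (j k : Fin n) (z : Cn n) : Cn n :=
  (-Complex.I / 2) • fieldL G E j k z

/-- `Im [L_{j,k}, conj L_{j,k}] = -2 [Re L_{j,k}, Im L_{j,k}]`, projected to `ℂⁿ`. -/
def imBracket (G E : Cn n → ℝ) (j k : Fin n) (z : Cn n) : Cn n :=
  (-2 : ℝ) • VectorField.lieBracket ℝ (reL G E j k) (imL G E j k) z

/-- The real distribution on `ℂⁿ` spanned by the projections of
`Re L_{j,k}`, `Im L_{j,k}`, `Im [L_{j,k}, conj L_{j,k}]`. -/
def crDistribution (G E : Cn n → ℝ) (z : Cn n) : Submodule ℝ (Cn n) :=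
  Submodule.span ℝ {v | ∃ j k : Fin n,
    v = reL G E j k z ∨ v = imL G E j k z ∨ v = imBracket G E j k z}

/-- `x` and `y` are the end points of a `C¹` curve in `W` that is tangent to the distribution `D`. -/
def TangentiallyJoined (D : Cn n → Submodule ℝ (Cn n)) (W : Set (Cn n)) (x y : Cn n) : Prop :=
  ∃ γ : ℝ → Cn n, ContDiffOn ℝ 1 γ (Icc 0 1) ∧ γ 0 = x ∧ γ 1 = y ∧
    ∀ t ∈ Icc (0 : ℝ) 1, γ t ∈ W ∧ derivWithin γ (Icc 0 1) t ∈ D (γ t)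

/-- The leaf through `x` of the distribution `D` on `W`: the points of `W` that are joined to `x` by
a piecewise `C¹` curve in `W` tangent to `D`. -/
def leaf (D : Cn n → Submodule ℝ (Cn n)) (W : Set (Cn n)) (x : Cn n) : Set (Cn n) :=
  {y | y ∈ W ∧ Relation.ReflTransGen (TangentiallyJoined D W) x y}

/-! ### Model and actual orbits and the regions they fill -/

/-- The model orbit `S⁰_r = {G = r²}` in the ball of radius `ρ`. -/
def modelOrbit (G : Cn n → ℝ) (ρ r : ℝ) : Set (Cn n) :=
  {z | z ∈ Metric.ball (0 : Cn n) ρ ∧ G z = r ^ 2}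

/-- The actual orbit `S_r`: the leaf, in the punctured ball of radius `ρ`, through the point
`r_a p₀`, `r_a > 0`, in which the ray of `p₀` meets `S⁰_r`. -/
def actualOrbit (G E : Cn n → ℝ) (p₀ : Cn n) (ρ r : ℝ) : Set (Cn n) :=
  {z | ∃ ra : ℝ, 0 < ra ∧ ra • p₀ ∈ modelOrbit G ρ r ∧
    z ∈ leaf (crDistribution G E) (Metric.ball (0 : Cn n) ρ \ {0}) (ra • p₀)}

/-- The domain enclosed by `S`: the union of the bounded components of its complement. -/
def enclosed (S : Set (Cn n)) : Set (Cn n) :=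
  {z | z ∉ S ∧ Bornology.IsBounded (connectedComponentIn Sᶜ z)}

/-- `{(z, u) : z ∈ closure Ω_r, 0 < u = r² < R²}` where `Ω_r` is the domain enclosed by `S r`. -/
def puncturedRegion (S : ℝ → Set (Cn n)) (R : ℝ) : Set (Cn n × ℝ) :=
  {p | ∃ r : ℝ, 0 < r ∧ r < R ∧ p.2 = r ^ 2 ∧ p.1 ∈ closure (enclosed (S r))}

/-- `z'` is a point of `S` on the ray from the origin through `z`. -/
def IsRayProjection (S : Set (Cn n)) (z z' : Cn n) : Prop :=
  z' ∈ S ∧ ∃ t : ℝ, 0 < t ∧ z' = t • z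

/-- `F`, with inverse `F'`, is a diffeomorphism of class `C^k` from `A` onto `B`, where `A`, `B` are
domains with (part of) their boundary. -/
def IsCkDiffeo (k : ℕ) (F F' : Cn n × ℝ → Cn n × ℝ) (A B : Set (Cn n × ℝ)) : Prop :=
  MapsTo F A B ∧ MapsTo F' B A ∧ InvOn F' F A B ∧
    ContDiffOn ℝ k F A ∧ ContDiffOn ℝ k F' B

/-- `A` is a `C^k`-smooth domain with boundary: each of its points is an interior point or has a
neighbourhood in which `A` is `{f ≤ 0}` for a `C^k` function `f` with non-vanishing differential. -/
def IsCkDomainWithBoundary (k : ℕ) (A : Set (Cn n × ℝ)) : Prop :=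
  ∀ p ∈ A, p ∈ interior A ∨ ∃ W : Set (Cn n × ℝ), IsOpen W ∧ p ∈ W ∧
    ∃ f : Cn n × ℝ → ℝ, ContDiffOn ℝ k f W ∧ (∀ q ∈ W, fderiv ℝ f q ≠ 0) ∧
      A ∩ W = {q ∈ W | f q ≤ 0}

/-- The mixed derivative of `f`, within `A`, taken `a` times in the real directions
`v 0, …, v (a - 1)` of `ℂⁿ` and `b` times in the variable `u`. As `v` varies this covers all
`D_z^α D_u^b` with `|α| = a`. -/
def mixedDeriv (f : Cn n × ℝ → Cn n × ℝ) (A : Set (Cn n × ℝ)) {a : ℕ} (v : Fin a → Cn n) (b : ℕ)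
    (p : Cn n × ℝ) : Cn n × ℝ :=
  iteratedFDerivWithin ℝ (a + b) f A p
    (Fin.append (fun i => ((v i, 0) : Cn n × ℝ)) (fun _ : Fin b => ((0, 1) : Cn n × ℝ)))

end

set_option linter.unusedSectionVars false

/-! ### Superposition operators on spaces of continuous functions -/

section Superposition

variable {Y : Type*} [TopologicalSpace Y] [CompactSpace Y]
  {E F H : Type*} [NormedAddCommGroup E] [NormedSpace ℝ E]
  [NormedAddCommGroup F] [NormedSpace ℝ F] [NormedAddCommGroup H] [NormedSpace ℝ H]

open Classical in
/-- The superposition operator `φ ↦ (y ↦ f y (φ y))`. -/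
noncomputable def nem (f : Y → E → F) (φ : C(Y, E)) : C(Y, F) :=
  if h : Continuous fun y => f y (φ y) then ⟨_, h⟩ else 0

/-- A continuous family of maps whose superposition operator is of class `C^k`. -/
structure SmoothFam (k : ℕ) (O : Set E) (f : Y → E → F) : Prop where
  cont : ContinuousOn (Function.uncurry f) (univ ×ˢ O)
  smooth : ContDiffOn ℝ k (nem f) {φ | ∀ y, φ y ∈ O}

theorem isOpen_forall_mem {O : Set E} (hO : IsOpen O) : IsOpen {φ : C(Y, E) | ∀ y, φ y ∈ O} := by
  have := ContinuousMap.isOpen_setOfPred_mapsTo (X := Y) (Y := E) isCompact_univ hO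
  convert this using 1
  ext φ
  simp [MapsTo]

theorem nem_apply {O : Set E} {f : Y → E → F}
    (hf : ContinuousOn (Function.uncurry f) (univ ×ˢ O)) {φ : C(Y, E)} (hφ : ∀ y, φ y ∈ O) (y : Y) :
    nem f φ y = f y (φ y) := by
  have h : Continuous fun y => f y (φ y) :=
    hf.comp_continuous (f := fun y => (y, φ y)) (by fun_prop) (fun y => ⟨mem_univ _, hφ y⟩)
  simp [nem, h]

theorem continuousOn_nem {O : Set E} {f : Y → E → F}
    (hf : ContinuousOn (Function.uncurry f) (univ ×ˢ O)) :
    ContinuousOn (nem f) {φ | ∀ y, φ y ∈ O} := by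
  rw [continuousOn_iff_continuous_domRestrict]
  refine ContinuousMap.continuous_of_continuous_uncurry _ ?_
  have h : Continuous fun p : {φ : C(Y, E) // ∀ y, φ y ∈ O} × Y => (p.2, p.1.1 p.2) := by
    fun_prop
  have := hf.comp_continuous h (fun p => ⟨mem_univ _, p.1.2 p.2⟩)
  refine this.congr fun p => ?_
  exact (nem_apply hf p.1.2 p.2).symm

/-- Pointwise application of a continuous family of operators. -/
noncomputable def pointwiseApply : C(Y, E →L[ℝ] F) →L[ℝ] C(Y, E) →L[ℝ] C(Y, F) :=
  LinearMap.mkContinuous₂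
    (LinearMap.mk₂ ℝ (fun (A : C(Y, E →L[ℝ] F)) (ψ : C(Y, E)) =>
        (⟨fun y => A y (ψ y), by fun_prop⟩ : C(Y, F)))
      (by intros; ext; simp) (by intros; ext; simp) (by intros; ext; simp) (by intros; ext; simp))
    1 (by
      intro A ψ
      rw [one_mul, ContinuousMap.norm_le _ (by positivity)]
      intro y
      exact (A y).le_of_opNorm_le_of_le (A.norm_coe_le_norm y) (ψ.norm_coe_le_norm y))

@[simp]
theorem pointwiseApply_apply (A : C(Y, E →L[ℝ] F)) (ψ : C(Y, E)) (y : Y) :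
    pointwiseApply A ψ y = A y (ψ y) := rfl

/-- The inclusion of the constant functions. -/
noncomputable def constCLM (Y E : Type*) [TopologicalSpace Y] [CompactSpace Y]
    [NormedAddCommGroup E] [NormedSpace ℝ E] : E →L[ℝ] C(Y, E) :=
  LinearMap.mkContinuous
    { toFun := fun e => ContinuousMap.const Y e
      map_add' := by intros; ext; simp
      map_smul' := by intros; ext; simp } 1 (by
      intro e
      rw [one_mul, ContinuousMap.norm_le _ (by positivity)]
      intro y
      simp)

@[simp]
theorem constCLM_apply (e : E) (y : Y) : constCLM Y E e y = e := rfl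

/-- Composition with a continuous map on the right. -/
noncomputable def precompCLM {Z : Type*} [TopologicalSpace Z] [CompactSpace Z] (p : C(Z, Y))
    (E : Type*) [NormedAddCommGroup E] [NormedSpace ℝ E] : C(Y, E) →L[ℝ] C(Z, E) :=
  LinearMap.mkContinuous
    { toFun := fun e => e.comp p
      map_add' := by intros; ext; simp
      map_smul' := by intros; ext; simp } 1 (by
      intro e
      rw [one_mul, ContinuousMap.norm_le _ (by positivity)]
      intro y
      exact e.norm_coe_le_norm _)

@[simp]
theorem precompCLM_apply {Z : Type*} [TopologicalSpace Z] [CompactSpace Z] (p : C(Z, Y))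
    (e : C(Y, E)) (z : Z) : precompCLM p E e z = e (p z) := rfl

/-- Pairing of continuous functions. -/
noncomputable def pairCLM (Y E F : Type*) [TopologicalSpace Y] [CompactSpace Y]
    [NormedAddCommGroup E] [NormedSpace ℝ E] [NormedAddCommGroup F] [NormedSpace ℝ F] :
    C(Y, E) × C(Y, F) →L[ℝ] C(Y, E × F) :=
  LinearMap.mkContinuous
    { toFun := fun e => e.1.prodMk e.2
      map_add' := by intros; ext <;> simp
      map_smul' := by intros; ext <;> simp } 1 (by
      intro e
      rw [one_mul, ContinuousMap.norm_le _ (by positivity)]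
      intro y
      exact max_le_max (e.1.norm_coe_le_norm _) (e.2.norm_coe_le_norm _))

@[simp]
theorem pairCLM_apply (e : C(Y, E) × C(Y, F)) (y : Y) : pairCLM Y E F e y = (e.1 y, e.2 y) := rfl

theorem hasFDerivAt_nem {O : Set E} (hO : IsOpen O) {f : Y → E → F} {f' : Y → E → E →L[ℝ] F}
    (hf : ContinuousOn (Function.uncurry f) (univ ×ˢ O))
    (hf' : ContinuousOn (Function.uncurry f') (univ ×ˢ O))
    (hd : ∀ y, ∀ x ∈ O, HasFDerivAt (f y) (f' y x) x) {φ : C(Y, E)} (hφ : ∀ y, φ y ∈ O) :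
    HasFDerivAt (nem f) (pointwiseApply (nem f' φ)) φ := by
  have hopen := isOpen_forall_mem (Y := Y) hO
  rw [hasFDerivAt_iff_isLittleO_nhds_zero, isLittleO_iff]
  intro ε hε
  have hcont : ContinuousAt (nem f') φ := (continuousOn_nem hf').continuousAt (hopen.mem_nhds hφ)
  obtain ⟨δ, hδ, hball⟩ : ∃ δ > 0, ∀ χ, dist χ φ < δ →
      (∀ y, χ y ∈ O) ∧ dist (nem f' χ) (nem f' φ) < ε := by
    obtain ⟨δ, hδ, h⟩ := Metric.eventually_nhds_iff.1
      ((hopen.eventually_mem hφ).and (hcont.eventually (Metric.ball_mem_nhds _ hε)))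
    exact ⟨δ, hδ, fun χ hχ => h hχ⟩
  have key : ∀ y, ∀ e ∈ Metric.ball (φ y) δ, e ∈ O ∧ ‖f' y e - f' y (φ y)‖ ≤ ε := by
    intro y e he
    have h1 : dist (φ + constCLM Y E (e - φ y)) φ < δ := by
      rw [dist_eq_norm, add_sub_cancel_left]
      refine lt_of_le_of_lt ?_ (by simpa [dist_eq_norm] using he)
      rw [ContinuousMap.norm_le _ (norm_nonneg _)]
      intro y
      simp
    obtain ⟨h2, h3⟩ := hball _ h1
    have h4 := h2 y
    simp only [ContinuousMap.add_apply, constCLM_apply, add_sub_cancel] at h4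
    refine ⟨h4, ?_⟩
    have h5 := (ContinuousMap.dist_apply_le_dist (f := nem f' (φ + constCLM Y E (e - φ y)))
      (g := nem f' φ) y).trans h3.le
    rw [nem_apply hf' h2, nem_apply hf' hφ, dist_eq_norm] at h5
    simpa using h5
  filter_upwards [Metric.ball_mem_nhds (0 : C(Y, E)) hδ] with ψ hψ
  have hψ' : ‖ψ‖ < δ := by simpa using hψ
  have hin := (hball (φ + ψ) (by simpa [dist_eq_norm] using hψ')).1
  rw [ContinuousMap.norm_le _ (by positivity)]
  intro y
  have hy : ‖ψ y‖ < δ := (ψ.norm_coe_le_norm y).trans_lt hψ'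
  simp only [ContinuousMap.sub_apply, pointwiseApply_apply]
  rw [nem_apply hf hin, nem_apply hf hφ, nem_apply hf' hφ]
  have := (convex_ball (φ y) δ).norm_image_sub_le_of_norm_hasFDerivWithin_le'
    (f := f y) (f' := f' y) (φ := f' y (φ y)) (C := ε)
    (fun e he => (hd y e (key y e he).1).hasFDerivWithinAt)
    (fun e he => (key y e he).2) (Metric.mem_ball_self hδ)
    (y := φ y + ψ y) (by simpa [dist_eq_norm] using hy)
  simp only [add_sub_cancel_left] at this
  refine this.trans ?_
  gcongr
  exact ψ.norm_coe_le_norm y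

theorem SmoothFam.succ {k : ℕ} {O : Set E} (hO : IsOpen O) {f : Y → E → F}
    {f' : Y → E → E →L[ℝ] F} (hf : ContinuousOn (Function.uncurry f) (univ ×ˢ O))
    (hd : ∀ y, ∀ x ∈ O, HasFDerivAt (f y) (f' y x) x) (hf' : SmoothFam k O f') :
    SmoothFam (k + 1) O f := by
  have hder : ∀ φ : C(Y, E), (∀ y, φ y ∈ O) →
      HasFDerivAt (nem f) (pointwiseApply (nem f' φ)) φ := fun φ hφ =>
    hasFDerivAt_nem hO hf hf'.cont hd hφ
  refine ⟨hf, ?_⟩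
  have := (contDiffOn_succ_iff_fderiv_of_isOpen (𝕜 := ℝ) (n := (k : WithTop ℕ∞)) (f := nem f)
    (isOpen_forall_mem (Y := Y) hO)).2
    ⟨fun φ hφ => (hder φ hφ).differentiableAt.differentiableWithinAt, by simp, ?_⟩
  · exact_mod_cast this
  · have h := hf'.smooth.continuousLinearMap_comp (pointwiseApply (Y := Y) (E := E) (F := F))
    exact h.congr fun φ hφ => (hder φ hφ).fderiv

theorem SmoothFam.of_le {k l : ℕ} (h : k ≤ l) {O : Set E} {f : Y → E → F} (hf : SmoothFam l O f) :
    SmoothFam k O f := ⟨hf.cont, hf.smooth.of_le (by exact_mod_cast h)⟩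

theorem SmoothFam.mono {k : ℕ} {O O' : Set E} {f : Y → E → F} (hf : SmoothFam k O f)
    (h : O' ⊆ O) : SmoothFam k O' f :=
  ⟨hf.cont.mono (prod_mono_right h), hf.smooth.mono fun _ hφ y => h (hφ y)⟩

theorem SmoothFam.congr {k : ℕ} {O : Set E} {f g : Y → E → F} (hf : SmoothFam k O f)
    (h : ∀ y, ∀ x ∈ O, g y x = f y x) : SmoothFam k O g := by
  have hc : ContinuousOn (Function.uncurry g) (univ ×ˢ O) :=
    hf.cont.congr fun p hp => h p.1 p.2 hp.2
  refine ⟨hc, hf.smooth.congr fun φ hφ => ?_⟩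
  ext y
  rw [nem_apply hc hφ, nem_apply hf.cont hφ, h _ _ (hφ y)]

theorem SmoothFam.zero {O : Set E} {f : Y → E → F}
    (hf : ContinuousOn (Function.uncurry f) (univ ×ˢ O)) : SmoothFam 0 O f :=
  ⟨hf, contDiffOn_zero (𝕜 := ℝ).2 (continuousOn_nem hf)⟩

theorem SmoothFam.param {k : ℕ} {O : Set E} (δ : C(Y, F)) :
    SmoothFam k O (fun y (_ : E) => δ y) := by
  have hc : ContinuousOn (Function.uncurry fun y (_ : E) => δ y) (univ ×ˢ O) := by
    apply Continuous.continuousOn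
    simp only [Function.uncurry_def]
    fun_prop
  have hδ : ContDiffOn ℝ k (fun _ : C(Y, E) => δ) {φ | ∀ y, φ y ∈ O} :=
    contDiffOn_const (c := δ)
  exact ⟨hc, hδ.congr fun φ hφ => ContinuousMap.ext fun y => nem_apply hc hφ y⟩

theorem SmoothFam.comp {k : ℕ} {O : Set E} {O' : Set F} {f : Y → E → F} {g : Y → F → H}
    (hg : SmoothFam k O' g) (hf : SmoothFam k O f) (h : ∀ y, ∀ x ∈ O, f y x ∈ O') :
    SmoothFam k O (fun y x => g y (f y x)) := by
  have hc : ContinuousOn (Function.uncurry fun y x => g y (f y x)) (univ ×ˢ O) :=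
    hg.cont.comp (f := fun p : Y × E => (p.1, f p.1 p.2)) (continuousOn_fst.prodMk hf.cont)
      fun p hp => ⟨mem_univ _, h _ _ hp.2⟩
  have hmem : ∀ φ ∈ {φ : C(Y, E) | ∀ y, φ y ∈ O}, nem f φ ∈ {φ : C(Y, F) | ∀ y, φ y ∈ O'} := by
    intro φ hφ y
    rw [nem_apply hf.cont hφ]
    exact h _ _ (hφ y)
  refine ⟨hc, (hg.smooth.comp hf.smooth hmem).congr fun φ hφ => ?_⟩
  ext y
  rw [nem_apply hc hφ, Function.comp_apply, nem_apply hg.cont (hmem φ hφ), nem_apply hf.cont hφ]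

theorem SmoothFam.prodMk {k : ℕ} {O : Set E} {f : Y → E → F} {g : Y → E → H}
    (hf : SmoothFam k O f) (hg : SmoothFam k O g) :
    SmoothFam k O (fun y x => (f y x, g y x)) := by
  have hc : ContinuousOn (Function.uncurry fun y x => (f y x, g y x)) (univ ×ˢ O) :=
    hf.cont.prodMk hg.cont
  refine ⟨hc, ((hf.smooth.prodMk hg.smooth).continuousLinearMap_comp (pairCLM Y F H)).congr
    fun φ hφ => ContinuousMap.ext fun y => ?_⟩
  rw [nem_apply hc hφ, ← nem_apply hf.cont hφ, ← nem_apply hg.cont hφ]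
  rfl

theorem SmoothFam.contDiffOn_slice {k : ℕ} {O : Set E} {f : Y → E → F} (hf : SmoothFam k O f)
    (y : Y) : ContDiffOn ℝ k (f y) O := by
  have h1 : ContDiffOn ℝ k (fun e => ContinuousMap.evalCLM ℝ y (nem f (constCLM Y E e))) O :=
    (ContinuousMap.evalCLM ℝ y : C(Y, F) →L[ℝ] F).contDiff.comp_contDiffOn
      (hf.smooth.comp (constCLM Y E).contDiff.contDiffOn fun e he y => he)
  refine h1.congr fun e he => ?_
  rw [ContinuousMap.evalCLM_apply, nem_apply hf.cont (fun y => he)]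
  rfl

theorem SmoothFam.fderiv_nem_apply {k : ℕ} (hk : 1 ≤ k) {O : Set E} (hO : IsOpen O)
    {f : Y → E → F} (hf : SmoothFam k O f) {φ : C(Y, E)} (hφ : ∀ y, φ y ∈ O) (ψ : C(Y, E)) (y : Y) :
    fderiv ℝ (nem f) φ ψ y = fderiv ℝ (f y) (φ y) (ψ y) := by
  have hk' : (k : WithTop ℕ∞) ≠ 0 := by exact_mod_cast (by omega : k ≠ 0)
  have hopen := isOpen_forall_mem (Y := Y) hO
  have h1 : HasFDerivAt (nem f) (fderiv ℝ (nem f) φ) φ :=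
    ((hf.smooth.contDiffAt (hopen.mem_nhds hφ)).differentiableAt hk').hasFDerivAt
  have h2 : HasFDerivAt (f y) (fderiv ℝ (f y) (φ y)) (φ y) :=
    (((hf.contDiffOn_slice y).contDiffAt (hO.mem_nhds (hφ y))).differentiableAt hk').hasFDerivAt
  have h3 : HasFDerivAt (fun χ => ContinuousMap.evalCLM ℝ y (nem f χ))
      ((ContinuousMap.evalCLM ℝ y).comp (fderiv ℝ (nem f) φ)) φ :=
    (ContinuousMap.evalCLM ℝ y : C(Y, F) →L[ℝ] F).hasFDerivAt.comp φ h1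
  have h4 : HasFDerivAt (fun χ : C(Y, E) => f y (ContinuousMap.evalCLM ℝ y χ))
      ((fderiv ℝ (f y) (φ y)).comp (ContinuousMap.evalCLM ℝ y)) φ :=
    HasFDerivAt.comp φ (f := fun χ : C(Y, E) => ContinuousMap.evalCLM ℝ y χ) (g := f y) h2
      (ContinuousMap.evalCLM ℝ y : C(Y, E) →L[ℝ] E).hasFDerivAt
  have h5 := h3.congr_of_eventuallyEq (f₁ := fun χ : C(Y, E) => f y (ContinuousMap.evalCLM ℝ y χ)) (by
    filter_upwards [hopen.mem_nhds hφ] with χ hχ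
    simp [nem_apply hf.cont hχ])
  have := DFunLike.congr_fun (h5.unique h4) ψ
  simpa using this

end Superposition

section

universe u

variable {Y : Type*} [TopologicalSpace Y] [CompactSpace Y]
  {E F H : Type u} [NormedAddCommGroup E] [NormedSpace ℝ E]
  [NormedAddCommGroup F] [NormedSpace ℝ F] [NormedAddCommGroup H] [NormedSpace ℝ H]

theorem SmoothFam.const {k : ℕ} {O : Set E} (hO : IsOpen O) {f : E → F} (hf : ContDiffOn ℝ k f O) :
    SmoothFam k O (fun _ : Y => f) := by
  induction k generalizing F with
  | zero =>
    exact SmoothFam.zero (hf.continuousOn.comp continuousOn_snd fun p hp => hp.2)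
  | succ k ih =>
    have hf1 : ContDiffOn ℝ ((k : WithTop ℕ∞) + 1) f O := by exact_mod_cast hf
    have h := (contDiffOn_succ_iff_fderiv_of_isOpen hO).1 hf1
    exact SmoothFam.succ hO (hf.continuousOn.comp continuousOn_snd fun p hp => hp.2)
      (fun y x hx => ((h.1 x hx).differentiableAt (hO.mem_nhds hx)).hasFDerivAt) (ih h.2.2)

theorem SmoothFam.map {k : ℕ} {O : Set E} {f : Y → E → F} (hf : SmoothFam k O f) {O' : Set F}
    (hO' : IsOpen O') {Φ : F → H} (hΦ : ContDiffOn ℝ k Φ O') (h : ∀ y, ∀ x ∈ O, f y x ∈ O') :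
    SmoothFam k O (fun y x => Φ (f y x)) :=
  (SmoothFam.const hO' hΦ).comp hf h

theorem SmoothFam.map_contDiff {k : ℕ} {O : Set E} {f : Y → E → F} (hf : SmoothFam k O f)
    {Φ : F → H} (hΦ : ContDiff ℝ k Φ) : SmoothFam k O (fun y x => Φ (f y x)) :=
  hf.map isOpen_univ hΦ.contDiffOn fun _ _ _ => mem_univ _

theorem SmoothFam.id {k : ℕ} {O : Set E} : SmoothFam k O (fun (_ : Y) (x : E) => x) :=
  (SmoothFam.const isOpen_univ contDiff_id.contDiffOn).mono (subset_univ _)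

end

section FixedPoint

variable {X Z : Type*} [NormedAddCommGroup X] [NormedSpace ℝ X] [CompleteSpace X]
  [NormedAddCommGroup Z] [NormedSpace ℝ Z] [CompleteSpace Z]

theorem isInvertible_one_sub {L : Z →L[ℝ] Z} (hL : ‖L‖ < 1) :
    (ContinuousLinearMap.id ℝ Z - L).IsInvertible :=
  ⟨ContinuousLinearEquiv.unitsEquiv ℝ Z (Units.oneSub L hL), by ext; simp⟩

/-- The fixed points of a `C^k` family of uniform contractions depend on the parameter in a `C^k`
way. -/
theorem contDiffOn_fixedPoint_of_isOpen {k : ℕ} (hk : k ≠ 0) {D : Set X} (hD : IsOpen D)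
    {W : Set Z} (hW : IsOpen W) {T : X × Z → Z} (hT : ContDiffOn ℝ k T (D ×ˢ W))
    (hlip : ∀ x ∈ D, ∀ z ∈ W, ∀ z' ∈ W, ‖T (x, z) - T (x, z')‖ ≤ 1 / 2 * ‖z - z'‖) {z : X → Z}
    (hzW : ∀ x ∈ D, z x ∈ W) (hz : ∀ x ∈ D, T (x, z x) = z x) : ContDiffOn ℝ k z D := by
  intro x hx
  have hk' : (k : WithTop ℕ∞) ≠ 0 := by exact_mod_cast hk
  have hTat : ContDiffAt ℝ k T (x, z x) :=
    hT.contDiffAt ((hD.prod hW).mem_nhds (Set.mk_mem_prod hx (hzW x hx)))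
  have hFat : ContDiffAt ℝ k (fun p : X × Z => p.2 - T p) (x, z x) := contDiffAt_snd.sub hTat
  have hinv : (fderiv ℝ (fun p : X × Z => p.2 - T p) (x, z x) ∘L .inr ℝ X Z).IsInvertible := by
    have h1 := hTat.differentiableAt hk'
    have h3 : HasFDerivAt (fun w : Z => T (x, w))
        (fderiv ℝ T (x, z x) ∘L .inr ℝ X Z) (z x) :=
      HasFDerivAt.comp (z x) h1.hasFDerivAt (hasFDerivAt_prodMk_right x (z x))
    have h4 : ‖fderiv ℝ T (x, z x) ∘L .inr ℝ X Z‖ ≤ 1 / 2 := by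
      refine h3.le_of_lipschitzOn (C := 1 / 2) (hW.mem_nhds (hzW x hx))
        (LipschitzOnWith.of_dist_le_mul fun w hw w' hw' => ?_)
      simpa [dist_eq_norm] using hlip x hx w hw w' hw'
    have h5 := isInvertible_one_sub (h4.trans_lt (by norm_num : (1 / 2 : ℝ) < 1))
    have h6 : HasFDerivAt (fun p : X × Z => p.2 - T p) (.snd ℝ X Z - fderiv ℝ T (x, z x))
        (x, z x) := hasFDerivAt_snd.sub h1.hasFDerivAt
    rw [h6.fderiv]
    have h7 : (.snd ℝ X Z - fderiv ℝ T (x, z x)) ∘L .inr ℝ X Z =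
        ContinuousLinearMap.id ℝ Z - fderiv ℝ T (x, z x) ∘L .inr ℝ X Z := by
      ext w
      simp
    rw [h7]
    exact h5
  have hψ := hFat.contDiffAt_implicitFunction hk' hinv
  have hev := hFat.eventually_apply_implicitFunction hk' hinv
  have hmem : ∀ᶠ x' in 𝓝 x, hFat.implicitFunction hk' hinv x' ∈ W :=
    hψ.continuousAt.eventually (hW.mem_nhds (by
      rw [hFat.implicitFunction_apply_self hk' hinv]
      exact hzW x hx))
  refine (hψ.congr_of_eventuallyEq ?_).contDiffWithinAt
  filter_upwards [hev, hD.mem_nhds hx, hmem] with x' h1 h2 hm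
  simp only [hz x hx, sub_self, sub_eq_zero] at h1
  have h3 := hlip x' h2 (z x') (hzW x' h2) (hFat.implicitFunction hk' hinv x') hm
  rw [hz x' h2, ← h1] at h3
  have h4 : ‖z x' - hFat.implicitFunction hk' hinv x'‖ ≤ 0 := by linarith
  exact sub_eq_zero.1 (norm_le_zero_iff.1 h4)

theorem contDiffOn_fixedPoint {k : ℕ} (hk : k ≠ 0) {D : Set X} (hD : IsOpen D) {T : X × Z → Z}
    (hT : ContDiffOn ℝ k T (D ×ˢ univ))
    (hlip : ∀ x ∈ D, ∀ z z', ‖T (x, z) - T (x, z')‖ ≤ 1 / 2 * ‖z - z'‖) {z : X → Z}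
    (hz : ∀ x ∈ D, T (x, z x) = z x) : ContDiffOn ℝ k z D :=
  contDiffOn_fixedPoint_of_isOpen hk hD isOpen_univ hT
    (fun x hx z _ z' _ => hlip x hx z z') (fun _ _ => mem_univ _) hz

end FixedPoint

/-! ### Functions vanishing to a given order and their rescalings -/

section Vanish

universe u

variable {E F : Type u} [NormedAddCommGroup E] [NormedSpace ℝ E]
  [NormedAddCommGroup F] [NormedSpace ℝ F]

/-- `f = o(‖x‖ ^ m)` at the origin, in terms of rescalings. -/
def VanishesTo (m : ℕ) (f : E → F) : Prop :=
  TendstoUniformlyOn (fun (t : ℝ) x => (t ^ m)⁻¹ • f (t • x)) 0 (𝓝[>] 0) (Metric.ball 0 1)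

theorem vanishesTo_iff {m : ℕ} {f : E → F} : VanishesTo m f ↔
    ∀ ε > 0, ∃ r > 0, ∀ t, 0 < t → t < r → ∀ x, ‖x‖ < 1 → ‖f (t • x)‖ ≤ ε * t ^ m := by
  rw [VanishesTo, Metric.tendstoUniformlyOn_iff]
  constructor
  · intro h ε hε
    obtain ⟨r, hr, h⟩ := mem_nhdsGT_iff_exists_Ioo_subset.1 (h ε hε)
    refine ⟨r, hr, fun t ht htr x hx => ?_⟩
    have h1 := h ⟨ht, htr⟩ x (by simpa using hx)
    have ht' : (0 : ℝ) < t ^ m := by positivity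
    simp only [Pi.zero_apply, dist_zero_left, norm_smul, norm_inv, Real.norm_eq_abs,
      abs_of_pos ht'] at h1
    rw [inv_mul_lt_iff₀ ht'] at h1
    linarith
  · intro h ε hε
    obtain ⟨r, hr, h⟩ := h (ε / 2) (by positivity)
    filter_upwards [Ioo_mem_nhdsGT hr] with t ht x hx
    have h1 := h t ht.1 ht.2 x (by simpa using hx)
    have h0 := ht.1
    have ht' : (0 : ℝ) < t ^ m := by positivity
    simp only [Pi.zero_apply, dist_zero_left, norm_smul, norm_inv, Real.norm_eq_abs, abs_of_pos ht']
    rw [inv_mul_lt_iff₀ ht']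
    nlinarith

theorem VanishesTo.of_isLittleO {m : ℕ} {f : E → F}
    (h : f =o[𝓝 (0 : E)] fun x => ‖x‖ ^ m) : VanishesTo m f := by
  rw [vanishesTo_iff]
  intro ε hε
  obtain ⟨r, hr, h⟩ := Metric.eventually_nhds_iff.1 (h.def hε)
  refine ⟨r, hr, fun t ht htr x hx => ?_⟩
  have hn : ‖t • x‖ = t * ‖x‖ := by rw [norm_smul, Real.norm_of_nonneg ht.le]
  have h1 := h (y := t • x) (by rw [dist_zero_right, hn]; nlinarith [norm_nonneg x])
  rw [norm_pow, norm_norm, hn] at h1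
  refine h1.trans ?_
  gcongr
  nlinarith [norm_nonneg x]

theorem VanishesTo.bound {m : ℕ} {f : E → F} (h : VanishesTo m f) {ε R : ℝ} (hε : 0 < ε)
    (hR : 0 < R) : ∃ r > 0, ∀ t, 0 < t → t < r → ∀ x, ‖x‖ < R → ‖f (t • x)‖ ≤ ε * t ^ m := by
  obtain ⟨r, hr, h⟩ := vanishesTo_iff.1 h (ε / R ^ m) (by positivity)
  refine ⟨r / R, by positivity, fun t ht htr x hx => ?_⟩
  have h1 := h (t * R) (by positivity) (by rwa [lt_div_iff₀ hR] at htr) (R⁻¹ • x) (by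
    rw [norm_smul, norm_inv, Real.norm_of_nonneg hR.le, inv_mul_lt_iff₀ hR]; linarith)
  rw [smul_smul, mul_assoc, mul_inv_cancel₀ hR.ne', mul_one] at h1
  refine h1.trans (le_of_eq ?_)
  rw [mul_pow]
  field_simp

theorem VanishesTo.of_le {k m : ℕ} (hkm : k ≤ m) {f : E → F} (h : VanishesTo m f) :
    VanishesTo k f := by
  rw [vanishesTo_iff] at h ⊢
  intro ε hε
  obtain ⟨r, hr, h⟩ := h ε hε
  refine ⟨min r 1, by positivity, fun t ht htr x hx => ?_⟩
  refine (h t ht (htr.trans_le (min_le_left _ _)) x hx).trans ?_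
  gcongr ε * ?_
  exact pow_le_pow_of_le_one ht.le (htr.trans_le (min_le_right _ _)).le hkm

theorem VanishesTo.apply_zero {m : ℕ} {f : E → F} (h : VanishesTo m f) : f 0 = 0 := by
  have h := vanishesTo_iff.1 (h.of_le (Nat.zero_le m))
  refine norm_le_zero_iff.1 (le_of_forall_pos_le_add fun ε hε => ?_)
  obtain ⟨r, hr, h⟩ := h ε hε
  simpa using h (r / 2) (by positivity) (by linarith) 0 (by simp)

theorem hasFDerivAt_rescale {m : ℕ} {f : E → F} {t : ℝ} (ht : t ≠ 0) {x : E}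
    (hf : DifferentiableAt ℝ f (t • x)) :
    HasFDerivAt (fun x => (t ^ (m + 1))⁻¹ • f (t • x)) ((t ^ m)⁻¹ • fderiv ℝ f (t • x)) x := by
  have h1 : HasFDerivAt (fun x : E => t • x) (t • ContinuousLinearMap.id ℝ E) x :=
    (hasFDerivAt_id x).const_smul t
  have h2 := (hf.hasFDerivAt.comp x h1).const_smul (t ^ (m + 1))⁻¹
  convert! h2 using 1
  ext v
  simp only [smul_apply, ContinuousLinearMap.comp_apply, ContinuousLinearMap.id_apply, map_smul,
    smul_smul]
  congr 1
  field_simp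
  ring

theorem UniformCauchySeqOn.congr_eventually {ι α β : Type*} [UniformSpace β] {f g : ι → α → β}
    {l : Filter ι} {s : Set α} (hf : UniformCauchySeqOn f l s) (h : ∀ᶠ i in l, f i = g i) :
    UniformCauchySeqOn g l s := by
  intro u hu
  filter_upwards [hf u hu, h.prod_mk h] with p hp hp' x hx
  rw [← hp'.1, ← hp'.2]
  exact hp x hx

variable [CompleteSpace F]

theorem VanishesTo.fderiv_of_cauchy {m : ℕ} {f : E → F} (hf : Differentiable ℝ f)
    (h : VanishesTo (m + 1) f)
    (hc : UniformCauchySeqOn (fun (t : ℝ) x => (t ^ m)⁻¹ • fderiv ℝ f (t • x)) (𝓝[>] 0)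
      (Metric.ball 0 1)) : VanishesTo m (fderiv ℝ f) := by
  have hlim : ∀ x ∈ Metric.ball (0 : E) 1, ∃ y, Tendsto
      (fun t : ℝ => (t ^ m)⁻¹ • fderiv ℝ f (t • x)) (𝓝[>] 0) (𝓝 y) := fun x hx =>
    cauchy_map_iff_exists_tendsto.1 (hc.cauchy_map hx)
  choose! g hg using hlim
  have hu := hc.tendstoUniformlyOn_of_tendsto hg
  have hz : ∀ x ∈ Metric.ball (0 : E) 1, g x = 0 := by
    intro x hx
    have h1 : HasFDerivAt (fun _ : E => (0 : F)) (g x) x := by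
      have h2 : TendstoUniformlyOnFilter (fun (t : ℝ) x => (t ^ m)⁻¹ • fderiv ℝ f (t • x)) g
          (𝓝[>] 0) (𝓝 x) := hu.tendstoUniformlyOnFilter.mono_right
            (le_principal_iff.2 (Metric.isOpen_ball.mem_nhds hx))
      refine hasFDerivAt_of_tendstoUniformlyOnFilter (l := 𝓝[>] (0 : ℝ))
        (f := fun (t : ℝ) x => (t ^ (m + 1))⁻¹ • f (t • x)) h2 ?_ ?_
      · filter_upwards [prod_mem_prod self_mem_nhdsWithin univ_mem] with p hp
        exact hasFDerivAt_rescale (ne_of_gt hp.1) (hf _)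
      · filter_upwards [Metric.isOpen_ball.mem_nhds hx] with x hx using h.tendsto_at hx
    exact h1.unique (hasFDerivAt_const _ _)
  exact hu.congr_right fun x hx => hz x hx

theorem uniformCauchySeqOn_rescale_fderiv {m : ℕ} {f : E → F} (hf : ContDiff ℝ (m + 1 : ℕ) f)
    (h : VanishesTo m f) :
    UniformCauchySeqOn (fun (t : ℝ) x => (t ^ m)⁻¹ • fderiv ℝ f (t • x)) (𝓝[>] 0)
      (Metric.ball 0 1) := by
  induction m generalizing F with
  | zero =>
    have hc := (hf.continuous_fderiv (by simp)).continuousAt (x := 0)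
    refine TendstoUniformlyOn.uniformCauchySeqOn (f := fun _ => fderiv ℝ f 0) ?_
    rw [Metric.tendstoUniformlyOn_iff]
    intro ε hε
    obtain ⟨r, hr, h⟩ := Metric.continuousAt_iff.1 hc ε hε
    filter_upwards [Ioo_mem_nhdsGT hr] with t ht x hx
    have h2 : dist (t • x) 0 < r := by
      rw [dist_zero_right, norm_smul, Real.norm_of_nonneg ht.1.le]
      have : ‖x‖ < 1 := by simpa using hx
      nlinarith [ht.1, ht.2, norm_nonneg x]
    simpa [dist_comm] using h h2
  | succ m ih =>
    have hf1 : ContDiff ℝ (m + 1 : ℕ) f := hf.of_le (by exact_mod_cast Nat.le_succ _)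
    have hd : Differentiable ℝ f := hf.differentiable (by simp)
    have hdf : ContDiff ℝ (m + 1 : ℕ) (fderiv ℝ f) :=
      hf.fderiv_right (by exact_mod_cast le_rfl)
    have h1 : VanishesTo m (fderiv ℝ f) :=
      VanishesTo.fderiv_of_cauchy hd h (ih hf1 (h.of_le (Nat.le_succ m)))
    let τ : ℝ → ℝ := fun t => if 0 < t then t else 1
    have hτ0 : ∀ t, τ t ≠ 0 := fun t => by
      simp only [τ]; split_ifs with h <;> [exact h.ne'; exact one_ne_zero]
    have hτ : ∀ᶠ t in 𝓝[>] (0 : ℝ), τ t = t := by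
      filter_upwards [self_mem_nhdsWithin] with t ht using if_pos ht
    suffices H : UniformCauchySeqOn (fun (t : ℝ) x => (τ t ^ (m + 1))⁻¹ • fderiv ℝ f (τ t • x))
        (𝓝[>] 0) (Metric.ball 0 1) from
      H.congr_eventually (hτ.mono fun t ht => by simp only [ht])
    refine uniformCauchySeqOn_ball_of_fderiv
      (f' := fun (t : ℝ) x => (τ t ^ m)⁻¹ • fderiv ℝ (fderiv ℝ f) (τ t • x))
      ((ih hdf h1).congr_eventually (hτ.mono fun t ht => by simp only [ht])) (x := 0) ?_ ?_
    · intro t x _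
      exact hasFDerivAt_rescale (hτ0 t) (hdf.differentiable (by simp) _)
    · simp only [smul_zero, h1.apply_zero]
      exact cauchy_map_iff_exists_tendsto.2 ⟨0, tendsto_const_nhds⟩

theorem VanishesTo.fderiv {m : ℕ} {f : E → F} (hf : ContDiff ℝ (m + 1 : ℕ) f)
    (h : VanishesTo (m + 1) f) : VanishesTo m (fderiv ℝ f) :=
  VanishesTo.fderiv_of_cauchy (hf.differentiable (by simp)) h
    (uniformCauchySeqOn_rescale_fderiv hf (h.of_le (Nat.le_succ m)))

end Vanish

section Rescale

universe u

variable {Y : Type*} [TopologicalSpace Y] [CompactSpace Y]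
  {E F : Type u} [NormedAddCommGroup E] [NormedSpace ℝ E]
  [NormedAddCommGroup F] [NormedSpace ℝ F] [CompleteSpace F]

/-- The family of rescalings `x ↦ δ⁻ᵐ f (δ x)`. -/
noncomputable def rescale (δ : Y → ℝ) (m : ℕ) (f : E → F) (y : Y) (x : E) : F :=
  (δ y ^ m)⁻¹ • f (δ y • x)

theorem smoothFam_rescale {δ : C(Y, ℝ)} (hδ : ∀ y, 0 ≤ δ y) {k m : ℕ} (hmk : m ≤ k) {f : E → F}
    (hf : ContDiff ℝ k f) (hv : VanishesTo m f) : SmoothFam k univ (rescale δ m f) := by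
  induction m generalizing k F with
  | zero =>
    have h1 : SmoothFam k univ (fun (y : Y) (x : E) => δ y • x) := by
      refine ⟨Continuous.continuousOn (by simp only [Function.uncurry_def]; fun_prop), ?_⟩
      have h2 : ContDiffOn ℝ k (fun φ : C(Y, E) => pointwiseApply
          ((ContinuousLinearMap.compLeftContinuous ℝ Y (ContinuousLinearMap.lsmul ℝ ℝ)) δ) φ)
          {φ : C(Y, E) | ∀ y, φ y ∈ univ} := (ContinuousLinearMap.contDiff _).contDiffOn
      refine h2.congr fun φ hφ => ContinuousMap.ext fun y => ?_
      rw [nem_apply (Continuous.continuousOn (by simp only [Function.uncurry_def]; fun_prop)) hφ]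
      rfl
    exact (h1.map_contDiff hf).congr fun y x _ => by simp [rescale]
  | succ m ih =>
    obtain ⟨k, rfl⟩ : ∃ l, k = l + 1 := ⟨k - 1, by omega⟩
    have hf1 : ContDiff ℝ (m + 1 : ℕ) f := hf.of_le (by exact_mod_cast hmk)
    have hd : Differentiable ℝ f := hf.differentiable (by simp)
    have hv' : VanishesTo m (fderiv ℝ f) := hv.fderiv hf1
    refine SmoothFam.succ isOpen_univ ?_ (f' := rescale δ m (fderiv ℝ f)) ?_
      (ih (by omega) (hf.fderiv_right (by exact_mod_cast le_rfl)) hv')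
    · rw [univ_prod_univ, continuousOn_univ, continuous_iff_continuousAt]
      rintro ⟨y, x⟩
      rcases (hδ y).eq_or_lt with h0 | h0
      · have hz : Function.uncurry (rescale δ (m + 1) f) (y, x) = 0 := by
          simp [rescale, ← h0]
        rw [ContinuousAt, hz, Metric.tendsto_nhds]
        intro ε hε
        obtain ⟨r, hr, h⟩ := hv.bound (ε := ε / 2) (R := ‖x‖ + 1) (by positivity) (by positivity)
        have e1 : ∀ᶠ p : Y × E in 𝓝 (y, x), δ p.1 < r := by
          refine Continuous.tendsto (f := fun p : Y × E => δ p.1) (by fun_prop) (y, x)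
            |>.eventually_lt_const ?_
          simpa [← h0] using hr
        have e2 : ∀ᶠ p : Y × E in 𝓝 (y, x), ‖p.2‖ < ‖x‖ + 1 := by
          refine Continuous.tendsto (f := fun p : Y × E => ‖p.2‖) (by fun_prop) (y, x)
            |>.eventually_lt_const ?_
          simp
        filter_upwards [e1, e2] with p h1 h2
        simp only [Function.uncurry_def, rescale, dist_zero_right]
        rcases (hδ p.1).eq_or_lt with h3 | h3
        · simpa [← h3] using hε
        · have h4 := h _ h3 h1 _ h2
          have h5 : 0 < δ p.1 ^ (m + 1) := by positivity
          rw [norm_smul, norm_inv, Real.norm_of_nonneg h5.le, inv_mul_lt_iff₀ h5]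
          nlinarith
      · have h1 : ContinuousAt (fun p : Y × E => (δ p.1 ^ (m + 1))⁻¹) (y, x) :=
          ContinuousAt.inv₀ (by fun_prop) (by positivity)
        have h2 : Continuous fun p : Y × E => f (δ p.1 • p.2) := by
          have := hf.continuous
          fun_prop
        exact h1.smul h2.continuousAt
    · intro y x _
      rcases (hδ y).eq_or_lt with h0 | h0
      · have e1 : rescale δ (m + 1) f y = fun _ => 0 := by
          ext; simp [rescale, ← h0]
        have e2 : rescale δ m (fderiv ℝ f) y x = 0 := by
          simp [rescale, ← h0, hv'.apply_zero]
        rw [e1, e2]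
        exact hasFDerivAt_const _ _
      · exact hasFDerivAt_rescale h0.ne' (hd _)

end Rescale

section Cutoff

variable {E : Type} [NormedAddCommGroup E] [NormedSpace ℝ E] [FiniteDimensional ℝ E]

theorem norm_fderiv_fderiv_mul_le {χ g : E → ℝ} (hχ : ContDiff ℝ 2 χ) (hg : ContDiff ℝ 2 g) (x : E)
    {C η : ℝ} (hC : ∀ i ≤ 2, ‖iteratedFDeriv ℝ i χ x‖ ≤ C) (h0 : ‖g x‖ ≤ η)
    (h1 : ‖fderiv ℝ g x‖ ≤ η) (h2 : ‖fderiv ℝ (fderiv ℝ g) x‖ ≤ η) :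
    ‖fderiv ℝ (fderiv ℝ fun x => χ x * g x) x‖ ≤ 4 * (C * η) := by
  have hη : ∀ i ≤ 2, ‖iteratedFDeriv ℝ i g x‖ ≤ η := by
    intro i hi
    interval_cases i
    · simpa using h0
    · rwa [norm_iteratedFDeriv_one]
    · rwa [← norm_iteratedFDeriv_fderiv, norm_iteratedFDeriv_one]
  have h := norm_iteratedFDeriv_mul_le hχ hg x (n := 2) (by norm_num)
  rw [← norm_iteratedFDeriv_one, norm_iteratedFDeriv_fderiv]
  refine h.trans ?_
  have hC0 : 0 ≤ C := (norm_nonneg _).trans (hC 0 (by norm_num))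
  have hb : ∀ i ∈ Finset.range 3, (Nat.choose 2 i : ℝ) * ‖iteratedFDeriv ℝ i χ x‖ *
      ‖iteratedFDeriv ℝ (2 - i) g x‖ ≤ (Nat.choose 2 i : ℝ) * (C * η) := by
    intro i hi
    have hi' : i ≤ 2 := by simp at hi; omega
    rw [mul_assoc]
    gcongr
    · exact hC i hi'
    · exact hη _ (by omega)
  refine (Finset.sum_le_sum hb).trans (le_of_eq ?_)
  rw [← Finset.sum_mul]
  norm_num [Finset.sum_range_succ, Nat.choose]

theorem exists_contDiff_eventuallyEq {N : ℕ} {U : Set E} (hU : U ∈ 𝓝 (0 : E)) {f : E → ℝ}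
    (hf : ContDiffOn ℝ N f U) : ∃ g : E → ℝ, ContDiff ℝ N g ∧ g =ᶠ[𝓝 0] f := by
  obtain ⟨r, hr, hrU⟩ := Metric.mem_nhds_iff.1 hU
  let χ : ContDiffBump (0 : E) := ⟨r / 4, r / 2, by positivity, by linarith⟩
  refine ⟨fun x => χ x * f x, ?_, ?_⟩
  · rw [contDiff_iff_contDiffAt]
    intro x
    by_cases hx : x ∈ Metric.ball (0 : E) r
    · exact χ.contDiff.contDiffAt.mul
        ((hf.mono hrU).contDiffAt (Metric.isOpen_ball.mem_nhds hx))
    · have : (fun x => χ x * f x) =ᶠ[𝓝 x] fun _ => 0 := by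
        have hx' : x ∈ (Metric.closedBall (0 : E) (r / 2))ᶜ := by
          simp only [mem_compl_iff, Metric.mem_closedBall, Metric.mem_ball, not_le, not_lt] at hx ⊢
          linarith
        filter_upwards [Metric.isClosed_closedBall.isOpen_compl.mem_nhds hx'] with y hy
        rw [χ.zero_of_le_dist, zero_mul]
        simp only [mem_compl_iff, Metric.mem_closedBall, not_le] at hy
        exact hy.le
      exact contDiffAt_const.congr_of_eventuallyEq this
  · filter_upwards [Metric.ball_mem_nhds (0 : E) (by positivity : (0 : ℝ) < r / 4)] with x hx
    rw [χ.one_of_mem_closedBall (Metric.ball_subset_closedBall hx), one_mul]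

theorem contDiff_iteratedFDeriv_bound {χ : E → ℝ} (hχ : ContDiff ℝ 2 χ)
    (hs : HasCompactSupport χ) : ∃ C, ∀ i ≤ 2, ∀ x, ‖iteratedFDeriv ℝ i χ x‖ ≤ C := by
  have h : ∀ i : ℕ, i ≤ 2 → ∃ C, ∀ x, ‖iteratedFDeriv ℝ i χ x‖ ≤ C := fun i hi =>
    (hχ.continuous_iteratedFDeriv (m := i) (by exact_mod_cast hi)).bounded_above_of_compact_support
      (hs.iteratedFDeriv i)
  choose! C hC using h
  refine ⟨max (C 0) (max (C 1) (C 2)), fun i hi x => (hC i hi x).trans ?_⟩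
  interval_cases i <;> simp

/-- A function vanishing to second order agrees near the origin with a compactly supported function
with small second derivative. -/
theorem exists_cutoff {N : ℕ} (hN : 2 ≤ N) {U : Set E} (hU : U ∈ 𝓝 (0 : E)) {f : E → ℝ}
    (hf : ContDiffOn ℝ N f U) (hv : f =o[𝓝 (0 : E)] fun x => ‖x‖ ^ 2) {ε : ℝ} (hε : 0 < ε) :
    ∃ g : E → ℝ, ContDiff ℝ N g ∧ g =ᶠ[𝓝 0] f ∧ (∀ x, 1 / 2 ≤ ‖x‖ → g x = 0) ∧
      ∀ x, ‖fderiv ℝ (fderiv ℝ g) x‖ ≤ ε := by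
  obtain ⟨f₁, hf₁, hff⟩ := exists_contDiff_eventuallyEq hU hf
  have hv₀ : VanishesTo 2 f₁ := VanishesTo.of_isLittleO (hv.congr' hff.symm EventuallyEq.rfl)
  have hf₂ : ContDiff ℝ (1 + 1 : ℕ) f₁ := hf₁.of_le (by exact_mod_cast hN)
  have hd : ContDiff ℝ (0 + 1 : ℕ) (fderiv ℝ f₁) := hf₂.fderiv_right (by exact_mod_cast le_rfl)
  have hv₁ : VanishesTo 1 (fderiv ℝ f₁) := hv₀.fderiv hf₂
  have hv₂ : VanishesTo 0 (fderiv ℝ (fderiv ℝ f₁)) := hv₁.fderiv hd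
  let χ : ContDiffBump (0 : E) := ⟨1, 2, by norm_num, by norm_num⟩
  obtain ⟨C, hC⟩ := contDiff_iteratedFDeriv_bound (χ := χ) χ.contDiff χ.hasCompactSupport
  have hC0 : 0 ≤ C := (norm_nonneg _).trans (hC 0 (by norm_num) 0)
  set η := ε / (4 * (C + 1)) with hη
  have hηpos : 0 < η := by positivity
  have hηC : 4 * (C * η) ≤ ε := by
    rw [hη]
    field_simp
    nlinarith
  obtain ⟨r₀, hr₀, h₀⟩ := hv₀.bound hηpos (R := 3) (by norm_num)
  obtain ⟨r₁, hr₁, h₁⟩ := hv₁.bound hηpos (R := 3) (by norm_num)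
  obtain ⟨r₂, hr₂, h₂⟩ := hv₂.bound hηpos (R := 3) (by norm_num)
  obtain ⟨r, hr, hr0', hr1', hr2', hr3'⟩ : ∃ r : ℝ, 0 < r ∧ r < r₀ ∧ r < r₁ ∧ r < r₂ ∧ r < 1 / 4 := by
    refine ⟨min (min r₀ r₁) (min r₂ (1 / 4)) / 2, by positivity, ?_, ?_, ?_, ?_⟩ <;>
    · refine (half_lt_self (by positivity)).trans_le ?_
      simp
  set gr : E → ℝ := fun y => (r ^ 2)⁻¹ • f₁ (r • y) with hgr
  set w : E → ℝ := fun y => χ y * gr y with hw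
  have hgrc : ContDiff ℝ N gr := (hf₁.comp (contDiff_id.const_smul r)).const_smul ((r ^ 2)⁻¹)
  have hwc : ContDiff ℝ N w := χ.contDiff.mul hgrc
  have hrne : r⁻¹ ≠ 0 := inv_ne_zero hr.ne'
  refine ⟨fun x => ((r⁻¹) ^ 2)⁻¹ • w (r⁻¹ • x), ?_, ?_, ?_, ?_⟩
  · exact (hwc.comp (contDiff_id.const_smul r⁻¹)).const_smul ((r⁻¹ ^ 2)⁻¹)
  · filter_upwards [hff, Metric.ball_mem_nhds (0 : E) hr] with x hx hxr
    have hx1 : ‖r⁻¹ • x‖ ≤ 1 := by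
      rw [norm_smul, norm_inv, Real.norm_of_nonneg hr.le, inv_mul_le_iff₀ hr]
      simpa using (mem_ball_zero_iff.1 hxr).le
    simp only [hw, hgr]
    rw [χ.one_of_mem_closedBall (by simpa using hx1), smul_smul, mul_inv_cancel₀ hr.ne', one_smul,
      hx, smul_eq_mul, smul_eq_mul]
    field_simp
  · intro x hx
    have : (2 : ℝ) ≤ dist (r⁻¹ • x) 0 := by
      rw [dist_zero_right, norm_smul, norm_inv, Real.norm_of_nonneg hr.le, ← div_eq_inv_mul,
        le_div_iff₀ hr]
      linarith
    simp only [hw]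
    rw [χ.zero_of_le_dist this, zero_mul, smul_zero]
  · intro x
    have hwd : Differentiable ℝ w := hwc.differentiable (by exact_mod_cast (by omega : N ≠ 0))
    have hw2 : ContDiff ℝ 2 w := hwc.of_le (by exact_mod_cast hN)
    have hwd' : Differentiable ℝ (fderiv ℝ w) :=
      (hw2.fderiv_right (m := 1) (by norm_num)).differentiable (by simp)
    have e1 : fderiv ℝ (fun x => ((r⁻¹) ^ 2)⁻¹ • w (r⁻¹ • x)) =
        fun x => ((r⁻¹) ^ (0 + 1))⁻¹ • fderiv ℝ w (r⁻¹ • x) := by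
      ext1 x
      exact (hasFDerivAt_rescale (m := 1) hrne (hwd _)).fderiv
    rw [e1, (hasFDerivAt_rescale (m := 0) hrne (hwd' _)).fderiv, pow_zero, inv_one, one_smul]
    generalize r⁻¹ • x = y
    have hgr2 : ContDiff ℝ 2 gr := hgrc.of_le (by exact_mod_cast hN)
    have hfd : Differentiable ℝ f₁ := hf₂.differentiable (by simp)
    have hfd' : Differentiable ℝ (fderiv ℝ f₁) := hd.differentiable (by simp)
    by_cases hy : ‖y‖ < 3
    · refine (norm_fderiv_fderiv_mul_le χ.contDiff hgr2 y (fun i hi => hC i hi y) (η := η)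
        ?_ ?_ ?_).trans hηC
      · rw [hgr, norm_smul, norm_inv, norm_pow, Real.norm_of_nonneg hr.le,
          inv_mul_le_iff₀ (by positivity), mul_comm]
        exact h₀ r hr hr0' y hy
      · have : fderiv ℝ gr y = (r ^ 1)⁻¹ • fderiv ℝ f₁ (r • y) :=
          (hasFDerivAt_rescale (m := 1) hr.ne' (hfd _)).fderiv
        rw [this, norm_smul, norm_inv, norm_pow, Real.norm_of_nonneg hr.le,
          inv_mul_le_iff₀ (by positivity), mul_comm]
        exact h₁ r hr hr1' y hy
      · have e1 : fderiv ℝ gr = fun x => (r ^ (0 + 1))⁻¹ • fderiv ℝ f₁ (r • x) := by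
          ext1 x
          exact (hasFDerivAt_rescale (m := 1) hr.ne' (hfd _)).fderiv
        rw [e1, (hasFDerivAt_rescale (m := 0) hr.ne' (hfd' _)).fderiv, pow_zero, inv_one, one_smul]
        simpa using h₂ r hr hr2' y hy
    · have hz : w =ᶠ[𝓝 y] fun _ => 0 := by
        have hy' : y ∈ (Metric.closedBall (0 : E) 2)ᶜ := by
          simp only [mem_compl_iff, Metric.mem_closedBall, dist_zero_right, not_le]
          linarith
        filter_upwards [Metric.isClosed_closedBall.isOpen_compl.mem_nhds hy'] with z hz
        rw [hw]
        simp only [mem_compl_iff, Metric.mem_closedBall, not_le] at hz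
        simp only [χ.zero_of_le_dist hz.le, zero_mul]
      have h0 : fderiv ℝ (fun _ : E => (0 : ℝ)) = fun _ => 0 := by
        ext1 z
        exact fderiv_const_apply _
      rw [(hz.fderiv).fderiv_eq, h0, fderiv_const_apply]
      exact (norm_zero (E := E →L[ℝ] E →L[ℝ] ℝ)).le.trans hε.le

end Cutoff

/-! ### Brackets of vector fields tangent to a `C¹` submanifold -/

section Bracket

theorem hasFDerivAt_clm_apply_of_eq_zero {P K V : Type*} [NormedAddCommGroup P] [NormedSpace ℝ P]
    [NormedAddCommGroup K] [NormedSpace ℝ K] [NormedAddCommGroup V] [NormedSpace ℝ V]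
    {A : P → K →L[ℝ] V} {r : P → K} {r' : P →L[ℝ] K} {p : P} (hA : ContinuousAt A p)
    (hr : HasFDerivAt r r' p) (h0 : r p = 0) :
    HasFDerivAt (fun q => A q (r q)) ((A p).comp r') p := by
  have h1 : HasFDerivAt (fun q => A p (r q)) ((A p).comp r') p := (A p).hasFDerivAt.comp p hr
  have h2 : HasFDerivAt (fun q => (A q - A p) (r q)) (0 : P →L[ℝ] V) p := by
    rw [hasFDerivAt_iff_isLittleO]
    have h3 : (fun q => A q - A p) =o[𝓝 p] fun _ => (1 : ℝ) := by
      rw [isLittleO_one_iff]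
      have h := hA.tendsto.sub_const (A p)
      rwa [sub_self] at h
    have h4 : r =O[𝓝 p] fun q => q - p := by simpa [h0] using hr.isBigO_sub
    have h5 : (fun q => (A q - A p) (r q)) =o[𝓝 p] fun q => 1 * ‖q - p‖ :=
      (IsBigO.of_bound 1 (Eventually.of_forall fun q => by
        rw [one_mul, norm_mul, norm_norm, norm_norm]
        exact (A q - A p).le_opNorm _)).trans_isLittleO (h3.norm_left.mul_isBigO h4.norm_norm)
    simpa [h0] using h5
  refine ((h1.add h2).congr_fderiv (add_zero _)).congr_of_eventuallyEq
    (Eventually.of_forall fun q => ?_)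
  simp

/-- If `φ` is only of class `C¹`, the commutator of the derivatives along `ξ` and `η` still is the
derivative along the bracket. -/
theorem bracket_of_contDiffAt_one {K V : Type*} [NormedAddCommGroup K] [NormedSpace ℝ K]
    [NormedAddCommGroup V] [NormedSpace ℝ V] {φ a b : K → V} {φ' : K → K →L[ℝ] V} {ξ η : K → K}
    {ξ' η' : K →L[ℝ] K} {a' b' : K →L[ℝ] V} (hφ : ∀ᶠ v in 𝓝 0, HasFDerivAt φ (φ' v) v)
    (hφ' : ContinuousAt φ' 0) (hξ : HasFDerivAt ξ ξ' 0) (hη : HasFDerivAt η η' 0)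
    (ha : HasFDerivAt a a' 0) (hb : HasFDerivAt b b' 0)
    (hφa : ∀ᶠ v in 𝓝 0, φ' v (ξ v) = a v) (hφb : ∀ᶠ v in 𝓝 0, φ' v (η v) = b v) :
    b' (ξ 0) - a' (η 0) = φ' 0 (η' (ξ 0) - ξ' (η 0)) := by
  let Ψ : ℝ × ℝ → K := fun p => p.1 • ξ 0 + p.2 • η 0 + (p.1 ^ 2 / 2) • ξ' (ξ 0) +
    (p.2 ^ 2 / 2) • η' (η 0) + (p.1 * p.2) • η' (ξ 0)
  let Ψs : ℝ × ℝ → K := fun p => ξ 0 + p.1 • ξ' (ξ 0) + p.2 • η' (ξ 0)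
  let Ψt : ℝ × ℝ → K := fun p => η 0 + p.2 • η' (η 0) + p.1 • η' (ξ 0)
  have hΨ0 : Ψ 0 = 0 := by simp [Ψ]
  let fs : ℝ × ℝ →L[ℝ] ℝ := .fst ℝ ℝ ℝ
  let sn : ℝ × ℝ →L[ℝ] ℝ := .snd ℝ ℝ ℝ
  have hfs : ∀ p, HasFDerivAt (fun p : ℝ × ℝ => p.1) fs p := fun p => hasFDerivAt_fst
  have hsn : ∀ p, HasFDerivAt (fun p : ℝ × ℝ => p.2) sn p := fun p => hasFDerivAt_snd
  have hΨd : ∀ p, HasFDerivAt Ψ (fs.smulRight (Ψs p) + sn.smulRight (Ψt p)) p := by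
    intro p
    have h := (((((hfs p).smul_const (ξ 0)).add ((hsn p).smul_const (η 0))).add
      ((((hfs p).pow 2).mul_const (1 / 2 : ℝ)).smul_const (ξ' (ξ 0)))).add
      ((((hsn p).pow 2).mul_const (1 / 2 : ℝ)).smul_const (η' (η 0)))).add
      (((hfs p).mul (hsn p)).smul_const (η' (ξ 0)))
    refine (h.congr_fderiv ?_).congr_of_eventuallyEq (Eventually.of_forall fun q => ?_)
    · ext <;> simp [Ψs, Ψt, fs, sn]
    · simp [Ψ, div_eq_mul_inv]
  have hΨc : ContinuousAt Ψ 0 := (hΨd 0).continuousAt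
  have hΨt0 : Tendsto Ψ (𝓝 0) (𝓝 0) := by simpa [ContinuousAt, hΨ0] using hΨc
  have hΨd0 : HasFDerivAt Ψ (fs.smulRight (ξ 0) + sn.smulRight (η 0)) 0 := by
    simpa [Ψs, Ψt] using hΨd 0
  have hsd : HasFDerivAt Ψs (fs.smulRight (ξ' (ξ 0)) + sn.smulRight (η' (ξ 0))) 0 := by
    have h := ((hfs 0).smul_const (ξ' (ξ 0))).add ((hsn 0).smul_const (η' (ξ 0)))
    refine (h.const_add (ξ 0)).congr_of_eventuallyEq (Eventually.of_forall fun q => ?_)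
    simp [Ψs, add_assoc]
  have htd : HasFDerivAt Ψt (sn.smulRight (η' (η 0)) + fs.smulRight (η' (ξ 0))) 0 := by
    have h := ((hsn 0).smul_const (η' (η 0))).add ((hfs 0).smul_const (η' (ξ 0)))
    refine (h.const_add (η 0)).congr_of_eventuallyEq (Eventually.of_forall fun q => ?_)
    simp [Ψt, add_assoc]
  have hcompV : ∀ {g : K → V} {g' : K →L[ℝ] V}, HasFDerivAt g g' 0 →
      HasFDerivAt (fun p => g (Ψ p)) (g'.comp (fs.smulRight (ξ 0) + sn.smulRight (η 0))) 0 :=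
    fun {g _} hg => HasFDerivAt.comp (g := g) 0 (by rwa [hΨ0]) hΨd0
  have hcompK : ∀ {g : K → K} {g' : K →L[ℝ] K}, HasFDerivAt g g' 0 →
      HasFDerivAt (fun p => g (Ψ p)) (g'.comp (fs.smulRight (ξ 0) + sn.smulRight (η 0))) 0 :=
    fun {g _} hg => HasFDerivAt.comp (g := g) 0 (by rwa [hΨ0]) hΨd0
  have hA : ContinuousAt (fun p => φ' (Ψ p)) 0 :=
    ContinuousAt.comp (f := Ψ) (g := φ') (by rwa [hΨ0]) hΨc
  have hu : HasFDerivAt (fun p => a (Ψ p) + φ' (Ψ p) (Ψs p - ξ (Ψ p)))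
      (a'.comp (fs.smulRight (ξ 0) + sn.smulRight (η 0)) +
        (φ' 0).comp (sn.smulRight (η' (ξ 0) - ξ' (η 0)))) 0 := by
    have h := hasFDerivAt_clm_apply_of_eq_zero hA (hsd.sub (hcompK hξ)) (by simp [Ψs, hΨ0])
    rw [hΨ0] at h
    refine ((hcompV ha).add h).congr_fderiv ?_
    ext <;> simp [fs, sn]
  have hv : HasFDerivAt (fun p => b (Ψ p) + φ' (Ψ p) (Ψt p - η (Ψ p)))
      (b'.comp (fs.smulRight (ξ 0) + sn.smulRight (η 0))) 0 := by
    have h := hasFDerivAt_clm_apply_of_eq_zero hA (htd.sub (hcompK hη)) (by simp [Ψt, hΨ0])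
    rw [hΨ0] at h
    refine ((hcompV hb).add h).congr_fderiv ?_
    ext <;> simp [fs, sn]
  have hk : ∀ᶠ p in 𝓝 0, HasFDerivAt (fun p => φ (Ψ p))
      (fs.smulRight (a (Ψ p) + φ' (Ψ p) (Ψs p - ξ (Ψ p))) +
        sn.smulRight (b (Ψ p) + φ' (Ψ p) (Ψt p - η (Ψ p)))) p := by
    filter_upwards [hΨt0.eventually hφ, hΨt0.eventually hφa, hΨt0.eventually hφb] with p h1 h2 h3
    refine (HasFDerivAt.comp p h1 (hΨd p)).congr_fderiv ?_
    ext <;> simp [fs, sn, ← h2, ← h3]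
  have hk' := (((ContinuousLinearMap.smulRightL ℝ (ℝ × ℝ) V fs).hasFDerivAt.comp (0 : ℝ × ℝ) hu).add
    ((ContinuousLinearMap.smulRightL ℝ (ℝ × ℝ) V sn).hasFDerivAt.comp (0 : ℝ × ℝ) hv))
  have hsymm := second_derivative_symmetric_of_eventually hk hk' (0, 1) (1, 0)
  simp [fs, sn] at hsymm
  rw [← hsymm, map_sub]
  abel

/-- The bracket of two vector fields tangent to a `C¹` submanifold is tangent to it. -/
theorem lieBracket_mem_ker {V : Type*} [NormedAddCommGroup V] [NormedSpace ℝ V]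
    [FiniteDimensional ℝ V] {c : ℕ} {W : Set V} (hW : IsOpen W) {x : V} (hx : x ∈ W)
    {f : V → Fin c → ℝ} (hf : ContDiffOn ℝ 1 f W) (hfx : f x = 0)
    (hsurj : Function.Surjective (fderiv ℝ f x)) {X Y : V → V} (hX : DifferentiableAt ℝ X x)
    (hY : DifferentiableAt ℝ Y x) (tX : ∀ y ∈ W, f y = 0 → fderiv ℝ f y (X y) = 0)
    (tY : ∀ y ∈ W, f y = 0 → fderiv ℝ f y (Y y) = 0) :
    fderiv ℝ f x (VectorField.lieBracket ℝ X Y x) = 0 := by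
  have hfat : ∀ y ∈ W, ContDiffAt ℝ 1 f y := fun y hy => hf.contDiffAt (hW.mem_nhds hy)
  have hfd : ∀ y ∈ W, HasFDerivAt f (fderiv ℝ f y) y := fun y hy =>
    ((hfat y hy).differentiableAt (by simp)).hasFDerivAt
  let K := LinearMap.ker (fderiv ℝ f x).toLinearMap
  obtain ⟨π₀, hπ₀⟩ := LinearMap.exists_leftInverse_of_injective K.subtype K.ker_subtype
  let π : V →L[ℝ] K := LinearMap.toContinuousLinearMap π₀
  have hπ : ∀ k : K, π k = k := fun k => LinearMap.congr_fun hπ₀ k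
  let Θ : V → (Fin c → ℝ) × K := fun y => (f y, π (y - x))
  have hΘd : ∀ y ∈ W, HasFDerivAt Θ ((fderiv ℝ f y).prod π) y := fun y hy =>
    (hfd y hy).prodMk (π.hasFDerivAt.comp y ((hasFDerivAt_id y).sub_const x))
  have hΘx : Θ x = 0 := by simp [Θ, hfx]
  have hΘc : ContDiffAt ℝ 1 Θ x :=
    (hfat x hx).prodMk (π.contDiff.contDiffAt.comp x (contDiffAt_id.sub contDiffAt_const))
  have hbij : Function.Bijective ((fderiv ℝ f x).prod π) := by
    constructor
    · rw [injective_iff_map_eq_zero]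
      intro v hv
      have h1 : fderiv ℝ f x v = 0 := congrArg Prod.fst hv
      have h2 : π v = 0 := congrArg Prod.snd hv
      have h3 := hπ ⟨v, h1⟩
      rw [h2] at h3
      exact congrArg Subtype.val h3.symm
    · rintro ⟨r, k⟩
      obtain ⟨v, hv⟩ := hsurj r
      refine ⟨v + ((k - π v : K) : V), ?_⟩
      have h1 : fderiv ℝ f x ((k - π v : K) : V) = 0 := (k - π v : K).2
      refine Prod.ext ?_ ?_
      · change fderiv ℝ f x (v + ((k - π v : K) : V)) = r
        rw [map_add, h1, hv, add_zero]
      · change π (v + ((k - π v : K) : V)) = k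
        rw [map_add, hπ, add_sub_cancel]
  let e : V ≃L[ℝ] (Fin c → ℝ) × K := ContinuousLinearEquiv.ofBijective ((fderiv ℝ f x).prod π)
    (LinearMap.ker_eq_bot.2 hbij.1) (LinearMap.range_eq_top.2 hbij.2)
  have hΘe : HasFDerivAt Θ (e : V →L[ℝ] (Fin c → ℝ) × K) x := by
    exact hΘd x hx
  have hst : HasStrictFDerivAt Θ (e : V →L[ℝ] (Fin c → ℝ) × K) x :=
    hΘc.hasStrictFDerivAt' hΘe (by simp)
  let g := hst.localInverse Θ e x
  have hgc : ContDiffAt ℝ 1 g 0 := by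
    have := hΘc.to_localInverse hΘe (by simp)
    rw [hΘx] at this
    exact this
  have hg0 : g 0 = x := by
    have := hst.localInverse_apply_image
    rwa [hΘx] at this
  have hright : ∀ᶠ p in 𝓝 0, Θ (g p) = p := by
    have := hst.eventually_right_inverse
    rwa [hΘx] at this
  have hleft : ∀ᶠ y in 𝓝 x, g (Θ y) = y := hst.eventually_left_inverse
  let ι : K →L[ℝ] (Fin c → ℝ) × K := .inr ℝ _ _
  have hι : Tendsto ι (𝓝 0) (𝓝 0) := by simpa using ι.continuous.tendsto 0
  let φ : K → V := fun v => g (ι v)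
  let φ' : K → K →L[ℝ] V := fun v => (fderiv ℝ g (ι v)).comp ι
  have hgd : ∀ᶠ p in 𝓝 0, DifferentiableAt ℝ g p :=
    (hgc.eventually (by simp)).mono fun p hp => hp.differentiableAt (by simp)
  have hφ : ∀ᶠ v in 𝓝 0, HasFDerivAt φ (φ' v) v :=
    (hι.eventually hgd).mono fun v hv => hv.hasFDerivAt.comp v ι.hasFDerivAt
  have hφ' : ContinuousAt φ' 0 := by
    have h1 : ContinuousAt (fderiv ℝ g) (ι 0) := by
      rw [map_zero]
      exact hgc.continuousAt_fderiv (by simp)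
    exact (h1.comp ι.continuous.continuousAt).clm_comp continuousAt_const
  have hφ0 : φ 0 = x := by simp [φ, hg0]
  have hφt : Tendsto φ (𝓝 0) (𝓝 x) := by
    have := hφ.self_of_nhds.continuousAt
    rwa [ContinuousAt, hφ0] at this
  have hfφ : ∀ᶠ v in 𝓝 0, Θ (φ v) = ι v := hι.eventually hright
  have key : ∀ {Z : V → V}, (∀ y ∈ W, f y = 0 → fderiv ℝ f y (Z y) = 0) →
      ∀ᶠ v in 𝓝 0, φ' v (π (Z (φ v))) = Z (φ v) := by
    intro Z hZ
    filter_upwards [hfφ, hι.eventually hgd, hφt.eventually hleft.eventually_nhds,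
      hφt.eventually (hW.mem_nhds hx)] with v h1 h2 h3 h4
    have h5 : HasFDerivAt (fun y => g (Θ y)) ((fderiv ℝ g (ι v)).comp
        ((fderiv ℝ f (φ v)).prod π)) (φ v) := by
      refine HasFDerivAt.comp (φ v) ?_ (hΘd _ h4)
      rw [h1]
      exact h2.hasFDerivAt
    have h6 := h5.unique ((hasFDerivAt_id (φ v)).congr_of_eventuallyEq h3)
    have h7 := DFunLike.congr_fun h6 (Z (φ v))
    have h8 : f (φ v) = 0 := congrArg Prod.fst h1
    simpa [hZ _ h4 h8, φ', ι] using h7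
  have hXφ : HasFDerivAt (fun v => X (φ v)) ((fderiv ℝ X x).comp (φ' 0)) 0 := by
    refine HasFDerivAt.comp 0 ?_ hφ.self_of_nhds
    rw [hφ0]
    exact hX.hasFDerivAt
  have hYφ : HasFDerivAt (fun v => Y (φ v)) ((fderiv ℝ Y x).comp (φ' 0)) 0 := by
    refine HasFDerivAt.comp 0 ?_ hφ.self_of_nhds
    rw [hφ0]
    exact hY.hasFDerivAt
  have hmain := bracket_of_contDiffAt_one hφ hφ' (π.hasFDerivAt.comp 0 hXφ)
    (π.hasFDerivAt.comp 0 hYφ) hXφ hYφ (key tX) (key tY)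
  have kX := (key tX).self_of_nhds
  have kY := (key tY).self_of_nhds
  simp only [Function.comp_apply, ContinuousLinearMap.comp_apply, hφ0] at hmain kX kY
  rw [kX, kY] at hmain
  rw [VectorField.lieBracket, hmain]
  have hzero : HasFDerivAt (fun v => f (φ v)) ((fderiv ℝ f x).comp (φ' 0)) 0 := by
    refine HasFDerivAt.comp 0 ?_ hφ.self_of_nhds
    rw [hφ0]
    exact hfd x hx
  have hz2 := hzero.unique ((hasFDerivAt_const (0 : Fin c → ℝ) (0 : K)).congr_of_eventuallyEq
    (hfφ.mono fun v hv => congrArg Prod.fst hv))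
  exact DFunLike.congr_fun hz2 _

end Bracket

/-! ### The distribution of the CR orbits as the kernel of a one-form -/

section CRForm

variable {n : ℕ}

/-- Multiplication by `i`, as a real operator. -/
noncomputable def mulI (n : ℕ) : Cn n →L[ℝ] Cn n :=
  (Complex.I • ContinuousLinearMap.id ℂ (Cn n)).restrictScalars ℝ

@[simp]
theorem mulI_apply (v : Cn n) : mulI n v = Complex.I • v := rfl

theorem norm_mulI (v : Cn n) : ‖mulI n v‖ = ‖v‖ := by
  rw [mulI_apply, norm_smul, Complex.norm_I, one_mul]

theorem mulI_mulI (v : Cn n) : mulI n (mulI n v) = -v := by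
  simp [smul_smul]

theorem complex_smul_eq (c : ℂ) (v : Cn n) : c • v = c.re • v + c.im • mulI n v := by
  ext i
  apply Complex.ext <;> (simp; try ring)

/-- The complex linear form `½ (∂g - i ∂e)` attached to two real forms. -/
noncomputable def cForm (g e : Cn n →L[ℝ] ℝ) : Cn n →ₗ[ℂ] ℂ where
  toFun v := (((g v - e (mulI n v) : ℝ) : ℂ) - Complex.I * ((g (mulI n v) + e v : ℝ) : ℂ)) / 2
  map_add' v w := by
    simp only [map_add]
    push_cast
    ring
  map_smul' c v := by
    have h1 : ∀ l : Cn n →L[ℝ] ℝ, l (c • v) = c.re * l v + c.im * l (mulI n v) := fun l => by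
      rw [complex_smul_eq, map_add, map_smul, map_smul, smul_eq_mul, smul_eq_mul]
    have h2 : ∀ l : Cn n →L[ℝ] ℝ, l (mulI n (c • v)) = c.re * l (mulI n v) - c.im * l v := fun l => by
      rw [complex_smul_eq, map_add, map_smul, map_smul, mulI_mulI, map_add, map_smul, map_smul,
        map_neg, smul_eq_mul, smul_eq_mul]
      ring
    rw [h1, h1, h2, h2]
    apply Complex.ext <;> simp <;> ring

theorem cForm_apply (g e : Cn n →L[ℝ] ℝ) (v : Cn n) :
    cForm g e v = (((g v - e (mulI n v) : ℝ) : ℂ) - Complex.I * ((g (mulI n v) + e v : ℝ) : ℂ)) / 2 :=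
  rfl

theorem cForm_re (g e : Cn n →L[ℝ] ℝ) (v : Cn n) :
    (cForm g e v).re = (g v - e (mulI n v)) / 2 := by
  rw [cForm_apply, show (2 : ℂ) = ((2 : ℝ) : ℂ) by norm_num, Complex.div_ofReal_re]
  simp

theorem cForm_im (g e : Cn n →L[ℝ] ℝ) (v : Cn n) :
    (cForm g e v).im = -(g (mulI n v) + e v) / 2 := by
  rw [cForm_apply, show (2 : ℂ) = ((2 : ℝ) : ℂ) by norm_num, Complex.div_ofReal_im]
  simp

theorem wirtinger_ofReal {f : Cn n → ℝ} {z : Cn n} (hf : DifferentiableAt ℝ f z) (k : Fin n) :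
    wirtinger (fun x => (f x : ℂ)) k z =
      ((fderiv ℝ f z (EuclideanSpace.single k 1) : ℂ) -
        Complex.I * (fderiv ℝ f z (EuclideanSpace.single k Complex.I) : ℂ)) / 2 := by
  have h : HasFDerivAt (fun x => (f x : ℂ)) (Complex.ofRealCLM.comp (fderiv ℝ f z)) z :=
    Complex.ofRealCLM.hasFDerivAt.comp z hf.hasFDerivAt
  rw [wirtinger, h.fderiv]
  rfl

theorem mulI_single (k : Fin n) : mulI n (EuclideanSpace.single k 1) =
    EuclideanSpace.single k Complex.I := by
  ext i
  by_cases h : i = k <;> simp [h]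

theorem coeffA_eq {G E : Cn n → ℝ} {z : Cn n} (hG : DifferentiableAt ℝ G z)
    (hE : DifferentiableAt ℝ E z) (k : Fin n) :
    coeffA G E k z = cForm (fderiv ℝ G z) (fderiv ℝ E z) (EuclideanSpace.single k 1) := by
  rw [coeffA, wirtinger_ofReal hG, wirtinger_ofReal hE, cForm_apply, mulI_single]
  push_cast
  linear_combination (-1 / 2 * (fderiv ℝ E z (EuclideanSpace.single k Complex.I) : ℂ)) *
    (-Complex.I_mul_I)

theorem single_eq_smul (k : Fin n) (c : ℂ) :
    (EuclideanSpace.single k c : Cn n) = c • EuclideanSpace.single k 1 := by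
  ext i
  by_cases h : i = k <;> simp [h]

theorem cForm_single (g e : Cn n →L[ℝ] ℝ) (k : Fin n) (c : ℂ) :
    cForm g e (EuclideanSpace.single k c) = c * cForm g e (EuclideanSpace.single k 1) := by
  rw [single_eq_smul, map_smul, smul_eq_mul]

theorem cForm_eq_sum (g e : Cn n →L[ℝ] ℝ) (v : Cn n) :
    cForm g e v = ∑ k, v k * cForm g e (EuclideanSpace.single k 1) := by
  have h : v = ∑ k, v k • (EuclideanSpace.single k 1 : Cn n) := by
    ext i
    simp [Finset.sum_apply, Pi.single_apply]
  conv_lhs => rw [h]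
  rw [map_sum]
  simp [map_smul]

theorem cForm_fieldL {G E : Cn n → ℝ} {z : Cn n} (hG : DifferentiableAt ℝ G z)
    (hE : DifferentiableAt ℝ E z) (j k : Fin n) :
    cForm (fderiv ℝ G z) (fderiv ℝ E z) (fieldL G E j k z) = 0 := by
  rw [fieldL, map_sub, cForm_single _ _ j, cForm_single _ _ k, ← coeffA_eq hG hE,
    ← coeffA_eq hG hE]
  ring

/-- The Levi form `¼ ∂∂̄ f`, up to normalization, in real terms. -/
noncomputable def levi (f : Cn n → ℝ) (z v : Cn n) : ℝ :=
  fderiv ℝ (fderiv ℝ f) z v v + fderiv ℝ (fderiv ℝ f) z (mulI n v) (mulI n v)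

theorem hasFDerivAt_coeffA {G E : Cn n → ℝ} {z : Cn n} (hG : ContDiffAt ℝ 2 G z)
    (hE : ContDiffAt ℝ 2 E z) (k : Fin n) :
    ∃ A' : Cn n →L[ℝ] ℂ, HasFDerivAt (coeffA G E k) A' z ∧ ∀ u, A' u =
      cForm (fderiv ℝ (fderiv ℝ G) z u) (fderiv ℝ (fderiv ℝ E) z u) (EuclideanSpace.single k 1) := by
  have hG1 : HasFDerivAt (fderiv ℝ G) (fderiv ℝ (fderiv ℝ G) z) z :=
    ((hG.fderiv_right (m := 1) (by norm_num)).differentiableAt (by simp)).hasFDerivAt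
  have hE1 : HasFDerivAt (fderiv ℝ E) (fderiv ℝ (fderiv ℝ E) z) z :=
    ((hE.fderiv_right (m := 1) (by norm_num)).differentiableAt (by simp)).hasFDerivAt
  have hev : coeffA G E k =ᶠ[𝓝 z] fun z =>
      cForm (fderiv ℝ G z) (fderiv ℝ E z) (EuclideanSpace.single k 1) := by
    filter_upwards [hG.eventually (by simp), hE.eventually (by simp)] with y h1 h2
    exact coeffA_eq (h1.differentiableAt (by simp)) (h2.differentiableAt (by simp)) k
  have happ : ∀ {f : Cn n → ℝ}, HasFDerivAt (fderiv ℝ f) (fderiv ℝ (fderiv ℝ f) z) z → ∀ v,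
      HasFDerivAt (fun z => ((fderiv ℝ f z v : ℝ) : ℂ)) (Complex.ofRealCLM.comp
        ((ContinuousLinearMap.apply ℝ ℝ v).comp (fderiv ℝ (fderiv ℝ f) z))) z := fun h v =>
    Complex.ofRealCLM.hasFDerivAt.comp z ((ContinuousLinearMap.apply ℝ ℝ v).hasFDerivAt.comp z h)
  have h := ((((happ hG1 (EuclideanSpace.single k 1)).sub
    (happ hE1 (mulI n (EuclideanSpace.single k 1)))).sub
    (((happ hG1 (mulI n (EuclideanSpace.single k 1))).add
      (happ hE1 (EuclideanSpace.single k 1))).const_mul Complex.I)).mul_const (2⁻¹ : ℂ))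
  refine ⟨_, (h.congr_of_eventuallyEq (hev.trans (Eventually.of_forall fun y => ?_))), fun u => ?_⟩
  · simp [cForm_apply, div_eq_mul_inv]
  · simp [cForm_apply, div_eq_mul_inv]
    ring

theorem cForm_imBracket {G E : Cn n → ℝ} {z : Cn n} (hG : ContDiffAt ℝ 2 G z)
    (hE : ContDiffAt ℝ 2 E z) (j k : Fin n) :
    cForm (fderiv ℝ G z) (fderiv ℝ E z) (imBracket G E j k z) =
      -(1 / 4) * ((levi E z (fieldL G E j k z) : ℂ) +
        Complex.I * (levi G z (fieldL G E j k z) : ℂ)) := by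
  have hGd := hG.differentiableAt (by simp)
  have hEd := hE.differentiableAt (by simp)
  obtain ⟨Aj, hAj, hAj'⟩ := hasFDerivAt_coeffA hG hE j
  obtain ⟨Ak, hAk, hAk'⟩ := hasFDerivAt_coeffA hG hE k
  set a := fieldL G E j k z with ha
  let sg : Fin n → ℂ →L[ℝ] Cn n := fun i =>
    ((ContinuousLinearMap.id ℂ ℂ).smulRight (EuclideanSpace.single i 1 : Cn n)).restrictScalars ℝ
  have hsg : ∀ i c, sg i c = EuclideanSpace.single i c := fun i c => (single_eq_smul i c).symm
  let D : Cn n →L[ℝ] Cn n := (sg j).comp Ak - (sg k).comp Aj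
  have hD : HasFDerivAt (fieldL G E j k) D z := by
    have h := ((sg j).hasFDerivAt.comp z hAk).sub ((sg k).hasFDerivAt.comp z hAj)
    refine h.congr_of_eventuallyEq (Eventually.of_forall fun y => ?_)
    simp [hsg, fieldL]
  have hcs : ∀ c : ℂ, HasFDerivAt (fun y => c • fieldL G E j k y)
      (((c • ContinuousLinearMap.id ℂ (Cn n)).restrictScalars ℝ).comp D) z := fun c =>
    ((c • ContinuousLinearMap.id ℂ (Cn n)).restrictScalars ℝ).hasFDerivAt.comp z hD
  have hre : fderiv ℝ (reL G E j k) z = _ := (hcs (1 / 2)).fderiv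
  have him : fderiv ℝ (imL G E j k) z = _ := (hcs (-Complex.I / 2)).fderiv
  have h1 : ((1 / 2 : ℂ)) • a = (1 / 2 : ℝ) • a := by
    ext i; apply Complex.ext <;> simp
  have h2 : (-Complex.I / 2) • a = (-(1 / 2) : ℝ) • mulI n a := by
    ext i; apply Complex.ext <;> simp <;> ring
  have hT : imBracket G E j k z = (Complex.I / 2) • D a - (1 / 2 : ℂ) • D (mulI n a) := by
    rw [imBracket, VectorField.lieBracket, hre, him, reL, imL, ← ha, h1, h2]
    simp only [ContinuousLinearMap.comp_apply, map_smul, ContinuousLinearMap.coe_restrictScalars',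
      smul_apply, ContinuousLinearMap.id_apply]
    ext i
    apply Complex.ext <;> simp <;> ring
  have hDu : ∀ u, cForm (fderiv ℝ G z) (fderiv ℝ E z) (D u) =
      -cForm (fderiv ℝ (fderiv ℝ G) z u) (fderiv ℝ (fderiv ℝ E) z u) a := by
    intro u
    have e1 : D u = EuclideanSpace.single j (Ak u) - EuclideanSpace.single k (Aj u) := by
      simp [D, hsg]
    rw [e1, map_sub, cForm_single _ _ j, cForm_single _ _ k, ← coeffA_eq hGd hEd,
      ← coeffA_eq hGd hEd, ha, fieldL, map_sub, cForm_single _ _ j, cForm_single _ _ k, ← hAj', ← hAk']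
    ring
  have sG : ∀ v w, fderiv ℝ (fderiv ℝ G) z v w = fderiv ℝ (fderiv ℝ G) z w v := fun v w =>
    (hG.isSymmSndFDerivAt (by simp)).eq v w
  have sE : ∀ v w, fderiv ℝ (fderiv ℝ E) z v w = fderiv ℝ (fderiv ℝ E) z w v := fun v w =>
    (hE.isSymmSndFDerivAt (by simp)).eq v w
  rw [hT, map_sub, map_smul, map_smul, hDu, hDu, cForm_apply, cForm_apply, sG (mulI n a) a,
    sE (mulI n a) a, levi, levi]
  apply Complex.ext <;> simp <;> ring

/-- The slope `θ` of the form defining the distribution. -/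
noncomputable def slope' (G E : Cn n → ℝ) (z : Cn n) : ℝ :=
  (∑ j, ∑ k, levi E z (fieldL G E j k z)) / ∑ j, ∑ k, levi G z (fieldL G E j k z)

/-- The real one-form whose kernel is the distribution of the CR orbits. -/
noncomputable def omegaForm (G E : Cn n → ℝ) (z : Cn n) : Cn n →L[ℝ] ℝ :=
  fderiv ℝ G z - (fderiv ℝ E z).comp (mulI n) +
    slope' G E z • (fderiv ℝ E z + (fderiv ℝ G z).comp (mulI n))

theorem omegaForm_apply (G E : Cn n → ℝ) (z v : Cn n) :
    omegaForm G E z v = 2 * ((cForm (fderiv ℝ G z) (fderiv ℝ E z) v).re -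
      slope' G E z * (cForm (fderiv ℝ G z) (fderiv ℝ E z) v).im) := by
  rw [cForm_re, cForm_im]
  simp [omegaForm]
  ring

end CRForm

/-! ### Tangent spaces of a graph and the consequences of non-minimality -/

section GraphTangent

variable {n : ℕ}

/-- The differential of `z ↦ (z, G z + i E z)`. -/
noncomputable def graphLift (G E : Cn n → ℝ) (z : Cn n) : Cn n →L[ℝ] Cn n × ℂ :=
  (ContinuousLinearMap.id ℝ (Cn n)).prod
    (Complex.ofRealCLM.comp (fderiv ℝ G z) + Complex.I • Complex.ofRealCLM.comp (fderiv ℝ E z))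

theorem graphLift_apply (G E : Cn n → ℝ) (z v : Cn n) :
    graphLift G E z v = (v, (fderiv ℝ G z v : ℂ) + Complex.I * (fderiv ℝ E z v : ℂ)) := rfl

theorem hasFDerivAt_graph {G E : Cn n → ℝ} {z : Cn n} (hG : DifferentiableAt ℝ G z)
    (hE : DifferentiableAt ℝ E z) :
    HasFDerivAt (fun z => ((z, (G z : ℂ) + Complex.I * (E z : ℂ)) : Cn n × ℂ))
      (graphLift G E z) z := by
  refine (hasFDerivAt_id z).prodMk (((Complex.ofRealCLM.hasFDerivAt.comp z hG.hasFDerivAt).add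
    ((Complex.ofRealCLM.hasFDerivAt.comp z hE.hasFDerivAt).const_mul Complex.I)))

theorem HasFDerivAt.map_realTangentSpace_eq_zero {V F : Type*} [NormedAddCommGroup V]
    [NormedSpace ℝ V] [NormedAddCommGroup F] [NormedSpace ℝ F] {S W : Set V}
    {f : V → F} {f' : V →L[ℝ] F} {x v : V} (hf : HasFDerivAt f f' x) (hW : W ∈ 𝓝 x)
    (hS : ∀ y ∈ S ∩ W, f y = 0) (hx : x ∈ S) (hv : v ∈ realTangentSpace S x) : f' v = 0 := by
  have hle : realTangentSpace S x ≤ LinearMap.ker f'.toLinearMap := by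
    refine Submodule.span_le.2 fun w hw => ?_
    rw [← tangentConeAt_inter_nhds hW] at hw
    have h1 := hf.hasFDerivWithinAt.mapsTo_tangent_cone hw
    have h2 : f '' (S ∩ W) ⊆ {0} := by
      rintro _ ⟨y, hy, rfl⟩
      exact hS y hy
    have h3 := tangentConeAt_mono (𝕜 := ℝ) h2 h1
    refine tangentConeAt_subset_zero (fun hacc => ?_) h3
    rw [accPt_iff_nhds] at hacc
    obtain ⟨y, hy, hne⟩ := hacc univ univ_mem
    exact hne (hy.2.trans (hS x ⟨hx, mem_of_mem_nhds hW⟩).symm)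
  exact hle hv

theorem mem_realTangentSpace_graph {U : Set (Cn n)} (hU : IsOpen U) {G E : Cn n → ℝ} {z : Cn n}
    (hz : z ∈ U) (hG : DifferentiableAt ℝ G z) (hE : DifferentiableAt ℝ E z) {p : Cn n × ℂ} :
    p ∈ realTangentSpace (graphManifold U G E) (z, (G z : ℂ) + Complex.I * (E z : ℂ)) ↔
      p = graphLift G E z p.1 := by
  constructor
  · intro hp
    have hd : HasFDerivAt (fun q : Cn n × ℂ => q.2 - ((G q.1 : ℂ) + Complex.I * (E q.1 : ℂ)))
        (ContinuousLinearMap.snd ℝ (Cn n) ℂ - ((ContinuousLinearMap.snd ℝ (Cn n) ℂ).comp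
          (graphLift G E z)).comp (ContinuousLinearMap.fst ℝ (Cn n) ℂ))
        (z, (G z : ℂ) + Complex.I * (E z : ℂ)) := by
      have h1 := (ContinuousLinearMap.snd ℝ (Cn n) ℂ).hasFDerivAt.comp z (hasFDerivAt_graph hG hE)
      exact hasFDerivAt_snd.sub (HasFDerivAt.comp
        (g := fun z => ((G z : ℂ) + Complex.I * (E z : ℂ)))
        ((z, (G z : ℂ) + Complex.I * (E z : ℂ)) : Cn n × ℂ) h1 hasFDerivAt_fst)
    have h := hd.map_realTangentSpace_eq_zero univ_mem (S := graphManifold U G E)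
      (fun y hy => by simp [hy.1.2]) ⟨hz, rfl⟩ hp
    refine Prod.ext rfl ?_
    simpa [sub_eq_zero] using h
  · intro hp
    rw [hp]
    refine Submodule.subset_span ?_
    have h1 : p.1 ∈ tangentConeAt ℝ U z := by
      rw [tangentConeAt_of_mem_nhds (hU.mem_nhds hz)]
      trivial
    refine tangentConeAt_mono ?_
      ((hasFDerivAt_graph hG hE).hasFDerivWithinAt.mapsTo_tangent_cone h1)
    rintro _ ⟨y, hy, rfl⟩
    exact ⟨hy, rfl⟩

theorem mem_complexTangentSpace_graph {U : Set (Cn n)} (hU : IsOpen U) {G E : Cn n → ℝ} {z : Cn n}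
    (hz : z ∈ U) (hG : DifferentiableAt ℝ G z) (hE : DifferentiableAt ℝ E z) {p : Cn n × ℂ} :
    p ∈ complexTangentSpace (graphManifold U G E) (z, (G z : ℂ) + Complex.I * (E z : ℂ)) ↔
      p = graphLift G E z p.1 ∧ cForm (fderiv ℝ G z) (fderiv ℝ E z) p.1 = 0 := by
  change (p ∈ realTangentSpace _ _ ∧ Complex.I • p ∈ realTangentSpace _ _) ↔ _
  rw [mem_realTangentSpace_graph hU hz hG hE, mem_realTangentSpace_graph hU hz hG hE]
  refine and_congr_right fun hp => ?_
  have h1 : (Complex.I • p = graphLift G E z (Complex.I • p).1) ↔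
      Complex.I * ((fderiv ℝ G z p.1 : ℂ) + Complex.I * (fderiv ℝ E z p.1 : ℂ)) =
        (fderiv ℝ G z (mulI n p.1) : ℂ) + Complex.I * (fderiv ℝ E z (mulI n p.1) : ℂ) := by
    rw [Prod.ext_iff]
    have h2 : p.2 = (fderiv ℝ G z p.1 : ℂ) + Complex.I * (fderiv ℝ E z p.1 : ℂ) :=
      congrArg Prod.snd hp
    rw [graphLift_apply]
    simp only [Prod.smul_fst, Prod.smul_snd, true_and, h2, smul_eq_mul, mulI_apply]
  rw [h1, Complex.ext_iff, Complex.ext_iff, cForm_re, cForm_im]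
  simp only [Complex.mul_re, Complex.mul_im, Complex.add_re, Complex.add_im, Complex.I_re,
    Complex.I_im, Complex.ofReal_re, Complex.ofReal_im, Complex.zero_re, Complex.zero_im]
  constructor <;> rintro ⟨h, h'⟩ <;> constructor <;> linarith

theorem finrank_complexTangentSpace_graph {U : Set (Cn n)} (hU : IsOpen U) {G E : Cn n → ℝ}
    {z : Cn n} (hz : z ∈ U) (hG : DifferentiableAt ℝ G z) (hE : DifferentiableAt ℝ E z)
    (hA : cForm (fderiv ℝ G z) (fderiv ℝ E z) ≠ 0) :
    crDim (graphManifold U G E) (z, (G z : ℂ) + Complex.I * (E z : ℂ)) = n - 1 := by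
  set T := complexTangentSpace (graphManifold U G E) (z, (G z : ℂ) + Complex.I * (E z : ℂ))
  have hinj : Function.Injective ((LinearMap.fst ℂ (Cn n) ℂ).domRestrict T) := by
    rw [injective_iff_map_eq_zero]
    rintro ⟨p, hp⟩ h
    have h1 := ((mem_complexTangentSpace_graph hU hz hG hE).1 hp).1
    have h2 : p.1 = 0 := h
    rw [h2, map_zero] at h1
    exact Subtype.ext h1
  have hrange : LinearMap.range ((LinearMap.fst ℂ (Cn n) ℂ).domRestrict T) =
      LinearMap.ker (cForm (fderiv ℝ G z) (fderiv ℝ E z)) := by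
    ext v
    constructor
    · rintro ⟨⟨p, hp⟩, rfl⟩
      exact ((mem_complexTangentSpace_graph hU hz hG hE).1 hp).2
    · intro hv
      exact ⟨⟨graphLift G E z v, (mem_complexTangentSpace_graph hU hz hG hE).2 ⟨rfl, hv⟩⟩, rfl⟩
  have h1 := Module.Dual.finrank_ker_add_one_of_ne_zero (f := cForm (fderiv ℝ G z) (fderiv ℝ E z)) hA
  rw [← hrange, LinearMap.finrank_range_of_inj hinj] at h1
  simp only [finrank_euclideanSpace, Fintype.card_fin] at h1
  change Module.finrank ℂ T = n - 1
  omega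

/-- Near a non-minimal point, the graph contains the zero set of a submersion into `ℝᶜ`, `c > 2`,
to which the complex tangent spaces of the graph are tangent. -/
theorem exists_submersion_of_nonminimal {U : Set (Cn n)} (hU : IsOpen U) {G E : Cn n → ℝ}
    (hG : DifferentiableOn ℝ G U) (hE : DifferentiableOn ℝ E U) {z : Cn n} (hz : z ∈ U)
    (hA : cForm (fderiv ℝ G z) (fderiv ℝ E z) ≠ 0)
    (hM : ∀ q, IsCRPoint (graphManifold U G E) q → IsNonMinimalAt (graphManifold U G E) q) :
    ∃ c : ℕ, 2 < c ∧ ∃ W : Set (Cn n × ℂ), IsOpen W ∧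
      (z, (G z : ℂ) + Complex.I * (E z : ℂ)) ∈ W ∧ ∃ f : Cn n × ℂ → Fin c → ℝ,
      ContDiffOn ℝ 1 f W ∧ f (z, (G z : ℂ) + Complex.I * (E z : ℂ)) = 0 ∧
      ∀ y ∈ W, f y = 0 → Function.Surjective (fderiv ℝ f y) ∧ y.1 ∈ U ∧
        (cForm (fderiv ℝ G y.1) (fderiv ℝ E y.1) ≠ 0 →
          ∀ v, cForm (fderiv ℝ G y.1) (fderiv ℝ E y.1) v = 0 →
            fderiv ℝ f y (graphLift G E y.1 v) = 0) := by
  have hGd : ∀ x ∈ U, DifferentiableAt ℝ G x := fun x hx => hG.differentiableAt (hU.mem_nhds hx)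
  have hEd : ∀ x ∈ U, DifferentiableAt ℝ E x := fun x hx => hE.differentiableAt (hU.mem_nhds hx)
  obtain ⟨S, hqS, hSM, c, hc, hS⟩ := hM (z, (G z : ℂ) + Complex.I * (E z : ℂ))
    ⟨⟨hz, rfl⟩, finrank_complexTangentSpace_graph hU hz (hGd z hz) (hEd z hz) hA⟩
  obtain ⟨W, hW, hqW, f, hf, hfS, hfs⟩ := (hS _ hqS).1
  have hmem : ∀ y ∈ W, f y = 0 → y ∈ S := fun y hy h => (hfS.symm.subset ⟨hy, h⟩).1
  refine ⟨c, hc, W, hW, hqW, f, hf, (hfS.subset ⟨hqS, hqW⟩).2, fun y hy h => ⟨hfs y ⟨hmem y hy h, hy⟩,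
    (hSM (hmem y hy h)).1, fun hA' v hv => ?_⟩⟩
  have hyS := hmem y hy h
  have hyM := hSM hyS
  have hy2 : y = (y.1, (G y.1 : ℂ) + Complex.I * (E y.1 : ℂ)) := Prod.ext rfl hyM.2
  have hle : complexTangentSpace S y ≤ complexTangentSpace (graphManifold U G E) y := by
    have hr : realTangentSpace S y ≤ realTangentSpace (graphManifold U G E) y :=
      Submodule.span_mono (tangentConeAt_mono hSM)
    exact fun p hp => ⟨hr hp.1, hr hp.2⟩
  have heq : complexTangentSpace S y = complexTangentSpace (graphManifold U G E) y := by
    refine Submodule.eq_of_le_of_finrank_eq hle ?_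
    have h1 := (hS y hyS).2
    have h2 := finrank_complexTangentSpace_graph hU hyM.1 (hGd _ hyM.1) (hEd _ hyM.1) hA'
    rw [← hy2] at h2
    exact h1.trans h2.symm
  have hv1 : graphLift G E y.1 v ∈ complexTangentSpace S y := by
    rw [heq, hy2]
    exact (mem_complexTangentSpace_graph hU hyM.1 (hGd _ hyM.1) (hEd _ hyM.1)).2 ⟨rfl, hv⟩
  refine ((hf.contDiffAt (hW.mem_nhds hy)).differentiableAt
    (by simp)).hasFDerivAt.map_realTangentSpace_eq_zero (hW.mem_nhds hy) (S := S) ?_ hyS hv1.1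
  intro y' hy'
  exact (hfS.subset hy').2

/-- The bracket of two lifted fields tangent to `{f = 0}` is the lift of the bracket, and tangent
to it. -/
theorem fderiv_graphLift_lieBracket {c : ℕ} {W : Set (Cn n × ℂ)} (hW : IsOpen W) {y : Cn n × ℂ}
    (hy : y ∈ W) {f : Cn n × ℂ → Fin c → ℝ} (hf : ContDiffOn ℝ 1 f W) (hfy : f y = 0)
    (hs : Function.Surjective (fderiv ℝ f y)) {G E : Cn n → ℝ} (hG : ContDiffAt ℝ 2 G y.1)
    (hE : ContDiffAt ℝ 2 E y.1) {X Y : Cn n → Cn n} (hX : DifferentiableAt ℝ X y.1)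
    (hY : DifferentiableAt ℝ Y y.1) {B : Set (Cn n)} (hB : B ∈ 𝓝 y.1)
    (tX : ∀ p ∈ W, p.1 ∈ B → f p = 0 → fderiv ℝ f p (graphLift G E p.1 (X p.1)) = 0)
    (tY : ∀ p ∈ W, p.1 ∈ B → f p = 0 → fderiv ℝ f p (graphLift G E p.1 (Y p.1)) = 0) :
    fderiv ℝ f y (graphLift G E y.1 (VectorField.lieBracket ℝ X Y y.1)) = 0 := by
  obtain ⟨B', hB', hB'o, hyB'⟩ := mem_nhds_iff.1 hB
  have hG1 : HasFDerivAt (fderiv ℝ G) (fderiv ℝ (fderiv ℝ G) y.1) y.1 :=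
    ((hG.fderiv_right (m := 1) (by norm_num)).differentiableAt (by simp)).hasFDerivAt
  have hE1 : HasFDerivAt (fderiv ℝ E) (fderiv ℝ (fderiv ℝ E) y.1) y.1 :=
    ((hE.fderiv_right (m := 1) (by norm_num)).differentiableAt (by simp)).hasFDerivAt
  have hlift : ∀ {X : Cn n → Cn n}, DifferentiableAt ℝ X y.1 →
      ∃ L : Cn n × ℂ →L[ℝ] Cn n × ℂ,
        HasFDerivAt (fun p : Cn n × ℂ => graphLift G E p.1 (X p.1)) L y ∧
        ∀ u, L u = (fderiv ℝ X y.1 u.1, ((fderiv ℝ (fderiv ℝ G) y.1 u.1 (X y.1) +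
          fderiv ℝ G y.1 (fderiv ℝ X y.1 u.1) : ℝ) : ℂ) + Complex.I *
          ((fderiv ℝ (fderiv ℝ E) y.1 u.1 (X y.1) +
          fderiv ℝ E y.1 (fderiv ℝ X y.1 u.1) : ℝ) : ℂ)) := by
    intro X hX
    have h1 := hX.hasFDerivAt
    have h2 := h1.prodMk ((Complex.ofRealCLM.hasFDerivAt.comp y.1 (hG1.clm_apply h1)).add
      ((Complex.ofRealCLM.hasFDerivAt.comp y.1 (hE1.clm_apply h1)).const_mul Complex.I))
    refine ⟨_, HasFDerivAt.comp y h2 hasFDerivAt_fst, fun u => ?_⟩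
    simp
    ring
  obtain ⟨LX, hLX, hLX'⟩ := hlift hX
  obtain ⟨LY, hLY, hLY'⟩ := hlift hY
  have hW' : IsOpen (W ∩ Prod.fst ⁻¹' B') := hW.inter (hB'o.preimage continuous_fst)
  have h := lieBracket_mem_ker hW' ⟨hy, hyB'⟩ (hf.mono inter_subset_left) hfy hs
    hLX.differentiableAt hLY.differentiableAt (fun p hp => tX p hp.1 (hB' hp.2))
    (fun p hp => tY p hp.1 (hB' hp.2))
  rw [← h]
  congr 1
  rw [VectorField.lieBracket, VectorField.lieBracket, hLX.fderiv, hLY.fderiv, hLX', hLY',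
    graphLift_apply]
  have sG : ∀ v w, fderiv ℝ (fderiv ℝ G) y.1 v w = fderiv ℝ (fderiv ℝ G) y.1 w v := fun v w =>
    (hG.isSymmSndFDerivAt (by simp)).eq v w
  have sE : ∀ v w, fderiv ℝ (fderiv ℝ E) y.1 v w = fderiv ℝ (fderiv ℝ E) y.1 w v := fun v w =>
    (hE.isSymmSndFDerivAt (by simp)).eq v w
  refine Prod.ext (by simp [graphLift_apply]) ?_
  simp only [graphLift_apply, Prod.snd_sub, map_sub]
  rw [sG (X y.1), sE (X y.1)]
  push_cast
  ring

/-- A submersion into `ℝᶜ`, `c > 2`, does not annihilate the tangent space of a graph. -/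
theorem exists_graphLift_ne_zero {c : ℕ} (hc : 2 < c) {f' : Cn n × ℂ →L[ℝ] (Fin c → ℝ)}
    (hs : Function.Surjective f') (G E : Cn n → ℝ) (z : Cn n) :
    ∃ v, f' (graphLift G E z v) ≠ 0 := by
  by_contra! h
  let g : ℂ →ₗ[ℝ] (Fin c → ℝ) := f'.toLinearMap ∘ₗ LinearMap.inr ℝ (Cn n) ℂ
  have hg : Function.Surjective g := by
    intro r
    obtain ⟨p, hp⟩ := hs r
    refine ⟨p.2 - (graphLift G E z p.1).2, ?_⟩
    rw [← hp]
    have h1 : p = graphLift G E z p.1 + LinearMap.inr ℝ (Cn n) ℂ (p.2 - (graphLift G E z p.1).2) := by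
      refine Prod.ext ?_ ?_ <;> simp [graphLift_apply]
    conv_rhs => rw [h1, map_add, h, zero_add]
    rfl
  have := LinearMap.finrank_le_finrank_of_surjective hg
  rw [Complex.finrank_real_complex] at this
  simp at this
  omega

end GraphTangent

section CRStructure

variable {n : ℕ}

theorem smul_fieldL_mem (G E : Cn n → ℝ) (z : Cn n) (j k : Fin n) (c : ℂ) :
    c • fieldL G E j k z ∈ crDistribution G E z := by
  have h : c • fieldL G E j k z = (2 * c.re) • reL G E j k z + (-2 * c.im) • imL G E j k z := by
    rw [reL, imL]
    ext i
    apply Complex.ext <;> simp <;> ring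
  rw [h]
  exact add_mem (Submodule.smul_mem _ _ (Submodule.subset_span ⟨j, k, Or.inl rfl⟩))
    (Submodule.smul_mem _ _ (Submodule.subset_span ⟨j, k, Or.inr (Or.inl rfl)⟩))

theorem mem_crDistribution_of_cForm_eq_zero {G E : Cn n → ℝ} {z : Cn n}
    (hG : DifferentiableAt ℝ G z) (hE : DifferentiableAt ℝ E z)
    (hA : cForm (fderiv ℝ G z) (fderiv ℝ E z) ≠ 0) {v : Cn n}
    (hv : cForm (fderiv ℝ G z) (fderiv ℝ E z) v = 0) : v ∈ crDistribution G E z := by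
  obtain ⟨k, hk⟩ : ∃ k, coeffA G E k z ≠ 0 := by
    by_contra! h
    refine hA (LinearMap.ext fun w => ?_)
    rw [cForm_eq_sum]
    simp [← coeffA_eq hG hE, h]
  have hsum : v = ∑ j, (v j / coeffA G E k z) • fieldL G E j k z := by
    have h1 : ∀ j, (v j / coeffA G E k z) • fieldL G E j k z = EuclideanSpace.single j (v j) -
        (v j * coeffA G E j z) • EuclideanSpace.single k (coeffA G E k z)⁻¹ := by
      intro j
      rw [fieldL, single_eq_smul j (coeffA G E k z), single_eq_smul k (coeffA G E j z),
        single_eq_smul j (v j), single_eq_smul k (coeffA G E k z)⁻¹, smul_sub, smul_smul, smul_smul,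
        smul_smul, div_mul_cancel₀ _ hk]
      congr 2
      field_simp
    simp only [h1]
    rw [Finset.sum_sub_distrib, ← Finset.sum_smul]
    rw [cForm_eq_sum] at hv
    simp only [← coeffA_eq hG hE] at hv
    rw [hv, zero_smul, sub_zero]
    ext i
    simp [Finset.sum_apply, Pi.single_apply]
  rw [hsum]
  exact Submodule.sum_mem _ fun j _ => smul_fieldL_mem G E z j k _

theorem fieldL_smul_mem_ker {G E : Cn n → ℝ} {z : Cn n} (hG : DifferentiableAt ℝ G z)
    (hE : DifferentiableAt ℝ E z) (j k : Fin n) :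
    cForm (fderiv ℝ G z) (fderiv ℝ E z) (reL G E j k z) = 0 ∧
      cForm (fderiv ℝ G z) (fderiv ℝ E z) (imL G E j k z) = 0 := by
  rw [reL, imL, map_smul, map_smul, cForm_fieldL hG hE, smul_zero, smul_zero]
  exact ⟨rfl, rfl⟩

theorem differentiableAt_fieldL {G E : Cn n → ℝ} {z : Cn n} (hG : ContDiffAt ℝ 2 G z)
    (hE : ContDiffAt ℝ 2 E z) (j k : Fin n) : DifferentiableAt ℝ (fieldL G E j k) z := by
  obtain ⟨Aj, hAj, -⟩ := hasFDerivAt_coeffA hG hE j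
  obtain ⟨Ak, hAk, -⟩ := hasFDerivAt_coeffA hG hE k
  have h : fieldL G E j k = fun y => coeffA G E k y • (EuclideanSpace.single j 1 : Cn n) -
      coeffA G E j y • (EuclideanSpace.single k 1 : Cn n) := by
    ext1 y
    rw [fieldL, single_eq_smul, single_eq_smul k]
  rw [h]
  exact (hAk.differentiableAt.smul_const _).sub (hAj.differentiableAt.smul_const _)

/-- If a nonzero real form annihilates `ker A` and all the brackets, the distribution is the kernel
of `omegaForm`. -/
theorem crDistribution_eq_ker_of_annihilator {G E : Cn n → ℝ} {z : Cn n} (hG : ContDiffAt ℝ 2 G z)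
    (hE : ContDiffAt ℝ 2 E z) (hA : cForm (fderiv ℝ G z) (fderiv ℝ E z) ≠ 0)
    (hL : ∑ j, ∑ k, levi G z (fieldL G E j k z) ≠ 0) {l : Cn n →L[ℝ] ℝ} (hl : l ≠ 0)
    (hlA : ∀ v, cForm (fderiv ℝ G z) (fderiv ℝ E z) v = 0 → l v = 0)
    (hlT : ∀ j k, l (imBracket G E j k z) = 0) :
    crDistribution G E z = LinearMap.ker (omegaForm G E z).toLinearMap ∧ omegaForm G E z ≠ 0 := by
  have hGd := hG.differentiableAt (by simp)
  have hEd := hE.differentiableAt (by simp)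
  set A := cForm (fderiv ℝ G z) (fderiv ℝ E z) with hAdef
  obtain ⟨e₀, he₀⟩ : ∃ e, A e ≠ 0 := by
    by_contra! h
    exact hA (LinearMap.ext h)
  obtain ⟨e, he⟩ : ∃ e, A e = 1 := ⟨(A e₀)⁻¹ • e₀, by simp [he₀]⟩
  have hlv : ∀ v, l v = (A v).re * l e + (A v).im * l (mulI n e) := by
    intro v
    have h := hlA (v - A v • e) (by rw [map_sub, map_smul, he]; simp)
    rw [map_sub, complex_smul_eq, map_add, map_smul, map_smul, sub_eq_zero] at h
    exact h
  set L := fun j k => levi G z (fieldL G E j k z)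
  set L' := fun j k => levi E z (fieldL G E j k z)
  have hT : ∀ j k, A (imBracket G E j k z) = -(1 / 4) * ((L' j k : ℂ) + Complex.I * (L j k : ℂ)) :=
    fun j k => cForm_imBracket hG hE j k
  have hTre : ∀ j k, (A (imBracket G E j k z)).re = -(1 / 4) * L' j k := fun j k => by
    rw [hT, show (-(1 / 4) : ℂ) = ((-(1 / 4) : ℝ) : ℂ) by norm_num, Complex.re_ofReal_mul]
    simp
  have hTim : ∀ j k, (A (imBracket G E j k z)).im = -(1 / 4) * L j k := fun j k => by
    rw [hT, show (-(1 / 4) : ℂ) = ((-(1 / 4) : ℝ) : ℂ) by norm_num, Complex.im_ofReal_mul]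
    simp
  have h1 : ∀ j k, L' j k * l e + L j k * l (mulI n e) = 0 := by
    intro j k
    have := hlT j k
    rw [hlv, hTre, hTim] at this
    linarith
  have hθ : slope' G E z = (∑ j, ∑ k, L' j k) / ∑ j, ∑ k, L j k := rfl
  have h2 : (∑ j, ∑ k, L' j k) * l e + (∑ j, ∑ k, L j k) * l (mulI n e) = 0 := by
    simp only [Finset.sum_mul, ← Finset.sum_add_distrib, h1, Finset.sum_const_zero]
  have h3 : l (mulI n e) = -slope' G E z * l e := by
    rw [hθ]
    have hL' : (∑ j, ∑ k, L j k) ≠ 0 := hL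
    field_simp
    linarith
  have hω : ∀ v, 2 * l v = l e * omegaForm G E z v := by
    intro v
    rw [omegaForm_apply, hlv v, h3]
    ring
  have hle : l e ≠ 0 := by
    intro h
    refine hl (ContinuousLinearMap.ext fun v => ?_)
    have := hω v
    rw [h, zero_mul] at this
    simpa using this
  have hω0 : ∀ v, l v = 0 ↔ omegaForm G E z v = 0 := by
    intro v
    have := hω v
    constructor
    · intro h
      rw [h, mul_zero, eq_comm, mul_eq_zero] at this
      exact this.resolve_left hle
    · intro h
      rw [h, mul_zero] at this
      linarith
  refine ⟨le_antisymm ?_ ?_, fun h => hl (ContinuousLinearMap.ext fun v => (hω0 v).2 (by simp [h]))⟩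
  · refine Submodule.span_le.2 ?_
    rintro v ⟨j, k, rfl | rfl | rfl⟩
    · exact (hω0 _).1 (hlA _ (fieldL_smul_mem_ker hGd hEd j k).1)
    · exact (hω0 _).1 (hlA _ (fieldL_smul_mem_ker hGd hEd j k).2)
    · exact (hω0 _).1 (hlT j k)
  · intro v hv
    obtain ⟨j, k, hjk⟩ : ∃ j k, L j k ≠ 0 := by
      by_contra! h
      exact hL (Finset.sum_eq_zero fun j _ => Finset.sum_eq_zero fun k _ => h j k)
    set s : ℝ := -4 * (A v).im / L j k
    have hv' : (A v).re = slope' G E z * (A v).im := by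
      have : omegaForm G E z v = 0 := hv
      rw [omegaForm_apply] at this
      linarith
    have hL'θ : L' j k = slope' G E z * L j k := by
      have := h1 j k
      rw [h3] at this
      have h4 : (L' j k - slope' G E z * L j k) * l e = 0 := by linarith
      linarith [(mul_eq_zero.1 h4).resolve_right hle]
    have hker : A (v - s • imBracket G E j k z) = 0 := by
      rw [map_sub, show s • imBracket G E j k z = (s : ℂ) • imBracket G E j k z by
        ext i; simp, map_smul]
      apply Complex.ext
      · rw [Complex.sub_re, smul_eq_mul, Complex.re_ofReal_mul, hTre, hL'θ, hv']
        simp only [s, Complex.zero_re]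
        field_simp
        ring
      · rw [Complex.sub_im, smul_eq_mul, Complex.im_ofReal_mul, hTim]
        simp only [s, Complex.zero_im]
        field_simp
        ring
    have := add_mem (mem_crDistribution_of_cForm_eq_zero hGd hEd hA hker)
      (Submodule.smul_mem _ s (Submodule.subset_span ⟨j, k, Or.inr (Or.inr rfl)⟩ :
        imBracket G E j k z ∈ crDistribution G E z))
    rwa [sub_add_cancel] at this

/-- Non-minimality of the graph makes the distribution a hyperplane field satisfying the Frobenius
condition. -/
theorem crDistribution_eq_ker_and_frobenius {U B : Set (Cn n)} (hU : IsOpen U) (hB : IsOpen B)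
    (hBU : B ⊆ U) {G E : Cn n → ℝ} (hG : ContDiffOn ℝ 2 G U) (hE : ContDiffOn ℝ 2 E U)
    (hA : ∀ z ∈ B, cForm (fderiv ℝ G z) (fderiv ℝ E z) ≠ 0)
    (hL : ∀ z ∈ B, ∑ j, ∑ k, levi G z (fieldL G E j k z) ≠ 0)
    (hM : ∀ q, IsCRPoint (graphManifold U G E) q → IsNonMinimalAt (graphManifold U G E) q)
    {z : Cn n} (hz : z ∈ B) :
    crDistribution G E z = LinearMap.ker (omegaForm G E z).toLinearMap ∧ omegaForm G E z ≠ 0 ∧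
    ∀ ω' : Cn n →L[ℝ] Cn n →L[ℝ] ℝ, HasFDerivAt (omegaForm G E) ω' z →
      ∀ v w, omegaForm G E z v = 0 → omegaForm G E z w = 0 → ω' v w = ω' w v := by
  have hGc : ∀ x ∈ U, ContDiffAt ℝ 2 G x := fun x hx => hG.contDiffAt (hU.mem_nhds hx)
  have hEc : ∀ x ∈ U, ContDiffAt ℝ 2 E x := fun x hx => hE.contDiffAt (hU.mem_nhds hx)
  obtain ⟨c, hc, W, hW, hqW, f, hf, hfq, hfW⟩ := exists_submersion_of_nonminimal hU
    (hG.differentiableOn (by simp)) (hE.differentiableOn (by simp)) (hBU hz) (hA z hz) hM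
  have hbr : ∀ y ∈ W, f y = 0 → y.1 ∈ B → ∀ {X Y : Cn n → Cn n}, DifferentiableAt ℝ X y.1 →
      DifferentiableAt ℝ Y y.1 → ∀ {B' : Set (Cn n)}, B' ∈ 𝓝 y.1 →
      (∀ p ∈ W, p.1 ∈ B' → f p = 0 → fderiv ℝ f p (graphLift G E p.1 (X p.1)) = 0) →
      (∀ p ∈ W, p.1 ∈ B' → f p = 0 → fderiv ℝ f p (graphLift G E p.1 (Y p.1)) = 0) →
      fderiv ℝ f y (graphLift G E y.1 (VectorField.lieBracket ℝ X Y y.1)) = 0 :=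
    fun y hy hfy hyB X Y hX hY B' hB' tX tY => fderiv_graphLift_lieBracket hW hy hf hfy
      (hfW y hy hfy).1 (hGc _ (hBU hyB)) (hEc _ (hBU hyB)) hX hY hB' tX tY
  have hTt : ∀ y ∈ W, f y = 0 → y.1 ∈ B → ∀ j k,
      fderiv ℝ f y (graphLift G E y.1 (imBracket G E j k y.1)) = 0 := by
    intro y hy hfy hyB j k
    have hd := differentiableAt_fieldL (hGc _ (hBU hyB)) (hEc _ (hBU hyB)) j k
    have ht : ∀ p ∈ W, p.1 ∈ B → f p = 0 → fderiv ℝ f p (graphLift G E p.1 (reL G E j k p.1)) = 0 ∧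
        fderiv ℝ f p (graphLift G E p.1 (imL G E j k p.1)) = 0 := by
      intro p hp hpB hfp
      have h1 := fieldL_smul_mem_ker ((hGc _ (hBU hpB)).differentiableAt (by simp))
        ((hEc _ (hBU hpB)).differentiableAt (by simp)) j k
      exact ⟨(hfW p hp hfp).2.2 (hA _ hpB) _ h1.1, (hfW p hp hfp).2.2 (hA _ hpB) _ h1.2⟩
    have h := hbr y hy hfy hyB (X := reL G E j k) (Y := imL G E j k)
      (hd.const_smul (1 / 2 : ℂ)) (hd.const_smul (-Complex.I / 2))
      (hB.mem_nhds hyB) (fun p hp hpB hfp => (ht p hp hpB hfp).1)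
      (fun p hp hpB hfp => (ht p hp hpB hfp).2)
    rw [imBracket, map_smul, map_smul, h, smul_zero]
  have hker : ∀ y ∈ W, f y = 0 → y.1 ∈ B →
      (crDistribution G E y.1 = LinearMap.ker (omegaForm G E y.1).toLinearMap ∧
        omegaForm G E y.1 ≠ 0) ∧
      ∀ v, omegaForm G E y.1 v = 0 → fderiv ℝ f y (graphLift G E y.1 v) = 0 := by
    intro y hy hfy hyB
    obtain ⟨v, hv⟩ := exists_graphLift_ne_zero hc (hfW y hy hfy).1 G E y.1
    obtain ⟨i, hi⟩ := Function.ne_iff.1 hv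
    let l : Cn n →L[ℝ] ℝ := ((ContinuousLinearMap.proj i).comp (fderiv ℝ f y)).comp (graphLift G E y.1)
    have hl : l ≠ 0 := fun h => hi (by
      have := DFunLike.congr_fun h v
      exact this)
    have h1 : _ ∧ _ := crDistribution_eq_ker_of_annihilator (hGc _ (hBU hyB)) (hEc _ (hBU hyB))
      (hA _ hyB) (hL _ hyB) hl (fun w hw => by
        have := congrFun ((hfW y hy hfy).2.2 (hA _ hyB) w hw) i
        exact this) (fun j k => by
        have := congrFun (hTt y hy hfy hyB j k) i
        exact this)
    refine ⟨h1, fun w hw => ?_⟩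
    have hle : crDistribution G E y.1 ≤
        LinearMap.ker ((fderiv ℝ f y).comp (graphLift G E y.1)).toLinearMap := by
      refine Submodule.span_le.2 ?_
      have h2 := fun j k => fieldL_smul_mem_ker ((hGc _ (hBU hyB)).differentiableAt (by simp))
        ((hEc _ (hBU hyB)).differentiableAt (by simp)) j k
      rintro v ⟨j, k, rfl | rfl | rfl⟩
      · exact (hfW y hy hfy).2.2 (hA _ hyB) _ (h2 j k).1
      · exact (hfW y hy hfy).2.2 (hA _ hyB) _ (h2 j k).2
      · exact hTt y hy hfy hyB j k
    refine hle ?_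
    rw [h1.1]
    exact hw
  obtain ⟨⟨h1, h2⟩, h3⟩ := hker _ hqW hfq hz
  refine ⟨h1, h2, fun ω' hω' v w hv hw => ?_⟩
  obtain ⟨e, he⟩ : ∃ e, omegaForm G E z e ≠ 0 := by
    by_contra! h
    exact h2 (ContinuousLinearMap.ext h)
  have happ : ∀ u, HasFDerivAt (fun y => omegaForm G E y u)
      ((ContinuousLinearMap.apply ℝ ℝ u).comp ω') z := fun u =>
    (ContinuousLinearMap.apply ℝ ℝ u).hasFDerivAt.comp z hω'
  let X : Cn n → Cn n → Cn n := fun u y => u - (omegaForm G E y u / omegaForm G E y e) • e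
  have hX : ∀ u, omegaForm G E z u = 0 → HasFDerivAt (X u)
      (-((omegaForm G E z e)⁻¹ • (ContinuousLinearMap.apply ℝ ℝ u).comp ω').smulRight e) z := by
    intro u hu
    have h := (((happ u).mul ((hasDerivAt_inv he).comp_hasFDerivAt z (happ e))).smul_const e).const_sub u
    refine (h.congr_fderiv ?_).congr_of_eventuallyEq (Eventually.of_forall fun y => ?_)
    · ext1 x
      simp [hu]
    · simp [X, div_eq_mul_inv]
  have hev : ∀ᶠ y in 𝓝 z, omegaForm G E y e ≠ 0 := (happ e).continuousAt.eventually_ne he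
  have ht : ∀ u, ∀ p ∈ W, p.1 ∈ {y | omegaForm G E y e ≠ 0} ∩ B → f p = 0 →
      fderiv ℝ f p (graphLift G E p.1 (X u p.1)) = 0 := by
    intro u p hp hpB hfp
    refine (hker p hp hfp hpB.2).2 _ ?_
    simp only [X, map_sub, map_smul, smul_eq_mul]
    rw [div_mul_cancel₀ _ hpB.1, sub_self]
  have hb := hbr _ hqW hfq hz (hX v hv).differentiableAt (hX w hw).differentiableAt
    (Filter.inter_mem hev (hB.mem_nhds hz)) (ht v) (ht w)
  have hXv : ∀ u, omegaForm G E z u = 0 → X u z = u := fun u hu => by simp [X, hu]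
  have hbe : VectorField.lieBracket ℝ (X v) (X w) z =
      ((ω' w v - ω' v w) * (omegaForm G E z e)⁻¹) • e := by
    rw [VectorField.lieBracket, (hX v hv).fderiv, (hX w hw).fderiv, hXv v hv, hXv w hw]
    simp only [neg_apply, ContinuousLinearMap.smulRight_apply,
      smul_apply, ContinuousLinearMap.comp_apply,
      ContinuousLinearMap.apply_apply, smul_eq_mul]
    rw [← neg_smul, ← neg_smul, ← sub_smul]
    congr 1
    ring
  obtain ⟨u, hu⟩ := exists_graphLift_ne_zero hc (hfW _ hqW hfq).1 G E z
  simp only [hbe, map_smul] at hb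
  rcases smul_eq_zero.1 hb with h | h
  · rcases mul_eq_zero.1 h with h | h
    · linarith
    · exact absurd h (inv_ne_zero he)
  · refine absurd ?_ hu
    have h5 := h3 (u - (omegaForm G E z u / omegaForm G E z e) • e) (by
      simp only [map_sub, map_smul, smul_eq_mul]
      rw [div_mul_cancel₀ _ he, sub_self])
    simp only [map_sub, map_smul, h, smul_zero, sub_zero] at h5
    exact h5

end CRStructure

/-! ### Ordinary differential equations with parameters in a compact space -/

section ODE

theorem continuous_projIcc_unit : Continuous (projIcc (0 : ℝ) 1 zero_le_one) :=
  continuous_projIcc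

theorem abs_integral_le_of_weighted {g : unitInterval → ℝ} {L c M : ℝ} (hL : 0 ≤ L)
    (hc : 0 < c) (hLc : 2 * L ≤ c) (hM : 0 ≤ M)
    (hb : ∀ s : unitInterval, |g s| ≤ L * (Real.exp (c * s) * M)) (t : unitInterval) :
    |∫ s in (0 : ℝ)..t, g (projIcc 0 1 zero_le_one s)| ≤ Real.exp (c * t) * (M / 2) := by
  have ht := t.2
  have h1 : |∫ s in (0 : ℝ)..t, g (projIcc 0 1 zero_le_one s)| ≤
      ∫ s in (0 : ℝ)..t, L * (Real.exp (c * s) * M) := by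
    rw [← Real.norm_eq_abs]
    refine intervalIntegral.norm_integral_le_of_norm_le ht.1 ?_ ?_
    · refine Eventually.of_forall fun s hs => ?_
      have hs' : s ∈ Icc (0 : ℝ) 1 := ⟨hs.1.le, hs.2.trans ht.2⟩
      rw [projIcc_of_mem zero_le_one hs', Real.norm_eq_abs]
      exact hb ⟨s, hs'⟩
    · exact (by fun_prop : Continuous fun s : ℝ => L * (Real.exp (c * s) * M)).intervalIntegrable _ _
  have h2 : ∫ s in (0 : ℝ)..t, L * (Real.exp (c * s) * M) =
      L * M / c * Real.exp (c * t) - L * M / c := by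
    have h3 : ∀ s ∈ uIcc (0 : ℝ) t, HasDerivAt (fun s => L * M / c * Real.exp (c * s))
        (L * (Real.exp (c * s) * M)) s := by
      intro s _
      have h := (((hasDerivAt_id s).const_mul c).exp).const_mul (L * M / c)
      refine h.congr_deriv ?_
      simp only [id]
      field_simp
    rw [intervalIntegral.integral_eq_sub_of_hasDerivAt h3
      ((by fun_prop : Continuous fun s : ℝ => L * (Real.exp (c * s) * M)).intervalIntegrable _ _)]
    simp
  have h3 : L * M / c ≤ M / 2 := by
    rw [div_le_div_iff₀ hc two_pos]
    nlinarith
  have h4 : 0 ≤ L * M / c := by positivity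
  have h5 := mul_le_mul_of_nonneg_right h3 (Real.exp_pos (c * t)).le
  linarith

theorem eq_of_integral_eq {y₁ y₂ g₁ g₂ : C(unitInterval, ℝ)} {L : ℝ} (hL : 0 ≤ L)
    (h₁ : ∀ t : unitInterval, y₁ t = ∫ s in (0 : ℝ)..t, g₁ (projIcc 0 1 zero_le_one s))
    (h₂ : ∀ t : unitInterval, y₂ t = ∫ s in (0 : ℝ)..t, g₂ (projIcc 0 1 zero_le_one s))
    (hg : ∀ s, |g₁ s - g₂ s| ≤ L * |y₁ s - y₂ s|) : y₁ = y₂ := by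
  set c := 2 * L + 1 with hc
  let z : C(unitInterval, ℝ) := ⟨fun s => Real.exp (-(c * s)) * (y₁ s - y₂ s), by fun_prop⟩
  have hz : ∀ s : unitInterval, |y₁ s - y₂ s| = Real.exp (c * s) * |z s| := by
    intro s
    have : z s = Real.exp (-(c * s)) * (y₁ s - y₂ s) := rfl
    rw [this, abs_mul, abs_of_pos (Real.exp_pos _), ← mul_assoc, ← Real.exp_add]
    simp
  have hb : ∀ s : unitInterval, |g₁ s - g₂ s| ≤ L * (Real.exp (c * s) * ‖z‖) := by
    intro s
    refine (hg s).trans (mul_le_mul_of_nonneg_left ?_ hL)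
    rw [hz]
    exact mul_le_mul_of_nonneg_left (z.norm_coe_le_norm s) (Real.exp_pos _).le
  have h3 : ‖z‖ ≤ ‖z‖ / 2 := by
    rw [ContinuousMap.norm_le _ (by positivity)]
    intro t
    have h := abs_integral_le_of_weighted hL (by positivity) (by linarith) (norm_nonneg z) hb t
    have hi : ∫ s in (0 : ℝ)..t, (g₁ (projIcc 0 1 zero_le_one s) - g₂ (projIcc 0 1 zero_le_one s)) =
        y₁ t - y₂ t := by
      rw [h₁, h₂]
      exact intervalIntegral.integral_sub
        ((g₁.continuous.comp continuous_projIcc_unit).intervalIntegrable _ _)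
        ((g₂.continuous.comp continuous_projIcc_unit).intervalIntegrable _ _)
    rw [hi, hz] at h
    exact le_of_mul_le_mul_left h (Real.exp_pos _)
  have h4 : z = 0 := norm_eq_zero.1 (le_antisymm (by linarith) (norm_nonneg z))
  ext s
  have := hz s
  rw [h4] at this
  simpa [sub_eq_zero] using this

variable {D : Type} [TopologicalSpace D] [CompactSpace D]

/-- Integration in the second variable, from `0` to the variable end point. -/
noncomputable def volterra (D : Type) [TopologicalSpace D] [CompactSpace D] :
    C(D × unitInterval, ℝ) →L[ℝ] C(D × unitInterval, ℝ) :=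
  LinearMap.mkContinuous
    { toFun := fun φ => ⟨fun p => ∫ s in (0 : ℝ)..p.2, φ (p.1, projIcc 0 1 zero_le_one s), by
        refine intervalIntegral.continuous_parametric_intervalIntegral_of_continuous
          (f := fun (p : D × unitInterval) s => φ (p.1, projIcc 0 1 zero_le_one s)) ?_
          (by fun_prop)
        have := continuous_projIcc_unit
        simp only [Function.uncurry_def]
        fun_prop⟩
      map_add' := fun φ ψ => by
        have := continuous_projIcc_unit
        ext p
        exact intervalIntegral.integral_add
          ((by fun_prop : Continuous fun s => φ (p.1, projIcc 0 1 zero_le_one s)).intervalIntegrable _ _)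
          ((by fun_prop : Continuous fun s => ψ (p.1, projIcc 0 1 zero_le_one s)).intervalIntegrable _ _)
      map_smul' := fun c φ => by
        ext p
        exact intervalIntegral.integral_const_mul c _ }
    1 fun φ => by
      rw [one_mul, ContinuousMap.norm_le _ (norm_nonneg _)]
      intro p
      have h := intervalIntegral.norm_integral_le_of_norm_le_const (a := 0) (b := (p.2 : ℝ))
        (f := fun s => φ (p.1, projIcc 0 1 zero_le_one s)) (C := ‖φ‖)
        (fun s _ => φ.norm_coe_le_norm _)
      have h2 : |(p.2 : ℝ) - 0| ≤ 1 := by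
        rw [sub_zero, abs_of_nonneg p.2.2.1]
        exact p.2.2.2
      exact h.trans (mul_le_of_le_one_right (norm_nonneg _) h2)

theorem volterra_apply (φ : C(D × unitInterval, ℝ)) (p : D × unitInterval) :
    volterra D φ p = ∫ s in (0 : ℝ)..p.2, φ (p.1, projIcc 0 1 zero_le_one s) := rfl

/-- The solutions of a family of integral equations depend smoothly on the parameters. -/
theorem exists_odeFamily {E : Type} [NormedAddCommGroup E] [NormedSpace ℝ E] [CompleteSpace E]
    {k : ℕ} (hk : k ≠ 0) {O : Set E} (hO : IsOpen O) {f : D × unitInterval → E × ℝ → ℝ}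
    (hf : SmoothFam k (O ×ˢ univ) f) {L : ℝ} (hL : 0 ≤ L)
    (hlip : ∀ p, ∀ x ∈ O, ∀ y y', |f p (x, y) - f p (x, y')| ≤ L * |y - y'|) :
    ∃ S : C(D, E) → C(D × unitInterval, ℝ), ContDiffOn ℝ k S {φ | ∀ d, φ d ∈ O} ∧
      ∀ φ : C(D, E), (∀ d, φ d ∈ O) →
        S φ = volterra D (nem f (pairCLM _ _ _ (precompCLM ⟨Prod.fst, continuous_fst⟩ E φ, S φ))) := by
  classical
  set c := 2 * L + 1 with hc
  let wp : C(D × unitInterval, ℝ) := ⟨fun p : D × unitInterval => Real.exp (c * p.2), by fun_prop⟩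
  let wm : C(D × unitInterval, ℝ) := ⟨fun p : D × unitInterval => Real.exp (-(c * p.2)), by fun_prop⟩
  have hpm : wp * wm = 1 := by
    ext p
    change Real.exp _ * Real.exp _ = 1
    rw [← Real.exp_add]
    simp
  let Mp : C(D × unitInterval, ℝ) →L[ℝ] C(D × unitInterval, ℝ) := ContinuousLinearMap.mul ℝ _ wp
  let Mm : C(D × unitInterval, ℝ) →L[ℝ] C(D × unitInterval, ℝ) := ContinuousLinearMap.mul ℝ _ wm
  have hMpm : ∀ z, Mp (Mm z) = z := fun z => by
    change wp * (wm * z) = z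
    rw [← mul_assoc, hpm, one_mul]
  let A : C(D, E) × C(D × unitInterval, ℝ) →L[ℝ] C(D × unitInterval, E × ℝ) := (pairCLM (D × unitInterval) E ℝ).comp
    (((precompCLM ⟨Prod.fst, continuous_fst⟩ E).comp (.fst ℝ _ _)).prod (Mp.comp (.snd ℝ _ _)))
  have hA : ∀ x z p, A (x, z) p = (x p.1, wp p * z p) := fun x z p => rfl
  let T : C(D, E) × C(D × unitInterval, ℝ) → C(D × unitInterval, ℝ) := fun q => Mm (volterra D (nem f (A q)))
  let Dom : Set C(D, E) := {φ | ∀ d, φ d ∈ O}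
  have hDom : IsOpen Dom := isOpen_forall_mem hO
  have hmaps : ∀ x ∈ Dom, ∀ z p, A (x, z) p ∈ O ×ˢ (univ : Set ℝ) := fun x hx z p =>
    ⟨hx p.1, trivial⟩
  have hT : ContDiffOn ℝ k T (Dom ×ˢ univ) := by
    have h1 : ContDiffOn ℝ k (fun q => nem f (A q)) (Dom ×ˢ univ) :=
      hf.smooth.comp A.contDiff.contDiffOn fun q hq => hmaps q.1 hq.1 q.2
    exact (Mm.comp (volterra D)).contDiff.comp_contDiffOn h1
  have hTlip : ∀ x ∈ Dom, ∀ z z', ‖T (x, z) - T (x, z')‖ ≤ 1 / 2 * ‖z - z'‖ := by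
    intro x hx z z'
    have h1 : T (x, z) - T (x, z') = Mm (volterra D (nem f (A (x, z)) - nem f (A (x, z')))) := by
      simp only [T, map_sub]
    rw [h1, ContinuousMap.norm_le _ (by positivity)]
    rintro ⟨d, t⟩
    have hb : ∀ s : unitInterval, |(nem f (A (x, z)) - nem f (A (x, z'))) (d, s)| ≤
        L * (Real.exp (c * s) * ‖z - z'‖) := by
      intro s
      rw [ContinuousMap.sub_apply, nem_apply hf.cont (hmaps x hx z), nem_apply hf.cont (hmaps x hx z'),
        hA, hA]
      refine (hlip _ _ (hx d) _ _).trans (mul_le_mul_of_nonneg_left ?_ hL)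
      rw [← mul_sub, abs_mul]
      refine mul_le_mul (abs_of_pos (Real.exp_pos _)).le ((z - z').norm_coe_le_norm (d, s))
        (abs_nonneg _) (Real.exp_pos _).le
    have h := abs_integral_le_of_weighted hL (by positivity) (by linarith) (norm_nonneg _) hb t
    change ‖Real.exp (-(c * t)) * volterra D _ (d, t)‖ ≤ _
    rw [norm_mul, Real.norm_eq_abs, Real.norm_eq_abs, abs_of_pos (Real.exp_pos _), volterra_apply]
    refine (mul_le_mul_of_nonneg_left h (Real.exp_pos _).le).trans (le_of_eq ?_)
    rw [← mul_assoc, ← Real.exp_add]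
    simp
    ring
  have hfix : ∀ x ∈ Dom, ∃ z, T (x, z) = z := by
    intro x hx
    have hcon : ContractingWith (1 / 2) fun z => T (x, z) :=
      ⟨by rw [← NNReal.coe_lt_coe]; norm_num, LipschitzWith.of_dist_le_mul fun z z' => by
        rw [dist_eq_norm, dist_eq_norm]
        exact_mod_cast hTlip x hx z z'⟩
    exact ⟨hcon.fixedPoint, hcon.fixedPoint_isFixedPt⟩
  choose! z hz using hfix
  have hzc : ContDiffOn ℝ k z Dom := contDiffOn_fixedPoint hk hDom hT hTlip hz
  refine ⟨fun x => Mp (z x), Mp.contDiff.comp_contDiffOn hzc, fun x hx => ?_⟩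
  have h1 : Mp (T (x, z x)) = Mp (z x) := congrArg Mp (hz x hx)
  have h2 : Mp (T (x, z x)) = volterra D (nem f (A (x, z x))) := hMpm _
  exact h1.symm.trans h2

end ODE

/-! ### The quadratic model and small perturbations of it -/

section Quad

variable {n : ℕ}

noncomputable def reCoord (j : Fin n) : Cn n →L[ℝ] ℝ :=
  Complex.reCLM.comp ((EuclideanSpace.proj j : Cn n →L[ℂ] ℂ).restrictScalars ℝ)

noncomputable def imCoord (j : Fin n) : Cn n →L[ℝ] ℝ :=
  Complex.imCLM.comp ((EuclideanSpace.proj j : Cn n →L[ℂ] ℂ).restrictScalars ℝ)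

@[simp]
theorem reCoord_apply (j : Fin n) (v : Cn n) : reCoord j v = (v j).re := rfl

@[simp]
theorem imCoord_apply (j : Fin n) (v : Cn n) : imCoord j v = (v j).im := rfl

/-- The symmetric bilinear form of the quadratic model. -/
noncomputable def quadBilin (lam : Fin n → ℝ) : Cn n →L[ℝ] Cn n →L[ℝ] ℝ :=
  ∑ j, ((reCoord j).smulRight ((1 + 2 * lam j) • reCoord j) +
    (imCoord j).smulRight ((1 - 2 * lam j) • imCoord j))

theorem quadBilin_apply (lam : Fin n → ℝ) (x v : Cn n) : quadBilin lam x v =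
    ∑ j, ((1 + 2 * lam j) * ((x j).re * (v j).re) + (1 - 2 * lam j) * ((x j).im * (v j).im)) := by
  rw [quadBilin]
  simp only [sum_apply, add_apply,
    ContinuousLinearMap.smulRight_apply, smul_apply, smul_eq_mul, reCoord_apply,
    imCoord_apply]
  refine Finset.sum_congr rfl fun j _ => ?_
  ring

theorem quadBilin_comm (lam : Fin n → ℝ) (x v : Cn n) : quadBilin lam x v = quadBilin lam v x := by
  rw [quadBilin_apply, quadBilin_apply]
  exact Finset.sum_congr rfl fun j _ => by ring

theorem quadModel_eq (lam : Fin n → ℝ) (x : Cn n) : quadModel lam x = quadBilin lam x x := by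
  rw [quadModel, quadBilin_apply]
  refine Finset.sum_congr rfl fun j _ => ?_
  rw [← Complex.normSq_eq_norm_sq, Complex.normSq_apply, pow_two, Complex.mul_re]
  ring

theorem hasFDerivAt_quadModel (lam : Fin n → ℝ) (x : Cn n) :
    HasFDerivAt (quadModel lam) ((2 : ℝ) • quadBilin lam x) x := by
  have h := (quadBilin lam).hasFDerivAt_of_bilinear (hasFDerivAt_id x) (hasFDerivAt_id x)
  refine (h.congr_fderiv ?_).congr_of_eventuallyEq (Eventually.of_forall fun y => quadModel_eq lam y)
  ext v
  simp [quadBilin_comm lam v x]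
  ring

theorem contDiff_quadModel (lam : Fin n → ℝ) {k : WithTop ℕ∞} : ContDiff ℝ k (quadModel lam) := by
  have h : quadModel lam = fun x => quadBilin lam x x := funext fun x => quadModel_eq lam x
  rw [h]
  exact (quadBilin lam).contDiff.clm_apply contDiff_id

theorem norm_sq_eq_sum (x : Cn n) : ‖x‖ ^ 2 = ∑ j, ((x j).re ^ 2 + (x j).im ^ 2) := by
  rw [EuclideanSpace.norm_sq_eq]
  refine Finset.sum_congr rfl fun j _ => ?_
  rw [← Complex.normSq_eq_norm_sq, Complex.normSq_apply]
  ring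

theorem quadBilin_self_ge {lam : Fin n → ℝ} {μ : ℝ} (h0 : ∀ j, 0 ≤ lam j)
    (hμ : ∀ j, 2 * lam j ≤ 1 - μ) (x : Cn n) : μ * ‖x‖ ^ 2 ≤ quadBilin lam x x := by
  rw [norm_sq_eq_sum, quadBilin_apply, Finset.mul_sum]
  refine Finset.sum_le_sum fun j _ => ?_
  nlinarith [h0 j, hμ j, sq_nonneg (x j).re, sq_nonneg (x j).im]

theorem abs_quadBilin_le {lam : Fin n → ℝ} (h0 : ∀ j, 0 ≤ lam j) (h1 : ∀ j, lam j ≤ 1 / 2)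
    (x v : Cn n) : |quadBilin lam x v| ≤ 2 * (‖x‖ * ‖v‖) := by
  have hself : ∀ x : Cn n, 0 ≤ quadBilin lam x x ∧ quadBilin lam x x ≤ 2 * ‖x‖ ^ 2 := by
    intro x
    refine ⟨by simpa using quadBilin_self_ge h0 (μ := 0) (fun j => by linarith [h1 j]) x, ?_⟩
    rw [norm_sq_eq_sum, quadBilin_apply, Finset.mul_sum]
    refine Finset.sum_le_sum fun j _ => ?_
    nlinarith [h0 j, h1 j, sq_nonneg (x j).re, sq_nonneg (x j).im]
  have hcs : quadBilin lam x v ^ 2 ≤ quadBilin lam x x * quadBilin lam v v := by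
    have h : ∀ t : ℝ, 0 ≤ quadBilin lam v v * (t * t) + 2 * quadBilin lam x v * t +
        quadBilin lam x x := by
      intro t
      have h := (hself (x + t • v)).1
      simp only [map_add, add_apply, map_smul, smul_apply, smul_eq_mul] at h
      rw [quadBilin_comm lam v x] at h
      linarith
    have := discrim_le_zero h
    rw [discrim] at this
    nlinarith
  refine abs_le_of_sq_le_sq ?_ (by positivity)
  refine hcs.trans ?_
  calc quadBilin lam x x * quadBilin lam v v ≤ (2 * ‖x‖ ^ 2) * (2 * ‖v‖ ^ 2) :=
        mul_le_mul (hself x).2 (hself v).2 (hself v).1 (by positivity)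
    _ = (2 * (‖x‖ * ‖v‖)) ^ 2 := by ring

theorem quadBilin_add_mulI (lam : Fin n → ℝ) (v : Cn n) :
    quadBilin lam v v + quadBilin lam (mulI n v) (mulI n v) = 2 * ‖v‖ ^ 2 := by
  rw [norm_sq_eq_sum, quadBilin_apply, quadBilin_apply, ← Finset.sum_add_distrib, Finset.mul_sum]
  refine Finset.sum_congr rfl fun j _ => ?_
  simp
  ring

end Quad

section SmallPerturbation

variable {n : ℕ}

/-- `G = Q + P` and `E` with `P`, `E` of vanishing gradient at the origin and with small second
derivatives. -/
structure SmallPert (lam : Fin n → ℝ) (μ : ℝ) (P E : Cn n → ℝ) : Prop where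
  mu_pos : 0 < μ
  mu_le : μ ≤ 1
  lam_nonneg : ∀ j, 0 ≤ lam j
  lam_le : ∀ j, 2 * lam j ≤ 1 - μ
  contDiff_P : ContDiff ℝ 2 P
  contDiff_E : ContDiff ℝ 2 E
  fderiv_P : fderiv ℝ P 0 = 0
  fderiv_E : fderiv ℝ E 0 = 0
  bound_P : ∀ x, ‖fderiv ℝ (fderiv ℝ P) x‖ ≤ μ / 8
  bound_E : ∀ x, ‖fderiv ℝ (fderiv ℝ E) x‖ ≤ μ / 8

namespace SmallPert

variable {lam : Fin n → ℝ} {μ : ℝ} {P E : Cn n → ℝ}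

theorem norm_fderiv_le {f : Cn n → ℝ} (hf : ContDiff ℝ 2 f) (h0 : fderiv ℝ f 0 = 0) {C : ℝ}
    (hC : ∀ x, ‖fderiv ℝ (fderiv ℝ f) x‖ ≤ C) (x : Cn n) : ‖fderiv ℝ f x‖ ≤ C * ‖x‖ := by
  have h := Convex.norm_image_sub_le_of_norm_fderiv_le (𝕜 := ℝ) (f := fderiv ℝ f) (s := univ)
    (fun y _ => ((hf.fderiv_right (m := 1) (by norm_num)).differentiable (by simp)) y)
    (fun y _ => hC y) convex_univ (mem_univ 0) (mem_univ x)
  simpa [h0] using h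

theorem norm_fderiv_P_le (h : SmallPert lam μ P E) (x : Cn n) : ‖fderiv ℝ P x‖ ≤ μ / 8 * ‖x‖ :=
  norm_fderiv_le h.contDiff_P h.fderiv_P h.bound_P x

theorem norm_fderiv_E_le (h : SmallPert lam μ P E) (x : Cn n) : ‖fderiv ℝ E x‖ ≤ μ / 8 * ‖x‖ :=
  norm_fderiv_le h.contDiff_E h.fderiv_E h.bound_E x

theorem contDiff_G (h : SmallPert lam μ P E) : ContDiff ℝ 2 (fun x => quadModel lam x + P x) :=
  (contDiff_quadModel lam).add h.contDiff_P

theorem fderiv_G (h : SmallPert lam μ P E) (x : Cn n) : fderiv ℝ (fun x => quadModel lam x + P x) x =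
    (2 : ℝ) • quadBilin lam x + fderiv ℝ P x :=
  ((hasFDerivAt_quadModel lam x).add
    ((h.contDiff_P.differentiable (by simp)) x).hasFDerivAt).fderiv

theorem fderiv_fderiv_G (h : SmallPert lam μ P E) (x : Cn n) : fderiv ℝ (fderiv ℝ (fun x => quadModel lam x + P x)) x =
    (2 : ℝ) • quadBilin lam + fderiv ℝ (fderiv ℝ P) x := by
  have h1 : fderiv ℝ (fun x => quadModel lam x + P x) = fun x =>
      ((2 : ℝ) • quadBilin lam) x + fderiv ℝ P x := funext fun x => h.fderiv_G x
  rw [h1]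
  exact (((2 : ℝ) • quadBilin lam).hasFDerivAt.add
    (((h.contDiff_P.fderiv_right (m := 1) (by norm_num)).differentiable (by simp)) x).hasFDerivAt).fderiv

theorem lam_le_half (h : SmallPert lam μ P E) (j : Fin n) : lam j ≤ 1 / 2 := by
  linarith [h.lam_le j, h.mu_pos]

theorem abs_fderiv_G_le (h : SmallPert lam μ P E) (x v : Cn n) :
    |fderiv ℝ (fun x => quadModel lam x + P x) x v| ≤ 5 * (‖x‖ * ‖v‖) := by
  rw [h.fderiv_G, add_apply, smul_apply, smul_eq_mul]
  have h1 := abs_quadBilin_le h.lam_nonneg h.lam_le_half x v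
  have h2 := (fderiv ℝ P x).le_of_opNorm_le (h.norm_fderiv_P_le x) v
  rw [Real.norm_eq_abs] at h2
  have h3 := abs_add_le (2 * quadBilin lam x v) (fderiv ℝ P x v)
  rw [abs_mul, abs_two] at h3
  have h4 : 0 ≤ ‖x‖ * ‖v‖ := by positivity
  nlinarith [h.mu_le, h.mu_pos]

theorem abs_fderiv_E_le (h : SmallPert lam μ P E) (x v : Cn n) : |fderiv ℝ E x v| ≤ μ / 8 * (‖x‖ * ‖v‖) := by
  have h2 := (fderiv ℝ E x).le_of_opNorm_le (h.norm_fderiv_E_le x) v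
  rw [Real.norm_eq_abs] at h2
  linarith

theorem fderiv_G_self_ge (h : SmallPert lam μ P E) (x : Cn n) :
    15 / 8 * (μ * ‖x‖ ^ 2) ≤ fderiv ℝ (fun x => quadModel lam x + P x) x x := by
  rw [h.fderiv_G, add_apply, smul_apply, smul_eq_mul]
  have h1 := quadBilin_self_ge h.lam_nonneg h.lam_le x
  have h2 := (fderiv ℝ P x).le_of_opNorm_le (h.norm_fderiv_P_le x) x
  rw [Real.norm_eq_abs] at h2
  have h3 := neg_le_of_abs_le h2
  nlinarith

theorem levi_G_ge (h : SmallPert lam μ P E) (x v : Cn n) :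
    3 * ‖v‖ ^ 2 ≤ levi (fun x => quadModel lam x + P x) x v := by
  rw [levi, h.fderiv_fderiv_G]
  simp only [add_apply, smul_apply, smul_eq_mul]
  have h1 := quadBilin_add_mulI lam v
  have h2 : ∀ v, -(μ / 8 * ‖v‖ ^ 2) ≤ fderiv ℝ (fderiv ℝ P) x v v := by
    intro v
    have h3 := (fderiv ℝ (fderiv ℝ P) x v).le_of_opNorm_le
      ((fderiv ℝ (fderiv ℝ P) x).le_of_opNorm_le (h.bound_P x) v) v
    have h4 := neg_le_of_abs_le h3
    linarith
  have h3 := h2 (mulI n v)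
  rw [norm_mulI] at h3
  have h4 := h2 v
  have h5 : μ * ‖v‖ ^ 2 ≤ ‖v‖ ^ 2 := by nlinarith [h.mu_le, sq_nonneg ‖v‖]
  linarith [sq_nonneg ‖v‖]

theorem abs_levi_E_le (h : SmallPert lam μ P E) (x v : Cn n) : |levi E x v| ≤ μ / 4 * ‖v‖ ^ 2 := by
  rw [levi]
  have h2 : ∀ v, |fderiv ℝ (fderiv ℝ E) x v v| ≤ μ / 8 * ‖v‖ ^ 2 := by
    intro v
    have h3 := (fderiv ℝ (fderiv ℝ E) x v).le_of_opNorm_le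
      ((fderiv ℝ (fderiv ℝ E) x).le_of_opNorm_le (h.bound_E x) v) v
    rw [Real.norm_eq_abs] at h3
    linarith
  have h3 := h2 (mulI n v)
  rw [norm_mulI] at h3
  have h4 := h2 v
  have h5 := abs_add_le (fderiv ℝ (fderiv ℝ E) x v v) (fderiv ℝ (fderiv ℝ E) x (mulI n v) (mulI n v))
  linarith

theorem cForm_ne_zero (h : SmallPert lam μ P E) {x : Cn n} (hx : x ≠ 0) :
    cForm (fderiv ℝ (fun x => quadModel lam x + P x) x) (fderiv ℝ E x) ≠ 0 := by
  intro h0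
  have h1 : (cForm (fderiv ℝ (fun x => quadModel lam x + P x) x) (fderiv ℝ E x) x).re = 0 := by
    rw [h0]; rfl
  rw [cForm_re] at h1
  have h2 := h.fderiv_G_self_ge x
  have h3 := abs_le.1 (h.abs_fderiv_E_le x (mulI n x))
  rw [norm_mulI] at h3
  have h4 : 0 < μ * ‖x‖ ^ 2 := mul_pos h.mu_pos (by positivity)
  nlinarith [h3.1, h3.2]

theorem sum_levi_pos (h : SmallPert lam μ P E) (hn : 2 ≤ n) {x : Cn n} (hx : x ≠ 0) :
    0 < ∑ j, ∑ k, levi (fun x => quadModel lam x + P x) x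
      (fieldL (fun x => quadModel lam x + P x) E j k x) := by
  set G := fun x => quadModel lam x + P x
  have hG : DifferentiableAt ℝ G x := (h.contDiff_G.differentiable (by simp)) x
  have hE : DifferentiableAt ℝ E x := (h.contDiff_E.differentiable (by simp)) x
  have hnn : ∀ j k, 0 ≤ levi G x (fieldL G E j k x) := fun j k =>
    le_trans (by positivity) (h.levi_G_ge x (fieldL G E j k x))
  obtain ⟨k, hk⟩ : ∃ k, coeffA G E k x ≠ 0 := by
    by_contra! hc
    refine h.cForm_ne_zero hx (LinearMap.ext fun w => ?_)
    rw [cForm_eq_sum]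
    refine Finset.sum_eq_zero fun k _ => ?_
    have := hc k
    rw [coeffA_eq hG hE] at this
    rw [this, mul_zero]
  obtain ⟨j, hj⟩ : ∃ j : Fin n, j ≠ k := by
    have : Nontrivial (Fin n) := Fin.nontrivial_iff_two_le.2 hn
    exact exists_ne k
  have hne : fieldL G E j k x ≠ 0 := by
    intro h0
    have := congrArg (fun v : Cn n => v j) h0
    simp [fieldL, hj] at this
    exact hk this
  have hpos : 0 < levi G x (fieldL G E j k x) := lt_of_lt_of_le
    (by have := norm_pos_iff.2 hne; positivity) (h.levi_G_ge x (fieldL G E j k x))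
  refine Finset.sum_pos' (fun j _ => Finset.sum_nonneg fun k _ => hnn j k) ⟨j, Finset.mem_univ _, ?_⟩
  exact Finset.sum_pos' (fun k _ => hnn j k) ⟨k, Finset.mem_univ _, hpos⟩

theorem abs_slope_le (h : SmallPert lam μ P E) (x : Cn n) : |slope' (fun x => quadModel lam x + P x) E x| ≤ μ / 8 := by
  rw [slope']
  set G := fun x => quadModel lam x + P x
  have h1 : |∑ j, ∑ k, levi E x (fieldL G E j k x)| ≤
      μ / 8 * ∑ j, ∑ k, levi G x (fieldL G E j k x) := by
    rw [Finset.mul_sum]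
    refine (Finset.abs_sum_le_sum_abs _ _).trans (Finset.sum_le_sum fun j _ => ?_)
    rw [Finset.mul_sum]
    refine (Finset.abs_sum_le_sum_abs _ _).trans (Finset.sum_le_sum fun k _ => ?_)
    have h2 := h.abs_levi_E_le x (fieldL G E j k x)
    have h3 := h.levi_G_ge x (fieldL G E j k x)
    nlinarith [h.mu_pos, sq_nonneg ‖fieldL G E j k x‖]
  have h0 : 0 ≤ ∑ j, ∑ k, levi G x (fieldL G E j k x) :=
    Finset.sum_nonneg fun j _ => Finset.sum_nonneg fun k _ =>
      le_trans (by positivity) (h.levi_G_ge x (fieldL G E j k x))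
  rw [abs_div, abs_of_nonneg h0]
  exact div_le_of_le_mul₀ h0 (by linarith [h.mu_pos]) h1

theorem abs_omegaForm_le (h : SmallPert lam μ P E) (x v : Cn n) :
    |omegaForm (fun x => quadModel lam x + P x) E x v| ≤ 6 * (‖x‖ * ‖v‖) := by
  have e : omegaForm (fun x => quadModel lam x + P x) E x v =
      fderiv ℝ (fun x => quadModel lam x + P x) x v - fderiv ℝ E x (mulI n v) +
      slope' (fun x => quadModel lam x + P x) E x *
        (fderiv ℝ E x v + fderiv ℝ (fun x => quadModel lam x + P x) x (mulI n v)) := rfl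
  rw [e]
  have h1 := h.abs_fderiv_G_le x v
  have h2 := h.abs_fderiv_E_le x (mulI n v)
  have h3 := h.abs_fderiv_E_le x v
  have h4 := h.abs_fderiv_G_le x (mulI n v)
  rw [norm_mulI] at h2 h4
  have h5 := h.abs_slope_le x
  set s := slope' (fun x => quadModel lam x + P x) E x
  have h0 : 0 ≤ ‖x‖ * ‖v‖ := by positivity
  have h6 : |s * (fderiv ℝ E x v + fderiv ℝ (fun x => quadModel lam x + P x) x (mulI n v))| ≤
      μ / 8 * (6 * (‖x‖ * ‖v‖)) := by
    rw [abs_mul]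
    refine mul_le_mul h5 ((abs_add_le _ _).trans ?_) (abs_nonneg _) (by linarith [h.mu_pos])
    nlinarith [h.mu_le]
  rw [abs_le] at *
  constructor <;> nlinarith [h.mu_le, h.mu_pos]

theorem omegaForm_self_ge (h : SmallPert lam μ P E) (x : Cn n) :
    μ / 2 * ‖x‖ ^ 2 ≤ omegaForm (fun x => quadModel lam x + P x) E x x := by
  have e : omegaForm (fun x => quadModel lam x + P x) E x x =
      fderiv ℝ (fun x => quadModel lam x + P x) x x - fderiv ℝ E x (mulI n x) +
      slope' (fun x => quadModel lam x + P x) E x *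
        (fderiv ℝ E x x + fderiv ℝ (fun x => quadModel lam x + P x) x (mulI n x)) := rfl
  rw [e]
  have h1 := h.fderiv_G_self_ge x
  have h2 := h.abs_fderiv_E_le x (mulI n x)
  have h3 := h.abs_fderiv_E_le x x
  have h4 := h.abs_fderiv_G_le x (mulI n x)
  rw [norm_mulI] at h2 h4
  have h5 := h.abs_slope_le x
  set s := slope' (fun x => quadModel lam x + P x) E x
  have h0 : 0 ≤ ‖x‖ * ‖x‖ := by positivity
  have h6 : |s * (fderiv ℝ E x x + fderiv ℝ (fun x => quadModel lam x + P x) x (mulI n x))| ≤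
      μ / 8 * (6 * (‖x‖ * ‖x‖)) := by
    rw [abs_mul]
    refine mul_le_mul h5 ((abs_add_le _ _).trans ?_) (abs_nonneg _) (by linarith [h.mu_pos])
    nlinarith [h.mu_le]
  have h7 := (abs_le.1 h6).1
  have h8 := (abs_le.1 h2).2
  nlinarith [h.mu_le, h.mu_pos, mul_nonneg h.mu_pos.le h0]

end SmallPert

end SmallPerturbation

/-! ### The rescaled one-forms as a smooth family -/

section Jets

variable {n : ℕ}

/-- `fieldL` in terms of the differentials `g`, `e`. -/
noncomputable def jetField (g e : Cn n →L[ℝ] ℝ) (j k : Fin n) : Cn n :=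
  EuclideanSpace.single j (cForm g e (EuclideanSpace.single k 1)) -
    EuclideanSpace.single k (cForm g e (EuclideanSpace.single j 1))

/-- `levi` in terms of the second derivative. -/
noncomputable def jetLevi (b : Cn n →L[ℝ] Cn n →L[ℝ] ℝ) (v : Cn n) : ℝ :=
  b v v + b (mulI n v) (mulI n v)

noncomputable def jetLeviSum (g e : Cn n →L[ℝ] ℝ) (b : Cn n →L[ℝ] Cn n →L[ℝ] ℝ) : ℝ :=
  ∑ j, ∑ k, jetLevi b (jetField g e j k)

theorem fieldL_eq_jetField {G E : Cn n → ℝ} {z : Cn n} (hG : DifferentiableAt ℝ G z)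
    (hE : DifferentiableAt ℝ E z) (j k : Fin n) :
    fieldL G E j k z = jetField (fderiv ℝ G z) (fderiv ℝ E z) j k := by
  rw [fieldL, jetField, coeffA_eq hG hE, coeffA_eq hG hE]

theorem sum_levi_eq_jet {G E : Cn n → ℝ} {z : Cn n} (hG : DifferentiableAt ℝ G z)
    (hE : DifferentiableAt ℝ E z) (f : Cn n → ℝ) :
    ∑ j, ∑ k, levi f z (fieldL G E j k z) =
      jetLeviSum (fderiv ℝ G z) (fderiv ℝ E z) (fderiv ℝ (fderiv ℝ f) z) := by
  simp only [fieldL_eq_jetField hG hE]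
  rfl

theorem cForm_smul (c : ℝ) (g e : Cn n →L[ℝ] ℝ) (v : Cn n) :
    cForm (c • g) (c • e) v = c • cForm g e v := by
  apply Complex.ext
  · rw [cForm_re, Complex.smul_re, cForm_re]
    simp
    ring
  · rw [cForm_im, Complex.smul_im, cForm_im]
    simp
    ring

theorem jetField_smul (c : ℝ) (g e : Cn n →L[ℝ] ℝ) (j k : Fin n) :
    jetField (c • g) (c • e) j k = c • jetField g e j k := by
  have h : ∀ (i : Fin n) (z : ℂ), (EuclideanSpace.single i (c • z) : Cn n) =
      c • EuclideanSpace.single i z := by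
    intro i z
    ext l
    by_cases h : l = i <;> simp [h]
  rw [jetField, jetField, cForm_smul, cForm_smul, h, h, smul_sub]

theorem jetLeviSum_smul (c d : ℝ) (g e : Cn n →L[ℝ] ℝ) (b : Cn n →L[ℝ] Cn n →L[ℝ] ℝ) :
    jetLeviSum (c • g) (c • e) (d • b) = c ^ 2 * (d * jetLeviSum g e b) := by
  simp only [jetLeviSum, jetLevi, jetField_smul, map_smul, smul_apply, smul_eq_mul, Finset.mul_sum]
  refine Finset.sum_congr rfl fun j _ => Finset.sum_congr rfl fun k _ => ?_
  ring

theorem contDiff_cForm_apply {k : WithTop ℕ∞} (w : Cn n) :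
    ContDiff ℝ k (fun p : (Cn n →L[ℝ] ℝ) × (Cn n →L[ℝ] ℝ) => cForm p.1 p.2 w) := by
  have h : ∀ w : Cn n, ContDiff ℝ k (fun p : (Cn n →L[ℝ] ℝ) × (Cn n →L[ℝ] ℝ) => p.1 w) ∧
      ContDiff ℝ k (fun p : (Cn n →L[ℝ] ℝ) × (Cn n →L[ℝ] ℝ) => p.2 w) := fun w =>
    ⟨contDiff_fst.clm_apply contDiff_const, contDiff_snd.clm_apply contDiff_const⟩
  simp only [cForm_apply, div_eq_mul_inv]
  exact ((Complex.ofRealCLM.contDiff.comp ((h w).1.sub (h (mulI n w)).2)).sub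
    (contDiff_const.mul (Complex.ofRealCLM.contDiff.comp ((h (mulI n w)).1.add (h w).2)))).mul
    contDiff_const

theorem contDiff_jetField {k : WithTop ℕ∞} (i j : Fin n) :
    ContDiff ℝ k (fun p : (Cn n →L[ℝ] ℝ) × (Cn n →L[ℝ] ℝ) => jetField p.1 p.2 i j) := by
  simp only [jetField]
  have h : ∀ i j, ContDiff ℝ k (fun p : (Cn n →L[ℝ] ℝ) × (Cn n →L[ℝ] ℝ) =>
      (EuclideanSpace.single i (cForm p.1 p.2 (EuclideanSpace.single j 1)) : Cn n)) := by
    intro i j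
    have h1 := (((ContinuousLinearMap.id ℂ ℂ).smulRight
      (EuclideanSpace.single i 1 : Cn n)).restrictScalars ℝ).contDiff.comp
      (contDiff_cForm_apply (k := k) (EuclideanSpace.single j (1 : ℂ)))
    convert h1 using 1
    ext1 p
    exact single_eq_smul _ _
  exact (h i j).sub (h j i)

theorem ContDiff.jetLeviSum {V : Type*} [NormedAddCommGroup V] [NormedSpace ℝ V]
    {k : WithTop ℕ∞} {g e : V → Cn n →L[ℝ] ℝ} {b : V → Cn n →L[ℝ] Cn n →L[ℝ] ℝ}
    (hg : ContDiff ℝ k g) (he : ContDiff ℝ k e) (hb : ContDiff ℝ k b) :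
    ContDiff ℝ k (fun p => jetLeviSum (g p) (e p) (b p)) := by
  have hf : ∀ i j, ContDiff ℝ k (fun p => jetField (g p) (e p) i j) := fun i j =>
    ContDiff.comp (g := fun p : (Cn n →L[ℝ] ℝ) × (Cn n →L[ℝ] ℝ) => jetField p.1 p.2 i j)
      (f := fun p => (g p, e p)) (contDiff_jetField i j) (hg.prodMk he)
  have hJ : ∀ i j, ContDiff ℝ k (fun p => mulI n (jetField (g p) (e p) i j)) := fun i j =>
    ContDiff.comp (g := mulI n) (f := fun p => jetField (g p) (e p) i j) (mulI n).contDiff (hf i j)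
  have h1 : ∀ i j, ContDiff ℝ k (fun p => b p (jetField (g p) (e p) i j) (jetField (g p) (e p) i j)) :=
    fun i j => (hb.clm_apply (hf i j)).clm_apply (hf i j)
  have h2 : ∀ i j, ContDiff ℝ k (fun p => b p (mulI n (jetField (g p) (e p) i j))
      (mulI n (jetField (g p) (e p) i j))) :=
    fun i j => (hb.clm_apply (hJ i j)).clm_apply (hJ i j)
  exact ContDiff.sum fun i _ => ContDiff.sum fun j _ => (h1 i j).add (h2 i j)

/-- The form `η` with `ω = dG + s η`, in terms of the jets `g` of `G` and `e`, `c` of `E / s`. -/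
noncomputable def jetEta
    (p : ℝ × (Cn n →L[ℝ] ℝ) × (Cn n →L[ℝ] ℝ) × (Cn n →L[ℝ] Cn n →L[ℝ] ℝ) ×
      (Cn n →L[ℝ] Cn n →L[ℝ] ℝ)) : Cn n →L[ℝ] ℝ :=
  -(p.2.2.1.comp (mulI n)) +
    (jetLeviSum p.2.1 (p.1 • p.2.2.1) p.2.2.2.2 / jetLeviSum p.2.1 (p.1 • p.2.2.1) p.2.2.2.1) •
      (p.1 • p.2.2.1 + p.2.1.comp (mulI n))

theorem contDiffOn_add_div_smul {V F : Type*} [NormedAddCommGroup V] [NormedSpace ℝ V]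
    [NormedAddCommGroup F] [NormedSpace ℝ F] {k : WithTop ℕ∞} {a b : V → ℝ} {c d : V → F}
    (ha : ContDiff ℝ k a) (hb : ContDiff ℝ k b) (hc : ContDiff ℝ k c) (hd : ContDiff ℝ k d) :
    ContDiffOn ℝ k (fun p => d p + (a p / b p) • c p) {p | b p ≠ 0} :=
  hd.contDiffOn.add ((ha.contDiffOn.div hb.contDiffOn fun _ hp => hp).smul hc.contDiffOn)

theorem contDiffOn_jetEta_comp {V : Type*} [NormedAddCommGroup V] [NormedSpace ℝ V] {k : ℕ}
    {s : V → ℝ} {g e : V → Cn n →L[ℝ] ℝ} {b c : V → Cn n →L[ℝ] Cn n →L[ℝ] ℝ}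
    (hs : ContDiff ℝ k s) (hg : ContDiff ℝ k g) (he : ContDiff ℝ k e) (hb : ContDiff ℝ k b)
    (hc : ContDiff ℝ k c) :
    ContDiffOn ℝ k (fun p => jetEta (s p, g p, e p, b p, c p))
      {p | jetLeviSum (g p) (s p • e p) (b p) ≠ 0} := by
  have hse : ContDiff ℝ k fun p => s p • e p := hs.smul he
  have hJ : ContDiff ℝ k fun v : Cn n →L[ℝ] ℝ => v.comp (mulI n) :=
    ((ContinuousLinearMap.compL ℝ (Cn n) (Cn n) ℝ).flip (mulI n)).contDiff
  have h4 : ContDiff ℝ k fun p => -((e p).comp (mulI n)) := (hJ.comp he).neg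
  have h5 : ContDiff ℝ k fun p => s p • e p + (g p).comp (mulI n) := hse.add (hJ.comp hg)
  exact contDiffOn_add_div_smul (hg.jetLeviSum hse hc) (hg.jetLeviSum hse hb) h5 h4

theorem isOpen_jetDom : IsOpen {p : ℝ × (Cn n →L[ℝ] ℝ) × (Cn n →L[ℝ] ℝ) ×
      (Cn n →L[ℝ] Cn n →L[ℝ] ℝ) × (Cn n →L[ℝ] Cn n →L[ℝ] ℝ) |
      jetLeviSum p.2.1 (p.1 • p.2.2.1) p.2.2.2.1 ≠ 0} := by
  refine isOpen_ne_fun ?_ continuous_const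
  have hg : ContDiff ℝ 0 fun p : ℝ × (Cn n →L[ℝ] ℝ) × (Cn n →L[ℝ] ℝ) ×
      (Cn n →L[ℝ] Cn n →L[ℝ] ℝ) × (Cn n →L[ℝ] Cn n →L[ℝ] ℝ) => p.2.1 := contDiff_snd.fst
  have he : ContDiff ℝ 0 fun p : ℝ × (Cn n →L[ℝ] ℝ) × (Cn n →L[ℝ] ℝ) ×
      (Cn n →L[ℝ] Cn n →L[ℝ] ℝ) × (Cn n →L[ℝ] Cn n →L[ℝ] ℝ) => p.1 • p.2.2.1 :=
    contDiff_fst.smul contDiff_snd.snd.fst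
  have hb : ContDiff ℝ 0 fun p : ℝ × (Cn n →L[ℝ] ℝ) × (Cn n →L[ℝ] ℝ) ×
      (Cn n →L[ℝ] Cn n →L[ℝ] ℝ) × (Cn n →L[ℝ] Cn n →L[ℝ] ℝ) => p.2.2.2.1 :=
    contDiff_snd.snd.snd.fst
  have h := hg.jetLeviSum he hb
  exact h.continuous

theorem contDiffOn_jetEta {k : ℕ} : ContDiffOn ℝ k (jetEta (n := n))
    {p | jetLeviSum p.2.1 (p.1 • p.2.2.1) p.2.2.2.1 ≠ 0} :=
  contDiffOn_jetEta_comp contDiff_fst contDiff_snd.fst contDiff_snd.snd.fst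
    contDiff_snd.snd.snd.fst contDiff_snd.snd.snd.snd

end Jets

section ScaledForms

variable {n : ℕ}

/-- `t⁻ᵏ f(t x)`. -/
noncomputable def dilate {E F : Type*} [NormedAddCommGroup E] [NormedSpace ℝ E]
    [NormedAddCommGroup F] [NormedSpace ℝ F] (k : ℕ) (f : E → F) (t : ℝ) (x : E) : F :=
  (t ^ k)⁻¹ • f (t • x)

theorem dilate_zero {E F : Type*} [NormedAddCommGroup E] [NormedSpace ℝ E]
    [NormedAddCommGroup F] [NormedSpace ℝ F] (k : ℕ) {f : E → F} (h : f 0 = 0) (x : E) :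
    dilate k f 0 x = 0 := by
  rw [dilate, zero_smul, h, smul_zero]

/-- The rescaled function `t⁻² G(t x)`, `G = Q + P`. -/
noncomputable def scaledG (lam : Fin n → ℝ) (P : Cn n → ℝ) (t : ℝ) (x : Cn n) : ℝ :=
  quadModel lam x + dilate 2 P t x

/-- The differential of `scaledG`. -/
noncomputable def scaledDG (lam : Fin n → ℝ) (P : Cn n → ℝ) (t : ℝ) (x : Cn n) : Cn n →L[ℝ] ℝ :=
  (2 : ℝ) • quadBilin lam x + dilate 1 (fderiv ℝ P) t x

/-- The rescaled form `η`. -/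
noncomputable def scaledEta (lam : Fin n → ℝ) (m : ℕ) (P E : Cn n → ℝ) (t : ℝ) (x : Cn n) :
    Cn n →L[ℝ] ℝ :=
  jetEta (t ^ m, scaledDG lam P t x, dilate (m + 1) (fderiv ℝ E) t x,
    (2 : ℝ) • quadBilin lam + dilate 0 (fderiv ℝ (fderiv ℝ P)) t x,
    dilate m (fderiv ℝ (fderiv ℝ E)) t x)

/-- The rescaled form `ω`. -/
noncomputable def scaledOmega (lam : Fin n → ℝ) (m : ℕ) (P E : Cn n → ℝ) (t : ℝ) (x : Cn n) :
    Cn n →L[ℝ] ℝ :=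
  scaledDG lam P t x + t ^ m • scaledEta lam m P E t x

/-- A small perturbation, `P` and `E` being of class `C^(m+2)` and vanishing to the orders
`2` and `m + 2`. -/
structure SmoothPert (lam : Fin n → ℝ) (μ : ℝ) (m : ℕ) (P E : Cn n → ℝ) : Prop
    extends SmallPert lam μ P E where
  two_le : 2 ≤ n
  m_pos : 1 ≤ m
  smooth_P : ContDiff ℝ (m + 2 : ℕ) P
  smooth_E : ContDiff ℝ (m + 2 : ℕ) E
  vanish_P : VanishesTo 2 P
  vanish_E : VanishesTo (m + 2) E
  zero_P : ∀ x, 1 / 2 ≤ ‖x‖ → P x = 0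
  zero_E : ∀ x, 1 / 2 ≤ ‖x‖ → E x = 0

namespace SmoothPert

variable {lam : Fin n → ℝ} {μ : ℝ} {m : ℕ} {P E : Cn n → ℝ}

theorem smooth_fderiv {F : Type*} [NormedAddCommGroup F] [NormedSpace ℝ F] {f : Cn n → F} {k : ℕ}
    (hf : ContDiff ℝ (k + 1 : ℕ) f) :
    ContDiff ℝ k (fderiv ℝ f) :=
  hf.fderiv_right (by norm_cast)

theorem vanish_fderiv_P (h : SmoothPert lam μ m P E) : VanishesTo 1 (fderiv ℝ P) :=
  VanishesTo.fderiv (h.smooth_P.of_le (by norm_cast; omega)) h.vanish_P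

theorem vanish_fderiv_fderiv_P (h : SmoothPert lam μ m P E) :
    VanishesTo 0 (fderiv ℝ (fderiv ℝ P)) :=
  VanishesTo.fderiv ((smooth_fderiv h.smooth_P).of_le (by norm_cast; omega)) h.vanish_fderiv_P

theorem vanish_fderiv_E (h : SmoothPert lam μ m P E) : VanishesTo (m + 1) (fderiv ℝ E) :=
  VanishesTo.fderiv h.smooth_E h.vanish_E

theorem vanish_fderiv_fderiv_E (h : SmoothPert lam μ m P E) :
    VanishesTo m (fderiv ℝ (fderiv ℝ E)) :=
  VanishesTo.fderiv (smooth_fderiv h.smooth_E) h.vanish_fderiv_E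

theorem scaledDG_eq (h : SmoothPert lam μ m P E) {t : ℝ} (ht : t ≠ 0) (x : Cn n) :
    scaledDG lam P t x = t⁻¹ • fderiv ℝ (fun x => quadModel lam x + P x) (t • x) := by
  rw [h.fderiv_G, scaledDG, dilate, pow_one, smul_add, map_smul, smul_comm t⁻¹, smul_smul t⁻¹,
    inv_mul_cancel₀ ht, one_smul]

theorem jetLeviSum_scaled_ne_zero (h : SmoothPert lam μ m P E) {t : ℝ} (ht : 0 ≤ t) {x : Cn n}
    (hx : x ≠ 0) : jetLeviSum (scaledDG lam P t x) (t ^ m • dilate (m + 1) (fderiv ℝ E) t x)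
      ((2 : ℝ) • quadBilin lam + dilate 0 (fderiv ℝ (fderiv ℝ P)) t x) ≠ 0 := by
  rcases ht.eq_or_lt with rfl | ht
  · have hb0 : ∀ x : Cn n, ‖fderiv ℝ (fderiv ℝ fun _ : Cn n => (0 : ℝ)) x‖ ≤ μ / 8 := fun x => by
      have h1 : fderiv ℝ (fun _ : Cn n => (0 : ℝ)) = fun _ => 0 := funext fun x => by simp
      rw [h1, (hasFDerivAt_const (0 : Cn n →L[ℝ] ℝ) x).fderiv]
      exact (norm_zero (E := Cn n →L[ℝ] Cn n →L[ℝ] ℝ)).le.trans (by linarith [h.mu_pos])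
    have h0 : SmallPert lam μ (fun _ => (0 : ℝ)) (fun _ : Cn n => (0 : ℝ)) :=
      { mu_pos := h.mu_pos, mu_le := h.mu_le, lam_nonneg := h.lam_nonneg, lam_le := h.lam_le
        contDiff_P := contDiff_const, contDiff_E := contDiff_const
        fderiv_P := by simp, fderiv_E := by simp
        bound_P := fun x => hb0 x
        bound_E := fun x => hb0 x }
    have h1 := h0.sum_levi_pos h.two_le hx
    rw [sum_levi_eq_jet ((h0.contDiff_G.differentiable (by simp)) x) (differentiableAt_const 0),
      h0.fderiv_G, h0.fderiv_fderiv_G] at h1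
    rw [scaledDG, dilate_zero 1 h.vanish_fderiv_P.apply_zero,
      dilate_zero _ h.vanish_fderiv_E.apply_zero, dilate_zero 0 h.vanish_fderiv_fderiv_P.apply_zero]
    simpa using h1.ne'
  · have h1 := h.sum_levi_pos h.two_le (smul_ne_zero ht.ne' hx)
    rw [sum_levi_eq_jet ((h.contDiff_G.differentiable (by simp)) _)
      ((h.contDiff_E.differentiable (by simp)) _), h.fderiv_fderiv_G] at h1
    have h2 : t ^ m • dilate (m + 1) (fderiv ℝ E) t x = t⁻¹ • fderiv ℝ E (t • x) := by
      rw [dilate, smul_smul, pow_succ]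
      congr 1
      field_simp
    have h3 : (2 : ℝ) • quadBilin lam + dilate 0 (fderiv ℝ (fderiv ℝ P)) t x =
        (1 : ℝ) • ((2 : ℝ) • quadBilin lam + fderiv ℝ (fderiv ℝ P) (t • x)) := by
      rw [dilate, pow_zero, inv_one, one_smul, one_smul]
    rw [h.scaledDG_eq ht.ne', h2, h3, jetLeviSum_smul]
    have := h1.ne'
    positivity

/-- `scaledOmega` is the rescaled `omegaForm`. -/
theorem scaledOmega_eq (h : SmoothPert lam μ m P E) {t : ℝ} (ht : t ≠ 0) (x : Cn n) :
    scaledOmega lam m P E t x =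
      t⁻¹ • omegaForm (fun x => quadModel lam x + P x) E (t • x) := by
  have hG := (h.contDiff_G.differentiable (by simp)) (t • x)
  have hE := (h.contDiff_E.differentiable (by simp)) (t • x)
  have h2 : t ^ m • dilate (m + 1) (fderiv ℝ E) t x = t⁻¹ • fderiv ℝ E (t • x) := by
    rw [dilate, smul_smul, pow_succ]
    congr 1
    field_simp
  have h3 : (2 : ℝ) • quadBilin lam + dilate 0 (fderiv ℝ (fderiv ℝ P)) t x =
      (1 : ℝ) • fderiv ℝ (fderiv ℝ (fun x => quadModel lam x + P x)) (t • x) := by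
    rw [h.fderiv_fderiv_G, dilate, pow_zero, inv_one, one_smul, one_smul]
  have h4 : jetLeviSum (scaledDG lam P t x) (t ^ m • dilate (m + 1) (fderiv ℝ E) t x)
      (dilate m (fderiv ℝ (fderiv ℝ E)) t x) / jetLeviSum (scaledDG lam P t x)
      (t ^ m • dilate (m + 1) (fderiv ℝ E) t x)
      ((2 : ℝ) • quadBilin lam + dilate 0 (fderiv ℝ (fderiv ℝ P)) t x) =
      (t ^ m)⁻¹ * slope' (fun x => quadModel lam x + P x) E (t • x) := by
    rw [h.scaledDG_eq ht, h2, h3, dilate, jetLeviSum_smul, jetLeviSum_smul, slope',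
      sum_levi_eq_jet hG hE, sum_levi_eq_jet hG hE]
    have ht2 : (t⁻¹) ^ 2 ≠ 0 := pow_ne_zero _ (inv_ne_zero ht)
    rw [one_mul, mul_div_mul_left _ _ ht2, mul_div_assoc]
  rw [scaledOmega, scaledEta, jetEta]
  dsimp only
  rw [h4, smul_add, smul_neg, smul_smul, ← mul_assoc, mul_inv_cancel₀ (pow_ne_zero m ht), one_mul,
    ← ContinuousLinearMap.smul_comp, h2, h.scaledDG_eq ht, omegaForm]
  ext v
  simp
  ring

theorem scaledEta_zero (h : SmoothPert lam μ m P E) (x : Cn n) : scaledEta lam m P E 0 x = 0 := by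
  rw [scaledEta, jetEta]
  dsimp only
  rw [dilate_zero _ h.vanish_fderiv_E.apply_zero, dilate_zero _ h.vanish_fderiv_fderiv_E.apply_zero]
  have h1 : ∀ g e, jetLeviSum (n := n) g e 0 = 0 := fun g e => by simp [jetLeviSum, jetLevi]
  rw [h1]
  simp

theorem scaledOmega_zero (h : SmoothPert lam μ m P E) (x : Cn n) :
    scaledOmega lam m P E 0 x = (2 : ℝ) • quadBilin lam x := by
  rw [scaledOmega, h.scaledEta_zero, smul_zero, add_zero, scaledDG,
    dilate_zero _ h.vanish_fderiv_P.apply_zero, add_zero]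

theorem abs_scaledOmega_le (h : SmoothPert lam μ m P E) {t : ℝ} (ht : 0 ≤ t) (x v : Cn n) :
    |scaledOmega lam m P E t x v| ≤ 6 * (‖x‖ * ‖v‖) := by
  rcases ht.eq_or_lt with rfl | ht
  · rw [h.scaledOmega_zero, smul_apply, smul_eq_mul, abs_mul, abs_two]
    have := abs_quadBilin_le h.lam_nonneg h.lam_le_half x v
    have : 0 ≤ ‖x‖ * ‖v‖ := by positivity
    linarith
  · rw [h.scaledOmega_eq ht.ne', smul_apply, smul_eq_mul, abs_mul, abs_inv, abs_of_pos ht]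
    have h1 := h.abs_omegaForm_le (t • x) v
    rw [norm_smul, Real.norm_of_nonneg ht.le] at h1
    calc t⁻¹ * _ ≤ t⁻¹ * (6 * (t * ‖x‖ * ‖v‖)) := by gcongr
      _ = _ := by field_simp

theorem scaledOmega_self_ge (h : SmoothPert lam μ m P E) {t : ℝ} (ht : 0 ≤ t) (x : Cn n) :
    μ / 2 * ‖x‖ ^ 2 ≤ scaledOmega lam m P E t x x := by
  rcases ht.eq_or_lt with rfl | ht
  · rw [h.scaledOmega_zero, smul_apply, smul_eq_mul]
    have := quadBilin_self_ge h.lam_nonneg h.lam_le x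
    have h2 : 0 ≤ μ * ‖x‖ ^ 2 := mul_nonneg h.mu_pos.le (by positivity)
    linarith
  · rw [h.scaledOmega_eq ht.ne', smul_apply, smul_eq_mul]
    have h1 := h.omegaForm_self_ge (t • x)
    rw [map_smul, smul_eq_mul, norm_smul, Real.norm_of_nonneg ht.le] at h1
    have h2 : t * (μ / 2 * (t * ‖x‖ ^ 2)) ≤
        t * omegaForm (fun x => quadModel lam x + P x) E (t • x) x := by linarith
    have h3 := le_of_mul_le_mul_left h2 ht
    calc μ / 2 * ‖x‖ ^ 2 = t⁻¹ * (μ / 2 * (t * ‖x‖ ^ 2)) := by field_simp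
      _ ≤ _ := by gcongr

variable {Y : Type} [TopologicalSpace Y] [CompactSpace Y]

theorem smoothFam_scaledDG (h : SmoothPert lam μ m P E) {δ : C(Y, ℝ)} (hδ : ∀ y, 0 ≤ δ y) :
    SmoothFam m univ (fun y => scaledDG lam P (δ y)) := by
  have h1 := (smoothFam_rescale hδ (by omega) (smooth_fderiv h.smooth_P)
    h.vanish_fderiv_P).of_le (Nat.le_succ m)
  have h2 : SmoothFam m univ (fun (_ : Y) (x : Cn n) => (2 : ℝ) • quadBilin lam x) :=
    SmoothFam.const isOpen_univ ((2 : ℝ) • quadBilin lam).contDiff.contDiffOn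
  exact (h2.prodMk h1).map_contDiff (Φ := fun p => p.1 + p.2) (by fun_prop)

theorem smoothFam_scaledG (h : SmoothPert lam μ m P E) {δ : C(Y, ℝ)} (hδ : ∀ y, 0 ≤ δ y) :
    SmoothFam m univ (fun y => scaledG lam P (δ y)) := by
  have h1 := (smoothFam_rescale hδ (by omega) h.smooth_P h.vanish_P).of_le (Nat.le_add_right m 2)
  have h2 : SmoothFam m univ (fun (_ : Y) (x : Cn n) => quadModel lam x) :=
    SmoothFam.const isOpen_univ (contDiff_quadModel lam).contDiffOn
  exact (h2.prodMk h1).map_contDiff (Φ := fun p => p.1 + p.2) (by fun_prop)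

theorem smoothFam_scaledEta (h : SmoothPert lam μ m P E) {δ : C(Y, ℝ)} (hδ : ∀ y, 0 ≤ δ y) :
    SmoothFam m {0}ᶜ (fun y => scaledEta lam m P E (δ y)) := by
  have hs : SmoothFam m univ (fun y (_ : Cn n) => (δ y) ^ m) := SmoothFam.param (δ ^ m)
  have he := (smoothFam_rescale hδ le_rfl (smooth_fderiv h.smooth_E)
    h.vanish_fderiv_E).of_le (Nat.le_succ m)
  have hb1 := smoothFam_rescale hδ (Nat.zero_le m) (smooth_fderiv (smooth_fderiv h.smooth_P))
    h.vanish_fderiv_fderiv_P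
  have hb2 : SmoothFam m univ (fun (_ : Y) (x : Cn n) => (2 : ℝ) • quadBilin lam) :=
    SmoothFam.const isOpen_univ contDiffOn_const
  have hb := (hb2.prodMk hb1).map_contDiff (Φ := fun p => p.1 + p.2) (by fun_prop)
  have hc := smoothFam_rescale hδ le_rfl (smooth_fderiv (smooth_fderiv h.smooth_E))
    h.vanish_fderiv_fderiv_E
  have hall := hs.prodMk ((h.smoothFam_scaledDG hδ).prodMk (he.prodMk (hb.prodMk hc)))
  refine (hall.mono (subset_univ {0}ᶜ)).map isOpen_jetDom contDiffOn_jetEta fun y x hx => ?_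
  exact h.jetLeviSum_scaled_ne_zero (hδ y) hx

theorem smoothFam_scaledOmega (h : SmoothPert lam μ m P E) {δ : C(Y, ℝ)} (hδ : ∀ y, 0 ≤ δ y) :
    SmoothFam m {0}ᶜ (fun y => scaledOmega lam m P E (δ y)) := by
  have hs : SmoothFam m {0}ᶜ (fun y (_ : Cn n) => (δ y) ^ m) := SmoothFam.param (δ ^ m)
  exact (((h.smoothFam_scaledDG hδ).mono (subset_univ {0}ᶜ)).prodMk
    (hs.prodMk (h.smoothFam_scaledEta hδ))).map_contDiff
    (Φ := fun p => p.1 + p.2.1 • p.2.2) (by fun_prop)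

end SmoothPert

end ScaledForms

section DerivBound

variable {n : ℕ} {lam : Fin n → ℝ} {μ : ℝ} {m : ℕ} {P E : Cn n → ℝ}

/-- A smooth lift to spaces of continuous maps defines a smooth family. -/
theorem SmoothFam.of_lift {Y E F : Type*} [TopologicalSpace Y] [CompactSpace Y]
    [NormedAddCommGroup E] [NormedSpace ℝ E] [NormedAddCommGroup F] [NormedSpace ℝ F] {k : ℕ}
    {O : Set E} {f : Y → E → F} {S : C(Y, E) → C(Y, F)}
    (hS : ContDiffOn ℝ k S {φ | ∀ y, φ y ∈ O})
    (h : ∀ φ : C(Y, E), (∀ y, φ y ∈ O) → ∀ y, S φ y = f y (φ y)) : SmoothFam k O f := by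
  have hcont : ContinuousOn (Function.uncurry f) (univ ×ˢ O) := by
    rintro ⟨y₀, x₀⟩ ⟨-, hx₀⟩
    have h1 : ContinuousOn (fun x => S (constCLM Y E x)) O :=
      hS.continuousOn.comp (constCLM Y E).continuous.continuousOn fun x hx y => hx
    have h2 : ∀ y, ∀ x ∈ O, f y x = S (constCLM Y E x) y := fun y x hx => (h (constCLM Y E x) (fun _ => hx) y).symm
    rw [Metric.continuousWithinAt_iff']
    intro ε hε
    have h3 : ∀ᶠ p : Y × E in 𝓝[univ ×ˢ O] (y₀, x₀),
        dist (S (constCLM Y E p.2)) (S (constCLM Y E x₀)) < ε / 2 := by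
      have h4 := Metric.tendsto_nhds.1 (h1 x₀ hx₀) (ε / 2) (half_pos hε)
      rw [nhdsWithin_prod_eq]
      exact (tendsto_snd (f := 𝓝[univ] y₀) (g := 𝓝[O] x₀)).eventually h4
    have h5 : ∀ᶠ p : Y × E in 𝓝[univ ×ˢ O] (y₀, x₀),
        dist (S (constCLM Y E x₀) p.1) (S (constCLM Y E x₀) y₀) < ε / 2 := by
      have h6 : ContinuousAt (fun p : Y × E => S (constCLM Y E x₀) p.1) (y₀, x₀) := by fun_prop
      exact (Metric.tendsto_nhds.1 h6 (ε / 2) (half_pos hε)).filter_mono nhdsWithin_le_nhds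
    filter_upwards [h3, h5, self_mem_nhdsWithin] with p hp1 hp2 hp
    simp only [Function.uncurry]
    rw [h2 p.1 p.2 hp.2, h2 y₀ x₀ hx₀]
    have h7 := ContinuousMap.dist_apply_le_dist (f := S (constCLM Y E p.2))
      (g := S (constCLM Y E x₀)) p.1
    linarith [dist_triangle (S (constCLM Y E p.2) p.1) (S (constCLM Y E x₀) p.1)
      (S (constCLM Y E x₀) y₀)]
  refine ⟨hcont, hS.congr fun φ hφ => ?_⟩
  ext y
  rw [nem_apply hcont hφ, h φ hφ]

namespace SmoothPert

theorem contDiffOn_scaledOmega (h : SmoothPert lam μ m P E) {t : ℝ} (ht : 0 ≤ t) :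
    ContDiffOn ℝ m (scaledOmega lam m P E t) {0}ᶜ :=
  (h.smoothFam_scaledOmega (Y := Unit) (δ := .const _ t) fun _ => ht).contDiffOn_slice ()

theorem differentiableAt_scaledOmega (h : SmoothPert lam μ m P E) {t : ℝ} (ht : 0 ≤ t) {x : Cn n}
    (hx : x ≠ 0) : DifferentiableAt ℝ (scaledOmega lam m P E t) x :=
  ((h.contDiffOn_scaledOmega ht).contDiffAt (isOpen_compl_singleton.mem_nhds hx)).differentiableAt
    (by exact_mod_cast (by have := h.m_pos; omega : m ≠ 0))

theorem scaledOmega_hom (h : SmoothPert lam μ m P E) {t : ℝ} (ht : t ≠ 0) (x : Cn n) :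
    scaledOmega lam m P E t x = t⁻¹ • scaledOmega lam m P E 1 (t • x) := by
  rw [h.scaledOmega_eq ht, h.scaledOmega_eq one_ne_zero, inv_one, one_smul, one_smul]

theorem fderiv_scaledOmega (h : SmoothPert lam μ m P E) {t : ℝ} (ht : 0 < t) {x : Cn n}
    (hx : x ≠ 0) :
    fderiv ℝ (scaledOmega lam m P E t) x = fderiv ℝ (scaledOmega lam m P E 1) (t • x) := by
  have h1 := (h.differentiableAt_scaledOmega zero_le_one (smul_ne_zero ht.ne' hx)).hasFDerivAt
  have h2 : HasFDerivAt (fun x : Cn n => t • x) (t • ContinuousLinearMap.id ℝ (Cn n)) x :=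
    (hasFDerivAt_id x).const_smul t
  have h3 := (HasFDerivAt.comp x h1 h2).const_smul t⁻¹
  have h4 : scaledOmega lam m P E t =
      fun x => t⁻¹ • (scaledOmega lam m P E 1 ∘ fun x => t • x) x :=
    funext fun x => h.scaledOmega_hom ht.ne' x
  rw [h4]
  refine h3.fderiv.trans ?_
  ext v w
  simp [ht.ne']

theorem scaledOmega_eq_quad (h : SmoothPert lam μ m P E) {x : Cn n} (hx : 1 / 2 < ‖x‖) :
    scaledOmega lam m P E 1 x = (2 : ℝ) • quadBilin lam x := by
  have hev : ∀ {f : Cn n → ℝ}, (∀ x, 1 / 2 ≤ ‖x‖ → f x = 0) →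
      f =ᶠ[𝓝 x] fun _ => (0 : ℝ) := fun {f} hf => by
    filter_upwards [(isOpen_lt continuous_const continuous_norm).mem_nhds hx] with y hy
    exact hf y (le_of_lt hy)
  have h1 : ∀ {f : Cn n → ℝ}, (∀ x, 1 / 2 ≤ ‖x‖ → f x = 0) →
      fderiv ℝ f x = 0 ∧ fderiv ℝ (fderiv ℝ f) x = 0 := fun {f} hf => by
    have h2 : fderiv ℝ f =ᶠ[𝓝 x] fun _ => (0 : Cn n →L[ℝ] ℝ) := by
      refine (hev hf).fderiv.trans (Eventually.of_forall fun y => ?_)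
      simp
    refine ⟨h2.self_of_nhds, ?_⟩
    rw [h2.fderiv_eq]
    exact (hasFDerivAt_const _ _).fderiv
  have h0 : ∀ g e, jetLeviSum (n := n) g e 0 = 0 := fun g e => by simp [jetLeviSum, jetLevi]
  have hη : scaledEta lam m P E 1 x = 0 := by
    rw [scaledEta, jetEta]
    simp only [dilate, one_smul, (h1 h.zero_E).1, (h1 h.zero_E).2, smul_zero, h0]
    simp
  rw [scaledOmega, hη, scaledDG, dilate, one_smul, (h1 h.zero_P).1]
  simp

theorem exists_fderiv_scaledOmega_le (h : SmoothPert lam μ m P E) :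
    ∃ C, 0 ≤ C ∧ ∀ t, 0 ≤ t → ∀ x : Cn n, x ≠ 0 → ‖fderiv ℝ (scaledOmega lam m P E t) x‖ ≤ C := by
  let δ : C(unitInterval, ℝ) := ⟨fun t => t, continuous_subtype_val⟩
  have hfam := h.smoothFam_scaledOmega (δ := δ) fun t => t.2.1
  have hm : (1 : WithTop ℕ∞) ≤ m := by exact_mod_cast h.m_pos
  have hO : IsOpen {φ : C(unitInterval, Cn n) | ∀ y, φ y ∈ ({0}ᶜ : Set (Cn n))} :=
    isOpen_forall_mem isOpen_compl_singleton
  have hc : ContinuousOn (fun x => ‖fderiv ℝ (nem fun t : unitInterval => scaledOmega lam m P E (δ t))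
      (constCLM unitInterval (Cn n) x)‖) (Metric.sphere 0 1) := by
    refine ContinuousOn.norm ((hfam.smooth.continuousOn_fderiv_of_isOpen hO hm).comp
      (constCLM unitInterval (Cn n)).continuous.continuousOn fun x hx y => ?_)
    rintro rfl
    simp at hx
  obtain ⟨C₁, hC₁⟩ := (isCompact_sphere (0 : Cn n) 1).bddAbove_image hc
  have h1 : ∀ t : unitInterval, ∀ x : Cn n, ‖x‖ = 1 →
      ‖fderiv ℝ (scaledOmega lam m P E t) x‖ ≤ max C₁ 0 := by
    intro t x hx
    have hx' : ∀ y : unitInterval, constCLM unitInterval (Cn n) x y ∈ ({0}ᶜ : Set (Cn n)) := by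
      rintro y h0
      have h0' : x = 0 := h0
      simp [h0'] at hx
    refine ContinuousLinearMap.opNorm_le_bound _ (le_max_right _ _) fun v => ?_
    have h2 := hfam.fderiv_nem_apply h.m_pos isOpen_compl_singleton hx'
      (constCLM unitInterval (Cn n) v) t
    rw [constCLM_apply, constCLM_apply] at h2
    change ‖fderiv ℝ (scaledOmega lam m P E (δ t)) x v‖ ≤ _
    rw [← h2]
    refine (ContinuousMap.norm_coe_le_norm _ t).trans ((ContinuousLinearMap.le_opNorm _ _).trans ?_)
    have h3 : ‖constCLM unitInterval (Cn n) v‖ ≤ ‖v‖ :=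
      (ContinuousMap.norm_le _ (norm_nonneg v)).2 fun y => le_rfl
    refine mul_le_mul ((hC₁ ⟨x, by simpa using hx, rfl⟩).trans (le_max_left _ _)) h3 (norm_nonneg _)
      (le_max_right _ _)
  set C := max (max C₁ 0) ‖(2 : ℝ) • quadBilin lam‖ with hC
  have hq : ∀ x : Cn n, fderiv ℝ (fun x => ((2 : ℝ) • quadBilin lam) x) x = (2 : ℝ) • quadBilin lam :=
    fun x => ((2 : ℝ) • quadBilin lam).hasFDerivAt.fderiv
  have h2 : ∀ z : Cn n, z ≠ 0 → ‖fderiv ℝ (scaledOmega lam m P E 1) z‖ ≤ C := by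
    intro z hz
    have hz0 : 0 < ‖z‖ := norm_pos_iff.2 hz
    by_cases hz1 : ‖z‖ ≤ 1
    · have h3 : z = ‖z‖ • (‖z‖⁻¹ • z) := by rw [smul_smul, mul_inv_cancel₀ hz0.ne', one_smul]
      have h4 := h.fderiv_scaledOmega hz0 (smul_ne_zero (inv_ne_zero hz0.ne') hz)
      rw [← h3] at h4
      rw [← h4]
      refine (h1 ⟨‖z‖, hz0.le, hz1⟩ _ ?_).trans (le_max_left _ _)
      rw [norm_smul, norm_inv, norm_norm, inv_mul_cancel₀ hz0.ne']
    · have h3 : scaledOmega lam m P E 1 =ᶠ[𝓝 z] fun x => ((2 : ℝ) • quadBilin lam) x := by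
        filter_upwards [(isOpen_lt continuous_const continuous_norm).mem_nhds
          (show 1 / 2 < ‖z‖ by linarith)] with y hy
        exact h.scaledOmega_eq_quad hy
      rw [h3.fderiv_eq, hq]
      exact le_max_right _ _
  refine ⟨C, (le_max_right C₁ 0).trans (le_max_left _ _), fun t ht x hx => ?_⟩
  rcases ht.eq_or_lt with rfl | ht
  · have h3 : scaledOmega lam m P E 0 = fun x => ((2 : ℝ) • quadBilin lam) x :=
      funext fun x => h.scaledOmega_zero x
    rw [h3, hq]
    exact le_max_right _ _
  · rw [h.fderiv_scaledOmega ht hx]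
    exact h2 _ (smul_ne_zero ht.ne' hx)

end SmoothPert

end DerivBound

/-! ### Curves in the kernel of a one-form that join a point to a fixed ray -/

section Paths

variable {n : ℕ}

/-- A unit vector `q` and a form `ℓ` of norm one with `ℓ q = 1`. -/
structure IsAxis (q : Cn n) (ℓ : Cn n →L[ℝ] ℝ) : Prop where
  norm_q : ‖q‖ = 1
  abs_le : ∀ x, |ℓ x| ≤ ‖x‖
  apply_q : ℓ q = 1

/-- A cone around the axis. -/
def axisCone (ℓ : Cn n →L[ℝ] ℝ) (κ : ℝ) : Set (Cn n) := {x | -(κ * ‖x‖) < ℓ x}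

theorem isOpen_axisCone (ℓ : Cn n →L[ℝ] ℝ) (κ : ℝ) : IsOpen (axisCone ℓ κ) :=
  isOpen_lt (by fun_prop) (by fun_prop)

theorem ne_zero_of_mem_axisCone {ℓ : Cn n →L[ℝ] ℝ} {κ : ℝ} {x : Cn n} (hx : x ∈ axisCone ℓ κ) :
    x ≠ 0 := by
  rintro rfl
  simp [axisCone] at hx

theorem smul_mem_axisCone {ℓ : Cn n →L[ℝ] ℝ} {κ : ℝ} {x : Cn n} (hx : x ∈ axisCone ℓ κ) {t : ℝ}
    (ht : 0 < t) : t • x ∈ axisCone ℓ κ := by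
  have : -(κ * ‖x‖) < ℓ x := hx
  change -(κ * ‖t • x‖) < ℓ (t • x)
  rw [norm_smul, Real.norm_of_nonneg ht.le, map_smul, smul_eq_mul]
  nlinarith

/-- The segment from `x` to `‖x‖ q`. -/
noncomputable def segPt (q : Cn n) (s : ℝ) (x : Cn n) : Cn n := (1 - s) • x + (s * ‖x‖) • q

noncomputable def segDir (q : Cn n) (x : Cn n) : Cn n := ‖x‖ • q - x

/-- The point `eʸ ξ(s)`, `ξ` the segment, for `p = (x, y)`. -/
noncomputable def pathPt (q : Cn n) (s : ℝ) (p : Cn n × ℝ) : Cn n := Real.exp p.2 • segPt q s p.1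

/-- The slope `y'` for which `eʸ ξ` is tangent to the kernel of `om`. -/
noncomputable def pathRhs (om : Cn n → Cn n →L[ℝ] ℝ) (q : Cn n) (s : ℝ) (p : Cn n × ℝ) : ℝ :=
  -(om (pathPt q s p) (segDir q p.1)) / om (pathPt q s p) (segPt q s p.1)

noncomputable def pathVel (om : Cn n → Cn n →L[ℝ] ℝ) (q : Cn n) (s : ℝ) (p : Cn n × ℝ) : Cn n :=
  Real.exp p.2 • (pathRhs om q s p • segPt q s p.1 + segDir q p.1)

theorem om_pathVel {om : Cn n → Cn n →L[ℝ] ℝ} {q : Cn n} {s : ℝ} {p : Cn n × ℝ}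
    (h : om (pathPt q s p) (segPt q s p.1) ≠ 0) : om (pathPt q s p) (pathVel om q s p) = 0 := by
  rw [pathVel, map_smul, map_add, map_smul, pathRhs, smul_eq_mul, smul_eq_mul,
    div_mul_cancel₀ _ h, neg_add_cancel, mul_zero]

theorem hasDerivAt_segPt (q : Cn n) (s : ℝ) (x : Cn n) :
    HasDerivAt (fun s => segPt q s x) (segDir q x) s := by
  have h := (((hasDerivAt_id s).const_sub 1).smul_const x).add
    (((hasDerivAt_id s).mul_const ‖x‖).smul_const q)
  refine h.congr_deriv ?_
  simp [segDir]
  abel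

variable {q : Cn n} {ℓ : Cn n →L[ℝ] ℝ}

theorem IsAxis.norm_segPt_ge (h : IsAxis q ℓ) {κ : ℝ} (hκ : 0 < κ) {x : Cn n}
    (hx : x ∈ axisCone ℓ κ) {s : ℝ} (hs : s ∈ Icc (0 : ℝ) 1) :
    (1 - κ) * ‖x‖ ≤ (3 + κ) * ‖segPt q s x‖ := by
  have hx' : -(κ * ‖x‖) < ℓ x := hx
  have h1 : (1 - 2 * s) * ‖x‖ ≤ ‖segPt q s x‖ := by
    have h2 := norm_sub_norm_le ((1 - s) • x) (-((s * ‖x‖) • q))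
    rw [sub_neg_eq_add, norm_neg, norm_smul, norm_smul, h.norm_q, Real.norm_of_nonneg
      (by linarith [hs.2]), Real.norm_of_nonneg (mul_nonneg hs.1 (norm_nonneg x))] at h2
    rw [segPt]
    linarith
  have h3 : (s - κ * (1 - s)) * ‖x‖ ≤ ‖segPt q s x‖ := by
    refine le_trans ?_ ((le_abs_self _).trans (h.abs_le (segPt q s x)))
    rw [segPt, map_add, map_smul, map_smul, h.apply_q, smul_eq_mul, smul_eq_mul]
    nlinarith [hs.2]
  nlinarith

theorem IsAxis.norm_segPt_le (h : IsAxis q ℓ) (x : Cn n) {s : ℝ} (hs : s ∈ Icc (0 : ℝ) 1) :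
    ‖segPt q s x‖ ≤ ‖x‖ := by
  refine (norm_add_le _ _).trans ?_
  rw [norm_smul, norm_smul, h.norm_q, Real.norm_of_nonneg (by linarith [hs.2]),
    Real.norm_of_nonneg (mul_nonneg hs.1 (norm_nonneg x))]
  linarith

theorem IsAxis.norm_segDir_le (h : IsAxis q ℓ) (x : Cn n) : ‖segDir q x‖ ≤ 2 * ‖x‖ := by
  refine (norm_sub_le _ _).trans ?_
  rw [norm_smul, h.norm_q, norm_norm]
  linarith

theorem IsAxis.segPt_ne_zero (h : IsAxis q ℓ) {κ : ℝ} (hκ : 0 < κ) (hκ1 : κ < 1) {x : Cn n}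
    (hx : x ∈ axisCone ℓ κ) {s : ℝ} (hs : s ∈ Icc (0 : ℝ) 1) : segPt q s x ≠ 0 := by
  intro h0
  have h1 := h.norm_segPt_ge hκ hx hs
  have h2 := norm_pos_iff.2 (ne_zero_of_mem_axisCone hx)
  rw [h0, norm_zero] at h1
  nlinarith

theorem IsAxis.pathPt_ne_zero (h : IsAxis q ℓ) {κ : ℝ} (hκ : 0 < κ) (hκ1 : κ < 1) {p : Cn n × ℝ}
    (hx : p.1 ∈ axisCone ℓ κ) {s : ℝ} (hs : s ∈ Icc (0 : ℝ) 1) : pathPt q s p ≠ 0 :=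
  smul_ne_zero (Real.exp_pos _).ne' (h.segPt_ne_zero hκ hκ1 hx hs)

/-- Bounds for a one-form that is homogeneous of degree one up to constants. -/
structure FormBounds (om : Cn n → Cn n →L[ℝ] ℝ) (a b C : ℝ) : Prop where
  a_pos : 0 < a
  b_nonneg : 0 ≤ b
  C_nonneg : 0 ≤ C
  self_ge : ∀ x, a * ‖x‖ ^ 2 ≤ om x x
  abs_le : ∀ x v, |om x v| ≤ b * (‖x‖ * ‖v‖)
  diff : ∀ x, x ≠ 0 → DifferentiableAt ℝ om x
  fderiv_le : ∀ x, x ≠ 0 → ‖fderiv ℝ om x‖ ≤ C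

variable {om : Cn n → Cn n →L[ℝ] ℝ} {a b C : ℝ}

theorem FormBounds.apply_segPt_ge (hb : FormBounds om a b C) (q : Cn n) (s : ℝ) (p : Cn n × ℝ) :
    a * (‖pathPt q s p‖ * ‖segPt q s p.1‖) ≤ om (pathPt q s p) (segPt q s p.1) := by
  have h1 := hb.self_ge (pathPt q s p)
  have h2 : om (pathPt q s p) (pathPt q s p) =
      Real.exp p.2 * om (pathPt q s p) (segPt q s p.1) := by
    conv_lhs => rw [show pathPt q s p = Real.exp p.2 • segPt q s p.1 from rfl]
    rw [map_smul, smul_eq_mul]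
    rfl
  have h3 : ‖pathPt q s p‖ = Real.exp p.2 * ‖segPt q s p.1‖ := by
    rw [pathPt, norm_smul, Real.norm_of_nonneg (Real.exp_pos _).le]
  rw [h2, h3] at h1
  rw [h3]
  refine le_of_mul_le_mul_left ?_ (Real.exp_pos p.2)
  linarith

theorem FormBounds.apply_segPt_pos (hb : FormBounds om a b C) {q : Cn n} {s : ℝ} {p : Cn n × ℝ}
    (h0 : segPt q s p.1 ≠ 0) : 0 < om (pathPt q s p) (segPt q s p.1) := by
  refine lt_of_lt_of_le ?_ (hb.apply_segPt_ge q s p)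
  have h1 := norm_pos_iff.2 h0
  have h2 : 0 < ‖pathPt q s p‖ := norm_pos_iff.2 (smul_ne_zero (Real.exp_pos _).ne' h0)
  have := hb.a_pos
  positivity

theorem FormBounds.abs_pathRhs_le (hb : FormBounds om a b C) {q : Cn n} {s : ℝ} {p : Cn n × ℝ}
    (h0 : segPt q s p.1 ≠ 0) :
    |pathRhs om q s p| ≤ b / a * (‖segDir q p.1‖ / ‖segPt q s p.1‖) := by
  have h1 := hb.apply_segPt_pos h0
  have h2 := hb.apply_segPt_ge q s p
  have h3 := norm_pos_iff.2 h0
  have h4 : 0 < ‖pathPt q s p‖ := norm_pos_iff.2 (smul_ne_zero (Real.exp_pos _).ne' h0)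
  have ha := hb.a_pos
  rw [pathRhs, abs_div, abs_neg, abs_of_pos h1, div_le_iff₀ h1]
  refine (hb.abs_le _ _).trans ?_
  calc b * (‖pathPt q s p‖ * ‖segDir q p.1‖)
      = b / a * (‖segDir q p.1‖ / ‖segPt q s p.1‖) * (a * (‖pathPt q s p‖ * ‖segPt q s p.1‖)) := by
        field_simp
    _ ≤ _ := mul_le_mul_of_nonneg_left h2 (by have := hb.b_nonneg; positivity)

theorem FormBounds.pathRhs_lipschitz (hb : FormBounds om a b C) {q : Cn n} {s : ℝ} {x : Cn n}
    (h0 : segPt q s x ≠ 0) (y y' : ℝ) : |pathRhs om q s (x, y) - pathRhs om q s (x, y')| ≤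
      (C / a + b * C / a ^ 2) * (‖segDir q x‖ / ‖segPt q s x‖) * |y - y'| := by
  have ha := hb.a_pos
  set ξ := segPt q s x
  set v := segDir q x
  have hξ := norm_pos_iff.2 h0
  have hz : ∀ y : ℝ, HasDerivAt (fun y : ℝ => pathPt q s (x, y)) (pathPt q s (x, y)) y := fun y =>
    (Real.hasDerivAt_exp y).smul_const ξ
  have hz0 : ∀ y, pathPt q s (x, y) ≠ 0 := fun y => smul_ne_zero (Real.exp_pos _).ne' h0
  have hom : ∀ (y : ℝ) (w : Cn n), HasDerivAt (fun y => om (pathPt q s (x, y)) w)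
      (fderiv ℝ om (pathPt q s (x, y)) (pathPt q s (x, y)) w) y := by
    intro y w
    have h1 := (hb.diff _ (hz0 y)).hasFDerivAt.comp_hasDerivAt y (hz y)
    exact (ContinuousLinearMap.apply ℝ ℝ w).hasFDerivAt.comp_hasDerivAt y h1
  have hder : ∀ y, HasDerivAt (fun y => pathRhs om q s (x, y)) _ y := fun y =>
    ((hom y v).neg).div (hom y ξ) (hb.apply_segPt_pos (p := (x, y)) h0).ne'
  have hbound := Convex.norm_image_sub_le_of_norm_hasDerivWithin_le (s := univ)
    (C := (C / a + b * C / a ^ 2) * (‖v‖ / ‖ξ‖)) (fun y _ => (hder y).hasDerivWithinAt) ?_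
    convex_univ (mem_univ y') (mem_univ y)
  · exact hbound
  · intro y _
    set z := pathPt q s (x, y)
    have hz1 : 0 < ‖z‖ := norm_pos_iff.2 (hz0 y)
    have hz1' := hz1.ne'
    have hD := hb.apply_segPt_ge q s (x, y)
    change a * (‖z‖ * ‖ξ‖) ≤ om z ξ at hD
    have hD0 : 0 < a * (‖z‖ * ‖ξ‖) := by positivity
    have hd : ∀ w, |fderiv ℝ om z z w| ≤ C * (‖z‖ * ‖w‖) := fun w => by
      have := (fderiv ℝ om z z).le_of_opNorm_le
        ((fderiv ℝ om z).le_of_opNorm_le (hb.fderiv_le z (hz0 y)) z) w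
      rw [Real.norm_eq_abs] at this
      linarith
    have hDp : 0 < om z ξ := hD0.trans_le hD
    have e : (-(fderiv ℝ om z z v) * om z ξ - -(om z v) * fderiv ℝ om z z ξ) / om z ξ ^ 2 =
        -(fderiv ℝ om z z v) / om z ξ + om z v * fderiv ℝ om z z ξ / (om z ξ * om z ξ) := by
      field_simp
      ring
    rw [Real.norm_eq_abs]
    refine (congrArg abs e).trans_le ((abs_add_le _ _).trans ?_)
    rw [abs_div, abs_neg, abs_of_pos hDp, abs_div, abs_mul, abs_mul, abs_of_pos hDp, add_mul]
    have hC := hb.C_nonneg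
    have hb0 := hb.b_nonneg
    refine add_le_add ?_ ?_
    · calc |fderiv ℝ om z z v| / om z ξ ≤ C * (‖z‖ * ‖v‖) / (a * (‖z‖ * ‖ξ‖)) :=
            div_le_div₀ (by positivity) (hd v) hD0 hD
        _ = _ := by field_simp
    · calc |om z v| * |fderiv ℝ om z z ξ| / (om z ξ * om z ξ) ≤
            (b * (‖z‖ * ‖v‖)) * (C * (‖z‖ * ‖ξ‖)) / ((a * (‖z‖ * ‖ξ‖)) * (a * (‖z‖ * ‖ξ‖))) := by
            refine div_le_div₀ (by positivity) ?_ (by positivity) ?_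
            · exact mul_le_mul (hb.abs_le z v) (hd ξ) (abs_nonneg _) (by positivity)
            · exact mul_le_mul hD hD hD0.le hDp.le
        _ = _ := by field_simp

theorem IsAxis.segDir_div_le (h : IsAxis q ℓ) {κ : ℝ} (hκ : 0 < κ) (hκ1 : κ < 1) {x : Cn n}
    (hx : x ∈ axisCone ℓ κ) {s : ℝ} (hs : s ∈ Icc (0 : ℝ) 1) :
    ‖segDir q x‖ / ‖segPt q s x‖ ≤ 2 * ((3 + κ) / (1 - κ)) := by
  have h1 := h.norm_segPt_ge hκ hx hs
  have h2 := h.norm_segDir_le x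
  have h3 := norm_pos_iff.2 (h.segPt_ne_zero hκ hκ1 hx hs)
  have h4 : 0 < 1 - κ := by linarith
  rw [div_le_iff₀ h3, mul_assoc, div_mul_eq_mul_div]
  refine h2.trans (mul_le_mul_of_nonneg_left ?_ zero_le_two)
  rw [le_div_iff₀ h4]
  linarith

end Paths

section Transport

variable {n : ℕ}

/-- `y` solves `y' = pathRhs`, `y(0) = 0`, in integral form. -/
def IsTransport (om : Cn n → Cn n →L[ℝ] ℝ) (q x : Cn n) (y : C(unitInterval, ℝ)) : Prop :=
  ∀ s : unitInterval, y s = ∫ σ in (0 : ℝ)..s, pathRhs om q (projIcc 0 1 zero_le_one σ)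
    (x, y (projIcc 0 1 zero_le_one σ))

open Classical in
/-- The solution of `y' = pathRhs`, `y(0) = 0`. -/
noncomputable def transport (om : Cn n → Cn n →L[ℝ] ℝ) (q x : Cn n) : C(unitInterval, ℝ) :=
  if h : ∃ y, IsTransport om q x y then h.choose else 0

variable {q : Cn n} {ℓ : Cn n →L[ℝ] ℝ} {om : Cn n → Cn n →L[ℝ] ℝ} {a b C κ : ℝ}

theorem continuous_segPt (q x : Cn n) : Continuous fun s => segPt q s x := by
  unfold segPt
  fun_prop

theorem FormBounds.continuousOn (hb : FormBounds om a b C) : ContinuousOn om {0}ᶜ := fun x hx =>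
  (hb.diff x hx).continuousAt.continuousWithinAt

theorem FormBounds.continuous_pathRhs (hb : FormBounds om a b C) (hax : IsAxis q ℓ) (hκ : 0 < κ)
    (hκ1 : κ < 1) {x : Cn n} (hx : x ∈ axisCone ℓ κ) (y : C(unitInterval, ℝ)) :
    Continuous fun s : unitInterval => pathRhs om q s (x, y s) := by
  have h1 : Continuous fun s : unitInterval => segPt q s x :=
    (continuous_segPt q x).comp continuous_subtype_val
  have h2 : Continuous fun s : unitInterval => pathPt q s (x, y s) :=
    (Real.continuous_exp.comp y.continuous).smul h1
  have h3 : Continuous fun s : unitInterval => om (pathPt q s (x, y s)) :=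
    hb.continuousOn.comp_continuous h2 fun s =>
      hax.pathPt_ne_zero (p := (x, y s)) hκ hκ1 hx s.2
  refine Continuous.div ?_ ?_ fun s => ?_
  · exact (h3.clm_apply (continuous_const (y := segDir q x))).neg
  · exact h3.clm_apply h1
  · exact (hb.apply_segPt_pos (p := (x, y s)) (hax.segPt_ne_zero hκ hκ1 hx s.2)).ne'

theorem IsTransport.unique (hb : FormBounds om a b C) (hax : IsAxis q ℓ) (hκ : 0 < κ)
    (hκ1 : κ < 1) {x : Cn n} (hx : x ∈ axisCone ℓ κ) {y₁ y₂ : C(unitInterval, ℝ)}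
    (h₁ : IsTransport om q x y₁) (h₂ : IsTransport om q x y₂) : y₁ = y₂ := by
  have ha := hb.a_pos
  have hC := hb.C_nonneg
  have hb0 := hb.b_nonneg
  have hk : 0 < 1 - κ := by linarith
  refine eq_of_integral_eq (L := (C / a + b * C / a ^ 2) * (2 * ((3 + κ) / (1 - κ))))
    (g₁ := ⟨_, hb.continuous_pathRhs hax hκ hκ1 hx y₁⟩)
    (g₂ := ⟨_, hb.continuous_pathRhs hax hκ hκ1 hx y₂⟩) (by positivity) h₁ h₂ fun s => ?_
  refine (hb.pathRhs_lipschitz (hax.segPt_ne_zero hκ hκ1 hx s.2) _ _).trans ?_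
  gcongr
  exact hax.segDir_div_le hκ hκ1 hx s.2

theorem IsTransport.eq_transport (hb : FormBounds om a b C) (hax : IsAxis q ℓ) (hκ : 0 < κ)
    (hκ1 : κ < 1) {x : Cn n} (hx : x ∈ axisCone ℓ κ) {y : C(unitInterval, ℝ)}
    (h : IsTransport om q x y) : transport om q x = y := by
  have hex : ∃ y, IsTransport om q x y := ⟨y, h⟩
  rw [transport, dif_pos hex]
  exact IsTransport.unique hb hax hκ hκ1 hx hex.choose_spec h

variable {Y : Type} [TopologicalSpace Y] [CompactSpace Y]

theorem smoothFam_path {k : ℕ} {σ : C(Y, ℝ)} (q : Cn n) (ℓ : Cn n →L[ℝ] ℝ) (κ : ℝ) :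
    SmoothFam k (axisCone ℓ κ ×ˢ (univ : Set ℝ)) (fun y p => segPt q (σ y) p.1) ∧
    SmoothFam k (axisCone ℓ κ ×ˢ (univ : Set ℝ)) (fun (_ : Y) p => segDir q p.1) ∧
    SmoothFam k (axisCone ℓ κ ×ˢ (univ : Set ℝ)) (fun y p => pathPt q (σ y) p) := by
  have hb : SmoothFam k (axisCone ℓ κ ×ˢ (univ : Set ℝ)) (fun (y : Y) (p : Cn n × ℝ) => (p, σ y)) :=
    SmoothFam.id.prodMk (SmoothFam.param σ)
  have hO : IsOpen {w : (Cn n × ℝ) × ℝ | w.1.1 ≠ 0} := isOpen_ne_fun (by fun_prop) (by fun_prop)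
  have hmem : ∀ y : Y, ∀ p ∈ axisCone ℓ κ ×ˢ (univ : Set ℝ),
      (p, σ y) ∈ {w : (Cn n × ℝ) × ℝ | w.1.1 ≠ 0} := fun y p hp => ne_zero_of_mem_axisCone hp.1
  have hn : ContDiffOn ℝ k (fun w : (Cn n × ℝ) × ℝ => ‖w.1.1‖) {w | w.1.1 ≠ 0} := fun w hw =>
    (ContDiffAt.norm ℂ (contDiff_fst.fst.contDiffAt) hw).contDiffWithinAt
  have hx : ContDiffOn ℝ k (fun w : (Cn n × ℝ) × ℝ => w.1.1) {w | w.1.1 ≠ 0} := by fun_prop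
  have hy : ContDiffOn ℝ k (fun w : (Cn n × ℝ) × ℝ => w.1.2) {w | w.1.1 ≠ 0} := by fun_prop
  have hs : ContDiffOn ℝ k (fun w : (Cn n × ℝ) × ℝ => w.2) {w | w.1.1 ≠ 0} := by fun_prop
  have hseg : ContDiffOn ℝ k (fun w : (Cn n × ℝ) × ℝ => segPt q w.2 w.1.1) {w | w.1.1 ≠ 0} :=
    ((contDiffOn_const.sub hs).smul hx).add ((hs.mul hn).smul contDiffOn_const)
  refine ⟨hb.map hO hseg hmem, hb.map hO (Φ := fun w => segDir q w.1.1) ?_ hmem,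
    hb.map hO (Φ := fun w => pathPt q w.2 w.1) ?_ hmem⟩
  · exact (hn.smul contDiffOn_const).sub hx
  · exact (hy.exp).smul hseg

theorem smoothFam_pathRhs {k : ℕ} {σ : C(Y, ℝ)} (hσ : ∀ y, σ y ∈ Icc (0 : ℝ) 1)
    (hax : IsAxis q ℓ) (hκ : 0 < κ) (hκ1 : κ < 1) {om : Y → Cn n → Cn n →L[ℝ] ℝ}
    (hom : SmoothFam k {0}ᶜ om) (hb : ∀ y, FormBounds (om y) a b C) :
    SmoothFam k (axisCone ℓ κ ×ˢ (univ : Set ℝ)) (fun y p => pathRhs (om y) q (σ y) p) := by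
  obtain ⟨h1, h2, h3⟩ := smoothFam_path (k := k) (σ := σ) q ℓ κ
  have h4 := hom.comp h3 fun y p hp => hax.pathPt_ne_zero hκ hκ1 hp.1 (hσ y)
  have hO : IsOpen {w : (Cn n →L[ℝ] ℝ) × Cn n × Cn n | w.1 w.2.1 ≠ 0} :=
    isOpen_ne_fun (by fun_prop) (by fun_prop)
  refine ((h4.prodMk (h1.prodMk h2)).map hO (Φ := fun w => -(w.1 w.2.2) / w.1 w.2.1) ?_
    fun y p hp => ?_)
  · have e1 : ContDiff ℝ k fun w : (Cn n →L[ℝ] ℝ) × Cn n × Cn n => w.1 w.2.2 :=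
      contDiff_fst.clm_apply contDiff_snd.snd
    have e2 : ContDiff ℝ k fun w : (Cn n →L[ℝ] ℝ) × Cn n × Cn n => w.1 w.2.1 :=
      contDiff_fst.clm_apply contDiff_snd.fst
    exact e1.neg.contDiffOn.div e2.contDiffOn fun w hw => hw
  · exact ((hb y).apply_segPt_pos (p := p) (hax.segPt_ne_zero hκ hκ1 hp.1 (hσ y))).ne'

theorem smoothFam_pathVel {k : ℕ} {σ : C(Y, ℝ)} (hσ : ∀ y, σ y ∈ Icc (0 : ℝ) 1)
    (hax : IsAxis q ℓ) (hκ : 0 < κ) (hκ1 : κ < 1) {om : Y → Cn n → Cn n →L[ℝ] ℝ}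
    (hom : SmoothFam k {0}ᶜ om) (hb : ∀ y, FormBounds (om y) a b C) :
    SmoothFam k (axisCone ℓ κ ×ˢ (univ : Set ℝ)) (fun y p => pathVel (om y) q (σ y) p) := by
  obtain ⟨h1, h2, -⟩ := smoothFam_path (k := k) (σ := σ) q ℓ κ
  have h4 := smoothFam_pathRhs hσ hax hκ hκ1 hom hb
  have h5 : SmoothFam k (axisCone ℓ κ ×ˢ (univ : Set ℝ)) (fun (_ : Y) (p : Cn n × ℝ) => p.2) :=
    SmoothFam.id.map_contDiff contDiff_snd
  have h6 : ContDiff ℝ k fun w : ℝ × ℝ × Cn n × Cn n => Real.exp w.1 • (w.2.1 • w.2.2.1 + w.2.2.2) := by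
    fun_prop
  exact (h5.prodMk (h4.prodMk (h1.prodMk h2))).map_contDiff h6

variable {D : Type} [TopologicalSpace D] [CompactSpace D]

/-- The solutions of the transport equation depend smoothly on the data. -/
theorem exists_transport_lift {k : ℕ} (hk : k ≠ 0) (hax : IsAxis q ℓ) (hκ : 0 < κ) (hκ1 : κ < 1)
    {om : D → Cn n → Cn n →L[ℝ] ℝ}
    (hom : SmoothFam k {0}ᶜ fun (p : D × unitInterval) => om p.1)
    (hb : ∀ d, FormBounds (om d) a b C) :
    ∃ S : C(D, Cn n) → C(D × unitInterval, ℝ), ContDiffOn ℝ k S {φ | ∀ d, φ d ∈ axisCone ℓ κ} ∧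
      ∀ φ : C(D, Cn n), (∀ d, φ d ∈ axisCone ℓ κ) →
        (∀ d, IsTransport (om d) q (φ d) (transport (om d) q (φ d))) ∧
        ∀ d s, S φ (d, s) = transport (om d) q (φ d) s := by
  let σ : C(D × unitInterval, ℝ) := ⟨fun p => p.2, by fun_prop⟩
  have hσ : ∀ p, σ p ∈ Icc (0 : ℝ) 1 := fun p => p.2.2
  have hf := smoothFam_pathRhs hσ hax hκ hκ1 hom fun p => hb p.1
  rcases isEmpty_or_nonempty D with hD | hD
  · have : Subsingleton C(D × unitInterval, ℝ) := ⟨fun f g => by ext p; exact hD.elim p.1⟩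
    exact ⟨fun _ => 0, contDiffOn_const, fun φ hφ => ⟨fun d => hD.elim d, fun d => hD.elim d⟩⟩
  obtain ⟨d₀⟩ := hD
  have ha := (hb d₀).a_pos
  have hC := (hb d₀).C_nonneg
  have hb0 := (hb d₀).b_nonneg
  have hk1 : 0 < 1 - κ := by linarith
  obtain ⟨S, hS, hS'⟩ := exists_odeFamily hk (isOpen_axisCone ℓ κ) hf
    (L := (C / a + b * C / a ^ 2) * (2 * ((3 + κ) / (1 - κ)))) (by positivity)
    fun p x hx y y' => by
      refine ((hb p.1).pathRhs_lipschitz (hax.segPt_ne_zero hκ hκ1 hx p.2.2) _ _).trans ?_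
      gcongr
      exact hax.segDir_div_le hκ hκ1 hx p.2.2
  refine ⟨S, hS, fun φ hφ => ?_⟩
  have hsl : ∀ d, IsTransport (om d) q (φ d) ⟨fun s => S φ (d, s), by fun_prop⟩ := by
    intro d s
    change S φ (d, s) = _
    conv_lhs => rw [hS' φ hφ]
    rw [volterra_apply]
    refine intervalIntegral.integral_congr fun τ _ => ?_
    have hmem : ∀ p, pairCLM (D × unitInterval) (Cn n) ℝ
        (precompCLM ⟨Prod.fst, continuous_fst⟩ (Cn n) φ, S φ) p ∈ axisCone ℓ κ ×ˢ (univ : Set ℝ) :=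
      fun p => by
        rw [pairCLM_apply]
        exact Set.mk_mem_prod (hφ p.1) (mem_univ _)
    dsimp only
    rw [nem_apply hf.cont hmem, pairCLM_apply, precompCLM_apply]
    rfl
  have heq : ∀ d, transport (om d) q (φ d) = ⟨fun s => S φ (d, s), by fun_prop⟩ := fun d =>
    (hsl d).eq_transport (hb d) hax hκ hκ1 (hφ d)
  exact ⟨fun d => by rw [heq d]; exact hsl d, fun d s => by rw [heq d]; rfl⟩

end Transport

section TransportEnd

variable {n : ℕ} {q x : Cn n} {ℓ : Cn n →L[ℝ] ℝ} {om : Cn n → Cn n →L[ℝ] ℝ} {a b C κ : ℝ}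

theorem hasDerivAt_integral_projIcc {g : unitInterval → ℝ} (hg : Continuous g) (s : ℝ) :
    HasDerivAt (fun s => ∫ σ in (0 : ℝ)..s, g (projIcc 0 1 zero_le_one σ))
      (g (projIcc 0 1 zero_le_one s)) s :=
  intervalIntegral.integral_hasDerivAt_right
    ((hg.comp continuous_projIcc_unit).intervalIntegrable _ _)
    (hg.comp continuous_projIcc_unit).stronglyMeasurable.stronglyMeasurableAtFilter
    (hg.comp continuous_projIcc_unit).continuousAt

theorem IsTransport.exists_logCurve (hb : FormBounds om a b C) (hax : IsAxis q ℓ) (hκ : 0 < κ)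
    (hκ1 : κ < 1) (hx : x ∈ axisCone ℓ κ) {y : C(unitInterval, ℝ)} (h : IsTransport om q x y) :
    ∃ L : ℝ → ℝ, ContDiff ℝ 1 L ∧ (∀ s : unitInterval, L s = y s) ∧ L 0 = 0 ∧
      ∀ s : unitInterval, HasDerivAt L (pathRhs om q s (x, y s)) s := by
  have hg := hb.continuous_pathRhs hax hκ hκ1 hx y
  refine ⟨fun s => ∫ σ in (0 : ℝ)..s, pathRhs om q (projIcc 0 1 zero_le_one σ)
    (x, y (projIcc 0 1 zero_le_one σ)), ?_, fun s => (h s).symm, by simp, fun s => ?_⟩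
  · rw [contDiff_one_iff_deriv]
    have h1 := hasDerivAt_integral_projIcc hg
    refine ⟨fun s => (h1 s).differentiableAt, ?_⟩
    rw [show deriv _ = _ from funext fun s => (h1 s).deriv]
    exact hg.comp continuous_projIcc_unit
  · have h1 := hasDerivAt_integral_projIcc hg s
    rwa [projIcc_of_mem zero_le_one s.2] at h1

theorem IsTransport.abs_le (hb : FormBounds om a b C) (hax : IsAxis q ℓ) (hκ : 0 < κ)
    (hκ1 : κ < 1) (hx : x ∈ axisCone ℓ κ) {y : C(unitInterval, ℝ)} (h : IsTransport om q x y)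
    (s : unitInterval) : |y s| ≤ b / a * (2 * ((3 + κ) / (1 - κ))) := by
  have ha := hb.a_pos
  have hb0 := hb.b_nonneg
  have hk : 0 < 1 - κ := by linarith
  rw [h s, ← Real.norm_eq_abs]
  have h1 := intervalIntegral.norm_integral_le_of_norm_le_const (a := 0) (b := (s : ℝ))
    (f := fun σ => pathRhs om q (projIcc 0 1 zero_le_one σ) (x, y (projIcc 0 1 zero_le_one σ)))
    (C := b / a * (2 * ((3 + κ) / (1 - κ)))) fun σ _ => by
      set τ := projIcc (0 : ℝ) 1 zero_le_one σ
      refine (hb.abs_pathRhs_le (p := (x, y τ)) (hax.segPt_ne_zero hκ hκ1 hx τ.2)).trans ?_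
      exact mul_le_mul_of_nonneg_left (hax.segDir_div_le hκ hκ1 hx τ.2) (by positivity)
  refine h1.trans (mul_le_of_le_one_right (by positivity) ?_)
  rw [sub_zero, abs_of_nonneg s.2.1]
  exact s.2.2

/-- The point of the ray of `q` reached from `x`. -/
noncomputable def transportEnd (om : Cn n → Cn n →L[ℝ] ℝ) (q x : Cn n) : Cn n :=
  pathPt q 1 (x, transport om q x 1)

theorem transportEnd_eq (om : Cn n → Cn n →L[ℝ] ℝ) (q x : Cn n) :
    transportEnd om q x = (Real.exp (transport om q x 1) * ‖x‖) • q := by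
  simp [transportEnd, pathPt, segPt, smul_smul]

theorem hasDerivAt_pathPt {L : ℝ → ℝ} {s : ℝ} {y : ℝ}
    (hL : HasDerivAt L (pathRhs om q s (x, y)) s) (hy : L s = y) :
    HasDerivAt (fun s => pathPt q s (x, L s)) (pathVel om q s (x, y)) s := by
  have h := (hL.exp).smul (hasDerivAt_segPt q s x)
  refine h.congr_deriv ?_
  rw [pathVel, hy, smul_add, smul_smul, add_comm]

theorem pathPt_zero (q x : Cn n) (y : ℝ) : pathPt q 0 (x, y) = Real.exp y • x := by
  simp [pathPt, segPt]

/-- The transport is realized by a `C¹` curve tangent to the kernel of the form. -/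
theorem IsTransport.exists_curve (hb : FormBounds om a b C) (hax : IsAxis q ℓ) (hκ : 0 < κ)
    (hκ1 : κ < 1) (hx : x ∈ axisCone ℓ κ) {y : C(unitInterval, ℝ)} (h : IsTransport om q x y) :
    ∃ c : ℝ → Cn n, ContDiff ℝ 1 c ∧ c 0 = x ∧
      ∀ s : unitInterval, c s = pathPt q s (x, y s) ∧
        HasDerivAt c (pathVel om q s (x, y s)) s := by
  obtain ⟨L, hL, hLy, hL0, hLd⟩ := h.exists_logCurve hb hax hκ hκ1 hx
  refine ⟨fun s => pathPt q s (x, L s), ?_, ?_, fun s => ⟨by simp only [hLy], ?_⟩⟩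
  · have h1 : ContDiff ℝ 1 fun s => segPt q s x := by
      unfold segPt
      fun_prop
    exact (Real.contDiff_exp.comp hL).smul h1
  · simp only [pathPt_zero, hL0]
    rw [Real.exp_zero, one_smul]
  · exact hasDerivAt_pathPt (hLd s) (hLy s)

theorem norm_pathPt_le (hax : IsAxis q ℓ) {s : ℝ} (hs : s ∈ Icc (0 : ℝ) 1) {y B : ℝ}
    (hy : |y| ≤ B) : ‖pathPt q s (x, y)‖ ≤ Real.exp B * ‖x‖ := by
  rw [pathPt, norm_smul, Real.norm_of_nonneg (Real.exp_pos _).le]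
  exact mul_le_mul (Real.exp_le_exp.2 ((le_abs_self _).trans hy)) (hax.norm_segPt_le x hs)
    (norm_nonneg _) (Real.exp_pos _).le

end TransportEnd

section ScaledTransport

variable {n : ℕ} {lam : Fin n → ℝ} {μ : ℝ} {m : ℕ} {P E : Cn n → ℝ} {q : Cn n}
  {ℓ : Cn n →L[ℝ] ℝ} {κ : ℝ}

/-- The rate at which `scaledG` changes along a transport curve, divided by `-tᵐ`. -/
noncomputable def deficitRate (lam : Fin n → ℝ) (m : ℕ) (P E : Cn n → ℝ) (q : Cn n) (t s : ℝ)
    (p : Cn n × ℝ) : ℝ :=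
  scaledEta lam m P E t (pathPt q s p) (pathVel (scaledOmega lam m P E t) q s p)

/-- The change of `scaledG` along a transport curve, divided by `-tᵐ`. -/
noncomputable def deficit (lam : Fin n → ℝ) (m : ℕ) (P E : Cn n → ℝ) (q : Cn n) (t : ℝ)
    (x : Cn n) : ℝ :=
  ∫ σ in (0 : ℝ)..1, deficitRate lam m P E q t (projIcc 0 1 zero_le_one σ)
    (x, transport (scaledOmega lam m P E t) q x (projIcc 0 1 zero_le_one σ))

theorem segPt_smul {q : Cn n} {s t : ℝ} (ht : 0 < t) (x : Cn n) :
    segPt q s (t • x) = t • segPt q s x := by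
  rw [segPt, segPt, norm_smul, Real.norm_of_nonneg ht.le, smul_add, smul_smul, smul_smul, smul_smul]
  congr 2 <;> ring

theorem segDir_smul {q : Cn n} {t : ℝ} (ht : 0 < t) (x : Cn n) :
    segDir q (t • x) = t • segDir q x := by
  rw [segDir, segDir, norm_smul, Real.norm_of_nonneg ht.le, smul_sub, smul_smul]

theorem pathPt_smul {q : Cn n} {s t : ℝ} (ht : 0 < t) (x : Cn n) (y : ℝ) :
    pathPt q s (t • x, y) = t • pathPt q s (x, y) := by
  rw [pathPt, pathPt, segPt_smul ht, smul_comm]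

namespace SmoothPert

theorem exists_formBounds (h : SmoothPert lam μ m P E) :
    ∃ C, ∀ t, 0 ≤ t → FormBounds (scaledOmega lam m P E t) (μ / 2) 6 C := by
  obtain ⟨C, hC, hC'⟩ := h.exists_fderiv_scaledOmega_le
  exact ⟨C, fun t ht => ⟨half_pos h.mu_pos, by norm_num, hC, h.scaledOmega_self_ge ht,
    h.abs_scaledOmega_le ht, fun x hx => h.differentiableAt_scaledOmega ht hx, hC' t ht⟩⟩

theorem pathRhs_smul (h : SmoothPert lam μ m P E) {t : ℝ} (ht : 0 < t) (s : ℝ) (x : Cn n) (y : ℝ) :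
    pathRhs (scaledOmega lam m P E 1) q s (t • x, y) = pathRhs (scaledOmega lam m P E t) q s (x, y) := by
  rw [pathRhs, pathRhs, pathPt_smul ht, h.scaledOmega_hom ht.ne' (pathPt q s (x, y))]
  dsimp only
  rw [segPt_smul ht, segDir_smul ht, map_smul, map_smul, smul_apply, smul_apply, smul_eq_mul,
    smul_eq_mul, smul_eq_mul, smul_eq_mul, ← mul_neg, ← mul_neg, mul_div_mul_left _ _ ht.ne',
    mul_div_mul_left _ _ (inv_ne_zero ht.ne')]

theorem transport_smul (h : SmoothPert lam μ m P E) {t : ℝ} (ht : 0 < t) (x : Cn n) :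
    transport (scaledOmega lam m P E 1) q (t • x) = transport (scaledOmega lam m P E t) q x := by
  have h1 : IsTransport (scaledOmega lam m P E 1) q (t • x) =
      IsTransport (scaledOmega lam m P E t) q x := by
    funext y
    simp only [IsTransport, h.pathRhs_smul ht]
  unfold transport
  rw [h1]

theorem transportEnd_smul (h : SmoothPert lam μ m P E) {t : ℝ} (ht : 0 < t) (x : Cn n) :
    transportEnd (scaledOmega lam m P E 1) q (t • x) =
      t • transportEnd (scaledOmega lam m P E t) q x := by
  rw [transportEnd, transportEnd, h.transport_smul ht, pathPt_smul ht]

theorem hasFDerivAt_scaledG (h : SmoothPert lam μ m P E) (t : ℝ) (x : Cn n) :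
    HasFDerivAt (scaledG lam P t) (scaledDG lam P t x) x := by
  refine (hasFDerivAt_quadModel lam x).add ?_
  by_cases ht : t = 0
  · subst ht
    rw [dilate_zero 1 h.vanish_fderiv_P.apply_zero]
    have h1 : dilate 2 P 0 = fun _ => (0 : ℝ) :=
      funext fun y => dilate_zero 2 h.vanish_P.apply_zero y
    rw [h1]
    exact hasFDerivAt_const _ _
  · exact hasFDerivAt_rescale ht ((h.contDiff_P.differentiable (by simp)) _)

variable {D : Type} [TopologicalSpace D] [CompactSpace D]

theorem smoothFam_deficitRate (h : SmoothPert lam μ m P E) (hax : IsAxis q ℓ) (hκ : 0 < κ)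
    (hκ1 : κ < 1) {δ : C(D, ℝ)} (hδ : ∀ d, 0 ≤ δ d) :
    SmoothFam m (axisCone ℓ κ ×ˢ (univ : Set ℝ))
      (fun (p : D × unitInterval) => deficitRate lam m P E q (δ p.1) p.2) := by
  obtain ⟨C, hC⟩ := h.exists_formBounds
  let σ : C(D × unitInterval, ℝ) := ⟨fun p => p.2, by fun_prop⟩
  have hσ : ∀ p, σ p ∈ Icc (0 : ℝ) 1 := fun p => p.2.2
  let δ' : C(D × unitInterval, ℝ) := ⟨fun p => δ p.1, by fun_prop⟩
  have hδ' : ∀ p, 0 ≤ δ' p := fun p => hδ p.1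
  have h1 := smoothFam_pathVel hσ hax hκ hκ1 (h.smoothFam_scaledOmega hδ')
    (fun p => hC _ (hδ' p))
  have h2 := (h.smoothFam_scaledEta hδ').comp (smoothFam_path (k := m) (σ := σ) q ℓ κ).2.2
    fun p w hw => hax.pathPt_ne_zero (p := w) hκ hκ1 hw.1 p.2.2
  have h3 : ContDiff ℝ m fun w : (Cn n →L[ℝ] ℝ) × Cn n => w.1 w.2 :=
    contDiff_fst.clm_apply contDiff_snd
  exact (h2.prodMk h1).map_contDiff h3

theorem m_ne_zero (h : SmoothPert lam μ m P E) : m ≠ 0 := by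
  have := h.m_pos
  omega

theorem exists_lift (h : SmoothPert lam μ m P E) (hax : IsAxis q ℓ) (hκ : 0 < κ)
    (hκ1 : κ < 1) {δ : C(D, ℝ)} (hδ : ∀ d, 0 ≤ δ d) :
    ∃ S : C(D, Cn n) → C(D × unitInterval, ℝ), ContDiffOn ℝ m S {φ | ∀ d, φ d ∈ axisCone ℓ κ} ∧
      ∀ φ : C(D, Cn n), (∀ d, φ d ∈ axisCone ℓ κ) →
        (∀ d, IsTransport (scaledOmega lam m P E (δ d)) q (φ d)
          (transport (scaledOmega lam m P E (δ d)) q (φ d))) ∧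
        ∀ d s, S φ (d, s) = transport (scaledOmega lam m P E (δ d)) q (φ d) s := by
  obtain ⟨C, hC⟩ := h.exists_formBounds
  let δ' : C(D × unitInterval, ℝ) := ⟨fun p => δ p.1, by fun_prop⟩
  exact exists_transport_lift h.m_ne_zero hax hκ hκ1
    (om := fun d => scaledOmega lam m P E (δ d))
    (h.smoothFam_scaledOmega (δ := δ') fun p => hδ p.1) fun d => hC _ (hδ d)

theorem isTransport (h : SmoothPert lam μ m P E) (hax : IsAxis q ℓ) (hκ : 0 < κ)
    (hκ1 : κ < 1) {t : ℝ} (ht : 0 ≤ t) {x : Cn n} (hx : x ∈ axisCone ℓ κ) :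
    IsTransport (scaledOmega lam m P E t) q x (transport (scaledOmega lam m P E t) q x) := by
  obtain ⟨S, -, hS⟩ := h.exists_lift (D := Unit) (δ := .const _ t) hax hκ hκ1 fun _ => ht
  exact (hS (.const _ x) fun _ => hx).1 ()

theorem smoothFam_transport (h : SmoothPert lam μ m P E) (hax : IsAxis q ℓ) (hκ : 0 < κ)
    (hκ1 : κ < 1) {δ : C(D, ℝ)} (hδ : ∀ d, 0 ≤ δ d) (s : unitInterval) :
    SmoothFam m (axisCone ℓ κ)
      (fun d x => transport (scaledOmega lam m P E (δ d)) q x s) := by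
  obtain ⟨S, hS, hS'⟩ := h.exists_lift hax hκ hκ1 hδ
  let e : C(D, D × unitInterval) := ⟨fun d => (d, s), by fun_prop⟩
  exact SmoothFam.of_lift (S := fun φ => precompCLM e ℝ (S φ))
    ((precompCLM e ℝ).contDiff.comp_contDiffOn hS) fun φ hφ d => (hS' φ hφ).2 d s

theorem smoothFam_transportEnd (h : SmoothPert lam μ m P E) (hax : IsAxis q ℓ) (hκ : 0 < κ)
    (hκ1 : κ < 1) {δ : C(D, ℝ)} (hδ : ∀ d, 0 ≤ δ d) :
    SmoothFam m (axisCone ℓ κ)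
      (fun d x => transportEnd (scaledOmega lam m P E (δ d)) q x) := by
  have h1 := (smoothFam_path (k := m) (σ := (1 : C(D, ℝ))) q ℓ κ).2.2
  exact h1.comp (SmoothFam.id.prodMk (h.smoothFam_transport hax hκ hκ1 hδ 1))
    fun d x hx => Set.mk_mem_prod hx (mem_univ _)

theorem smoothFam_deficit (h : SmoothPert lam μ m P E) (hax : IsAxis q ℓ) (hκ : 0 < κ)
    (hκ1 : κ < 1) {δ : C(D, ℝ)} (hδ : ∀ d, 0 ≤ δ d) :
    SmoothFam m (axisCone ℓ κ) (fun d => deficit lam m P E q (δ d)) := by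
  obtain ⟨S, hS, hS'⟩ := h.exists_lift hax hκ hκ1 hδ
  have hrate := h.smoothFam_deficitRate hax hκ hκ1 hδ
  let e : C(D, D × unitInterval) := ⟨fun d => (d, 1), by fun_prop⟩
  let A : C(D, Cn n) × C(D × unitInterval, ℝ) →L[ℝ] C(D × unitInterval, Cn n × ℝ) :=
    (pairCLM (D × unitInterval) (Cn n) ℝ).comp
      (((precompCLM ⟨Prod.fst, continuous_fst⟩ (Cn n)).comp (.fst ℝ _ _)).prod (.snd ℝ _ _))
  have hA : ∀ φ z p, A (φ, z) p = (φ p.1, z p) := fun _ _ _ => rfl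
  have hmem : ∀ φ : C(D, Cn n), (∀ d, φ d ∈ axisCone ℓ κ) → ∀ z p,
      A (φ, z) p ∈ axisCone ℓ κ ×ˢ (univ : Set ℝ) := fun φ hφ z p => by
    rw [hA]
    exact Set.mk_mem_prod (hφ p.1) (mem_univ _)
  refine SmoothFam.of_lift (S := fun φ => precompCLM e ℝ (volterra D (nem
    (fun (p : D × unitInterval) => deficitRate lam m P E q (δ p.1) p.2) (A (φ, S φ))))) ?_ ?_
  · refine ((precompCLM e ℝ).comp (volterra D)).contDiff.comp_contDiffOn ?_
    exact hrate.smooth.comp (A.contDiff.comp_contDiffOn (contDiffOn_id.prodMk hS))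
      fun φ hφ => hmem φ hφ (S φ)
  · intro φ hφ d
    rw [precompCLM_apply, volterra_apply, deficit]
    refine intervalIntegral.integral_congr fun σ _ => ?_
    rw [nem_apply hrate.cont (hmem φ hφ (S φ)), hA, (hS' φ hφ).2]
    rfl

theorem deficit_zero (h : SmoothPert lam μ m P E) (x : Cn n) : deficit lam m P E q 0 x = 0 := by
  simp [deficit, deficitRate, h.scaledEta_zero]

/-- The change of `scaledG` under the transport. -/
theorem scaledG_transportEnd (h : SmoothPert lam μ m P E) (hax : IsAxis q ℓ) (hκ : 0 < κ)
    (hκ1 : κ < 1) {t : ℝ} (ht : 0 ≤ t) {x : Cn n} (hx : x ∈ axisCone ℓ κ) :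
    scaledG lam P t (transportEnd (scaledOmega lam m P E t) q x) =
      scaledG lam P t x - t ^ m * deficit lam m P E q t x := by
  obtain ⟨C, hC⟩ := h.exists_formBounds
  have hT := h.isTransport hax hκ hκ1 ht hx
  obtain ⟨c, hc, hc0, hc'⟩ := hT.exists_curve (hC t ht) hax hκ hκ1 hx
  set y := transport (scaledOmega lam m P E t) q x with hy
  have hd : ∀ s ∈ uIcc (0 : ℝ) 1, HasDerivAt (fun s => scaledG lam P t (c s))
      (-(t ^ m * deficitRate lam m P E q t (projIcc 0 1 zero_le_one s)
        (x, y (projIcc 0 1 zero_le_one s)))) s := by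
    intro s hs
    rw [uIcc_of_le zero_le_one] at hs
    rw [projIcc_of_mem zero_le_one hs]
    obtain ⟨h1, h2⟩ := hc' ⟨s, hs⟩
    have h3 := (h.hasFDerivAt_scaledG t (c s)).comp_hasDerivAt s h2
    refine h3.congr_deriv ?_
    have h4 := om_pathVel (om := scaledOmega lam m P E t) (q := q) (s := s)
      (p := (x, y ⟨s, hs⟩)) ((hC t ht).apply_segPt_pos (p := (x, y ⟨s, hs⟩))
        (hax.segPt_ne_zero hκ hκ1 hx hs)).ne'
    rw [scaledOmega, add_apply, smul_apply, smul_eq_mul] at h4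
    rw [h1, deficitRate]
    linarith
  have hcont : Continuous fun s : unitInterval => deficitRate lam m P E q t s (x, y s) := by
    have h1 := (h.smoothFam_deficitRate (D := Unit) (δ := .const _ t) hax hκ hκ1 fun _ => ht).cont
    exact h1.comp_continuous (f := fun s : unitInterval => (((() : Unit), s), (x, y s)))
      (by fun_prop) fun s => Set.mk_mem_prod (mem_univ _) (Set.mk_mem_prod hx (mem_univ _))
  have hcont' : Continuous fun s : ℝ => deficitRate lam m P E q t (projIcc 0 1 zero_le_one s)
      (x, y (projIcc 0 1 zero_le_one s)) := hcont.comp continuous_projIcc_unit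
  have h5 := intervalIntegral.integral_eq_sub_of_hasDerivAt hd
    ((hcont'.const_mul (t ^ m)).neg.intervalIntegrable _ _)
  have h6 : c 1 = transportEnd (scaledOmega lam m P E t) q x := (hc' 1).1
  rw [intervalIntegral.integral_neg, intervalIntegral.integral_const_mul, hc0, h6] at h5
  rw [deficit, ← hy]
  linarith

end SmoothPert

end ScaledTransport

section Variation

variable {n : ℕ} {q x : Cn n} {ℓ : Cn n →L[ℝ] ℝ} {om : Cn n → Cn n →L[ℝ] ℝ} {a b C κ : ℝ} {k : ℕ}

theorem contDiffOn_transport (hk : k ≠ 0) (hom : ContDiffOn ℝ k om {0}ᶜ)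
    (hb : FormBounds om a b C) (hax : IsAxis q ℓ) (hκ : 0 < κ) (hκ1 : κ < 1) :
    ContDiffOn ℝ k (transport om q) (axisCone ℓ κ) ∧
      ∀ x ∈ axisCone ℓ κ, IsTransport om q x (transport om q x) := by
  obtain ⟨S, hS, hS'⟩ := exists_transport_lift (D := Unit) (om := fun _ => om) hk hax hκ hκ1
    (SmoothFam.const isOpen_compl_singleton hom) fun _ => hb
  refine ⟨?_, fun x hx => (hS' (.const _ x) fun _ => hx).1 ()⟩
  let e : C(unitInterval, Unit × unitInterval) := ⟨fun s => ((), s), by fun_prop⟩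
  have h1 : ContDiffOn ℝ k (fun x => precompCLM e ℝ (S (constCLM Unit (Cn n) x))) (axisCone ℓ κ) :=
    (precompCLM e ℝ).contDiff.comp_contDiffOn
      (hS.comp (constCLM Unit (Cn n)).contDiff.contDiffOn fun x hx _ => hx)
  refine h1.congr fun x hx => ?_
  ext s
  exact ((hS' (constCLM Unit (Cn n) x) fun _ => hx).2 () s).symm

/-- The variation of the solution of the transport equation in the direction `v`. -/
theorem exists_variation (hk : 1 ≤ k) (hom : ContDiffOn ℝ k om {0}ᶜ)
    (hb : FormBounds om a b C) (hax : IsAxis q ℓ) (hκ : 0 < κ) (hκ1 : κ < 1)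
    (hx : x ∈ axisCone ℓ κ) (v : Cn n) : ∃ u B : C(unitInterval, ℝ),
      (∀ s, HasDerivAt (fun τ : ℝ => transport om q (x + τ • v) s) (u s) 0) ∧
      (∀ s : unitInterval, u s = ∫ σ in (0 : ℝ)..s, B (projIcc 0 1 zero_le_one σ)) ∧
      ∀ s : unitInterval, HasDerivAt
        (fun τ : ℝ => pathRhs om q s (x + τ • v, transport om q x s + τ * u s)) (B s) 0 := by
  obtain ⟨hS, hST⟩ := contDiffOn_transport (by omega) hom hb hax hκ hκ1
  have hk' : (k : WithTop ℕ∞) ≠ 0 := by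
    exact_mod_cast (by omega : k ≠ 0)
  have hcone := (isOpen_axisCone ℓ κ).mem_nhds hx
  have hSx := ((hS.contDiffAt hcone).differentiableAt hk').hasFDerivAt
  set y := transport om q x
  let σ : C(unitInterval, ℝ) := ⟨fun s => s, continuous_subtype_val⟩
  have hF := smoothFam_pathRhs (σ := σ) (fun s => s.2) hax hκ hκ1
    (SmoothFam.const isOpen_compl_singleton hom) fun _ => hb
  set F : unitInterval → Cn n × ℝ → ℝ := fun s p => pathRhs om q (σ s) p
  have hO : IsOpen (axisCone ℓ κ ×ˢ (univ : Set ℝ)) := (isOpen_axisCone ℓ κ).prod isOpen_univ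
  let e : C(unitInterval, Unit × unitInterval) := ⟨fun s => ((), s), by fun_prop⟩
  let V : C(unitInterval, ℝ) →L[ℝ] C(unitInterval, ℝ) :=
    ((precompCLM e ℝ).comp (volterra Unit)).comp (precompCLM ⟨Prod.snd, continuous_snd⟩ ℝ)
  have hV : ∀ φ s, V φ s = ∫ σ in (0 : ℝ)..s, φ (projIcc 0 1 zero_le_one σ) := fun φ s => rfl
  let A : Cn n × C(unitInterval, ℝ) →L[ℝ] C(unitInterval, Cn n × ℝ) :=
    (pairCLM unitInterval (Cn n) ℝ).comp
      (((constCLM unitInterval (Cn n)).comp (.fst ℝ _ _)).prod (.snd ℝ _ _))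
  have hA : ∀ x z s, A (x, z) s = (x, z s) := fun _ _ _ => rfl
  have hmem : ∀ x' ∈ axisCone ℓ κ, ∀ z s, A (x', z) s ∈ axisCone ℓ κ ×ˢ (univ : Set ℝ) :=
    fun x' hx' z s => by
      rw [hA]
      exact Set.mk_mem_prod hx' (mem_univ _)
  have hfix : ∀ x' ∈ axisCone ℓ κ, transport om q x' = V (nem F (A (x', transport om q x'))) := by
    intro x' hx'
    ext s
    rw [hST x' hx' s, hV]
    refine intervalIntegral.integral_congr fun τ _ => ?_
    rw [nem_apply hF.cont (hmem x' hx' _), hA]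
    rfl
  set u := fderiv ℝ (transport om q) x v with hu
  set B := fderiv ℝ (nem F) (A (x, y)) (A (v, u)) with hB
  have hnem : HasFDerivAt (nem F) (fderiv ℝ (nem F) (A (x, y))) (A (x, y)) :=
    ((hF.smooth.contDiffAt ((isOpen_forall_mem hO).mem_nhds (hmem x hx y))).differentiableAt
      hk').hasFDerivAt
  have hcomp : HasFDerivAt (fun x' => V (nem F (A (x', transport om q x'))))
      (V.comp ((fderiv ℝ (nem F) (A (x, y))).comp (A.comp ((ContinuousLinearMap.id ℝ (Cn n)).prod
        (fderiv ℝ (transport om q) x))))) x := by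
    have h1 : HasFDerivAt (fun x' => A (x', transport om q x'))
        (A.comp ((ContinuousLinearMap.id ℝ (Cn n)).prod (fderiv ℝ (transport om q) x))) x :=
      A.hasFDerivAt.comp x ((hasFDerivAt_id x).prodMk hSx)
    have h2 : HasFDerivAt (fun x' => nem F (A (x', transport om q x'))) _ x :=
      HasFDerivAt.comp (g := nem F) x hnem h1
    exact V.hasFDerivAt.comp x h2
  have huV : u = V B := by
    have h1 := (hcomp.congr_of_eventuallyEq (Filter.eventually_of_mem hcone hfix)).unique hSx
    rw [hu, ← h1]
    rfl
  refine ⟨u, B, fun s => ?_, fun s => ?_, fun s => ?_⟩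
  · let ev : C(unitInterval, ℝ) →L[ℝ] ℝ := ContinuousMap.evalCLM ℝ s
    have hline : HasDerivAt (fun τ : ℝ => x + τ • v) v 0 := by
      simpa using ((hasDerivAt_id (0 : ℝ)).smul_const v).const_add x
    have h1 : HasFDerivAt (fun x' => ev (transport om q x'))
        (ev.comp (fderiv ℝ (transport om q) x)) (x + (0 : ℝ) • v) := by
      rw [zero_smul, add_zero]
      exact ev.hasFDerivAt.comp x hSx
    exact h1.comp_hasDerivAt 0 hline
  · rw [← hV, ← huV]
  · have h1 : ContDiffAt ℝ k (F s) (x, y s) :=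
      (hF.contDiffOn_slice s).contDiffAt (hO.mem_nhds (Set.mk_mem_prod hx (mem_univ _)))
    have h2 := hF.fderiv_nem_apply hk hO (hmem x hx y) (A (v, u)) s
    rw [hA, hA] at h2
    have hline : HasDerivAt (fun τ : ℝ => (x + τ • v, y s + τ * u s)) (v, u s) 0 := by
      have e1 : HasDerivAt (fun τ : ℝ => x + τ • v) v 0 := by
        simpa using ((hasDerivAt_id (0 : ℝ)).smul_const v).const_add x
      have e2 : HasDerivAt (fun τ : ℝ => y s + τ * u s) (u s) 0 := by
        simpa using ((hasDerivAt_id (0 : ℝ)).mul_const (u s)).const_add (y s)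
      exact e1.prodMk e2
    have h3 : HasFDerivAt (F s) (fderiv ℝ (F s) (x, y s))
        (x + (0 : ℝ) • v, y s + 0 * u s) := by
      rw [zero_smul, add_zero, zero_mul, add_zero]
      exact (h1.differentiableAt hk').hasFDerivAt
    have h4 := h3.comp_hasDerivAt (0 : ℝ) hline
    rw [← h2] at h4
    exact h4

/-- The radius at which the transport curve from `x` meets the ray of `q`. -/
noncomputable def transportRadius (om : Cn n → Cn n →L[ℝ] ℝ) (q x : Cn n) : ℝ :=
  Real.exp (transport om q x 1) * ‖x‖

/-- If `om` satisfies the Frobenius condition along the transport curve, the transport is constant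
in the directions of the kernel of `om`. -/
theorem fderiv_transportRadius_eq_zero (hk : 1 ≤ k) (hom : ContDiffOn ℝ k om {0}ᶜ)
    (hb : FormBounds om a b C) (hax : IsAxis q ℓ) (hκ : 0 < κ) (hκ1 : κ < 1)
    (hx : x ∈ axisCone ℓ κ)
    (hfrob : ∀ s : unitInterval, ∀ v w,
      om (pathPt q s (x, transport om q x s)) v = 0 → om (pathPt q s (x, transport om q x s)) w = 0 →
      fderiv ℝ om (pathPt q s (x, transport om q x s)) v w =
        fderiv ℝ om (pathPt q s (x, transport om q x s)) w v)
    {v : Cn n} (hv : om x v = 0) :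
    HasDerivAt (fun τ : ℝ => transportRadius om q (x + τ • v)) 0 0 := by
  obtain ⟨u, B, hu, huB, hB⟩ := exists_variation hk hom hb hax hκ hκ1 hx v
  obtain ⟨-, hST⟩ := contDiffOn_transport (by omega) hom hb hax hκ hκ1
  set y := transport om q x with hy
  obtain ⟨Y, hY, hYy, hY0, hYd⟩ := (hST x hx).exists_logCurve hb hax hκ hκ1 hx
  rw [← hy] at hYy hYd
  let U : ℝ → ℝ := fun s => ∫ σ in (0 : ℝ)..s, B (projIcc 0 1 zero_le_one σ)
  have hUu : ∀ s : unitInterval, U s = u s := fun s => (huB s).symm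
  have hUd : ∀ s : unitInterval, HasDerivAt U (B s) s := fun s => by
    have := hasDerivAt_integral_projIcc B.continuous s
    rwa [projIcc_of_mem zero_le_one s.2] at this
  have hx0 := ne_zero_of_mem_axisCone hx
  have hline : HasDerivAt (fun τ : ℝ => x + τ • v) v 0 := by
    simpa using ((hasDerivAt_id (0 : ℝ)).smul_const v).const_add x
  have hline0 : x + (0 : ℝ) • v = x := by simp
  obtain ⟨ν, hν⟩ : ∃ ν, HasDerivAt (fun τ : ℝ => ‖x + τ • v‖) ν 0 := by
    have h1 : DifferentiableAt ℝ (fun x : Cn n => ‖x‖) (x + (0 : ℝ) • v) := by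
      rw [hline0]
      exact (ContDiffAt.norm ℂ (n := 1) contDiffAt_id hx0).differentiableAt (by simp)
    exact ⟨_, h1.hasFDerivAt.comp_hasDerivAt 0 hline⟩
  -- the variation of the curve
  let dseg : ℝ → Cn n := fun s => (1 - s) • v + (s * ν) • q
  let cv : ℝ → Cn n := fun s => Real.exp (Y s) • (U s • segPt q s x + dseg s)
  have hseg : ∀ s : ℝ, HasDerivAt (fun τ : ℝ => segPt q s (x + τ • v)) (dseg s) 0 := fun s =>
    (hline.const_smul (1 - s)).add ((hν.const_mul s).smul_const q)
  have hdir : HasDerivAt (fun τ : ℝ => segDir q (x + τ • v)) (ν • q - v) 0 :=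
    (hν.smul_const q).sub hline
  have hdseg : ∀ s : ℝ, HasDerivAt dseg (ν • q - v) s := by
    intro s
    have h := (((hasDerivAt_id s).const_sub 1).smul_const v).add
      (((hasDerivAt_id s).mul_const ν).smul_const q)
    refine h.congr_deriv ?_
    simp
    abel
  have hseg0 : ∀ s : unitInterval, segPt q s x ≠ 0 := fun s => hax.segPt_ne_zero hκ hκ1 hx s.2
  let dcv : unitInterval → Cn n := fun s => Real.exp (y s) • (u s • (pathRhs om q s (x, y s) •
    segPt q s x + segDir q x) + (B s • segPt q s x + pathRhs om q s (x, y s) • dseg s + (ν • q - v)))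
  have hcvd : ∀ s : unitInterval, HasDerivAt cv (dcv s) s := by
    intro s
    have h := ((hYd s).exp).smul (((hUd s).smul (hasDerivAt_segPt q s x)).add (hdseg s))
    refine h.congr_deriv ?_
    simp only [dcv, hYy, hUu, Pi.smul_apply', Pi.add_apply]
    module
  let c : ℝ → Cn n := fun s => pathPt q s (x, Y s)
  have hcd : ∀ s : unitInterval, HasDerivAt c (pathVel om q s (x, y s)) s := fun s =>
    hasDerivAt_pathPt (hYd s) (hYy s)
  have hcy : ∀ s : unitInterval, c s = pathPt q s (x, y s) := fun s => by simp only [c, hYy]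
  have hc0 : ∀ s : unitInterval, c s ≠ 0 := fun s => by
    rw [hcy]
    exact hax.pathPt_ne_zero (p := (x, y s)) hκ hκ1 hx s.2
  have hω : ∀ s : unitInterval, HasFDerivAt om (fderiv ℝ om (c s)) (c s) := fun s =>
    (hb.diff _ (hc0 s)).hasFDerivAt
  -- the variation of the tangency condition
  have hvar : ∀ s : unitInterval, fderiv ℝ om (c s) (cv s) (pathVel om q s (x, y s)) +
      om (c s) (dcv s) = 0 := by
    intro s
    have hyu : HasDerivAt (fun τ : ℝ => y s + τ * u s) (u s) 0 := by
      simpa using ((hasDerivAt_id (0 : ℝ)).mul_const (u s)).const_add (y s)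
    have h0 : y s + 0 * u s = y s := by simp
    have hexp : HasDerivAt (fun τ : ℝ => Real.exp (y s + τ * u s)) (Real.exp (y s) * u s) 0 := by
      have := hyu.exp
      rwa [h0] at this
    have hZ : HasDerivAt (fun τ : ℝ => pathPt q s (x + τ • v, y s + τ * u s)) (cv s) 0 := by
      have h1 := hexp.smul (hseg s)
      refine h1.congr_deriv ?_
      simp only [cv, hYy, hUu, h0, hline0]
      module
    have hW : HasDerivAt (fun τ : ℝ => pathVel om q s (x + τ • v, y s + τ * u s)) (dcv s) 0 := by
      have h1 := hexp.smul (((hB s).smul (hseg s)).add hdir)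
      refine h1.congr_deriv ?_
      simp only [dcv, h0, hline0, Pi.smul_apply', Pi.add_apply]
      module
    have hZ0 : pathPt q s (x + (0 : ℝ) • v, y s + 0 * u s) = c s := by rw [h0, hline0, hcy]
    have hωZ : HasDerivAt (fun τ : ℝ => om (pathPt q s (x + τ • v, y s + τ * u s)))
        (fderiv ℝ om (c s) (cv s)) 0 := by
      have h1 : HasFDerivAt om (fderiv ℝ om (c s)) (pathPt q s (x + (0 : ℝ) • v, y s + 0 * u s)) := by
        rw [hZ0]
        exact hω s
      exact h1.comp_hasDerivAt (0 : ℝ) hZ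
    have h1 := hωZ.clm_apply hW
    rw [hZ0, h0, hline0] at h1
    refine h1.unique ((hasDerivAt_const (0 : ℝ) (0 : ℝ)).congr_of_eventuallyEq ?_)
    have hnear : ∀ᶠ τ : ℝ in 𝓝 0, x + τ • v ∈ axisCone ℓ κ :=
      hline.continuousAt.eventually (by simpa using (isOpen_axisCone ℓ κ).mem_nhds hx)
    filter_upwards [hnear] with τ hτ
    exact om_pathVel (hb.apply_segPt_pos (p := (x + τ • v, y s + τ * u s))
      (hax.segPt_ne_zero hκ hκ1 hτ s.2)).ne'
  -- the linear equation satisfied by `om (c) (cv)`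
  let f : ℝ → ℝ := fun s => om (c s) (cv s)
  let f' : unitInterval → ℝ := fun s => fderiv ℝ om (c s) (pathVel om q s (x, y s)) (cv s) -
    fderiv ℝ om (c s) (cv s) (pathVel om q s (x, y s))
  have hfd : ∀ s : unitInterval, HasDerivAt f (f' s) s := by
    intro s
    have h1 := ((hω s).comp_hasDerivAt (s : ℝ) (hcd s)).clm_apply (hcvd s)
    refine h1.congr_deriv ?_
    have h2 := hvar s
    simp only [f', Function.comp_apply]
    linarith
  set r := 2 * ((3 + κ) / (1 - κ)) with hr
  have ha := hb.a_pos
  have hC := hb.C_nonneg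
  have hb0 := hb.b_nonneg
  have hk1 : 0 < 1 - κ := by linarith
  have hr0 : 0 ≤ r := by positivity
  have hbound : ∀ s : unitInterval, |f' s| ≤ 2 * C * ((b / a + 1) * r) / a * |f s| := by
    intro s
    have hcn : 0 < ‖c s‖ := norm_pos_iff.2 (hc0 s)
    have hself : a * ‖c s‖ ^ 2 ≤ om (c s) (c s) := hb.self_ge _
    have hpos : 0 < om (c s) (c s) := lt_of_lt_of_le (by positivity) hself
    set β := om (c s) (cv s) / om (c s) (c s) with hβ
    have hker : om (c s) (cv s - β • c s) = 0 := by
      rw [map_sub, (om (c s)).map_smul β (c s), smul_eq_mul, hβ, div_mul_cancel₀ _ hpos.ne', sub_self]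
    have hvel : om (c s) (pathVel om q s (x, y s)) = 0 := by
      rw [hcy]
      exact om_pathVel (hb.apply_segPt_pos (p := (x, y s)) (hseg0 s)).ne'
    have h1 : fderiv ℝ om (c s) (pathVel om q s (x, y s)) (cv s - β • c s) =
        fderiv ℝ om (c s) (cv s - β • c s) (pathVel om q s (x, y s)) := by
      have := hfrob s
      rw [← hcy] at this
      exact this _ _ hvel hker
    have h2 : f' s = β * (fderiv ℝ om (c s) (pathVel om q s (x, y s)) (c s) -
        fderiv ℝ om (c s) (c s) (pathVel om q s (x, y s))) := by
      have key : ∀ (L : Cn n →L[ℝ] Cn n →L[ℝ] ℝ) (p w z : Cn n) (β : ℝ),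
          L p (w - β • z) = L (w - β • z) p → L p w - L w p = β * (L p z - L z p) := by
        intro L p w z β h
        simp only [map_sub, map_smul, sub_apply, smul_apply, smul_eq_mul] at h
        linarith
      exact key _ _ _ _ _ h1
    have hD : ∀ v w, |fderiv ℝ om (c s) v w| ≤ C * ‖v‖ * ‖w‖ := fun v w =>
      (fderiv ℝ om (c s) v).le_of_opNorm_le
        ((fderiv ℝ om (c s)).le_of_opNorm_le (hb.fderiv_le _ (hc0 s)) v) w
    have hvn : ‖pathVel om q s (x, y s)‖ ≤ (b / a + 1) * r * ‖c s‖ := by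
      have hsp : 0 < ‖segPt q s x‖ := norm_pos_iff.2 (hseg0 s)
      have e1 := hax.segDir_div_le hκ hκ1 hx s.2
      have e2 := hb.abs_pathRhs_le (p := (x, y s)) (hseg0 s)
      have e3 : ‖segDir q x‖ ≤ r * ‖segPt q s x‖ := (div_le_iff₀ hsp).1 e1
      have e4 : |pathRhs om q s (x, y s)| ≤ b / a * r :=
        e2.trans (mul_le_mul_of_nonneg_left e1 (by positivity))
      rw [hcy, pathVel, pathPt, norm_smul, norm_smul]
      have e5 : ‖pathRhs om q s (x, y s) • segPt q s x + segDir q x‖ ≤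
          (b / a + 1) * r * ‖segPt q s x‖ := by
        refine (norm_add_le _ _).trans ?_
        rw [norm_smul, Real.norm_eq_abs]
        have := mul_le_mul_of_nonneg_right e4 hsp.le
        linarith
      calc _ ≤ ‖Real.exp (y s)‖ * ((b / a + 1) * r * ‖segPt q s x‖) :=
            mul_le_mul_of_nonneg_left e5 (norm_nonneg _)
        _ = _ := by ring
    have h3 : |fderiv ℝ om (c s) (pathVel om q s (x, y s)) (c s) -
        fderiv ℝ om (c s) (c s) (pathVel om q s (x, y s))| ≤
        2 * C * ((b / a + 1) * r) * ‖c s‖ ^ 2 := by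
      refine (abs_sub _ _).trans ?_
      have e1 := hD (pathVel om q s (x, y s)) (c s)
      have e2 := hD (c s) (pathVel om q s (x, y s))
      have e3 : C * ‖pathVel om q s (x, y s)‖ * ‖c s‖ ≤ C * ((b / a + 1) * r * ‖c s‖) * ‖c s‖ := by
        gcongr
      nlinarith
    have h4 : |β| ≤ |f s| / (a * ‖c s‖ ^ 2) := by
      rw [hβ, abs_div, abs_of_pos hpos]
      exact div_le_div_of_nonneg_left (abs_nonneg _) (by positivity) hself
    rw [h2, abs_mul]
    calc _ ≤ |f s| / (a * ‖c s‖ ^ 2) * (2 * C * ((b / a + 1) * r) * ‖c s‖ ^ 2) :=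
          mul_le_mul h4 h3 (abs_nonneg _) (by positivity)
      _ = _ := by field_simp
  have hf0 : f 0 = 0 := by
    have e1 : c 0 = x := by simp only [c, pathPt_zero, hY0, Real.exp_zero, one_smul]
    have e2 : cv 0 = v := by simp [cv, hY0, U, dseg]
    simp only [f, e1, e2, hv]
  have hf1 : f 1 = 0 := by
    have h1 := norm_le_gronwallBound_of_norm_deriv_right_le (f := f)
      (f' := fun s => f' (projIcc 0 1 zero_le_one s)) (δ := 0)
      (K := 2 * C * ((b / a + 1) * r) / a) (ε := 0) (a := 0) (b := 1)
      (fun s hs => (hfd ⟨s, hs⟩).continuousAt.continuousWithinAt)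
      (fun s hs => by
        have hs' : s ∈ Icc (0 : ℝ) 1 := ⟨hs.1, hs.2.le⟩
        rw [projIcc_of_mem zero_le_one hs']
        exact (hfd ⟨s, hs'⟩).hasDerivWithinAt) (by rw [hf0, norm_zero])
      (fun s hs => by
        have hs' : s ∈ Icc (0 : ℝ) 1 := ⟨hs.1, hs.2.le⟩
        rw [projIcc_of_mem zero_le_one hs', add_zero]
        exact hbound ⟨s, hs'⟩) 1 (right_mem_Icc.2 zero_le_one)
    rw [gronwallBound_ε0_δ0] at h1
    exact norm_le_zero_iff.1 h1
  have hR := ((hu 1).exp).mul hν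
  refine hR.congr_deriv ?_
  rw [hline0, ← hy]
  have e1 : cv 1 = (Real.exp (y 1) * (u 1 * ‖x‖ + ν)) • q := by
    have h1 : Y 1 = y 1 := hYy 1
    have h2 : U 1 = u 1 := hUu 1
    simp only [cv, h1, h2, dseg, segPt]
    module
  have e2 : om (c 1) q ≠ 0 := by
    have h1 := (hb.apply_segPt_pos (p := (x, y 1)) (hseg0 1)).ne'
    have h2 : segPt q ((1 : unitInterval) : ℝ) x = ‖x‖ • q := by simp [segPt]
    have h3 : c 1 = pathPt q ((1 : unitInterval) : ℝ) (x, y 1) := hcy 1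
    rw [h3]
    dsimp only at h1
    rw [h2, map_smul] at h1
    exact right_ne_zero_of_smul h1
  have e3 : f 1 = (Real.exp (y 1) * (u 1 * ‖x‖ + ν)) * om (c 1) q := by
    simp only [f, e1, map_smul, smul_eq_mul]
  rw [hf1] at e3
  have e4 := (mul_eq_zero.1 e3.symm).resolve_right e2
  linarith

end Variation

section Curry

universe u

variable {Y : Type u} [TopologicalSpace Y] [CompactSpace Y]
  {E F : Type u} [NormedAddCommGroup E] [NormedSpace ℝ E] [NormedAddCommGroup F] [NormedSpace ℝ F]
  {k : ℕ} {O O' : Set E} {f : Y → E → F}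

/-- The restriction of a function of two variables to the diagonal. -/
noncomputable def diagCLM (Y F : Type*) [TopologicalSpace Y] [CompactSpace Y]
    [NormedAddCommGroup F] [NormedSpace ℝ F] : C(Y, C(Y, F)) →L[ℝ] C(Y, F) :=
  LinearMap.mkContinuous
    { toFun := fun φ => ⟨fun y => φ y y, by fun_prop⟩
      map_add' := by intros; ext; simp
      map_smul' := by intros; ext; simp } 1 (by
      intro φ
      rw [one_mul, ContinuousMap.norm_le _ (norm_nonneg _)]
      intro y
      exact ((φ y).norm_coe_le_norm y).trans (φ.norm_coe_le_norm y))

@[simp]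
theorem diagCLM_apply (φ : C(Y, C(Y, F))) (y : Y) : diagCLM Y F φ y = φ y y := rfl

theorem SmoothFam.curry (hf : SmoothFam k O f) :
    ∃ Φ : E → C(Y, F), ContDiffOn ℝ k Φ O ∧ ∀ x ∈ O, ∀ y, Φ x y = f y x :=
  ⟨fun x => nem f (constCLM Y E x),
    hf.smooth.comp (constCLM Y E).contDiff.contDiffOn fun _ hx _ => hx,
    fun _ hx y => nem_apply hf.cont (fun _ => hx) y⟩

theorem SmoothFam.of_curry (hO : IsOpen O) {Φ : E → C(Y, F)} (hΦ : ContDiffOn ℝ k Φ O)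
    (h : ∀ x ∈ O, ∀ y, Φ x y = f y x) : SmoothFam k O f := by
  have h1 : SmoothFam k O (fun _ : Y => Φ) := SmoothFam.const hO hΦ
  refine SmoothFam.of_lift (S := fun φ => diagCLM Y F (nem (fun _ : Y => Φ) φ))
    ((diagCLM Y F).contDiff.comp_contDiffOn h1.smooth) fun φ hφ y => ?_
  rw [diagCLM_apply, nem_apply h1.cont hφ, h _ (hφ y)]

open Classical in
theorem SmoothFam.union (hO : IsOpen O) (hO' : IsOpen O') (hf : SmoothFam k O f)
    (hf' : SmoothFam k O' f) : SmoothFam k (O ∪ O') f := by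
  obtain ⟨Φ, hΦ, h⟩ := hf.curry
  obtain ⟨Φ', hΦ', h'⟩ := hf'.curry
  have heq : ∀ x ∈ O', (if x ∈ O then Φ x else Φ' x) = Φ' x := fun x hx => by
    by_cases hxO : x ∈ O
    · rw [if_pos hxO]
      ext y
      rw [h x hxO, h' x hx]
    · rw [if_neg hxO]
  refine SmoothFam.of_curry (Φ := fun x => if x ∈ O then Φ x else Φ' x) (hO.union hO') ?_ ?_
  · rintro x (hx | hx)
    · refine ((hΦ.contDiffAt (hO.mem_nhds hx)).congr_of_eventuallyEq ?_).contDiffWithinAt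
      filter_upwards [hO.mem_nhds hx] with x' hx'
      exact if_pos hx'
    · refine ((hΦ'.contDiffAt (hO'.mem_nhds hx)).congr_of_eventuallyEq ?_).contDiffWithinAt
      filter_upwards [hO'.mem_nhds hx] with x' hx'
      exact heq x' hx'
  · rintro x (hx | hx) y
    · rw [if_pos hx, h x hx]
    · rw [heq x hx, h' x hx]

end Curry

section Axes

variable {n : ℕ} {q q' x : Cn n} {κ : ℝ}

/-- The real part of the inner product with `q`. -/
noncomputable def reInner (q : Cn n) : Cn n →L[ℝ] ℝ :=
  Complex.reCLM.comp ((innerSL ℂ q).restrictScalars ℝ)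

theorem reInner_apply (q x : Cn n) : reInner q x = (inner ℂ q x).re := rfl

theorem isAxis_reInner (hq : ‖q‖ = 1) : IsAxis q (reInner q) where
  norm_q := hq
  abs_le x := by
    rw [reInner_apply]
    exact (Complex.abs_re_le_norm _).trans ((norm_inner_le_norm q x).trans (by rw [hq, one_mul]))
  apply_q := by
    rw [reInner_apply, inner_self_eq_norm_sq_to_K, hq]
    simp

theorem reInner_single (i : Fin n) (a : ℂ) (x : Cn n) :
    reInner (EuclideanSpace.single i a) x = a.re * (x i).re + a.im * (x i).im := by
  rw [reInner_apply, EuclideanSpace.inner_single_left]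
  simp

theorem norm_segPt_ge_of_nonneg (hx : 0 ≤ reInner q x) {s : ℝ} (hs : s ∈ Icc (0 : ℝ) 1) :
    (1 - s) * ‖x‖ ≤ ‖segPt q s x‖ := by
  have h1 : 0 ≤ 1 - s := by linarith [hs.2]
  refine le_of_sq_le_sq ?_ (norm_nonneg _)
  have h2 : (inner ℂ ((1 - s) • x) ((s * ‖x‖) • q)).re = (1 - s) * (s * ‖x‖ * reInner q x) := by
    rw [reInner_apply, ← inner_conj_symm q x, RCLike.real_smul_eq_coe_smul (K := ℂ) (1 - s),
      RCLike.real_smul_eq_coe_smul (K := ℂ) (s * ‖x‖), inner_smul_left, inner_smul_right]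
    have h3 : (inner ℂ x q).re = (inner ℂ q x).re := by
      rw [← inner_conj_symm x q, Complex.conj_re]
    simp [-Complex.coe_smul, h3]
  rw [segPt, norm_add_sq (𝕜 := ℂ)]
  have h3 : 0 ≤ (1 - s) * (s * ‖x‖ * reInner q x) :=
    mul_nonneg h1 (mul_nonneg (mul_nonneg hs.1 (norm_nonneg _)) hx)
  have h4 : RCLike.re (inner ℂ ((1 - s) • x) ((s * ‖x‖) • q)) = _ := h2
  rw [h4, norm_smul, Real.norm_of_nonneg h1]
  have := sq_nonneg ‖(s * ‖x‖) • q‖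
  linarith

theorem segPt_mem_axisCone (hκ : 0 < κ) (hq : ‖q‖ = 1) (hqq : reInner q' q = 0)
    (hx : x ∈ axisCone (reInner q') κ) (hxq : 0 ≤ reInner q x) {s : ℝ} (hs : s ∈ Icc (0 : ℝ) 1) :
    segPt q s x ∈ axisCone (reInner q') κ := by
  have h1 := norm_segPt_ge_of_nonneg hxq hs
  have hx0 : 0 < ‖x‖ := norm_pos_iff.2 (ne_zero_of_mem_axisCone hx)
  have hx' : -(κ * ‖x‖) < reInner q' x := hx
  change -(κ * ‖segPt q s x‖) < reInner q' (segPt q s x)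
  have h2 : reInner q' (segPt q s x) = (1 - s) * reInner q' x := by
    rw [segPt, map_add, map_smul, map_smul, hqq, smul_eq_mul, smul_zero, add_zero]
  rw [h2]
  rcases hs.2.eq_or_lt with rfl | hs1
  · have : segPt q 1 x = ‖x‖ • q := by simp [segPt]
    rw [this, norm_smul, hq, norm_norm, mul_one, sub_self, zero_mul]
    exact neg_neg_of_pos (mul_pos hκ hx0)
  · have h3 : κ * ((1 - s) * ‖x‖) ≤ κ * ‖segPt q s x‖ := by gcongr
    have h4 : (1 - s) * -(κ * ‖x‖) < (1 - s) * reInner q' x :=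
      mul_lt_mul_of_pos_left hx' (by linarith)
    linarith

theorem smul_mem_axisCone_of_orthogonal (hκ : 0 < κ) (hq : ‖q‖ = 1) (hqq : reInner q' q = 0)
    {r : ℝ} (hr : 0 < r) : r • q ∈ axisCone (reInner q') κ := by
  change -(κ * ‖r • q‖) < reInner q' (r • q)
  rw [map_smul, hqq, smul_zero, norm_smul, hq, Real.norm_of_nonneg hr.le, mul_one]
  exact neg_neg_of_pos (mul_pos hκ hr)

end Axes

section Composition

variable {n : ℕ} {q q' x : Cn n} {ℓ ℓ' : Cn n →L[ℝ] ℝ} {om : Cn n → Cn n →L[ℝ] ℝ}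
  {a b C κ ρ : ℝ} {k : ℕ}

/-- The Frobenius condition for the kernel of `om` in a punctured ball. -/
def IsIntegrableOn (om : Cn n → Cn n →L[ℝ] ℝ) (ρ : ℝ) : Prop :=
  ∀ z : Cn n, z ≠ 0 → ‖z‖ < ρ → ∀ v w, om z v = 0 → om z w = 0 →
    fderiv ℝ om z v w = fderiv ℝ om z w v

/-- A bound for the logarithm of the dilation along transport curves. -/
noncomputable def transportBound (a b κ : ℝ) : ℝ := b / a * (2 * ((3 + κ) / (1 - κ)))

theorem transportEnd_eq_radius (om : Cn n → Cn n →L[ℝ] ℝ) (q x : Cn n) :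
    transportEnd om q x = transportRadius om q x • q := transportEnd_eq om q x

theorem transportRadius_pos (hx : x ≠ 0) : 0 < transportRadius om q x :=
  mul_pos (Real.exp_pos _) (norm_pos_iff.2 hx)

theorem differentiableAt_transportRadius (hk : 1 ≤ k) (hom : ContDiffOn ℝ k om {0}ᶜ)
    (hb : FormBounds om a b C) (hax : IsAxis q ℓ) (hκ : 0 < κ) (hκ1 : κ < 1)
    (hx : x ∈ axisCone ℓ κ) : DifferentiableAt ℝ (transportRadius om q) x := by
  have hk' : (k : WithTop ℕ∞) ≠ 0 := by exact_mod_cast (by omega : k ≠ 0)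
  have h1 := (((contDiffOn_transport (by omega) hom hb hax hκ hκ1).1.contDiffAt
    ((isOpen_axisCone ℓ κ).mem_nhds hx)).differentiableAt hk')
  have h2 : DifferentiableAt ℝ (fun x => transport om q x 1) x :=
    ((ContinuousMap.evalCLM ℝ (1 : unitInterval) : C(unitInterval, ℝ) →L[ℝ] ℝ).differentiableAt).comp
      x h1
  exact h2.exp.mul ((ContDiffAt.norm ℂ (n := 1) contDiffAt_id
    (ne_zero_of_mem_axisCone hx)).differentiableAt (by simp))

theorem norm_transport_pathPt_le (hb : FormBounds om a b C) (hax : IsAxis q ℓ) (hκ : 0 < κ)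
    (hκ1 : κ < 1) (hx : x ∈ axisCone ℓ κ) {y : C(unitInterval, ℝ)} (h : IsTransport om q x y)
    (s : unitInterval) : ‖pathPt q s (x, y s)‖ ≤ Real.exp (transportBound a b κ) * ‖x‖ :=
  norm_pathPt_le hax s.2 (h.abs_le hb hax hκ hκ1 hx s)

theorem fderiv_transportRadius_apply (hk : 1 ≤ k) (hom : ContDiffOn ℝ k om {0}ᶜ)
    (hb : FormBounds om a b C) (hax : IsAxis q ℓ) (hκ : 0 < κ) (hκ1 : κ < 1)
    (hx : x ∈ axisCone ℓ κ) (hint : IsIntegrableOn om ρ)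
    (hρ : Real.exp (transportBound a b κ) * ‖x‖ < ρ) {v : Cn n} (hv : om x v = 0) :
    fderiv ℝ (transportRadius om q) x v = 0 := by
  have hT := (contDiffOn_transport (by omega) hom hb hax hκ hκ1).2 x hx
  have h1 := fderiv_transportRadius_eq_zero hk hom hb hax hκ hκ1 hx (fun s =>
    hint _ (hax.pathPt_ne_zero (p := (x, transport om q x s)) hκ hκ1 hx s.2)
      ((norm_transport_pathPt_le hb hax hκ hκ1 hx hT s).trans_lt hρ)) hv
  have hline : HasDerivAt (fun τ : ℝ => x + τ • v) v 0 := by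
    simpa using ((hasDerivAt_id (0 : ℝ)).smul_const v).const_add x
  have h2 : HasFDerivAt (transportRadius om q) (fderiv ℝ (transportRadius om q) x)
      (x + (0 : ℝ) • v) := by
    rw [zero_smul, add_zero]
    exact (differentiableAt_transportRadius hk hom hb hax hκ hκ1 hx).hasFDerivAt
  have h3 := HasFDerivAt.comp_hasDerivAt (0 : ℝ) (f := fun τ : ℝ => x + τ • v)
    (l := transportRadius om q) h2 hline
  exact h3.unique h1

theorem transportEnd_transportEnd (hk : 1 ≤ k) (hom : ContDiffOn ℝ k om {0}ᶜ)
    (hb : FormBounds om a b C) (hax : IsAxis q ℓ) (hax' : IsAxis q' ℓ') (hκ : 0 < κ) (hκ1 : κ < 1)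
    (hx : x ∈ axisCone ℓ κ) (hcone : ∀ s ∈ Icc (0 : ℝ) 1, segPt q s x ∈ axisCone ℓ' κ)
    (hint : IsIntegrableOn om ρ)
    (hρ : Real.exp (transportBound a b κ) * (Real.exp (transportBound a b κ) * ‖x‖) < ρ) :
    transportEnd om q' (transportEnd om q x) = transportEnd om q' x := by
  have hT := (contDiffOn_transport (by omega) hom hb hax hκ hκ1).2 x hx
  obtain ⟨c, hc, hc0, hc'⟩ := hT.exists_curve hb hax hκ hκ1 hx
  set y := transport om q x with hy
  have hmem : ∀ s : unitInterval, c s ∈ axisCone ℓ' κ := fun s => by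
    rw [(hc' s).1]
    exact smul_mem_axisCone (hcone s s.2) (Real.exp_pos _)
  have hd : ∀ s : unitInterval, HasDerivAt (fun s => transportRadius om q' (c s)) 0 s := by
    intro s
    have h1 := (differentiableAt_transportRadius hk hom hb hax' hκ hκ1 (hmem s)).hasFDerivAt
    have h2 := h1.comp_hasDerivAt (s : ℝ) (hc' s).2
    refine h2.congr_deriv ?_
    refine fderiv_transportRadius_apply hk hom hb hax' hκ hκ1 (hmem s) hint ?_ ?_
    · refine lt_of_le_of_lt ?_ hρ
      rw [(hc' s).1]
      gcongr
      exact norm_transport_pathPt_le hb hax hκ hκ1 hx hT s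
    · rw [(hc' s).1]
      exact om_pathVel (hb.apply_segPt_pos (p := (x, y s)) (hax.segPt_ne_zero hκ hκ1 hx s.2)).ne'
  have h1 := constant_of_has_deriv_right_zero (f := fun s => transportRadius om q' (c s)) (a := 0)
    (b := 1) (fun s hs => (hd ⟨s, hs⟩).continuousAt.continuousWithinAt)
    (fun s hs => (hd ⟨s, hs.1, hs.2.le⟩).hasDerivWithinAt) 1 (right_mem_Icc.2 zero_le_one)
  have h2 : c 1 = transportEnd om q x := (hc' 1).1
  simp only [h2, hc0] at h1
  rw [transportEnd_eq_radius, h1, ← transportEnd_eq_radius]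

end Composition

section Rays

variable {n : ℕ}

theorem strictMonoOn_ray {Φ : Cn n → ℝ} {z : Cn n} {I : Set ℝ} (hI : Convex ℝ I)
    (hpos : I ⊆ Ici 0) (hc : ContinuousOn (fun s : ℝ => Φ (s • z)) I)
    (hd : ∀ s ∈ interior I, DifferentiableAt ℝ Φ (s • z) ∧ 0 < fderiv ℝ Φ (s • z) (s • z)) :
    StrictMonoOn (fun s : ℝ => Φ (s • z)) I := by
  refine strictMonoOn_of_deriv_pos hI hc fun s hs => ?_
  obtain ⟨h1, h2⟩ := hd s hs
  have hline : HasDerivAt (fun s : ℝ => s • z) z s := by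
    simpa using (hasDerivAt_id s).smul_const z
  have h3 := HasFDerivAt.comp_hasDerivAt s (f := fun s : ℝ => s • z) (l := Φ) h1.hasFDerivAt hline
  rw [show (fun s : ℝ => Φ (s • z)) = Φ ∘ fun s : ℝ => s • z from rfl, h3.deriv]
  rw [map_smul, smul_eq_mul] at h2
  exact (pos_iff_pos_of_mul_pos h2).1 (lt_of_le_of_ne (hpos (interior_subset hs)) fun h => by
    rw [← h, zero_mul] at h2
    exact lt_irrefl _ h2)

theorem TangentiallyJoined.symm {D : Cn n → Submodule ℝ (Cn n)} {W : Set (Cn n)} {x y : Cn n}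
    (h : TangentiallyJoined D W x y) : TangentiallyJoined D W y x := by
  obtain ⟨γ, hγ, h0, h1, ht⟩ := h
  have hmaps : MapsTo (fun t : ℝ => 1 - t) (Icc 0 1) (Icc 0 1) := fun t ht =>
    ⟨by linarith [ht.2], by linarith [ht.1]⟩
  refine ⟨fun t => γ (1 - t), hγ.comp (by fun_prop) hmaps, by simpa using h1, by simpa using h0,
    fun t hti => ?_⟩
  obtain ⟨h2, h3⟩ := ht (1 - t) (hmaps hti)
  refine ⟨h2, ?_⟩
  have h4 := ((hγ.differentiableOn (by simp)) (1 - t) (hmaps hti)).hasDerivWithinAt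
  have h5 : HasDerivWithinAt (fun t : ℝ => 1 - t) (-1) (Icc 0 1) t :=
    ((hasDerivAt_id t).const_sub 1).hasDerivWithinAt
  have h6 := h4.scomp t h5 hmaps
  have h7 : HasDerivWithinAt (fun t => γ (1 - t)) _ (Icc 0 1) t := h6
  rw [h7.derivWithin (uniqueDiffOn_Icc_zero_one t hti)]
  exact Submodule.smul_mem _ _ h3

theorem tangentiallyJoined_of_curve {D : Cn n → Submodule ℝ (Cn n)} {W : Set (Cn n)}
    {c c' : ℝ → Cn n} (hc : ContDiff ℝ 1 c)
    (h : ∀ s ∈ Icc (0 : ℝ) 1, c s ∈ W ∧ HasDerivAt c (c' s) s ∧ c' s ∈ D (c s)) :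
    TangentiallyJoined D W (c 0) (c 1) := by
  refine ⟨c, hc.contDiffOn, rfl, rfl, fun t ht => ⟨(h t ht).1, ?_⟩⟩
  rw [(h t ht).2.1.hasDerivWithinAt.derivWithin (uniqueDiffOn_Icc_zero_one t ht)]
  exact (h t ht).2.2

end Rays

section LeafFunction

variable {n : ℕ} {lam : Fin n → ℝ} {μ : ℝ} {m : ℕ} {P E : Cn n → ℝ} {q₁ q₂ q₃ x : Cn n} {t ρ : ℝ}

/-- Three unit vectors, orthogonal over `ℝ`. -/
structure IsFrame (q₁ q₂ q₃ : Cn n) : Prop where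
  norm₁ : ‖q₁‖ = 1
  norm₂ : ‖q₂‖ = 1
  norm₃ : ‖q₃‖ = 1
  orth₁₂ : reInner q₁ q₂ = 0
  orth₁₃ : reInner q₁ q₃ = 0
  orth₂₃ : reInner q₂ q₃ = 0
  sq_le : ∀ x, reInner q₁ x ^ 2 + reInner q₂ x ^ 2 ≤ ‖x‖ ^ 2

theorem isFrame_single {i j : Fin n} (h : i ≠ j) : IsFrame (EuclideanSpace.single i (1 : ℂ))
    (EuclideanSpace.single i Complex.I) (EuclideanSpace.single j (1 : ℂ)) where
  norm₁ := by simp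
  norm₂ := by simp
  norm₃ := by simp
  orth₁₂ := by simp [reInner_single]
  orth₁₃ := by simp [reInner_single, h]
  orth₂₃ := by simp [reInner_single, h]
  sq_le x := by
    have h1 := PiLp.norm_apply_le x i
    have h2 : ‖x i‖ ^ 2 ≤ ‖x‖ ^ 2 := by gcongr
    rw [Complex.sq_norm, Complex.normSq_apply] at h2
    simp only [reInner_single, Complex.one_re, Complex.one_im, Complex.I_re, Complex.I_im]
    linarith

namespace IsFrame

theorem neg₃ (hq : IsFrame q₁ q₂ q₃) : IsFrame q₁ q₂ (-q₃) :=
  { hq with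
    norm₃ := by rw [norm_neg, hq.norm₃]
    orth₁₃ := by rw [map_neg, hq.orth₁₃, neg_zero]
    orth₂₃ := by rw [map_neg, hq.orth₂₃, neg_zero] }

theorem mem_or_mem (hq : IsFrame q₁ q₂ q₃) (hx : x ≠ 0) :
    x ∈ axisCone (reInner q₁) (3 / 4) ∨ x ∈ axisCone (reInner q₂) (3 / 4) := by
  by_contra! h
  have h1 : reInner q₁ x ≤ -(3 / 4 * ‖x‖) := not_lt.1 h.1
  have h2 : reInner q₂ x ≤ -(3 / 4 * ‖x‖) := not_lt.1 h.2
  have h3 : 0 < ‖x‖ := norm_pos_iff.2 hx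
  have := hq.sq_le x
  nlinarith

end IsFrame

/-- The bound for the dilation along the transport curves of `scaledOmega`. -/
noncomputable def leafConst (μ : ℝ) : ℝ := Real.exp (transportBound (μ / 2) 6 (3 / 4))

theorem leafConst_pos (μ : ℝ) : 0 < leafConst μ := Real.exp_pos _

theorem one_le_leafConst (hμ : 0 < μ) : 1 ≤ leafConst μ := by
  refine Real.one_le_exp ?_
  rw [transportBound]
  positivity

/-- The difference of `scaledG` between a point and the point of the first axis in the same leaf,
divided by `tᵐ`. -/
noncomputable def leafRem (lam : Fin n → ℝ) (m : ℕ) (P E : Cn n → ℝ) (q₁ q₂ : Cn n) (t : ℝ)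
    (x : Cn n) : ℝ :=
  open Classical in
  if x ∈ axisCone (reInner q₁) (3 / 4) then -deficit lam m P E q₁ t x
  else -(deficit lam m P E q₁ t (transportEnd (scaledOmega lam m P E t) q₂ x) +
    deficit lam m P E q₂ t x)

/-- The first integral of the foliation. -/
noncomputable def leafFun (lam : Fin n → ℝ) (m : ℕ) (P E : Cn n → ℝ) (q₁ q₂ : Cn n)
    (x : Cn n) : ℝ :=
  quadModel lam x + P x + leafRem lam m P E q₁ q₂ 1 x

theorem quadModel_smul (t : ℝ) (x : Cn n) : quadModel lam (t • x) = t ^ 2 * quadModel lam x := by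
  rw [quadModel_eq, quadModel_eq, (quadBilin lam).map_smul, smul_apply,
    (quadBilin lam x).map_smul, smul_eq_mul, smul_eq_mul]
  ring

theorem scaledG_smul (ht : t ≠ 0) (x : Cn n) :
    scaledG lam P 1 (t • x) = t ^ 2 * scaledG lam P t x := by
  rw [scaledG, scaledG, dilate, dilate, quadModel_smul]
  simp
  field_simp

theorem scaledG_one (x : Cn n) : scaledG lam P 1 x = quadModel lam x + P x := by
  simp [scaledG, dilate]

namespace SmoothPert

theorem transportEnd_mem (hq : IsFrame q₁ q₂ q₃) (hx : x ≠ 0) :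
    transportEnd (scaledOmega lam m P E t) q₂ x ∈ axisCone (reInner q₁) (3 / 4) := by
  rw [transportEnd_eq_radius]
  exact smul_mem_axisCone_of_orthogonal (by norm_num) hq.norm₂ hq.orth₁₂ (transportRadius_pos hx)

theorem transport_comm_aux (h : SmoothPert lam μ m P E) (hq : IsFrame q₁ q₂ q₃)
    (hint : IsIntegrableOn (scaledOmega lam m P E 1) ρ)
    (hx₁ : x ∈ axisCone (reInner q₁) (3 / 4)) (hx₂ : x ∈ axisCone (reInner q₂) (3 / 4))
    (hx₃ : 0 ≤ reInner q₃ x) (hρ : leafConst μ ^ 3 * ‖x‖ < ρ) :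
    transportEnd (scaledOmega lam m P E 1) q₁ (transportEnd (scaledOmega lam m P E 1) q₂ x) =
      transportEnd (scaledOmega lam m P E 1) q₁ x := by
  obtain ⟨C, hC⟩ := h.exists_formBounds
  have hb := hC 1 zero_le_one
  have hom := h.contDiffOn_scaledOmega (zero_le_one (α := ℝ))
  have a1 := isAxis_reInner hq.norm₁
  have a2 := isAxis_reInner hq.norm₂
  have a3 := isAxis_reInner hq.norm₃
  have hκ : (0 : ℝ) < 3 / 4 := by norm_num
  have hκ1 : (3 / 4 : ℝ) < 1 := by norm_num
  have hL := one_le_leafConst h.mu_pos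
  have hL0 := leafConst_pos μ
  have hx0 := ne_zero_of_mem_axisCone hx₁
  have hx3 : x ∈ axisCone (reInner q₃) (3 / 4) := by
    have : 0 < ‖x‖ := norm_pos_iff.2 hx0
    exact lt_of_lt_of_le (neg_neg_of_pos (mul_pos hκ this)) hx₃
  set om := scaledOmega lam m P E 1 with hom'
  have hle : leafConst μ * (leafConst μ * ‖x‖) < ρ := by
    refine lt_of_le_of_lt ?_ hρ
    calc _ = leafConst μ ^ 2 * ‖x‖ * 1 := by ring
      _ ≤ leafConst μ ^ 2 * ‖x‖ * leafConst μ := by gcongr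
      _ = _ := by ring
  have e1 := transportEnd_transportEnd h.m_pos hom hb a3 a1 hκ hκ1 hx3
    (fun s hs => segPt_mem_axisCone hκ hq.norm₃ hq.orth₁₃ hx₁ hx₃ hs) hint hle
  have e2 := transportEnd_transportEnd h.m_pos hom hb a3 a2 hκ hκ1 hx3
    (fun s hs => segPt_mem_axisCone hκ hq.norm₃ hq.orth₂₃ hx₂ hx₃ hs) hint hle
  have hT := h.isTransport a3 hκ hκ1 zero_le_one hx3
  have hy : ‖transportEnd om q₃ x‖ ≤ leafConst μ * ‖x‖ :=
    norm_transport_pathPt_le hb a3 hκ hκ1 hx3 hT 1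
  have hyq : transportEnd om q₃ x = transportRadius om q₃ x • q₃ := transportEnd_eq_radius _ _ _
  have hr := transportRadius_pos (om := om) (q := q₃) hx0
  have hy1 : transportEnd om q₃ x ∈ axisCone (reInner q₁) (3 / 4) := by
    rw [hyq]
    exact smul_mem_axisCone_of_orthogonal hκ hq.norm₃ hq.orth₁₃ hr
  have hy2 : transportEnd om q₃ x ∈ axisCone (reInner q₂) (3 / 4) := by
    rw [hyq]
    exact smul_mem_axisCone_of_orthogonal hκ hq.norm₃ hq.orth₂₃ hr
  have hy0 : 0 ≤ reInner q₂ (transportEnd om q₃ x) := by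
    rw [hyq, map_smul, hq.orth₂₃, smul_zero]
  have e3 := transportEnd_transportEnd h.m_pos hom hb a2 a1 hκ hκ1 hy2
    (fun s hs => segPt_mem_axisCone hκ hq.norm₂ hq.orth₁₂ hy1 hy0 hs) hint (by
      refine lt_of_le_of_lt ?_ hρ
      calc leafConst μ * (leafConst μ * ‖transportEnd om q₃ x‖) ≤
          leafConst μ * (leafConst μ * (leafConst μ * ‖x‖)) := by gcongr
        _ = _ := by ring)
  rw [e1, e2] at e3
  exact e3

/-- The two ways of transporting a point to the first axis agree. -/
theorem transportEnd_comm (h : SmoothPert lam μ m P E) (hq : IsFrame q₁ q₂ q₃)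
    (hint : IsIntegrableOn (scaledOmega lam m P E 1) ρ) (ht : 0 < t)
    (hx₁ : x ∈ axisCone (reInner q₁) (3 / 4)) (hx₂ : x ∈ axisCone (reInner q₂) (3 / 4))
    (hρ : leafConst μ ^ 3 * (t * ‖x‖) < ρ) :
    transportEnd (scaledOmega lam m P E t) q₁ (transportEnd (scaledOmega lam m P E t) q₂ x) =
      transportEnd (scaledOmega lam m P E t) q₁ x := by
  have hρ' : leafConst μ ^ 3 * ‖t • x‖ < ρ := by rwa [norm_smul, Real.norm_of_nonneg ht.le]
  have h1 : transportEnd (scaledOmega lam m P E 1) q₁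
      (transportEnd (scaledOmega lam m P E 1) q₂ (t • x)) =
      transportEnd (scaledOmega lam m P E 1) q₁ (t • x) := by
    rcases le_total 0 (reInner q₃ (t • x)) with h3 | h3
    · exact h.transport_comm_aux hq hint (smul_mem_axisCone hx₁ ht) (smul_mem_axisCone hx₂ ht) h3 hρ'
    · refine h.transport_comm_aux hq.neg₃ hint (smul_mem_axisCone hx₁ ht)
        (smul_mem_axisCone hx₂ ht) ?_ hρ'
      have : reInner (-q₃) (t • x) = -reInner q₃ (t • x) := by
        rw [reInner_apply, reInner_apply, inner_neg_left, Complex.neg_re]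
      linarith
  rw [h.transportEnd_smul ht, h.transportEnd_smul ht, h.transportEnd_smul ht] at h1
  exact smul_right_injective _ ht.ne' h1

theorem leafRem_zero (h : SmoothPert lam μ m P E) (x : Cn n) :
    leafRem lam m P E q₁ q₂ 0 x = 0 := by
  rw [leafRem]
  simp [h.deficit_zero]

theorem scaledG_add_leafRem₁ (h : SmoothPert lam μ m P E) (hq : IsFrame q₁ q₂ q₃) (ht : 0 ≤ t)
    (hx₁ : x ∈ axisCone (reInner q₁) (3 / 4)) :
    scaledG lam P t x + t ^ m * leafRem lam m P E q₁ q₂ t x =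
      scaledG lam P t (transportEnd (scaledOmega lam m P E t) q₁ x) := by
  rw [leafRem, if_pos hx₁, h.scaledG_transportEnd (isAxis_reInner hq.norm₁) (by norm_num)
    (by norm_num) ht hx₁]
  ring

theorem leafRem_eq₂ (h : SmoothPert lam μ m P E) (hq : IsFrame q₁ q₂ q₃)
    (hint : IsIntegrableOn (scaledOmega lam m P E 1) ρ) (ht : 0 ≤ t)
    (hx₂ : x ∈ axisCone (reInner q₂) (3 / 4)) (hρ : leafConst μ ^ 3 * (t * ‖x‖) < ρ) :
    leafRem lam m P E q₁ q₂ t x =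
      -(deficit lam m P E q₁ t (transportEnd (scaledOmega lam m P E t) q₂ x) +
        deficit lam m P E q₂ t x) := by
  rcases ht.eq_or_lt with rfl | ht0
  · simp [h.leafRem_zero, h.deficit_zero]
  by_cases hx₁ : x ∈ axisCone (reInner q₁) (3 / 4)
  · have h0 := h.scaledG_add_leafRem₁ hq ht hx₁
    have h1 := h.scaledG_transportEnd (isAxis_reInner hq.norm₂) (by norm_num) (by norm_num) ht hx₂
    have h2 := h.scaledG_transportEnd (isAxis_reInner hq.norm₁) (by norm_num) (by norm_num) ht
      (transportEnd_mem (lam := lam) (m := m) (P := P) (E := E) (t := t) hq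
        (ne_zero_of_mem_axisCone hx₂))
    rw [h.transportEnd_comm hq hint ht0 hx₁ hx₂ hρ] at h2
    have h3 : t ^ m * leafRem lam m P E q₁ q₂ t x = t ^ m *
        -(deficit lam m P E q₁ t (transportEnd (scaledOmega lam m P E t) q₂ x) +
          deficit lam m P E q₂ t x) := by linarith
    exact mul_left_cancel₀ (pow_ne_zero m ht0.ne') h3
  · rw [leafRem, if_neg hx₁]

theorem scaledG_add_leafRem₂ (h : SmoothPert lam μ m P E) (hq : IsFrame q₁ q₂ q₃)
    (hint : IsIntegrableOn (scaledOmega lam m P E 1) ρ) (ht : 0 ≤ t)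
    (hx₂ : x ∈ axisCone (reInner q₂) (3 / 4)) (hρ : leafConst μ ^ 3 * (t * ‖x‖) < ρ) :
    scaledG lam P t x + t ^ m * leafRem lam m P E q₁ q₂ t x =
      scaledG lam P t (transportEnd (scaledOmega lam m P E t) q₁
        (transportEnd (scaledOmega lam m P E t) q₂ x)) := by
  rw [h.leafRem_eq₂ hq hint ht hx₂ hρ,
    h.scaledG_transportEnd (isAxis_reInner hq.norm₁) (by norm_num) (by norm_num) ht
      (transportEnd_mem hq (ne_zero_of_mem_axisCone hx₂)),
    h.scaledG_transportEnd (isAxis_reInner hq.norm₂) (by norm_num) (by norm_num) ht hx₂]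
  ring

theorem leafRem_smul (h : SmoothPert lam μ m P E) (hq : IsFrame q₁ q₂ q₃)
    (hint : IsIntegrableOn (scaledOmega lam m P E 1) ρ) (ht : 0 < t) (hx : x ≠ 0)
    (hρ : leafConst μ ^ 3 * (t * ‖x‖) < ρ) :
    leafRem lam m P E q₁ q₂ 1 (t • x) = t ^ (m + 2) * leafRem lam m P E q₁ q₂ t x := by
  have hρ' : leafConst μ ^ 3 * (1 * ‖t • x‖) < ρ := by
    rwa [norm_smul, Real.norm_of_nonneg ht.le, one_mul]
  rcases hq.mem_or_mem hx with hx₁ | hx₂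
  · have h1 := h.scaledG_add_leafRem₁ hq ht.le hx₁
    have h2 := h.scaledG_add_leafRem₁ hq zero_le_one (smul_mem_axisCone hx₁ ht)
    rw [h.transportEnd_smul ht, scaledG_smul ht.ne', scaledG_smul ht.ne', ← h1] at h2
    rw [one_pow, one_mul] at h2
    rw [pow_add]
    linarith
  · have h1 := h.scaledG_add_leafRem₂ hq hint ht.le hx₂ hρ
    have h2 := h.scaledG_add_leafRem₂ hq hint zero_le_one (smul_mem_axisCone hx₂ ht) hρ'
    rw [h.transportEnd_smul ht, h.transportEnd_smul ht, scaledG_smul ht.ne', scaledG_smul ht.ne',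
      ← h1] at h2
    rw [one_pow, one_mul] at h2
    rw [pow_add]
    linarith

theorem smoothFam_leafRem (h : SmoothPert lam μ m P E) (hq : IsFrame q₁ q₂ q₃)
    (hint : IsIntegrableOn (scaledOmega lam m P E 1) ρ) {D : Type} [TopologicalSpace D]
    [CompactSpace D] {δ : C(D, ℝ)} (hδ : ∀ d, 0 ≤ δ d) {O : Set (Cn n)} (hO : IsOpen O)
    (hO0 : ∀ x ∈ O, x ≠ 0) (hρ : ∀ x ∈ O, ∀ d, leafConst μ ^ 3 * (δ d * ‖x‖) < ρ) :
    SmoothFam m O (fun d => leafRem lam m P E q₁ q₂ (δ d)) := by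
  have hκ : (0 : ℝ) < 3 / 4 := by norm_num
  have hκ1 : (3 / 4 : ℝ) < 1 := by norm_num
  have a1 := isAxis_reInner hq.norm₁
  have a2 := isAxis_reInner hq.norm₂
  have h1 : SmoothFam m (O ∩ axisCone (reInner q₁) (3 / 4))
      (fun d => leafRem lam m P E q₁ q₂ (δ d)) := by
    refine (((h.smoothFam_deficit a1 hκ hκ1 hδ).map_contDiff contDiff_neg).mono
      inter_subset_right).congr fun d x hx => ?_
    rw [leafRem, if_pos hx.2]
  have h2 : SmoothFam m (O ∩ axisCone (reInner q₂) (3 / 4))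
      (fun d => leafRem lam m P E q₁ q₂ (δ d)) := by
    have e1 := (h.smoothFam_deficit a1 hκ hκ1 hδ).comp (h.smoothFam_transportEnd a2 hκ hκ1 hδ)
      fun d x hx => transportEnd_mem hq (ne_zero_of_mem_axisCone hx)
    have e2 := (e1.prodMk (h.smoothFam_deficit a2 hκ hκ1 hδ)).map_contDiff
      (contDiff_fst.add contDiff_snd).neg
    refine (e2.mono inter_subset_right).congr fun d x hx => ?_
    exact h.leafRem_eq₂ hq hint (hδ d) hx.2 (hρ x hx.1 d)
  refine (h1.union (hO.inter (isOpen_axisCone _ _)) (hO.inter (isOpen_axisCone _ _)) h2).mono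
    fun x hx => ?_
  rcases hq.mem_or_mem (hO0 x hx) with h3 | h3
  exacts [Or.inl ⟨hx, h3⟩, Or.inr ⟨hx, h3⟩]

end SmoothPert

end LeafFunction

section LeafFunctionDerivative

variable {n : ℕ} {lam : Fin n → ℝ} {μ : ℝ} {m : ℕ} {P E : Cn n → ℝ} {q₁ q₂ q₃ x : Cn n} {t ρ : ℝ}

namespace SmoothPert

theorem leafFun_eq₁ (h : SmoothPert lam μ m P E) (hq : IsFrame q₁ q₂ q₃)
    (hx₁ : x ∈ axisCone (reInner q₁) (3 / 4)) :
    leafFun lam m P E q₁ q₂ x = scaledG lam P 1 (transportEnd (scaledOmega lam m P E 1) q₁ x) := by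
  have h1 := h.scaledG_add_leafRem₁ hq zero_le_one hx₁
  rw [one_pow, one_mul, scaledG_one] at h1
  exact h1

theorem leafFun_eq₂ (h : SmoothPert lam μ m P E) (hq : IsFrame q₁ q₂ q₃)
    (hint : IsIntegrableOn (scaledOmega lam m P E 1) ρ)
    (hx₂ : x ∈ axisCone (reInner q₂) (3 / 4)) (hρ : leafConst μ ^ 3 * ‖x‖ < ρ) :
    leafFun lam m P E q₁ q₂ x = scaledG lam P 1 (transportEnd (scaledOmega lam m P E 1) q₁
      (transportEnd (scaledOmega lam m P E 1) q₂ x)) := by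
  have h1 := h.scaledG_add_leafRem₂ hq hint zero_le_one hx₂ (by rwa [one_mul])
  rw [one_pow, one_mul, scaledG_one] at h1
  exact h1

theorem leafConst_le_cube (h : SmoothPert lam μ m P E) : leafConst μ ≤ leafConst μ ^ 3 :=
  le_self_pow₀ (one_le_leafConst h.mu_pos) (by norm_num)

/-- The first integral is differentiable, and its differential vanishes on the kernel of the
form. -/
theorem fderiv_leafFun_apply (h : SmoothPert lam μ m P E) (hq : IsFrame q₁ q₂ q₃)
    (hint : IsIntegrableOn (scaledOmega lam m P E 1) ρ) (hx : x ≠ 0)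
    (hρ : leafConst μ ^ 3 * ‖x‖ < ρ) :
    DifferentiableAt ℝ (leafFun lam m P E q₁ q₂) x ∧ ∀ v, scaledOmega lam m P E 1 x v = 0 →
      fderiv ℝ (leafFun lam m P E q₁ q₂) x v = 0 := by
  obtain ⟨C, hC⟩ := h.exists_formBounds
  have hb := hC 1 zero_le_one
  have hom := h.contDiffOn_scaledOmega (zero_le_one (α := ℝ))
  have a1 := isAxis_reInner hq.norm₁
  have a2 := isAxis_reInner hq.norm₂
  have hκ : (0 : ℝ) < 3 / 4 := by norm_num
  have hκ1 : (3 / 4 : ℝ) < 1 := by norm_num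
  have hL : leafConst μ * ‖x‖ < ρ :=
    (mul_le_mul_of_nonneg_right h.leafConst_le_cube (norm_nonneg x)).trans_lt hρ
  set om := scaledOmega lam m P E 1
  -- a function of the transport radius
  have key : ∀ {q : Cn n} (_ : IsAxis q (reInner q)) (_ : x ∈ axisCone (reInner q) (3 / 4))
      {g : ℝ → ℝ} (_ : DifferentiableAt ℝ g (transportRadius om q x))
      (_ : leafFun lam m P E q₁ q₂ =ᶠ[𝓝 x] fun x => g (transportRadius om q x)),
      DifferentiableAt ℝ (leafFun lam m P E q₁ q₂) x ∧ ∀ v, om x v = 0 →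
      fderiv ℝ (leafFun lam m P E q₁ q₂) x v = 0 := by
    intro q hax hxq g hg heq
    have h1 := differentiableAt_transportRadius h.m_pos hom hb hax hκ hκ1 hxq
    have h2 := HasDerivAt.comp_hasFDerivAt x hg.hasDerivAt h1.hasFDerivAt
    have h3 := h2.congr_of_eventuallyEq (f₁ := leafFun lam m P E q₁ q₂) heq
    refine ⟨h3.differentiableAt, fun v hv => ?_⟩
    rw [h3.fderiv, smul_apply,
      fderiv_transportRadius_apply h.m_pos hom hb hax hκ hκ1 hxq hint hL hv, smul_zero]
  have hG : Differentiable ℝ (scaledG lam P 1) := fun z =>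
    (h.hasFDerivAt_scaledG 1 z).differentiableAt
  have hg1 : Differentiable ℝ fun r : ℝ => scaledG lam P 1 (r • q₁) := fun r =>
    (hG _).comp r ((differentiableAt_id).smul_const q₁)
  rcases hq.mem_or_mem hx with hx₁ | hx₂
  · refine key a1 hx₁ (hg1 _) ?_
    filter_upwards [(isOpen_axisCone _ _).mem_nhds hx₁] with z hz
    rw [h.leafFun_eq₁ hq hz, transportEnd_eq_radius]
  · have hr := transportRadius_pos (om := om) (q := q₂) hx
    have hy := smul_mem_axisCone_of_orthogonal (κ := 3 / 4) (by norm_num) hq.norm₂ hq.orth₁₂ hr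
    have h1 := differentiableAt_transportRadius h.m_pos hom hb a1 hκ hκ1 hy
    have h2 : DifferentiableAt ℝ (fun r : ℝ => transportRadius om q₁ (r • q₂))
        (transportRadius om q₂ x) :=
      DifferentiableAt.comp (f := fun r : ℝ => r • q₂) (g := transportRadius om q₁) _ h1
        (differentiableAt_id.smul_const q₂)
    refine key a2 hx₂ (g := fun r => scaledG lam P 1 (transportRadius om q₁ (r • q₂) • q₁))
      (DifferentiableAt.comp (g := fun r : ℝ => scaledG lam P 1 (r • q₁))
        (f := fun r : ℝ => transportRadius om q₁ (r • q₂)) _ (hg1 _) h2) ?_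
    have hopen : IsOpen {z : Cn n | leafConst μ ^ 3 * ‖z‖ < ρ} :=
      isOpen_lt (by fun_prop) continuous_const
    filter_upwards [(isOpen_axisCone _ _).mem_nhds hx₂, hopen.mem_nhds hρ] with z hz hz'
    rw [h.leafFun_eq₂ hq hint hz hz', transportEnd_eq_radius, transportEnd_eq_radius]

theorem tangentiallyJoined_transportEnd (h : SmoothPert lam μ m P E) {q : Cn n} (hq : ‖q‖ = 1)
    {D : Cn n → Submodule ℝ (Cn n)} {W : Set (Cn n)}
    (hW : ∀ z, z ≠ 0 → ‖z‖ ≤ leafConst μ * ‖x‖ → z ∈ W)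
    (hD : ∀ z ∈ W, ∀ v, scaledOmega lam m P E 1 z v = 0 → v ∈ D z)
    (hx : x ∈ axisCone (reInner q) (3 / 4)) :
    TangentiallyJoined D W x (transportEnd (scaledOmega lam m P E 1) q x) ∧
      ‖transportEnd (scaledOmega lam m P E 1) q x‖ ≤ leafConst μ * ‖x‖ := by
  obtain ⟨C, hC⟩ := h.exists_formBounds
  have hb := hC 1 zero_le_one
  have hax := isAxis_reInner hq
  have hκ : (0 : ℝ) < 3 / 4 := by norm_num
  have hκ1 : (3 / 4 : ℝ) < 1 := by norm_num
  have hT := h.isTransport hax hκ hκ1 zero_le_one hx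
  obtain ⟨c, hc, hc0, hc'⟩ := hT.exists_curve hb hax hκ hκ1 hx
  set om := scaledOmega lam m P E 1
  set y := transport om q x with hy
  have hn : ∀ s : unitInterval, ‖c s‖ ≤ leafConst μ * ‖x‖ := fun s => by
    rw [(hc' s).1]
    exact norm_transport_pathPt_le hb hax hκ hκ1 hx hT s
  have h1 : c 1 = transportEnd om q x := (hc' 1).1
  refine ⟨?_, by rw [← h1]; exact hn 1⟩
  rw [← h1, ← hc0]
  refine tangentiallyJoined_of_curve hc (c' := fun s => pathVel om q s (x, y (projIcc 0 1
    zero_le_one s))) fun s hs => ?_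
  rw [projIcc_of_mem zero_le_one hs]
  have hcW : c s ∈ W := hW _ (by
    rw [(hc' ⟨s, hs⟩).1]
    exact hax.pathPt_ne_zero (p := (x, y ⟨s, hs⟩)) hκ hκ1 hx hs) (hn ⟨s, hs⟩)
  refine ⟨hcW, (hc' ⟨s, hs⟩).2, hD _ hcW _ ?_⟩
  rw [(hc' ⟨s, hs⟩).1]
  exact om_pathVel (hb.apply_segPt_pos (p := (x, y ⟨s, hs⟩)) (hax.segPt_ne_zero hκ hκ1 hx hs)).ne'

theorem strictMonoOn_G_ray (h : SmallPert lam μ P E) {z : Cn n} (hz : z ≠ 0) :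
    StrictMonoOn (fun s : ℝ => quadModel lam (s • z) + P (s • z)) (Ici 0) := by
  have hG := h.contDiff_G.differentiable (by simp)
  refine strictMonoOn_ray (Φ := fun x => quadModel lam x + P x) (convex_Ici 0) subset_rfl
    (hG.continuous.comp (by fun_prop)).continuousOn fun s hs => ⟨hG _, ?_⟩
  rw [interior_Ici] at hs
  refine lt_of_lt_of_le ?_ (h.fderiv_G_self_ge (s • z))
  have : 0 < ‖s • z‖ := norm_pos_iff.2 (smul_ne_zero (ne_of_gt hs) hz)
  have := h.mu_pos
  positivity

/-- The points of a level set of the first integral are joined by tangential curves. -/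
theorem reflTransGen_of_leafFun_eq (h : SmoothPert lam μ m P E) (hq : IsFrame q₁ q₂ q₃)
    (hint : IsIntegrableOn (scaledOmega lam m P E 1) ρ)
    {D : Cn n → Submodule ℝ (Cn n)} {W : Set (Cn n)} {b : ℝ} (hbρ : leafConst μ ^ 3 * b < ρ)
    (hW : ∀ z, z ≠ 0 → ‖z‖ ≤ leafConst μ ^ 2 * b → z ∈ W)
    (hD : ∀ z ∈ W, ∀ v, scaledOmega lam m P E 1 z v = 0 → v ∈ D z) {y : Cn n} (hx : x ≠ 0)
    (hy : y ≠ 0) (hxb : ‖x‖ ≤ b) (hyb : ‖y‖ ≤ b)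
    (hxy : leafFun lam m P E q₁ q₂ x = leafFun lam m P E q₁ q₂ y) :
    Relation.ReflTransGen (TangentiallyJoined D W) x y := by
  set om := scaledOmega lam m P E 1 with hom
  have hL := one_le_leafConst h.mu_pos
  have hL0 := leafConst_pos μ
  have key : ∀ x : Cn n, x ≠ 0 → ‖x‖ ≤ b → ∃ r : ℝ, 0 < r ∧
      leafFun lam m P E q₁ q₂ x = scaledG lam P 1 (r • q₁) ∧
      Relation.ReflTransGen (TangentiallyJoined D W) x (r • q₁) ∧
      Relation.ReflTransGen (TangentiallyJoined D W) (r • q₁) x := by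
    intro x hx hxb
    have hb0 : 0 ≤ b := (norm_nonneg x).trans hxb
    have h12 : leafConst μ ≤ leafConst μ ^ 2 := le_self_pow₀ hL (by norm_num)
    have hW1 : ∀ z, z ≠ 0 → ‖z‖ ≤ leafConst μ * ‖x‖ → z ∈ W := fun z hz hzx =>
      hW z hz (hzx.trans (by gcongr))
    rcases hq.mem_or_mem hx with hx₁ | hx₂
    · obtain ⟨h1, -⟩ := h.tangentiallyJoined_transportEnd hq.norm₁ hW1 hD hx₁
      refine ⟨transportRadius om q₁ x, transportRadius_pos hx, ?_, ?_, ?_⟩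
      · rw [h.leafFun_eq₁ hq hx₁, transportEnd_eq_radius]
      · rw [← transportEnd_eq_radius]
        exact .single h1
      · rw [← transportEnd_eq_radius]
        exact .single h1.symm
    · obtain ⟨h1, h1n⟩ := h.tangentiallyJoined_transportEnd hq.norm₂ hW1 hD hx₂
      have hz := transportEnd_mem (lam := lam) (m := m) (P := P) (E := E) (t := 1) hq hx
      have hW2 : ∀ z, z ≠ 0 → ‖z‖ ≤ leafConst μ * ‖transportEnd om q₂ x‖ → z ∈ W :=
        fun z hz hzx => hW z hz (hzx.trans (by
          calc _ ≤ leafConst μ * (leafConst μ * b) := by gcongr; exact h1n.trans (by gcongr)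
            _ = _ := by ring))
      obtain ⟨h2, -⟩ := h.tangentiallyJoined_transportEnd hq.norm₁ hW2 hD hz
      refine ⟨transportRadius om q₁ (transportEnd om q₂ x),
        transportRadius_pos (ne_zero_of_mem_axisCone hz), ?_, ?_, ?_⟩
      · rw [h.leafFun_eq₂ hq hint hx₂ (lt_of_le_of_lt (by gcongr) hbρ), transportEnd_eq_radius _ q₁]
      · rw [← transportEnd_eq_radius]
        exact (Relation.ReflTransGen.single h1).tail h2
      · rw [← transportEnd_eq_radius]
        exact (Relation.ReflTransGen.single h2.symm).tail h1.symm
  obtain ⟨r, hr, e1, e2, -⟩ := key x hx hxb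
  obtain ⟨r', hr', e1', -, e2'⟩ := key y hy hyb
  have hq0 : q₁ ≠ 0 := fun h0 => by simpa [h0] using hq.norm₁
  have h1 : r = r' := by
    refine (strictMonoOn_G_ray h.toSmallPert hq0).injOn hr.le hr'.le ?_
    rw [e1, e1', scaledG_one, scaledG_one] at hxy
    exact hxy
  subst h1
  exact e2.trans e2'

end SmoothPert

end LeafFunctionDerivative

section FamilyDerivatives

universe u

variable {Y : Type u} [TopologicalSpace Y] [CompactSpace Y]
  {E F : Type u} [NormedAddCommGroup E] [NormedSpace ℝ E] [NormedAddCommGroup F] [NormedSpace ℝ F]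
  {k : ℕ} {O K : Set E} {f : Y → E → F}

theorem SmoothFam.exists_bound_iteratedFDeriv (hf : SmoothFam k O f) (hO : IsOpen O)
    (hK : IsCompact K) (hKO : K ⊆ O) {j : ℕ} (hj : j ≤ k) :
    ∃ C, 0 ≤ C ∧ ∀ x ∈ K, ∀ y, ‖iteratedFDeriv ℝ j (f y) x‖ ≤ C := by
  obtain ⟨Φ, hΦ, h⟩ := hf.curry
  have hj' : (j : WithTop ℕ∞) ≤ k := by exact_mod_cast hj
  obtain ⟨C, hC⟩ := hK.exists_bound_of_continuousOn
    ((ContinuousOn.continuousOn_iteratedFDeriv hΦ hO hj').mono hKO)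
  refine ⟨max C 0, le_max_right _ _, fun x hx y => ?_⟩
  let ev : C(Y, F) →L[ℝ] F := ContinuousMap.evalCLM ℝ y
  have h1 : f y =ᶠ[𝓝 x] ev ∘ Φ := by
    filter_upwards [hO.mem_nhds (hKO hx)] with x' hx'
    exact (h x' hx' y).symm
  have hev : ‖ev‖ ≤ 1 := ContinuousLinearMap.opNorm_le_bound _ zero_le_one fun φ => by
    rw [one_mul]
    exact φ.norm_coe_le_norm y
  rw [(h1.iteratedFDeriv ℝ j).eq_of_nhds]
  refine (ev.norm_iteratedFDeriv_comp_left (hΦ.contDiffAt (hO.mem_nhds (hKO hx))) hj').trans ?_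
  calc _ ≤ 1 * ‖iteratedFDeriv ℝ j Φ x‖ := by gcongr
    _ ≤ _ := by
      rw [one_mul]
      exact (hC x hx).trans (le_max_left _ _)

theorem SmoothFam.continuousOn_iteratedFDeriv_apply (hf : SmoothFam k O f) (hO : IsOpen O)
    {j : ℕ} (hj : j ≤ k) (w : Fin j → E) :
    ContinuousOn (fun p : Y × E => iteratedFDeriv ℝ j (f p.1) p.2 w) (univ ×ˢ O) := by
  obtain ⟨Φ, hΦ, h⟩ := hf.curry
  have hj' : (j : WithTop ℕ∞) ≤ k := by exact_mod_cast hj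
  have h1 : ∀ y, ∀ x ∈ O, iteratedFDeriv ℝ j (f y) x w = iteratedFDeriv ℝ j Φ x w y := by
    intro y x hx
    let ev : C(Y, F) →L[ℝ] F := ContinuousMap.evalCLM ℝ y
    have h1 : f y =ᶠ[𝓝 x] ev ∘ Φ := by
      filter_upwards [hO.mem_nhds hx] with x' hx'
      exact (h x' hx' y).symm
    rw [(h1.iteratedFDeriv ℝ j).eq_of_nhds,
      ev.iteratedFDeriv_comp_left (hΦ.contDiffAt (hO.mem_nhds hx)) hj']
    rfl
  have h2 : ContinuousOn (fun p : Y × E => iteratedFDeriv ℝ j Φ p.2 w) (univ ×ˢ O) := by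
    have h3 := (ContinuousOn.continuousOn_iteratedFDeriv hΦ hO hj').comp
      (continuousOn_snd (s := (univ : Set Y) ×ˢ O)) fun p hp => hp.2
    exact (ContinuousMultilinearMap.apply ℝ (fun _ : Fin j => E) C(Y, F) w).continuous.comp_continuousOn
      h3
  have h3 : ContinuousOn (fun p : Y × E => iteratedFDeriv ℝ j Φ p.2 w p.1) (univ ×ˢ O) :=
    (continuous_eval (F := C(Y, F))).comp_continuousOn (h2.prodMk continuousOn_fst)
  exact h3.congr fun p hp => h1 p.1 p.2 hp.2

theorem SmoothFam.eventually_norm_iteratedFDeriv_lt (hf : SmoothFam k O f) (hO : IsOpen O)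
    (hK : IsCompact K) (hKO : K ⊆ O) {j : ℕ} (hj : j ≤ k) (w : Fin j → E) {y₀ : Y}
    (h0 : ∀ x ∈ O, f y₀ x = 0) {ε : ℝ} (hε : 0 < ε) :
    ∀ᶠ y in 𝓝 y₀, ∀ x ∈ K, ‖iteratedFDeriv ℝ j (f y) x w‖ < ε := by
  refine hK.eventually_forall_of_forall_eventually fun x hx => ?_
  have h1 := (hf.continuousOn_iteratedFDeriv_apply hO hj w).continuousAt
    ((isOpen_univ.prod hO).mem_nhds (Set.mk_mem_prod (mem_univ y₀) (hKO hx)))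
  have h2 : iteratedFDeriv ℝ j (f y₀) x w = 0 := by
    have h3 : f y₀ =ᶠ[𝓝 x] fun _ => (0 : F) := by
      filter_upwards [hO.mem_nhds (hKO hx)] with x' hx'
      exact h0 x' hx'
    rw [(h3.iteratedFDeriv ℝ j).eq_of_nhds]
    rw [iteratedFDeriv_fun_zero]
    rfl
  have h3 : Tendsto _ _ (𝓝 _) := h1.norm
  simp only [h2, norm_zero] at h3
  exact h3.eventually (gt_mem_nhds hε)

theorem SmoothFam.integral {D : Type} [TopologicalSpace D] [CompactSpace D] {E : Type}
    [NormedAddCommGroup E] [NormedSpace ℝ E] {O : Set E} {f : D × unitInterval → E → ℝ}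
    (hf : SmoothFam k O f) : SmoothFam k O
      (fun d x => ∫ σ in (0 : ℝ)..1, f (d, projIcc 0 1 zero_le_one σ) x) := by
  let e : C(D, D × unitInterval) := ⟨fun d => (d, 1), by fun_prop⟩
  let A : C(D, E) →L[ℝ] C(D × unitInterval, E) := precompCLM ⟨Prod.fst, continuous_fst⟩ E
  refine SmoothFam.of_lift (S := fun φ => precompCLM e ℝ (volterra D (nem f (A φ)))) ?_ ?_
  · refine ((precompCLM e ℝ).comp (volterra D)).contDiff.comp_contDiffOn ?_
    exact hf.smooth.comp A.contDiff.contDiffOn fun φ hφ p => hφ p.1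
  · intro φ hφ d
    rw [precompCLM_apply, volterra_apply]
    refine intervalIntegral.integral_congr fun σ _ => ?_
    rw [nem_apply hf.cont fun p => hφ p.1]
    rfl

end FamilyDerivatives

section Removable

universe u

variable {E F : Type u} [NormedAddCommGroup E] [NormedSpace ℝ E] [NormedAddCommGroup F]
  [NormedSpace ℝ F]

/-- A function on a punctured ball whose derivatives vanish at the origin fast enough is of class
`C^k` on the ball. -/
theorem contDiffOn_ball_of_punctured {k : ℕ} {ρ : ℝ} (hρ : 0 < ρ) {f : E → F} (h0 : f 0 = 0)
    (hf : ContDiffOn ℝ k f (Metric.ball 0 ρ \ {0}))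
    (hb : ∀ j ≤ k, ∃ C, ∀ z ∈ Metric.ball (0 : E) ρ \ {0},
      ‖iteratedFDeriv ℝ j f z‖ ≤ C * ‖z‖ ^ (k + 1 - j)) :
    ContDiffOn ℝ k f (Metric.ball 0 ρ) := by
  have hopen : IsOpen (Metric.ball (0 : E) ρ \ {0}) := Metric.isOpen_ball.sdiff isClosed_singleton
  induction k generalizing F with
  | zero =>
    refine contDiffOn_zero.2 fun z hz => ?_
    by_cases hz0 : z = 0
    · subst hz0
      obtain ⟨C, hC⟩ := hb 0 le_rfl
      refine ContinuousAt.continuousWithinAt ?_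
      rw [ContinuousAt, h0, tendsto_zero_iff_norm_tendsto_zero]
      have h1 : Tendsto (fun z : E => C * ‖z‖) (𝓝 0) (𝓝 0) := by
        have : Continuous fun z : E => C * ‖z‖ := by fun_prop
        simpa using this.tendsto 0
      refine squeeze_zero' (Eventually.of_forall fun _ => norm_nonneg _) ?_ h1
      filter_upwards [Metric.ball_mem_nhds (0 : E) hρ] with z hz
      by_cases hz0 : z = 0
      · simp [hz0, h0]
      · simpa using hC z ⟨hz, hz0⟩
    · exact (hf.continuousOn.continuousAt (hopen.mem_nhds ⟨hz, hz0⟩)).continuousWithinAt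
  | succ k ih =>
    have hf1 : ContDiffOn ℝ ((k : WithTop ℕ∞) + 1) f (Metric.ball 0 ρ \ {0}) := by exact_mod_cast hf
    have h1 := (contDiffOn_succ_iff_fderiv_of_isOpen hopen).1 hf1
    have hd0 : HasFDerivAt f (0 : E →L[ℝ] F) 0 := by
      obtain ⟨C, hC⟩ := hb 0 (Nat.zero_le _)
      have h2 : (fun z => f z) =O[𝓝 0] fun z => ‖z‖ ^ (k + 2) := by
        refine IsBigO.of_bound C ?_
        filter_upwards [Metric.ball_mem_nhds (0 : E) hρ] with z hz
        by_cases hz0 : z = 0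
        · simp [hz0, h0]
        · have := hC z ⟨hz, hz0⟩
          rw [norm_iteratedFDeriv_zero] at this
          simpa using this
      rw [hasFDerivAt_iff_isLittleO_nhds_zero]
      simp only [zero_add, h0, sub_zero, zero_apply]
      refine h2.trans_isLittleO ?_
      have h3 : (fun z : E => ‖z‖ ^ (k + 2)) =o[𝓝 0] fun z => ‖z‖ ^ 1 :=
        (isLittleO_pow_pow (by omega : 1 < k + 2)).comp_tendsto tendsto_norm_zero
      simp only [pow_one] at h3
      exact isLittleO_norm_right.1 h3
    have h2 : ContDiffOn ℝ k (fderiv ℝ f) (Metric.ball 0 ρ) := by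
      refine ih hd0.fderiv h1.2.2 fun j hj => ?_
      obtain ⟨C, hC⟩ := hb (j + 1) (by omega)
      refine ⟨C, fun z hz => ?_⟩
      rw [norm_iteratedFDeriv_fderiv]
      simpa using hC z hz
    have h3 := (contDiffOn_succ_iff_fderiv_of_isOpen (𝕜 := ℝ) (n := (k : WithTop ℕ∞)) (f := f)
      (Metric.isOpen_ball (x := (0 : E)) (ε := ρ))).2 ⟨fun z hz => ?_, by simp, h2⟩
    · exact_mod_cast h3
    · by_cases hz0 : z = 0
      · subst hz0
        exact hd0.differentiableAt.differentiableWithinAt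
      · exact ((h1.1 z ⟨hz, hz0⟩).differentiableAt (hopen.mem_nhds ⟨hz, hz0⟩)).differentiableWithinAt

end Removable

section ScalingDerivatives

variable {E F : Type*} [NormedAddCommGroup E] [NormedSpace ℝ E] [NormedAddCommGroup F]
  [NormedSpace ℝ F]

theorem iteratedFDeriv_of_comp_eq {j : ℕ} {f g : E → F} {Λ : E ≃L[ℝ] E} {c : ℝ} {p : E}
    (h : (fun x => f (Λ x)) =ᶠ[𝓝 p] fun x => c • g x) (hg : ContDiffAt ℝ j g p) (w : Fin j → E) :
    iteratedFDeriv ℝ j f (Λ p) (fun i => Λ (w i)) = c • iteratedFDeriv ℝ j g p w := by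
  have h1 : iteratedFDeriv ℝ j (f ∘ Λ) p =
      (iteratedFDeriv ℝ j f (Λ p)).compContinuousLinearMap fun _ => (Λ : E →L[ℝ] E) := by
    have := Λ.iteratedFDerivWithin_comp_right f uniqueDiffOn_univ (x := p) (mem_univ _) j
    simpa only [preimage_univ, iteratedFDerivWithin_univ] using this
  have h2 : iteratedFDeriv ℝ j (f ∘ Λ) p = _ := (h.iteratedFDeriv ℝ j).eq_of_nhds
  rw [iteratedFDeriv_const_smul_apply' hg] at h2
  change _ = (c • iteratedFDeriv ℝ j g p) w
  rw [← h2]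
  exact (DFunLike.congr_fun h1 w).symm

/-- Multiplication by a non-zero number. -/
noncomputable def dilationEquiv (E : Type*) [NormedAddCommGroup E] [NormedSpace ℝ E] {t : ℝ}
    (ht : t ≠ 0) : E ≃L[ℝ] E :=
  ContinuousLinearEquiv.smulLeft (Units.mk0 t ht)

@[simp]
theorem dilationEquiv_apply {t : ℝ} (ht : t ≠ 0) (x : E) : dilationEquiv E ht x = t • x := rfl

theorem norm_iteratedFDeriv_le_of_comp_smul_eq {j : ℕ} {f g : E → F} {t c C : ℝ} (ht : 0 < t) (hC : 0 ≤ C)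
    (hc : 0 ≤ c) {p : E} (h : (fun x => f (t • x)) =ᶠ[𝓝 p] fun x => c • g x)
    (hg : ContDiffAt ℝ j g p) (hb : ‖iteratedFDeriv ℝ j g p‖ ≤ C) :
    ‖iteratedFDeriv ℝ j f (t • p)‖ ≤ (t ^ j)⁻¹ * c * C := by
  refine ContinuousMultilinearMap.opNorm_le_bound (by positivity) fun w => ?_
  have h1 := iteratedFDeriv_of_comp_eq (Λ := dilationEquiv E ht.ne') h hg w
  simp only [dilationEquiv_apply] at h1
  rw [ContinuousMultilinearMap.map_smul_univ, Finset.prod_const, Finset.card_univ,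
    Fintype.card_fin] at h1
  have h2 : iteratedFDeriv ℝ j f (t • p) w = ((t ^ j)⁻¹ * c) • iteratedFDeriv ℝ j g p w := by
    rw [mul_smul, ← h1, smul_smul, inv_mul_cancel₀ (by positivity), one_smul]
  rw [h2, norm_smul, Real.norm_of_nonneg (by positivity), mul_assoc _ C]
  refine mul_le_mul_of_nonneg_left ?_ (by positivity)
  exact (ContinuousMultilinearMap.le_opNorm _ _).trans (by gcongr)

end ScalingDerivatives

section LeafRemRegularity

variable {n : ℕ} {lam : Fin n → ℝ} {μ : ℝ} {m : ℕ} {P E : Cn n → ℝ} {q₁ q₂ q₃ x : Cn n} {t ρ : ℝ}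

theorem pathPt_apply_zero (q : Cn n) (s y : ℝ) : pathPt q s (0, y) = 0 := by
  simp [pathPt, segPt]

theorem deficit_apply_zero (q : Cn n) (t : ℝ) : deficit lam m P E q t 0 = 0 := by
  simp [deficit, deficitRate, pathVel, segPt, segDir]

theorem leafRem_apply_zero (t : ℝ) : leafRem lam m P E q₁ q₂ t 0 = 0 := by
  have h1 : transportEnd (scaledOmega lam m P E t) q₂ 0 = 0 := pathPt_apply_zero _ _ _
  rw [leafRem, h1, deficit_apply_zero, deficit_apply_zero]
  simp

namespace SmoothPert

theorem contDiffOn_leafRem (h : SmoothPert lam μ m P E) (hq : IsFrame q₁ q₂ q₃)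
    (hint : IsIntegrableOn (scaledOmega lam m P E 1) ρ) (ht : 0 ≤ t) {r : ℝ}
    (hr : leafConst μ ^ 3 * (t * r) ≤ ρ) (ht' : 0 < t) :
    ContDiffOn ℝ m (leafRem lam m P E q₁ q₂ t) (Metric.ball 0 r \ {0}) := by
  have hL := leafConst_pos μ
  refine (h.smoothFam_leafRem (D := Unit) hq hint (δ := .const _ t) (fun _ => ht)
    (Metric.isOpen_ball.sdiff isClosed_singleton) (fun x hx => hx.2) fun x hx _ => ?_).contDiffOn_slice ()
  have h1 : ‖x‖ < r := by simpa using hx.1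
  refine lt_of_lt_of_le ?_ hr
  show leafConst μ ^ 3 * (t * ‖x‖) < _
  gcongr

/-- The remainder of the first integral is smooth, also at the origin. -/
theorem exists_leafRem_regular (h : SmoothPert lam μ m P E) (hq : IsFrame q₁ q₂ q₃)
    (hρ : 0 < ρ) (hint : IsIntegrableOn (scaledOmega lam m P E 1) ρ) :
    ∃ r, 0 < r ∧ leafConst μ ^ 3 * r ≤ ρ ∧
      ContDiffOn ℝ m (leafRem lam m P E q₁ q₂ 1) (Metric.ball 0 r) ∧
      ∃ C, 0 ≤ C ∧ ∀ z ∈ Metric.ball (0 : Cn n) r,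
        ‖fderiv ℝ (leafRem lam m P E q₁ q₂ 1) z‖ ≤ C * ‖z‖ ^ (m + 1) := by
  have hL := leafConst_pos μ
  set r := ρ / (2 * leafConst μ ^ 3) with hr
  have hr0 : 0 < r := by positivity
  have hrρ : leafConst μ ^ 3 * (2 * r) = ρ := by
    rw [hr]
    field_simp
  have hrle : leafConst μ ^ 3 * r ≤ ρ := by
    have : 0 < leafConst μ ^ 3 * r := by positivity
    linarith
  let δ : C(unitInterval, ℝ) := ⟨fun d => r * d, by fun_prop⟩
  have hδ : ∀ d, 0 ≤ δ d := fun d => mul_nonneg hr0.le d.2.1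
  have hO : IsOpen (Metric.ball (0 : Cn n) 2 \ {0}) := Metric.isOpen_ball.sdiff isClosed_singleton
  have hfam := h.smoothFam_leafRem hq hint hδ hO (fun x hx => hx.2) fun x hx d => by
    have h1 : ‖x‖ < 2 := by simpa using hx.1
    have h2 : r * d ≤ r := mul_le_of_le_one_right hr0.le d.2.2
    have h3 : r * d * ‖x‖ < 2 * r := by
      have := norm_nonneg x
      have := mul_le_mul_of_nonneg_right h2 (norm_nonneg x)
      nlinarith
    rw [← hrρ]
    exact mul_lt_mul_of_pos_left h3 (by positivity)
  have hK : IsCompact (Metric.sphere (0 : Cn n) 1) := isCompact_sphere 0 1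
  have hKO : Metric.sphere (0 : Cn n) 1 ⊆ Metric.ball 0 2 \ {0} := fun x hx => by
    have h1 : ‖x‖ = 1 := by simpa using hx
    refine ⟨by simp [h1], fun h0 => ?_⟩
    rw [mem_singleton_iff] at h0
    simp [h0] at h1
  have hbound : ∀ j ≤ m, ∃ C, 0 ≤ C ∧ ∀ z ∈ Metric.ball (0 : Cn n) r \ {0},
      ‖iteratedFDeriv ℝ j (leafRem lam m P E q₁ q₂ 1) z‖ ≤ C * ‖z‖ ^ (m + 2 - j) := by
    intro j hj
    obtain ⟨C, hC0, hC⟩ := hfam.exists_bound_iteratedFDeriv hO hK hKO hj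
    refine ⟨C, hC0, fun z hz => ?_⟩
    have hz0 : 0 < ‖z‖ := norm_pos_iff.2 hz.2
    have hzr : ‖z‖ < r := by simpa using hz.1
    let d : unitInterval := ⟨‖z‖ / r, by positivity, (div_le_one hr0).2 hzr.le⟩
    have hd : δ d = ‖z‖ := mul_div_cancel₀ _ hr0.ne'
    set x := ‖z‖⁻¹ • z with hx
    have hxz : ‖z‖ • x = z := by rw [hx, smul_smul, mul_inv_cancel₀ hz0.ne', one_smul]
    have hx1 : x ∈ Metric.sphere (0 : Cn n) 1 := by
      rw [mem_sphere_zero_iff_norm, hx, norm_smul, norm_inv, norm_norm, inv_mul_cancel₀ hz0.ne']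
    have h1 := hC x hx1 d
    rw [hd] at h1
    have hev : (fun y => leafRem lam m P E q₁ q₂ 1 (‖z‖ • y)) =ᶠ[𝓝 x]
        fun y => ‖z‖ ^ (m + 2) • leafRem lam m P E q₁ q₂ ‖z‖ y := by
      filter_upwards [hO.mem_nhds (hKO hx1)] with y hy
      refine h.leafRem_smul hq hint hz0 hy.2 ?_
      rw [← hrρ]
      have hy2 : ‖y‖ < 2 := by simpa using hy.1
      gcongr ?_ * ?_
      nlinarith [norm_nonneg y]
    have hsm : ContDiffAt ℝ j (leafRem lam m P E q₁ q₂ ‖z‖) x := by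
      have h2 := (hfam.contDiffOn_slice d).contDiffAt (hO.mem_nhds (hKO hx1))
      rw [hd] at h2
      exact h2.of_le (by exact_mod_cast hj)
    have h2 := norm_iteratedFDeriv_le_of_comp_smul_eq hz0 hC0 (by positivity) hev hsm h1
    rw [hxz] at h2
    refine h2.trans_eq ?_
    have h3 : ‖z‖ ^ (m + 2) = ‖z‖ ^ j * ‖z‖ ^ (m + 2 - j) := by
      rw [← pow_add]
      congr 1
      omega
    rw [h3, ← mul_assoc, inv_mul_cancel₀ (by positivity), one_mul, mul_comm]
  have hball : ContDiffOn ℝ m (leafRem lam m P E q₁ q₂ 1) (Metric.ball 0 r) := by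
    refine contDiffOn_ball_of_punctured hr0 (leafRem_apply_zero 1)
      (h.contDiffOn_leafRem hq hint zero_le_one (by rwa [one_mul]) one_pos) fun j hj => ?_
    obtain ⟨C, hC0, hC⟩ := hbound j hj
    refine ⟨C * r, fun z hz => (hC z hz).trans ?_⟩
    have hzr : ‖z‖ < r := by simpa using hz.1
    have : m + 2 - j = m + 1 - j + 1 := by omega
    rw [this, pow_succ]
    calc C * (‖z‖ ^ (m + 1 - j) * ‖z‖) ≤ C * (‖z‖ ^ (m + 1 - j) * r) := by gcongr
      _ = _ := by ring
  obtain ⟨C, hC0, hC⟩ := hbound 1 h.m_pos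
  refine ⟨r, hr0, hrle, hball, C, hC0, fun z hz => ?_⟩
  have hcont : ContinuousOn (fun z => C * ‖z‖ ^ (m + 1) -
      ‖fderiv ℝ (leafRem lam m P E q₁ q₂ 1) z‖) (Metric.ball 0 r) := by
    have h1 := hball.continuousOn_fderiv_of_isOpen Metric.isOpen_ball
      (by exact_mod_cast h.m_pos)
    exact (by fun_prop : Continuous fun z : Cn n => C * ‖z‖ ^ (m + 1)).continuousOn.sub h1.norm
  by_cases hz0 : z = 0
  · subst hz0
    have h1 : fderiv ℝ (leafRem lam m P E q₁ q₂ 1) 0 = 0 := by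
      obtain ⟨C', hC0', hC'⟩ := hbound 0 (Nat.zero_le _)
      refine HasFDerivAt.fderiv ?_
      rw [hasFDerivAt_iff_isLittleO_nhds_zero]
      simp only [zero_add, leafRem_apply_zero, sub_zero, zero_apply]
      have h2 : (fun z => leafRem lam m P E q₁ q₂ 1 z) =O[𝓝 0] fun z => ‖z‖ ^ (m + 2) := by
        refine IsBigO.of_bound C' ?_
        filter_upwards [Metric.ball_mem_nhds (0 : Cn n) hr0] with z hz
        by_cases hz0 : z = 0
        · simp [hz0, leafRem_apply_zero]
        · have := hC' z ⟨hz, hz0⟩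
          rw [norm_iteratedFDeriv_zero] at this
          simpa using this
      have h3 : (fun z : Cn n => ‖z‖ ^ (m + 2)) =o[𝓝 0] fun z => ‖z‖ ^ 1 :=
        (isLittleO_pow_pow (by omega : 1 < m + 2)).comp_tendsto tendsto_norm_zero
      simp only [pow_one] at h3
      exact h2.trans_isLittleO (isLittleO_norm_right.1 h3)
    rw [h1]
    simp
  · have h1 := hC z ⟨hz, hz0⟩
    rw [norm_iteratedFDeriv_one] at h1
    exact h1

end SmoothPert

end LeafRemRegularity

section ScaledFixedPoint

/-- The equation `κ = f (τ κ, x)` with small `τ` has a solution depending smoothly on `x`. -/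
theorem exists_scaled_fixedPoint {D E : Type} [TopologicalSpace D] [CompactSpace D]
    [NormedAddCommGroup E] [NormedSpace ℝ E] [CompleteSpace E] {k : ℕ} (hk : k ≠ 0) {O : Set E}
    (hO : IsOpen O) {O' : Set (ℝ × E)} {f : D → ℝ × E → ℝ} (hf : SmoothFam k O' f) {τ : C(D, ℝ)}
    {C : ℝ} (hC : 0 < C) (hmem : ∀ s : ℝ, |s| ≤ 1 / 4 → ∀ x ∈ O, (s, x) ∈ O')
    (hbound : ∀ d, ∀ s : ℝ, |s| ≤ 1 / 4 → ∀ x ∈ O, |f d (s, x)| ≤ C)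
    (hlip : ∀ d, ∀ s : ℝ, |s| ≤ 1 / 4 → ∀ s' : ℝ, |s'| ≤ 1 / 4 → ∀ x ∈ O,
      |f d (s, x) - f d (s', x)| ≤ C * |s - s'|) (hτ : ∀ d, |τ d| * (2 * C) ≤ 1 / 4) :
    ∃ κ : D → E → ℝ, SmoothFam k O κ ∧
      ∀ x ∈ O, ∀ d, |τ d * κ d x| ≤ 1 / 4 ∧ f d (τ d * κ d x, x) = κ d x := by
  classical
  let Mτ : C(D, ℝ) →L[ℝ] C(D, ℝ) := ContinuousLinearMap.mul ℝ _ τ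
  let A : E × C(D, ℝ) →L[ℝ] C(D, ℝ × E) := (pairCLM D ℝ E).comp
    ((Mτ.comp (.snd ℝ _ _)).prod ((constCLM D E).comp (.fst ℝ _ _)))
  have hA : ∀ x z d, A (x, z) d = (τ d * z d, x) := fun x z d => rfl
  let W : Set C(D, ℝ) := Metric.ball 0 (2 * C)
  have hτz : ∀ z ∈ W, ∀ d, |τ d * z d| ≤ 1 / 4 := by
    intro z hz d
    have hz' : ‖z‖ < 2 * C := by simpa [W] using hz
    rw [abs_mul]
    exact (mul_le_mul_of_nonneg_left ((z.norm_coe_le_norm d).trans hz'.le) (abs_nonneg _)).trans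
      (hτ d)
  have hmaps : ∀ x ∈ O, ∀ z ∈ W, ∀ d, A (x, z) d ∈ O' := fun x hx z hz d => by
    rw [hA]
    exact hmem _ (hτz z hz d) x hx
  let T : E × C(D, ℝ) → C(D, ℝ) := fun q => nem f (A q)
  have hTd : ∀ x ∈ O, ∀ z ∈ W, ∀ d, T (x, z) d = f d (τ d * z d, x) := fun x hx z hz d =>
    nem_apply hf.cont (hmaps x hx z hz) d
  have hT : ContDiffOn ℝ k T (O ×ˢ W) :=
    hf.smooth.comp A.contDiff.contDiffOn fun q hq => hmaps q.1 hq.1 q.2 hq.2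
  have hTlip : ∀ x ∈ O, ∀ z ∈ W, ∀ z' ∈ W, ‖T (x, z) - T (x, z')‖ ≤ 1 / 2 * ‖z - z'‖ := by
    intro x hx z hz z' hz'
    rw [ContinuousMap.norm_le _ (by positivity)]
    intro d
    rw [ContinuousMap.sub_apply, hTd x hx z hz, hTd x hx z' hz', Real.norm_eq_abs]
    refine (hlip d _ (hτz z hz d) _ (hτz z' hz' d) x hx).trans ?_
    rw [← mul_sub, abs_mul]
    have h1 := (z - z').norm_coe_le_norm d
    rw [ContinuousMap.sub_apply, Real.norm_eq_abs] at h1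
    have h2 := hτ d
    calc C * (|τ d| * |z d - z' d|) = |τ d| * C * |z d - z' d| := by ring
      _ ≤ 1 / 2 * ‖z - z'‖ := mul_le_mul (by linarith) h1 (abs_nonneg _) (by norm_num)
  have hsub : Metric.closedBall (0 : C(D, ℝ)) C ⊆ W :=
    Metric.closedBall_subset_ball (by linarith)
  have hfix : ∀ x ∈ O, ∃ z ∈ W, T (x, z) = z := by
    intro x hx
    have hself : MapsTo (fun z => T (x, z)) (Metric.closedBall 0 C) (Metric.closedBall 0 C) := by
      intro z hz
      rw [mem_closedBall_zero_iff, ContinuousMap.norm_le _ hC.le]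
      intro d
      rw [hTd x hx z (hsub hz), Real.norm_eq_abs]
      exact hbound d _ (hτz z (hsub hz) d) x hx
    have hcon : ContractingWith (1 / 2) (hself.restrict _ _ _) :=
      ⟨by rw [← NNReal.coe_lt_coe]; norm_num, LipschitzWith.of_dist_le_mul fun z z' => by
        rw [Subtype.dist_eq, Subtype.dist_eq, dist_eq_norm, dist_eq_norm]
        exact_mod_cast hTlip x hx z (hsub z.2) z' (hsub z'.2)⟩
    obtain ⟨z, hz, hz', -⟩ := hcon.exists_fixedPoint' Metric.isClosed_closedBall.isComplete hself
      (x := 0) (Metric.mem_closedBall_self hC.le) (edist_ne_top _ _)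
    exact ⟨z, hsub hz, hz'⟩
  choose! z hzW hz using hfix
  have hzc := contDiffOn_fixedPoint_of_isOpen hk hO Metric.isOpen_ball hT hTlip hzW hz
  refine ⟨fun d x => z x d, SmoothFam.of_curry hO hzc fun x _ d => rfl, fun x hx d =>
    ⟨hτz _ (hzW x hx) d, ?_⟩⟩
  rw [← hTd x hx _ (hzW x hx), hz x hx]

end ScaledFixedPoint

section RayShift

variable {n : ℕ} {lam : Fin n → ℝ} {μ : ℝ} {m : ℕ} {P E : Cn n → ℝ} {q₁ q₂ q₃ x : Cn n} {t ρ : ℝ}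

/-- The mean of the radial derivative of `scaledG` between `x` and `(1 + s) x`, `p = (s, x)`. -/
noncomputable def rayMean (lam : Fin n → ℝ) (P : Cn n → ℝ) (t : ℝ) (p : ℝ × Cn n) : ℝ :=
  ∫ σ in (0 : ℝ)..1, scaledDG lam P t ((1 + (projIcc (0 : ℝ) 1 zero_le_one σ : ℝ) * p.1) • p.2) p.2

noncomputable def rayShiftRhs (lam : Fin n → ℝ) (m : ℕ) (P E : Cn n → ℝ) (q₁ q₂ : Cn n) (t : ℝ)
    (p : ℝ × Cn n) : ℝ :=
  -leafRem lam m P E q₁ q₂ t ((1 + p.1) • p.2) / rayMean lam P t p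

namespace SmoothPert

theorem scaledDG_self_ge (h : SmoothPert lam μ m P E) (ht : 0 ≤ t) (x : Cn n) :
    15 / 8 * (μ * ‖x‖ ^ 2) ≤ scaledDG lam P t x x := by
  rcases ht.eq_or_lt with rfl | ht
  · rw [scaledDG, dilate_zero _ h.vanish_fderiv_P.apply_zero, add_zero, smul_apply, smul_eq_mul]
    have := quadBilin_self_ge h.lam_nonneg h.lam_le x
    have h2 : 0 ≤ μ * ‖x‖ ^ 2 := mul_nonneg h.mu_pos.le (by positivity)
    linarith
  · rw [h.scaledDG_eq ht.ne', smul_apply, smul_eq_mul]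
    have h1 := h.fderiv_G_self_ge (t • x)
    rw [map_smul, smul_eq_mul, norm_smul, Real.norm_of_nonneg ht.le] at h1
    refine le_of_mul_le_mul_left ?_ (by positivity : 0 < t * t)
    calc t * t * (15 / 8 * (μ * ‖x‖ ^ 2)) = 15 / 8 * (μ * (t * ‖x‖) ^ 2) := by ring
      _ ≤ _ := h1
      _ = _ := by field_simp

theorem continuous_scaledDG (h : SmoothPert lam μ m P E) (ht : 0 ≤ t) :
    Continuous (scaledDG lam P t) :=
  continuousOn_univ.1 ((h.smoothFam_scaledDG (Y := Unit) (δ := .const _ t)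
    fun _ => ht).contDiffOn_slice ()).continuousOn

theorem continuous_rayMean_integrand (h : SmoothPert lam μ m P E) (ht : 0 ≤ t) (p : ℝ × Cn n) :
    Continuous fun σ => scaledDG lam P t
      ((1 + (projIcc (0 : ℝ) 1 zero_le_one σ : ℝ) * p.1) • p.2) p.2 := by
  have h1 : Continuous fun σ : ℝ => (1 + (projIcc (0 : ℝ) 1 zero_le_one σ : ℝ) * p.1) • p.2 := by
    have := continuous_projIcc_unit
    fun_prop
  exact ((h.continuous_scaledDG ht).comp h1).clm_apply continuous_const

theorem rayMean_pos (h : SmoothPert lam μ m P E) (ht : 0 ≤ t) {s : ℝ} (hs : |s| < 1)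
    (hx : x ≠ 0) : 0 < rayMean lam P t (s, x) := by
  refine intervalIntegral.intervalIntegral_pos_of_pos_on
    ((h.continuous_rayMean_integrand ht (s, x)).intervalIntegrable _ _) (fun σ hσ => ?_) one_pos
  set c := 1 + (projIcc (0 : ℝ) 1 zero_le_one σ : ℝ) * s with hc
  have hc0 : 0 < c := by
    have h1 : |(projIcc (0 : ℝ) 1 zero_le_one σ : ℝ) * s| < 1 := by
      rw [abs_mul, abs_of_nonneg (projIcc (0 : ℝ) 1 zero_le_one σ).2.1]
      exact (mul_le_of_le_one_left (abs_nonneg _) (projIcc (0 : ℝ) 1 zero_le_one σ).2.2).trans_lt hs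
    linarith [neg_abs_le ((projIcc (0 : ℝ) 1 zero_le_one σ : ℝ) * s)]
  have h1 := h.scaledDG_self_ge ht (c • x)
  rw [map_smul, smul_eq_mul] at h1
  have h2 : 0 < ‖c • x‖ := norm_pos_iff.2 (smul_ne_zero hc0.ne' hx)
  have h3 := h.mu_pos
  have h4 : 0 < c * scaledDG lam P t (c • x) x := lt_of_lt_of_le (by positivity) h1
  exact (pos_iff_pos_of_mul_pos h4).1 hc0

theorem mul_rayMean (h : SmoothPert lam μ m P E) (ht : 0 ≤ t) (s : ℝ) (x : Cn n) :
    s * rayMean lam P t (s, x) = scaledG lam P t ((1 + s) • x) - scaledG lam P t x := by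
  have hd : ∀ σ ∈ uIcc (0 : ℝ) 1, HasDerivAt (fun σ : ℝ => scaledG lam P t ((1 + σ * s) • x))
      (s * scaledDG lam P t ((1 + (projIcc (0 : ℝ) 1 zero_le_one σ : ℝ) * s) • x) x) σ := by
    intro σ hσ
    rw [uIcc_of_le zero_le_one] at hσ
    rw [projIcc_of_mem zero_le_one hσ]
    have h1 : HasDerivAt (fun σ : ℝ => (1 + σ * s) • x) (s • x) σ := by
      simpa using (((hasDerivAt_id σ).mul_const s).const_add 1).smul_const x
    refine ((h.hasFDerivAt_scaledG t ((1 + σ * s) • x)).comp_hasDerivAt σ h1).congr_deriv ?_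
    rw [map_smul, smul_eq_mul]
  have h1 := intervalIntegral.integral_eq_sub_of_hasDerivAt hd
    (((h.continuous_rayMean_integrand ht (s, x)).const_mul s).intervalIntegrable _ _)
  rw [intervalIntegral.integral_const_mul] at h1
  rw [rayMean, h1]
  simp

variable {D : Type} [TopologicalSpace D] [CompactSpace D]

theorem smoothFam_rayMean (h : SmoothPert lam μ m P E) {δ : C(D, ℝ)} (hδ : ∀ d, 0 ≤ δ d) :
    SmoothFam m univ (fun d => rayMean lam P (δ d)) := by
  let δ' : C(D × unitInterval, ℝ) := ⟨fun p => δ p.1, by fun_prop⟩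
  let σ : C(D × unitInterval, ℝ) := ⟨fun p => p.2, by fun_prop⟩
  have h1 : SmoothFam m univ fun (p : D × unitInterval) (w : ℝ × Cn n) =>
      (1 + (p.2 : ℝ) * w.1) • w.2 :=
    ((SmoothFam.param σ).prodMk SmoothFam.id).map_contDiff
      (Φ := fun w : ℝ × ℝ × Cn n => (1 + w.1 * w.2.1) • w.2.2) (by fun_prop)
  have h2 := (h.smoothFam_scaledDG (δ := δ') fun p => hδ p.1).comp h1 fun _ _ _ => mem_univ _
  have h3 : ContDiff ℝ m fun w : (Cn n →L[ℝ] ℝ) × ℝ × Cn n => w.1 w.2.2 :=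
    contDiff_fst.clm_apply contDiff_snd.snd
  exact ((h2.prodMk SmoothFam.id).map_contDiff h3).integral

theorem smoothFam_rayShiftRhs (h : SmoothPert lam μ m P E) (hq : IsFrame q₁ q₂ q₃)
    (hint : IsIntegrableOn (scaledOmega lam m P E 1) ρ) {δ : C(D, ℝ)} (hδ : ∀ d, 0 ≤ δ d) {A : ℝ}
    (hρ : ∀ d, leafConst μ ^ 3 * (δ d * (2 * A)) < ρ) :
    SmoothFam m (Ioo (-1 / 2 : ℝ) (1 / 2) ×ˢ (Metric.ball (0 : Cn n) (4 / 3 * A) \ {0}))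
      (fun d => rayShiftRhs lam m P E q₁ q₂ (δ d)) := by
  have hL := leafConst_pos μ
  have h1 := h.smoothFam_leafRem hq hint hδ
    (O := Metric.ball (0 : Cn n) (2 * A) \ {0}) (Metric.isOpen_ball.sdiff isClosed_singleton)
    (fun x hx => hx.2) fun x hx d => by
      have h2 : ‖x‖ < 2 * A := by simpa using hx.1
      refine lt_of_le_of_lt ?_ (hρ d)
      have := hδ d
      gcongr
  have h2 : SmoothFam m (Ioo (-1 / 2 : ℝ) (1 / 2) ×ˢ (Metric.ball (0 : Cn n) (4 / 3 * A) \ {0}))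
      fun (_ : D) (w : ℝ × Cn n) => (1 + w.1) • w.2 :=
    SmoothFam.id.map_contDiff (Φ := fun w : ℝ × Cn n => (1 + w.1) • w.2) (by fun_prop)
  have h3 := h1.comp h2 fun d w hw => by
    have e1 := hw.1.1
    have e2 := hw.1.2
    have e3 : ‖w.2‖ < 4 / 3 * A := by simpa using hw.2.1
    refine ⟨?_, fun h0 => smul_ne_zero (by linarith) hw.2.2 h0⟩
    rw [mem_ball_zero_iff, norm_smul, Real.norm_of_nonneg (by linarith)]
    nlinarith [norm_nonneg w.2]
  refine (h3.prodMk ((h.smoothFam_rayMean hδ).mono (subset_univ _))).map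
    (O' := {w : ℝ × ℝ | w.2 ≠ 0}) (isOpen_ne_fun continuous_snd continuous_const)
    (Φ := fun w : ℝ × ℝ => -w.1 / w.2) ?_ fun d w hw => ?_
  · exact contDiff_fst.neg.contDiffOn.div contDiff_snd.contDiffOn fun w hw => hw
  · refine (h.rayMean_pos (x := w.2) (hδ d) ?_ hw.2.2).ne'
    rw [abs_lt]
    exact ⟨by linarith [hw.1.1], by linarith [hw.1.2]⟩

/-- The displacement along the rays that takes the level sets of `scaledG` to those of the first
integral. -/
theorem exists_rayShift (h : SmoothPert lam μ m P E) (hq : IsFrame q₁ q₂ q₃) (hρ : 0 < ρ)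
    (hint : IsIntegrableOn (scaledOmega lam m P E 1) ρ) {c A : ℝ} (hc : 0 < c) (hA : 0 < A) :
    ∃ δ₁ : ℝ, 0 < δ₁ ∧ δ₁ ≤ 1 ∧ leafConst μ ^ 3 * (δ₁ * (2 * A)) < ρ ∧ ∃ κ : ℝ → Cn n → ℝ,
      SmoothFam m {x | c < ‖x‖ ∧ ‖x‖ < A} (fun d : unitInterval => κ (δ₁ * d)) ∧
      ∀ x, c < ‖x‖ → ‖x‖ < A → κ 0 x = 0 ∧ ∀ t ∈ Icc 0 δ₁, |t ^ m * κ t x| ≤ 1 / 4 ∧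
        scaledG lam P t ((1 + t ^ m * κ t x) • x) +
          t ^ m * leafRem lam m P E q₁ q₂ t ((1 + t ^ m * κ t x) • x) = scaledG lam P t x := by
  have hL := leafConst_pos μ
  set δ₀ := ρ / (4 * A * leafConst μ ^ 3) with hδ₀
  have hδ₀0 : 0 < δ₀ := by positivity
  have hδρ : leafConst μ ^ 3 * (δ₀ * (2 * A)) < ρ := by
    have h1 : leafConst μ ^ 3 * (δ₀ * (2 * A)) = ρ / 2 := by
      rw [hδ₀]
      field_simp
      norm_num
    linarith
  set O' := Ioo (-1 / 2 : ℝ) (1 / 2) ×ˢ (Metric.ball (0 : Cn n) (4 / 3 * A) \ {0})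
  set O := {x : Cn n | c < ‖x‖ ∧ ‖x‖ < A}
  set K := Icc (-1 / 4 : ℝ) (1 / 4) ×ˢ {x : Cn n | c ≤ ‖x‖ ∧ ‖x‖ ≤ A}
  have hO' : IsOpen O' := isOpen_Ioo.prod (Metric.isOpen_ball.sdiff isClosed_singleton)
  have hO : IsOpen O := (isOpen_lt continuous_const continuous_norm).inter
    (isOpen_lt continuous_norm continuous_const)
  have hK : IsCompact K := by
    refine isCompact_Icc.prod ((isCompact_closedBall (0 : Cn n) A).of_isClosed_subset
      ((isClosed_le continuous_const continuous_norm).inter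
        (isClosed_le continuous_norm continuous_const)) fun x hx => ?_)
    rw [mem_closedBall_zero_iff]
    exact hx.2
  have hKO : K ⊆ O' := by
    rintro ⟨s, x⟩ ⟨⟨hs1, hs2⟩, hx1, hx2⟩
    simp only at hs1 hs2 hx1 hx2
    refine ⟨⟨by simp only; linarith, by simp only; linarith⟩, ?_, fun h0 => ?_⟩
    · rw [mem_ball_zero_iff]
      simp only
      linarith
    · have h1 : x = 0 := h0
      rw [h1, norm_zero] at hx1
      linarith
  have hOK : ∀ s : ℝ, |s| ≤ 1 / 4 → ∀ x ∈ O, (s, x) ∈ K := fun s hs x hx =>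
    ⟨⟨by simp only; linarith [(abs_le.1 hs).1], (abs_le.1 hs).2⟩, hx.1.le, hx.2.le⟩
  have mkδ : ∀ r : ℝ, ∃ δ : C(unitInterval, ℝ), ∀ d : unitInterval, δ d = r * d := fun r =>
    ⟨⟨fun d => r * d, by fun_prop⟩, fun _ => rfl⟩
  obtain ⟨δ, hδ⟩ := mkδ δ₀
  have hδnn : ∀ d, 0 ≤ δ d := fun d => by
    rw [hδ]
    exact mul_nonneg hδ₀0.le d.2.1
  have hfam := h.smoothFam_rayShiftRhs hq hint hδnn (A := A) fun d => lt_of_le_of_lt (by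
    have : δ d ≤ δ₀ := by
      rw [hδ]
      exact mul_le_of_le_one_right hδ₀0.le d.2.2
    gcongr) hδρ
  obtain ⟨C₀, hC₀, hb₀⟩ := hfam.exists_bound_iteratedFDeriv hO' hK hKO (Nat.zero_le _)
  obtain ⟨C₁, hC₁, hb₁⟩ := hfam.exists_bound_iteratedFDeriv hO' hK hKO h.m_pos
  set C := C₀ + C₁ + 1 with hC
  have hC0 : 0 < C := by positivity
  set δ₁ := min (min δ₀ 1) (1 / (8 * C)) with hδ₁
  have hδ₁0 : 0 < δ₁ := by positivity
  have h10 : δ₁ ≤ δ₀ := (min_le_left _ _).trans (min_le_left _ _)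
  have h11 : δ₁ ≤ 1 := (min_le_left _ _).trans (min_le_right _ _)
  obtain ⟨ε, hε⟩ := mkδ δ₁
  have hεnn : ∀ d, 0 ≤ ε d := fun d => by
    rw [hε]
    exact mul_nonneg hδ₁0.le d.2.1
  have hε1 : ∀ d, ε d ≤ δ₁ := fun d => by
    rw [hε]
    exact mul_le_of_le_one_right hδ₁0.le d.2.2
  have hδ₁ρ : leafConst μ ^ 3 * (δ₁ * (2 * A)) < ρ := lt_of_le_of_lt (by gcongr) hδρ
  have hfam' := h.smoothFam_rayShiftRhs hq hint hεnn (A := A) fun d => lt_of_le_of_lt (by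
    have := hε1 d
    gcongr) hδ₁ρ
  have hd : ∀ d, ∃ d' : unitInterval, δ d' = ε d := fun d =>
    ⟨⟨ε d / δ₀, div_nonneg (hεnn d) hδ₀0.le, (div_le_one hδ₀0).2 ((hε1 d).trans h10)⟩, by
      rw [hδ]
      exact mul_div_cancel₀ _ hδ₀0.ne'⟩
  have hm : m ≠ 0 := h.m_ne_zero
  obtain ⟨κ, hκ, hκ'⟩ := exists_scaled_fixedPoint hm hO hfam' (τ := ε ^ m) hC0
    (fun s hs x hx => hKO (hOK s hs x hx))
    (fun d s hs x hx => by
      obtain ⟨d', hd'⟩ := hd d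
      have h1 := hb₀ _ (hOK s hs x hx) d'
      rw [norm_iteratedFDeriv_zero, hd', Real.norm_eq_abs] at h1
      linarith)
    (fun d s hs s' hs' x hx => by
      obtain ⟨d', hd'⟩ := hd d
      have hdiff : ∀ p ∈ K, DifferentiableAt ℝ (rayShiftRhs lam m P E q₁ q₂ (ε d)) p := fun p hp =>
        ((hfam'.contDiffOn_slice d).contDiffAt (hO'.mem_nhds (hKO hp))).differentiableAt
          (by exact_mod_cast hm)
      have hconv : Convex ℝ (Icc (-1 / 4 : ℝ) (1 / 4)) := convex_Icc _ _
      have hder : ∀ s ∈ Icc (-1 / 4 : ℝ) (1 / 4), HasDerivWithinAt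
          (fun s => rayShiftRhs lam m P E q₁ q₂ (ε d) (s, x))
          (fderiv ℝ (rayShiftRhs lam m P E q₁ q₂ (ε d)) (s, x) (1, 0)) (Icc (-1 / 4 : ℝ) (1 / 4)) s :=
        fun s hs => by
          have e1 := (hdiff (s, x) ⟨hs, hx.1.le, hx.2.le⟩).hasFDerivAt
          have e2 : HasDerivAt (fun s : ℝ => (s, x)) ((1 : ℝ), (0 : Cn n)) s :=
            (hasDerivAt_id s).prodMk (hasDerivAt_const s x)
          exact (HasFDerivAt.comp_hasDerivAt s (f := fun s : ℝ => (s, x))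
            (l := rayShiftRhs lam m P E q₁ q₂ (ε d)) e1 e2).hasDerivWithinAt
      have hmem : ∀ s : ℝ, |s| ≤ 1 / 4 → s ∈ Icc (-1 / 4 : ℝ) (1 / 4) := fun s hs =>
        ⟨by linarith [(abs_le.1 hs).1], (abs_le.1 hs).2⟩
      have h2 := hconv.norm_image_sub_le_of_norm_hasDerivWithin_le (C := C) hder (fun s hs => by
        have e1 := hb₁ (s, x) ⟨hs, hx.1.le, hx.2.le⟩ d'
        rw [norm_iteratedFDeriv_one, hd'] at e1
        refine ((fderiv ℝ (rayShiftRhs lam m P E q₁ q₂ (ε d)) (s, x)).le_of_opNorm_le e1 _).trans ?_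
        have : ‖((1 : ℝ), (0 : Cn n))‖ = 1 := by simp [Prod.norm_def]
        rw [this]
        linarith) (hmem s' hs') (hmem s hs)
      simpa [Real.norm_eq_abs] using h2)
    (fun d => by
      have e0 := hεnn d
      have e1 : |(ε ^ m) d| ≤ 1 / (8 * C) := by
        rw [ContinuousMap.pow_apply, abs_of_nonneg (by positivity)]
        exact (pow_le_of_le_one e0 ((hε1 d).trans h11) hm).trans
          ((hε1 d).trans (min_le_right _ _))
      calc |(ε ^ m) d| * (2 * C) ≤ 1 / (8 * C) * (2 * C) := by gcongr
        _ = _ := by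
          field_simp
          norm_num)
  have hproj : ∀ t ∈ Icc 0 δ₁, t / δ₁ ∈ Icc (0 : ℝ) 1 := fun t ht =>
    ⟨div_nonneg ht.1 hδ₁0.le, (div_le_one hδ₁0).2 ht.2⟩
  have hpd : ∀ d : unitInterval, projIcc (0 : ℝ) 1 zero_le_one (δ₁ * d / δ₁) = d := fun d => by
    rw [mul_div_cancel_left₀ _ hδ₁0.ne', projIcc_val]
  refine ⟨δ₁, hδ₁0, h11, hδ₁ρ, fun t => κ (projIcc 0 1 zero_le_one (t / δ₁)), ?_,
    fun x hx1 hx2 => ?_⟩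
  · simp only [hpd]
    exact hκ
  · have hx : x ∈ O := ⟨hx1, hx2⟩
    have hx0 : x ≠ 0 := norm_pos_iff.1 (hc.trans hx1)
    have key : ∀ t ∈ Icc 0 δ₁, |t ^ m * κ (projIcc 0 1 zero_le_one (t / δ₁)) x| ≤ 1 / 4 ∧
        rayShiftRhs lam m P E q₁ q₂ t (t ^ m * κ (projIcc 0 1 zero_le_one (t / δ₁)) x, x) =
          κ (projIcc 0 1 zero_le_one (t / δ₁)) x := fun t ht => by
      have e1 := hκ' x hx (projIcc 0 1 zero_le_one (t / δ₁))
      have e2 : ε (projIcc 0 1 zero_le_one (t / δ₁)) = t := by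
        rw [hε, projIcc_of_mem _ (hproj t ht)]
        exact mul_div_cancel₀ _ hδ₁0.ne'
      rw [ContinuousMap.pow_apply, e2] at e1
      exact e1
    refine ⟨?_, fun t ht => ⟨(key t ht).1, ?_⟩⟩
    · have h0 := (key 0 ⟨le_rfl, hδ₁0.le⟩).2
      rw [rayShiftRhs, h.leafRem_zero, neg_zero, zero_div] at h0
      exact h0.symm
    · obtain ⟨h1, h2⟩ := key t ht
      set s := t ^ m * κ (projIcc 0 1 zero_le_one (t / δ₁)) x with hs
      have h3 := h.mul_rayMean ht.1 s x
      have h4 := h.rayMean_pos ht.1 (h1.trans_lt (by norm_num)) hx0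
      rw [rayShiftRhs, div_eq_iff h4.ne'] at h2
      have h5 : t ^ m * leafRem lam m P E q₁ q₂ t ((1 + s) • x) =
          -(s * rayMean lam P t (s, x)) := by
        have : leafRem lam m P E q₁ q₂ t ((1 + s) • x) =
          -(κ (projIcc 0 1 zero_le_one (t / δ₁)) x * rayMean lam P t (s, x)) := by linarith
        rw [this, hs]
        ring
      linarith

end SmoothPert

end RayShift

section RadialFunctions

variable {n : ℕ}

/-- A function on a ball that grows quadratically along the rays. -/
structure IsRadial (Φ : Cn n → ℝ) (μ r : ℝ) : Prop where
  mu_pos : 0 < μ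
  contDiffOn : ContDiffOn ℝ 1 Φ (Metric.ball 0 r)
  map_zero : Φ 0 = 0
  le_fderiv : ∀ z ∈ Metric.ball (0 : Cn n) r, μ * ‖z‖ ^ 2 ≤ fderiv ℝ Φ z z

namespace IsRadial

variable {Φ : Cn n → ℝ} {μ r ρ c : ℝ} {z : Cn n}

theorem mono (h : IsRadial Φ μ r) (hρ : ρ ≤ r) : IsRadial Φ μ ρ :=
  ⟨h.mu_pos, h.contDiffOn.mono (Metric.ball_subset_ball hρ), h.map_zero, fun z hz =>
    h.le_fderiv z (Metric.ball_subset_ball hρ hz)⟩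

theorem differentiableAt (h : IsRadial Φ μ r) (hz : z ∈ Metric.ball (0 : Cn n) r) :
    DifferentiableAt ℝ Φ z :=
  (h.contDiffOn.contDiffAt (Metric.isOpen_ball.mem_nhds hz)).differentiableAt (by simp)

theorem continuousOn (h : IsRadial Φ μ r) : ContinuousOn Φ (Metric.ball 0 r) :=
  h.contDiffOn.continuousOn

/-- The parameters for which a ray stays in the ball. -/
def raySet (z : Cn n) (r : ℝ) : Set ℝ := {s | 0 ≤ s ∧ s * ‖z‖ < r}

theorem smul_mem_ball {s : ℝ} (hs : s ∈ raySet z r) : s • z ∈ Metric.ball (0 : Cn n) r := by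
  rw [mem_ball_zero_iff, norm_smul, Real.norm_of_nonneg hs.1]
  exact hs.2

theorem convex_raySet (z : Cn n) (r : ℝ) : Convex ℝ (raySet z r) := by
  have h1 : raySet z r = Ici 0 ∩ (fun s : ℝ => s * ‖z‖) ⁻¹' Iio r := rfl
  rw [h1]
  refine (convex_Ici 0).inter ?_
  have h2 := (convex_Iio r).linear_preimage (LinearMap.mulRight ℝ ‖z‖)
  exact h2

theorem continuousOn_ray (h : IsRadial Φ μ r) (z : Cn n) :
    ContinuousOn (fun s : ℝ => Φ (s • z)) (raySet z r) :=
  h.continuousOn.comp (by fun_prop) fun _ hs => smul_mem_ball hs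

theorem strictMonoOn (h : IsRadial Φ μ r) (hz : z ≠ 0) :
    StrictMonoOn (fun s : ℝ => Φ (s • z)) (raySet z r) := by
  refine strictMonoOn_ray (convex_raySet z r) (fun s hs => hs.1) (h.continuousOn_ray z)
    fun s hs => ?_
  have hs' := interior_subset hs
  have hs0 : 0 < s := by
    have h1 : s ∈ interior (Ici (0 : ℝ)) := interior_mono (fun s hs => hs.1) hs
    rwa [interior_Ici] at h1
  refine ⟨h.differentiableAt (smul_mem_ball hs'), ?_⟩
  refine lt_of_lt_of_le ?_ (h.le_fderiv _ (smul_mem_ball hs'))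
  have : 0 < ‖s • z‖ := norm_pos_iff.2 (smul_ne_zero hs0.ne' hz)
  have := h.mu_pos
  positivity

theorem Icc_subset_raySet {s : ℝ} (hs : s ∈ raySet z r) : Icc 0 s ⊆ raySet z r := fun _ hs' =>
  ⟨hs'.1, (mul_le_mul_of_nonneg_right hs'.2 (norm_nonneg z)).trans_lt hs.2⟩

theorem one_mem_raySet (hz : z ∈ Metric.ball (0 : Cn n) r) : (1 : ℝ) ∈ raySet z r :=
  ⟨zero_le_one, by simpa using hz⟩

theorem le_apply (h : IsRadial Φ μ r) (hz : z ∈ Metric.ball (0 : Cn n) r) :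
    μ / 2 * ‖z‖ ^ 2 ≤ Φ z := by
  have hI : Icc (0 : ℝ) 1 ⊆ raySet z r := Icc_subset_raySet (one_mem_raySet hz)
  have hder : ∀ s ∈ Icc (0 : ℝ) 1, HasDerivAt (fun s : ℝ => Φ (s • z) - μ / 2 * s ^ 2 * ‖z‖ ^ 2)
      (fderiv ℝ Φ (s • z) z - μ * s * ‖z‖ ^ 2) s := by
    intro s hs
    have h1 : HasDerivAt (fun s : ℝ => s • z) z s := by
      simpa using (hasDerivAt_id s).smul_const z
    have h2 := HasFDerivAt.comp_hasDerivAt s (f := fun s : ℝ => s • z) (l := Φ)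
      (h.differentiableAt (smul_mem_ball (hI hs))).hasFDerivAt h1
    have h3 : HasDerivAt (fun s : ℝ => μ / 2 * s ^ 2 * ‖z‖ ^ 2) (μ * s * ‖z‖ ^ 2) s := by
      refine (((hasDerivAt_pow 2 s).const_mul (μ / 2)).mul_const (‖z‖ ^ 2)).congr_deriv ?_
      simp only [Nat.cast_ofNat, Nat.add_one_sub_one, pow_one]
      ring
    exact h2.sub h3
  have hmono := monotoneOn_of_deriv_nonneg (convex_Icc (0 : ℝ) 1)
    (fun s hs => (hder s hs).continuousAt.continuousWithinAt)
    (fun s hs => (hder s (interior_subset hs)).differentiableAt.differentiableWithinAt)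
    (fun s hs => by
      have hs' := interior_subset hs
      rw [interior_Icc] at hs
      rw [(hder s hs').deriv]
      have h1 := h.le_fderiv _ (smul_mem_ball (hI hs'))
      rw [map_smul, smul_eq_mul, norm_smul, Real.norm_of_nonneg hs.1.le] at h1
      have h2 : s * (μ * s * ‖z‖ ^ 2) ≤ s * fderiv ℝ Φ (s • z) z := by
        refine le_trans (le_of_eq ?_) h1
        ring
      linarith [le_of_mul_le_mul_left h2 hs.1])
  have h1 := hmono (left_mem_Icc.2 zero_le_one) (right_mem_Icc.2 zero_le_one) zero_le_one
  simp [h.map_zero] at h1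
  linarith

theorem norm_lt_of_apply_le (h : IsRadial Φ μ r) (hρ0 : 0 < ρ)
    (hc : c < μ / 2 * ρ ^ 2) (hz : z ∈ Metric.ball (0 : Cn n) r) (hzc : Φ z ≤ c) : ‖z‖ < ρ := by
  have h1 := (h.le_apply hz).trans hzc
  have h2 : ‖z‖ ^ 2 < ρ ^ 2 := by
    have := h.mu_pos
    by_contra! h3
    have : μ / 2 * ρ ^ 2 ≤ μ / 2 * ‖z‖ ^ 2 := by gcongr
    linarith
  exact lt_of_pow_lt_pow_left₀ 2 hρ0.le h2

theorem exists_smaller (hr : 0 < r) (hc : c < μ / 2 * r ^ 2) :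
    ∃ ρ, 0 < ρ ∧ ρ < r ∧ c < μ / 2 * ρ ^ 2 := by
  have h1 : Tendsto (fun ρ : ℝ => μ / 2 * ρ ^ 2) (𝓝[<] r) (𝓝 (μ / 2 * r ^ 2)) :=
    ((by fun_prop : Continuous fun ρ : ℝ => μ / 2 * ρ ^ 2).tendsto r).mono_left nhdsWithin_le_nhds
  obtain ⟨ρ, h2, h3⟩ := ((h1.eventually (lt_mem_nhds hc)).and (Ioo_mem_nhdsLT hr)).exists
  exact ⟨ρ, h3.1, h3.2, h2⟩

/-- Each ray meets each level set exactly once. -/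
theorem existsUnique_smul (h : IsRadial Φ μ r) (hr : 0 < r) (hc0 : 0 < c) (hc : c < μ / 2 * r ^ 2)
    (hz : z ≠ 0) : ∃! s : ℝ, 0 < s ∧ s • z ∈ Metric.ball (0 : Cn n) r ∧ Φ (s • z) = c := by
  have hz0 : 0 < ‖z‖ := norm_pos_iff.2 hz
  obtain ⟨ρ, hρ0, hρr, hρc⟩ := exists_smaller hr hc
  have h1 : ρ / ‖z‖ ∈ raySet z r := ⟨by positivity, by rwa [div_mul_cancel₀ _ hz0.ne']⟩
  have h2 : c ≤ Φ ((ρ / ‖z‖) • z) := by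
    have h3 := h.le_apply (smul_mem_ball h1)
    rw [norm_smul, Real.norm_of_nonneg h1.1, div_mul_cancel₀ _ hz0.ne'] at h3
    linarith
  obtain ⟨s, hs, hsc⟩ := intermediate_value_Icc h1.1
    ((h.continuousOn_ray z).mono (Icc_subset_raySet h1))
    ⟨by simp only [zero_smul, h.map_zero]; exact hc0.le, h2⟩
  have hsr := Icc_subset_raySet h1 hs
  refine ⟨s, ⟨?_, smul_mem_ball hsr, hsc⟩, ?_⟩
  · refine lt_of_le_of_ne hs.1 fun h0 => ?_
    subst h0
    simp only [zero_smul, h.map_zero] at hsc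
    exact hc0.ne hsc
  · rintro s' ⟨hs0, hs'b, hs'c⟩
    have hs' : s' ∈ raySet z r := ⟨hs0.le, by
      rwa [mem_ball_zero_iff, norm_smul, Real.norm_of_nonneg hs0.le] at hs'b⟩
    exact (h.strictMonoOn hz).injOn hs' hsr (hs'c.trans hsc.symm)

theorem apply_smul_le (h : IsRadial Φ μ r) (hz : z ∈ Metric.ball (0 : Cn n) r) {s : ℝ}
    (hs : s ∈ Icc (0 : ℝ) 1) : Φ (s • z) ≤ Φ z := by
  by_cases hz0 : z = 0
  · rw [hz0, smul_zero]
  have h1 := (h.strictMonoOn hz0).monotoneOn (Icc_subset_raySet (one_mem_raySet hz) hs)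
    (one_mem_raySet hz) hs.2
  simpa using h1

theorem apply_smul_lt (h : IsRadial Φ μ r) (hz : z ∈ Metric.ball (0 : Cn n) r) (hz0 : z ≠ 0) {s : ℝ}
    (hs : s ∈ Ico (0 : ℝ) 1) : Φ (s • z) < Φ z := by
  have h1 := h.strictMonoOn hz0 (Icc_subset_raySet (one_mem_raySet hz) ⟨hs.1, hs.2.le⟩)
    (one_mem_raySet hz) hs.2
  simpa using h1

/-- The sublevel sets are the domains enclosed by the level sets. -/
theorem enclosed_level (h : IsRadial Φ μ r) (hr : 0 < r) (hc0 : 0 < c) (hc : c < μ / 2 * r ^ 2) :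
    enclosed {z | z ∈ Metric.ball (0 : Cn n) r ∧ Φ z = c} =
      {z | z ∈ Metric.ball (0 : Cn n) r ∧ Φ z < c} := by
  set S := {z | z ∈ Metric.ball (0 : Cn n) r ∧ Φ z = c} with hS
  set Ω := {z | z ∈ Metric.ball (0 : Cn n) r ∧ Φ z < c} with hΩ
  obtain ⟨ρ, hρ0, hρr, hρc⟩ := exists_smaller hr hc
  have hΩopen : IsOpen Ω := h.continuousOn.isOpen_inter_preimage Metric.isOpen_ball isOpen_Iio
  have hΩbd : Bornology.IsBounded Ω := Metric.isBounded_ball.subset fun z hz => hz.1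
  have hcompl : IsOpen (Ω ∪ S)ᶜ := by
    have h1 : Ω ∪ S = Metric.closedBall 0 ρ ∩ Φ ⁻¹' Iic c := by
      ext z
      constructor
      · rintro (hz | hz)
        · exact ⟨mem_closedBall_zero_iff.2
            (h.norm_lt_of_apply_le hρ0 hρc hz.1 hz.2.le).le, hz.2.le⟩
        · exact ⟨mem_closedBall_zero_iff.2
            (h.norm_lt_of_apply_le hρ0 hρc hz.1 hz.2.le).le, hz.2.le⟩
      · rintro ⟨hz1, hz2⟩
        have hzr : z ∈ Metric.ball (0 : Cn n) r := Metric.closedBall_subset_ball hρr hz1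
        rcases (show Φ z ≤ c from hz2).lt_or_eq with h2 | h2
        exacts [Or.inl ⟨hzr, h2⟩, Or.inr ⟨hzr, h2⟩]
    rw [h1]
    exact ((h.continuousOn.mono (Metric.closedBall_subset_ball hρr)).preimage_isClosed_of_isClosed
      Metric.isClosed_closedBall isClosed_Iic).isOpen_compl
  have hΩS : Ω ⊆ Sᶜ := fun z hz hz' => hz.2.ne hz'.2
  ext z
  constructor
  · rintro ⟨hzS, hbd⟩
    by_contra hzΩ
    have hout : ∀ s : ℝ, 1 ≤ s → s • z ∈ (Ω ∪ S)ᶜ := by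
      intro s hs hmem
      have h1 : s • z ∈ Metric.ball (0 : Cn n) r ∧ Φ (s • z) ≤ c := by
        rcases hmem with h2 | h2
        exacts [⟨h2.1, h2.2.le⟩, ⟨h2.1, h2.2.le⟩]
      have hs0 : 0 < s := by linarith
      have h2 := h.apply_smul_le h1.1 (s := s⁻¹) ⟨by positivity, inv_le_one_of_one_le₀ hs⟩
      rw [smul_smul, inv_mul_cancel₀ hs0.ne', one_smul] at h2
      have h3 : z ∈ Metric.ball (0 : Cn n) r := by
        have h4 := h1.1
        rw [mem_ball_zero_iff, norm_smul, Real.norm_of_nonneg hs0.le] at h4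
        rw [mem_ball_zero_iff]
        exact (le_mul_of_one_le_left (norm_nonneg z) hs).trans_lt h4
      rcases (h2.trans h1.2).lt_or_eq with h4 | h4
      exacts [hzΩ ⟨h3, h4⟩, hzS ⟨h3, h4⟩]
    have hz0 : z ≠ 0 := by
      rintro rfl
      exact hzΩ ⟨Metric.mem_ball_self hr, by rw [h.map_zero]; exact hc0⟩
    have hsub : (fun s : ℝ => s • z) '' Ici 1 ⊆ connectedComponentIn Sᶜ z := by
      refine IsPreconnected.subset_connectedComponentIn ?_ ⟨1, self_mem_Ici, one_smul _ _⟩ ?_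
      · exact isPreconnected_Ici.image _ (by fun_prop)
      · rintro _ ⟨s, hs, rfl⟩ hsS
        exact hout s hs (Or.inr hsS)
    obtain ⟨C, hC⟩ := (hbd.subset hsub).exists_norm_le
    have hz1 : 0 < ‖z‖ := norm_pos_iff.2 hz0
    have h1 := hC _ ⟨max 1 ((C + 1) / ‖z‖), mem_Ici.2 (le_max_left _ _), rfl⟩
    rw [norm_smul, Real.norm_of_nonneg (le_trans zero_le_one (le_max_left _ _))] at h1
    have h2 : (C + 1) / ‖z‖ * ‖z‖ ≤ max 1 ((C + 1) / ‖z‖) * ‖z‖ := by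
      gcongr
      exact le_max_right _ _
    rw [div_mul_cancel₀ _ hz1.ne'] at h2
    linarith
  · intro hz
    refine ⟨hΩS hz, hΩbd.subset ?_⟩
    refine isPreconnected_connectedComponentIn.subset_left_of_subset_union hΩopen hcompl
      (disjoint_left.2 fun x hx hx' => hx' (Or.inl hx)) ?_ ⟨z, mem_connectedComponentIn (hΩS hz), hz⟩
    intro x hx
    have h1 := connectedComponentIn_subset _ _ hx
    by_cases h2 : x ∈ Ω
    exacts [Or.inl h2, Or.inr fun h3 => h3.elim h2 h1]

theorem closure_sublevel (h : IsRadial Φ μ r) (hr : 0 < r) (hc0 : 0 < c)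
    (hc : c < μ / 2 * r ^ 2) : closure {z | z ∈ Metric.ball (0 : Cn n) r ∧ Φ z < c} =
      {z | z ∈ Metric.ball (0 : Cn n) r ∧ Φ z ≤ c} := by
  obtain ⟨ρ, hρ0, hρr, hρc⟩ := exists_smaller hr hc
  refine Subset.antisymm ?_ ?_
  · have h1 : IsClosed (Metric.closedBall 0 ρ ∩ Φ ⁻¹' Iic c) :=
      (h.continuousOn.mono (Metric.closedBall_subset_ball hρr)).preimage_isClosed_of_isClosed
        Metric.isClosed_closedBall isClosed_Iic
    refine (closure_minimal (fun z hz => ?_) h1).trans fun z hz =>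
      ⟨Metric.closedBall_subset_ball hρr hz.1, hz.2⟩
    exact ⟨mem_closedBall_zero_iff.2 (h.norm_lt_of_apply_le hρ0 hρc hz.1 hz.2.le).le,
      hz.2.le⟩
  · rintro z ⟨hz, hzc⟩
    by_cases hz0 : z = 0
    · subst hz0
      exact subset_closure ⟨hz, by rw [h.map_zero]; exact hc0⟩
    · have h1 : Tendsto (fun s : ℝ => s • z) (𝓝[<] 1) (𝓝 z) := by
        have : Tendsto (fun s : ℝ => s • z) (𝓝 1) (𝓝 ((1 : ℝ) • z)) :=
          (by fun_prop : Continuous fun s : ℝ => s • z).tendsto 1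
        rw [one_smul] at this
        exact this.mono_left nhdsWithin_le_nhds
      refine mem_closure_of_tendsto h1 ?_
      filter_upwards [Ioo_mem_nhdsLT (zero_lt_one (α := ℝ))] with s hs
      exact ⟨smul_mem_ball (Icc_subset_raySet (one_mem_raySet hz) ⟨hs.1.le, hs.2.le⟩),
        (h.apply_smul_lt hz hz0 ⟨hs.1.le, hs.2⟩).trans_le hzc⟩

theorem puncturedRegion_eq (h : IsRadial Φ μ r) (hr : 0 < r) {S : ℝ → Set (Cn n)} {R : ℝ}
    (hR : R ^ 2 ≤ μ / 2 * r ^ 2) (hR0 : 0 < R)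
    (hS : ∀ s, 0 < s → s < R → S s = {z | z ∈ Metric.ball (0 : Cn n) r ∧ Φ z = s ^ 2}) :
    puncturedRegion S R =
      {p | p.1 ∈ Metric.ball (0 : Cn n) r ∧ 0 < p.2 ∧ p.2 < R ^ 2 ∧ Φ p.1 ≤ p.2} := by
  have key : ∀ s, 0 < s → s < R → closure (enclosed (S s)) =
      {z | z ∈ Metric.ball (0 : Cn n) r ∧ Φ z ≤ s ^ 2} := fun s hs hsR => by
    have h1 : s ^ 2 < μ / 2 * r ^ 2 := lt_of_lt_of_le (by gcongr) hR
    rw [hS s hs hsR, h.enclosed_level hr (by positivity) h1,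
      h.closure_sublevel hr (by positivity) h1]
  ext p
  constructor
  · rintro ⟨s, hs, hsR, hp, hmem⟩
    rw [key s hs hsR] at hmem
    refine ⟨hmem.1, ?_, ?_, ?_⟩ <;> rw [hp]
    · positivity
    · gcongr
    · exact hmem.2
  · rintro ⟨h1, h2, h3, h4⟩
    have hs : 0 < Real.sqrt p.2 := Real.sqrt_pos.2 h2
    have hsR : Real.sqrt p.2 < R := (Real.sqrt_lt' hR0).2 h3
    have hsq : p.2 = Real.sqrt p.2 ^ 2 := (Real.sq_sqrt h2.le).symm
    refine ⟨Real.sqrt p.2, hs, hsR, hsq, ?_⟩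
    rw [key _ hs hsR, ← hsq]
    exact ⟨h1, h4⟩

end IsRadial

end RadialFunctions

section Leaves

variable {n : ℕ}

theorem TangentiallyJoined.apply_eq {D : Cn n → Submodule ℝ (Cn n)} {W : Set (Cn n)}
    {H : Cn n → ℝ} (hH : ∀ z ∈ W, DifferentiableAt ℝ H z ∧ ∀ v ∈ D z, fderiv ℝ H z v = 0)
    {x y : Cn n} (h : TangentiallyJoined D W x y) : H y = H x := by
  obtain ⟨γ, hγ, h0, h1, ht⟩ := h
  have hd : ∀ t ∈ Icc (0 : ℝ) 1, HasDerivWithinAt (fun t => H (γ t)) 0 (Icc 0 1) t := by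
    intro t hti
    obtain ⟨hW, hD⟩ := ht t hti
    obtain ⟨e1, e2⟩ := hH _ hW
    have e3 := ((hγ.differentiableOn (by simp)) t hti).hasDerivWithinAt
    have e4 := e1.hasFDerivAt.comp_hasDerivWithinAt t e3
    rw [e2 _ hD] at e4
    exact e4
  have h2 := constant_of_has_deriv_right_zero (f := fun t => H (γ t)) (a := 0) (b := 1)
    (fun t ht => (hd t ht).continuousWithinAt)
    (fun t ht => ((hd t ⟨ht.1, ht.2.le⟩).mono_of_mem_nhdsWithin
      (Icc_mem_nhdsGE_of_mem ht))) 1 (right_mem_Icc.2 zero_le_one)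
  simpa [h0, h1] using h2

theorem apply_eq_of_mem_leaf {D : Cn n → Submodule ℝ (Cn n)} {W : Set (Cn n)}
    {H : Cn n → ℝ} (hH : ∀ z ∈ W, DifferentiableAt ℝ H z ∧ ∀ v ∈ D z, fderiv ℝ H z v = 0)
    {x y : Cn n} (h : y ∈ leaf D W x) : H y = H x := by
  have h1 := h.2
  clear h
  induction h1 with
  | refl => rfl
  | tail _ h2 ih => exact (h2.apply_eq hH).trans ih

end Leaves

section RayDiffeomorphism

variable {n m : ℕ} {G H : Cn n → ℝ} {μ r : ℝ}

/-- The sublevel region `{(z, u) : Φ z ≤ u}`, `0 < u < R²`. -/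
def sublevelRegion (Φ : Cn n → ℝ) (ρ R : ℝ) : Set (Cn n × ℝ) :=
  {p | p.1 ∈ Metric.ball (0 : Cn n) ρ ∧ 0 < p.2 ∧ p.2 < R ^ 2 ∧ Φ p.1 ≤ p.2}

theorem IsRadial.norm_le_of_apply_le (h : IsRadial G μ r) {z : Cn n}
    (hz : z ∈ Metric.ball (0 : Cn n) r) {u : ℝ} (hu : G z ≤ u) :
    ‖z‖ ≤ Real.sqrt (2 / μ) * Real.sqrt u := by
  have h1 := (h.le_apply hz).trans hu
  have hμ := h.mu_pos
  rw [← Real.sqrt_mul (by positivity)]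
  refine Real.le_sqrt_of_sq_le ?_
  calc ‖z‖ ^ 2 = 2 / μ * (μ / 2 * ‖z‖ ^ 2) := by field_simp
    _ ≤ 2 / μ * u := by gcongr

/-- The map `(z, u) ↦ ((1 + θ) z, u)`. -/
noncomputable def rayMap (θ : Cn n × ℝ → ℝ) (p : Cn n × ℝ) : Cn n × ℝ := (p.1 + θ p • p.1, p.2)

/-- Conditions under which `rayMap θ` takes the sublevel sets of `G` to those of `H`. -/
structure IsRayDeformation (m : ℕ) (G H : Cn n → ℝ) (μ r : ℝ) (θ : Cn n × ℝ → ℝ) (a δ : ℝ) : Prop where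
  radial_left : IsRadial G μ r
  radial_right : IsRadial H μ r
  sqrt_lt : Real.sqrt (2 / μ) < a
  smooth : ∀ p : Cn n × ℝ, 0 < p.2 → p.2 < δ ^ 2 → ‖p.1‖ < a * Real.sqrt p.2 →
    ContDiffAt ℝ m (fun p => θ p • p.1) p
  lipschitz : ∀ u, 0 < u → u < δ ^ 2 → ∀ z z' : Cn n, ‖z‖ < a * Real.sqrt u →
    ‖z'‖ < a * Real.sqrt u → ‖θ (z, u) • z - θ (z', u) • z'‖ ≤ 1 / 2 * ‖z - z'‖
  abs_le : ∀ p, |θ p| ≤ 1 / 4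
  level : ∀ u, 0 < u → u < δ ^ 2 → ∀ z : Cn n, ‖z‖ < a * Real.sqrt u → G z = u →
    H (z + θ (z, u) • z) = u
  delta_pos : 0 < δ
  delta_le : 2 * a * δ ≤ r
  m_ne_zero : m ≠ 0

namespace IsRayDeformation

variable {θ : Cn n × ℝ → ℝ} {a δ ρ R : ℝ}

theorem a_pos (h : IsRayDeformation m G H μ r θ a δ) : 0 < a :=
  (Real.sqrt_nonneg _).trans_lt h.sqrt_lt

/-- A region on which `rayMap` is injective. -/
def dom (a δ : ℝ) : Set (Cn n × ℝ) := {p | 0 < p.2 ∧ p.2 < δ ^ 2 ∧ ‖p.1‖ < a * Real.sqrt p.2}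

theorem isOpen_dom : IsOpen (dom a δ : Set (Cn n × ℝ)) := by
  refine IsOpen.inter (isOpen_lt continuous_const continuous_snd) (IsOpen.inter
    (isOpen_lt continuous_snd continuous_const) ?_)
  exact isOpen_lt (f := fun p : Cn n × ℝ => ‖p.1‖) (g := fun p => a * Real.sqrt p.2)
    (by fun_prop) (by fun_prop)

theorem mem_dom_of_le (h : IsRayDeformation m G H μ r θ a δ) {Φ : Cn n → ℝ} (hΦ : IsRadial Φ μ r)
    {p : Cn n × ℝ} (hp : p.1 ∈ Metric.ball (0 : Cn n) r) (h0 : 0 < p.2) (h1 : p.2 < δ ^ 2)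
    (h2 : Φ p.1 ≤ p.2) : p ∈ dom a δ := by
  refine ⟨h0, h1, (hΦ.norm_le_of_apply_le hp h2).trans_lt ?_⟩
  have := Real.sqrt_pos.2 h0
  have := h.sqrt_lt
  gcongr

theorem injOn (h : IsRayDeformation m G H μ r θ a δ) : InjOn (rayMap θ) (dom a δ) := by
  rintro ⟨z, u⟩ ⟨h1, h2, h3⟩ ⟨z', u'⟩ ⟨-, -, h3'⟩ heq
  simp only [rayMap, Prod.mk.injEq] at heq
  obtain ⟨heq, rfl⟩ := heq
  have h4 := h.lipschitz u h1 h2 z z' h3 h3'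
  have h5 : θ (z, u) • z - θ (z', u) • z' = -(z - z') := by
    rw [sub_eq_sub_iff_add_eq_add.2 ?_]
    · exact neg_sub _ _ |>.symm
    · rw [add_comm, heq, add_comm]
  rw [h5, norm_neg] at h4
  have h6 : ‖z - z'‖ ≤ 0 := by linarith [norm_nonneg (z - z')]
  rw [sub_eq_zero.1 (norm_le_zero_iff.1 h6)]

theorem contDiffAt (h : IsRayDeformation m G H μ r θ a δ) {p : Cn n × ℝ} (hp : p ∈ dom a δ) :
    ContDiffAt ℝ m (rayMap θ) p :=
  (contDiffAt_fst.add (h.smooth p hp.1 hp.2.1 hp.2.2)).prodMk contDiffAt_snd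

theorem exists_equiv (h : IsRayDeformation m G H μ r θ a δ) {p : Cn n × ℝ} (hp : p ∈ dom a δ) :
    ∃ L : (Cn n × ℝ) ≃L[ℝ] (Cn n × ℝ), HasFDerivAt (rayMap θ) (L : (Cn n × ℝ) →L[ℝ] (Cn n × ℝ)) p := by
  have hm : (m : WithTop ℕ∞) ≠ 0 := by exact_mod_cast h.m_ne_zero
  set A := fderiv ℝ (fun p => θ p • p.1) p
  have hA : HasFDerivAt (fun p => θ p • p.1) A p :=
    ((h.smooth p hp.1 hp.2.1 hp.2.2).differentiableAt hm).hasFDerivAt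
  have hF : HasFDerivAt (rayMap θ) ((ContinuousLinearMap.fst ℝ (Cn n) ℝ + A).prod
    (ContinuousLinearMap.snd ℝ (Cn n) ℝ)) p := (hasFDerivAt_fst.add hA).prodMk hasFDerivAt_snd
  have hle : ‖A.comp (ContinuousLinearMap.inl ℝ (Cn n) ℝ)‖ ≤ 1 / 2 := by
    have h1 : HasFDerivAt (fun z : Cn n => θ (z, p.2) • z)
        (A.comp (ContinuousLinearMap.inl ℝ (Cn n) ℝ)) p.1 :=
      HasFDerivAt.comp (g := fun p : Cn n × ℝ => θ p • p.1) p.1 hA (hasFDerivAt_prodMk_left p.1 p.2)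
    have hopen : IsOpen {z : Cn n | ‖z‖ < a * Real.sqrt p.2} :=
      isOpen_lt continuous_norm continuous_const
    refine h1.le_of_lipschitzOn (C := 1 / 2) (hopen.mem_nhds hp.2.2)
      (LipschitzOnWith.of_dist_le_mul fun z hz z' hz' => ?_)
    simpa [dist_eq_norm] using h.lipschitz p.2 hp.1 hp.2.1 z z' hz hz'
  have hinj : Function.Injective ((ContinuousLinearMap.fst ℝ (Cn n) ℝ + A).prod
      (ContinuousLinearMap.snd ℝ (Cn n) ℝ)) := by
    rw [injective_iff_map_eq_zero]
    rintro ⟨w, v⟩ hwv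
    have h1 : w + A (w, v) = 0 := congrArg Prod.fst hwv
    obtain rfl : v = 0 := congrArg Prod.snd hwv
    have h2 := (A.comp (ContinuousLinearMap.inl ℝ (Cn n) ℝ)).le_of_opNorm_le hle w
    have h3 : A.comp (ContinuousLinearMap.inl ℝ (Cn n) ℝ) w = -w := by
      rw [ContinuousLinearMap.comp_apply, ContinuousLinearMap.inl_apply]
      exact eq_neg_of_add_eq_zero_right h1
    rw [h3, norm_neg] at h2
    have h4 : ‖w‖ ≤ 0 := by linarith [norm_nonneg w]
    rw [norm_le_zero_iff.1 h4]
    rfl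
  refine ⟨(LinearEquiv.ofInjectiveEndo _ hinj).toContinuousLinearEquiv, ?_⟩
  have h5 : (((LinearEquiv.ofInjectiveEndo _ hinj).toContinuousLinearEquiv :
      (Cn n × ℝ) ≃L[ℝ] (Cn n × ℝ)) : (Cn n × ℝ) →L[ℝ] (Cn n × ℝ)) =
      (ContinuousLinearMap.fst ℝ (Cn n) ℝ + A).prod (ContinuousLinearMap.snd ℝ (Cn n) ℝ) := by
    exact ContinuousLinearMap.ext fun x => rfl
  rw [h5]
  exact hF

/-- The radial factor of the deformation increases along rays. -/
theorem ray_lt (h : IsRayDeformation m G H μ r θ a δ) {u : ℝ} (h0 : 0 < u) (h1 : u < δ ^ 2) {z : Cn n}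
    (hz : z ≠ 0) {s s' : ℝ} (hs0 : 0 ≤ s) (hs : s < s') (hs' : ‖s' • z‖ < a * Real.sqrt u) :
    s * (1 + θ (s • z, u)) < s' * (1 + θ (s' • z, u)) := by
  have hz0 : 0 < ‖z‖ := norm_pos_iff.2 hz
  have h2 : ‖s • z‖ < a * Real.sqrt u := by
    refine lt_of_le_of_lt ?_ hs'
    rw [norm_smul, norm_smul, Real.norm_of_nonneg hs0, Real.norm_of_nonneg (hs0.trans hs.le)]
    gcongr
  have h3 := h.lipschitz u h0 h1 _ _ hs' h2
  rw [smul_smul, smul_smul, ← sub_smul, ← sub_smul, norm_smul, norm_smul, Real.norm_eq_abs,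
    Real.norm_of_nonneg (sub_nonneg.2 hs.le), ← mul_assoc] at h3
  have h4 := (_root_.abs_le.1 (le_of_mul_le_mul_right h3 hz0)).1
  nlinarith

theorem one_add_pos (h : IsRayDeformation m G H μ r θ a δ) (p : Cn n × ℝ) : 0 < 1 + θ p := by
  linarith [(_root_.abs_le.1 (h.abs_le p)).1]

theorem rayMap_eq (θ : Cn n × ℝ → ℝ) (p : Cn n × ℝ) : rayMap θ p = ((1 + θ p) • p.1, p.2) := by
  rw [rayMap, add_smul, one_smul]

theorem norm_smul_lt (h : IsRayDeformation m G H μ r θ a δ) {u : ℝ} (h1 : u < δ ^ 2) {z : Cn n}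
    (hz : ‖z‖ < a * Real.sqrt u) : ‖(1 + θ (z, u)) • z‖ < r := by
  have h2 : Real.sqrt u ≤ δ := (Real.sqrt_le_sqrt h1.le).trans_eq (Real.sqrt_sq h.delta_pos.le)
  have h3 : a * Real.sqrt u ≤ a * δ := by
    have := h.a_pos
    gcongr
  rw [norm_smul, Real.norm_of_nonneg (h.one_add_pos _).le]
  have h4 := (_root_.abs_le.1 (h.abs_le (z, u))).2
  have h5 := h.delta_le
  nlinarith [norm_nonneg z]

theorem u_lt (h : IsRayDeformation m G H μ r θ a δ) {u : ℝ} (h1 : u < δ ^ 2) :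
    u < μ / 2 * r ^ 2 := by
  have hμ := h.radial_left.mu_pos
  have ha := h.a_pos
  have h2 : 2 / μ < a ^ 2 := by
    have h3 := h.sqrt_lt
    rwa [Real.sqrt_lt' ha] at h3
  have h4 : (2 * a * δ) ^ 2 ≤ r ^ 2 := by
    have := h.delta_le
    have := h.delta_pos
    gcongr
  have h5 : 1 < μ / 2 * a ^ 2 := by
    rw [div_lt_iff₀ hμ] at h2
    linarith
  have h6 : μ / 2 * (2 * a * δ) ^ 2 ≤ μ / 2 * r ^ 2 := by gcongr
  have h7 := h.delta_pos
  nlinarith [pow_pos h7 2]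

/-- The outermost point of `{G ≤ u}` on a ray. -/
theorem exists_level_smul (h : IsRayDeformation m G H μ r θ a δ) {u : ℝ} (h0 : 0 < u)
    (h1 : u < δ ^ 2) {z : Cn n} (hz : z ≠ 0) : ∃ s : ℝ, 0 < s ∧ ‖s • z‖ < r ∧
      ‖s • z‖ < a * Real.sqrt u ∧ G (s • z) = u ∧ H ((s * (1 + θ (s • z, u))) • z) = u ∧
      ‖(s * (1 + θ (s • z, u))) • z‖ < r := by
  have hr : 0 < r := by
    have := h.delta_le
    have := h.delta_pos
    have := h.a_pos
    have : 0 < 2 * a * δ := by positivity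
    linarith
  obtain ⟨s, ⟨hs0, hsb, hsG⟩, -⟩ := h.radial_left.existsUnique_smul hr h0 (h.u_lt h1) hz
  have h2 := (h.mem_dom_of_le h.radial_left (p := (s • z, u)) hsb h0 h1 hsG.le).2.2
  have h3 := h.level u h0 h1 _ h2 hsG
  have h4 : s • z + θ (s • z, u) • s • z = (s * (1 + θ (s • z, u))) • z := by
    rw [smul_smul, ← add_smul]
    congr 1
    ring
  refine ⟨s, hs0, by simpa using hsb, h2, hsG, by rwa [← h4], ?_⟩
  have h5 := h.norm_smul_lt h1 h2
  rwa [smul_smul, mul_comm] at h5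

theorem mapsTo (h : IsRayDeformation m G H μ r θ a δ) (hρ : 0 < ρ) (hρr : ρ ≤ r) (hRδ : R ≤ δ)
    (hR0 : 0 < R) (hR : R ^ 2 ≤ μ / 2 * ρ ^ 2) :
    MapsTo (rayMap θ) (sublevelRegion G ρ R) (sublevelRegion H ρ R) := by
  rintro ⟨z, u⟩ ⟨hz, hu0, huR, hzu⟩
  simp only at hz hu0 huR hzu
  have hu1 : u < δ ^ 2 := huR.trans_le (by gcongr)
  have hzr := Metric.ball_subset_ball hρr hz
  rw [rayMap_eq]
  have hzd := (h.mem_dom_of_le h.radial_left (p := (z, u)) hzr hu0 hu1 hzu).2.2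
  have hnr := h.norm_smul_lt hu1 hzd
  have key : H ((1 + θ (z, u)) • z) ≤ u := by
    by_cases hz0 : z = 0
    · rw [hz0, smul_zero, h.radial_right.map_zero]
      exact hu0.le
    obtain ⟨s, hs0, hsr, hsa, hsG, hsH, hsr'⟩ := h.exists_level_smul hu0 hu1 hz0
    have h1 : 1 ≤ s := by
      by_contra! hlt
      have h2 := h.radial_left.apply_smul_lt hzr hz0 ⟨hs0.le, hlt⟩
      rw [hsG] at h2
      linarith
    have h2 : 1 + θ (z, u) ≤ s * (1 + θ (s • z, u)) := by
      rcases h1.eq_or_lt with rfl | h1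
      · simp
      · have h3 := h.ray_lt hu0 hu1 hz0 zero_le_one h1 hsa
        rw [one_mul, one_smul] at h3
        exact h3.le
    refine le_trans ?_ hsH.le
    have h3 := (h.radial_right.strictMonoOn hz0).monotoneOn (a := 1 + θ (z, u))
      (b := s * (1 + θ (s • z, u))) ⟨(h.one_add_pos _).le, ?_⟩ ⟨?_, ?_⟩ h2
    · exact h3
    · rwa [norm_smul, Real.norm_of_nonneg (h.one_add_pos _).le] at hnr
    · exact mul_nonneg hs0.le (h.one_add_pos _).le
    · rwa [norm_smul, Real.norm_of_nonneg (mul_nonneg hs0.le (h.one_add_pos _).le)] at hsr'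
  refine ⟨?_, hu0, huR, key⟩
  rw [mem_ball_zero_iff]
  exact h.radial_right.norm_lt_of_apply_le hρ (huR.trans_le hR) (mem_ball_zero_iff.2 hnr) key

theorem surjOn (h : IsRayDeformation m G H μ r θ a δ) (hρ : 0 < ρ) (hρr : ρ ≤ r) (hRδ : R ≤ δ)
    (hR0 : 0 < R) (hR : R ^ 2 ≤ μ / 2 * ρ ^ 2) :
    SurjOn (rayMap θ) (sublevelRegion G ρ R) (sublevelRegion H ρ R) := by
  rintro ⟨w, u⟩ ⟨hw, hu0, huR, hwu⟩
  simp only at hw hu0 huR hwu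
  have hu1 : u < δ ^ 2 := huR.trans_le (by gcongr)
  have hwr := Metric.ball_subset_ball hρr hw
  by_cases hw0 : w = 0
  · subst hw0
    refine ⟨(0, u), ⟨hw, hu0, huR, ?_⟩, by simp [rayMap]⟩
    simp only [h.radial_left.map_zero]
    exact hu0.le
  obtain ⟨s, hs0, hsr, hsa, hsG, hsH, hsr'⟩ := h.exists_level_smul hu0 hu1 hw0
  have hw1 : 0 < ‖w‖ := norm_pos_iff.2 hw0
  have h1 : 1 ≤ s * (1 + θ (s • w, u)) := by
    by_contra! hlt
    have h2 := h.radial_right.apply_smul_lt hwr hw0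
      ⟨mul_nonneg hs0.le (h.one_add_pos (s • w, u)).le, hlt⟩
    rw [hsH] at h2
    linarith
  have hnle : ∀ s' ∈ Icc 0 s, ‖s' • w‖ ≤ ‖s • w‖ := fun s' hs' => by
    rw [norm_smul, norm_smul, Real.norm_of_nonneg hs'.1, Real.norm_of_nonneg hs0.le]
    have := hs'.2
    gcongr
  have hcont : ContinuousOn (fun s' : ℝ => ‖(rayMap θ (s' • w, u)).1‖) (Icc 0 s) := by
    intro s' hs'
    have h2 : (s' • w, u) ∈ dom a δ := ⟨hu0, hu1, (hnle s' hs').trans_lt hsa⟩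
    have h3 := (h.contDiffAt h2).continuousAt
    have h4 : ContinuousAt (fun s' : ℝ => rayMap θ (s' • w, u)) s' :=
      ContinuousAt.comp (f := fun s' : ℝ => (s' • w, u)) h3 (by fun_prop)
    exact h4.fst.norm.continuousWithinAt
  have hnorm : ∀ s', 0 ≤ s' → ‖(rayMap θ (s' • w, u)).1‖ = s' * (1 + θ (s' • w, u)) * ‖w‖ :=
    fun s' hs' => by
      rw [rayMap_eq, smul_smul, norm_smul, mul_comm (1 + _), Real.norm_of_nonneg
        (mul_nonneg hs' (h.one_add_pos _).le)]
  have hmem : ‖w‖ ∈ Icc ‖(rayMap θ ((0 : ℝ) • w, u)).1‖ ‖(rayMap θ (s • w, u)).1‖ := by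
    rw [hnorm 0 le_rfl, hnorm s hs0.le, zero_mul, zero_mul]
    exact ⟨hw1.le, le_mul_of_one_le_left hw1.le h1⟩
  obtain ⟨s', hs', hs'w⟩ := intermediate_value_Icc hs0.le hcont hmem
  simp only [hnorm s' hs'.1] at hs'w
  have h2 : s' * (1 + θ (s' • w, u)) = 1 := by
    have h3 : s' * (1 + θ (s' • w, u)) * ‖w‖ = 1 * ‖w‖ := by rw [hs'w, one_mul]
    exact mul_right_cancel₀ hw1.ne' h3
  have hs'G : G (s' • w) ≤ u := by
    have h3 := (h.radial_left.strictMonoOn hw0).monotoneOn (a := s') (b := s) ⟨hs'.1, ?_⟩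
      ⟨hs0.le, ?_⟩ hs'.2
    · exact h3.trans_eq hsG
    · have := (hnle s' hs').trans_lt hsr
      rwa [norm_smul, Real.norm_of_nonneg hs'.1] at this
    · rwa [norm_smul, Real.norm_of_nonneg hs0.le] at hsr
  refine ⟨(s' • w, u), ⟨?_, hu0, huR, hs'G⟩, ?_⟩
  · rw [mem_ball_zero_iff]
    exact h.radial_left.norm_lt_of_apply_le hρ (huR.trans_le hR)
      (mem_ball_zero_iff.2 ((hnle s' hs').trans_lt hsr)) hs'G
  · rw [rayMap_eq, smul_smul, mul_comm, h2, one_smul]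

theorem isCkDiffeo (h : IsRayDeformation m G H μ r θ a δ) (hρ : 0 < ρ) (hρr : ρ ≤ r) (hRδ : R ≤ δ)
    (hR0 : 0 < R) (hR : R ^ 2 ≤ μ / 2 * ρ ^ 2) :
    IsCkDiffeo m (rayMap θ) (Function.invFunOn (rayMap θ) (sublevelRegion G ρ R))
      (sublevelRegion G ρ R) (sublevelRegion H ρ R) := by
  have hm : (m : WithTop ℕ∞) ≠ 0 := by exact_mod_cast h.m_ne_zero
  have hmaps := h.mapsTo hρ hρr hRδ hR0 hR
  have hsurj := h.surjOn hρ hρr hRδ hR0 hR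
  have hsub : sublevelRegion G ρ R ⊆ dom a δ := fun p hp =>
    h.mem_dom_of_le h.radial_left (Metric.ball_subset_ball hρr hp.1) hp.2.1
      (hp.2.2.1.trans_le (by gcongr)) hp.2.2.2
  have hinj : InjOn (rayMap θ) (sublevelRegion G ρ R) := h.injOn.mono hsub
  have hinv : ∀ q ∈ sublevelRegion H ρ R,
      Function.invFunOn (rayMap θ) (sublevelRegion G ρ R) q ∈ sublevelRegion G ρ R ∧
      rayMap θ (Function.invFunOn (rayMap θ) (sublevelRegion G ρ R) q) = q := fun q hq =>
    ⟨Function.invFunOn_mem (hsurj hq), Function.invFunOn_eq (hsurj hq)⟩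
  refine ⟨hmaps, fun q hq => (hinv q hq).1, ⟨fun p hp => hinj.leftInvOn_invFunOn hp,
    fun q hq => (hinv q hq).2⟩, fun p hp => (h.contDiffAt (hsub hp)).contDiffWithinAt,
    fun q hq => ?_⟩
  obtain ⟨hp, hpq⟩ := hinv q hq
  set p := Function.invFunOn (rayMap θ) (sublevelRegion G ρ R) q with hpdef
  obtain ⟨L, hL⟩ := h.exists_equiv (hsub hp)
  have hcd := h.contDiffAt (hsub hp)
  have hstrict := hcd.hasStrictFDerivAt' hL hm
  have hψ := hcd.to_localInverse hL hm
  rw [hpq] at hψ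
  have h1 : hcd.localInverse hL hm q = p := by
    conv_lhs => rw [← hpq]
    exact hcd.localInverse_apply_image hL hm
  have h2 : ∀ᶠ q' in 𝓝 q, hcd.localInverse hL hm q' ∈ dom a δ :=
    hψ.continuousAt.eventually (isOpen_dom.mem_nhds (by rw [h1]; exact hsub hp))
  have h3 : ∀ᶠ q' in 𝓝 q, rayMap θ (hcd.localInverse hL hm q') = q' := by
    have := hstrict.eventually_right_inverse
    rwa [hpq] at this
  refine hψ.contDiffWithinAt.congr_of_eventuallyEq ?_ (hpdef.symm.trans h1.symm)
  filter_upwards [nhdsWithin_le_nhds h2, nhdsWithin_le_nhds h3, self_mem_nhdsWithin] with q' e2 e3 e4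
  exact h.injOn (hsub (hinv q' e4).1) e2 ((hinv q' e4).2.trans e3.symm)

end IsRayDeformation

end RayDiffeomorphism

section ParabolicScaling

variable {n m : ℕ}

/-- The parabolic dilation `(z, u) ↦ (t z, t² u)`. -/
noncomputable def parabolicEquiv (n : ℕ) {t : ℝ} (ht : t ≠ 0) : (Cn n × ℝ) ≃L[ℝ] (Cn n × ℝ) :=
  (dilationEquiv (Cn n) ht).prodCongr (dilationEquiv ℝ (pow_ne_zero 2 ht))

@[simp]
theorem parabolicEquiv_apply {t : ℝ} (ht : t ≠ 0) (p : Cn n × ℝ) :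
    parabolicEquiv n ht p = (t • p.1, t ^ 2 * p.2) := rfl

/-- The domain of the rescalings of a deformation. -/
def scalingDom (n : ℕ) (A : ℝ) : Set (Cn n × ℝ) := Metric.ball 0 A ×ˢ Ioo (1 / 2) 2

theorem isOpen_scalingDom (n : ℕ) (A : ℝ) : IsOpen (scalingDom n A) :=
  Metric.isOpen_ball.prod isOpen_Ioo

/-- The parabolic rescalings of `(z, u) ↦ θ (z, u) z`, divided by `tᵐ⁺¹`, form a smooth family that
vanishes for `t = 0`. -/
structure IsParabolic (m : ℕ) (θ : Cn n × ℝ → ℝ) (A δ : ℝ) (Θ : ℝ → Cn n × ℝ → Cn n) : Prop where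
  pos : 0 < δ
  smoothFam : SmoothFam m (scalingDom n A) (fun d : unitInterval => Θ (δ * d))
  zero : ∀ p ∈ scalingDom n A, Θ 0 p = 0
  eq : ∀ t ∈ Ioc 0 δ, ∀ p ∈ scalingDom n A,
    θ (t • p.1, t ^ 2 * p.2) • t • p.1 = t ^ (m + 1) • Θ t p

namespace IsParabolic

variable {θ : Cn n × ℝ → ℝ} {a A δ : ℝ} {Θ : ℝ → Cn n × ℝ → Cn n}

theorem contDiffOn (h : IsParabolic m θ A δ Θ) {t : ℝ} (ht : t ∈ Icc 0 δ) :
    ContDiffOn ℝ m (Θ t) (scalingDom n A) := by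
  have h1 := h.smoothFam.contDiffOn_slice
    (⟨t / δ, div_nonneg ht.1 h.pos.le, (div_le_one h.pos).2 ht.2⟩ : unitInterval)
  simpa only [mul_div_cancel₀ t h.pos.ne'] using h1

theorem comp_eventuallyEq (h : IsParabolic m θ A δ Θ) {t : ℝ} (ht : t ∈ Ioc 0 δ) {p : Cn n × ℝ}
    (hp : p ∈ scalingDom n A) :
    (fun q => (fun q : Cn n × ℝ => θ q • q.1) (parabolicEquiv n ht.1.ne' q)) =ᶠ[𝓝 p]
      fun q => t ^ (m + 1) • Θ t q := by
  filter_upwards [(isOpen_scalingDom n A).mem_nhds hp] with q hq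
  exact h.eq t ht q hq

theorem contDiffAt (h : IsParabolic m θ A δ Θ) {t : ℝ} (ht : t ∈ Ioc 0 δ) {p : Cn n × ℝ}
    (hp : p ∈ scalingDom n A) :
    ContDiffAt ℝ m (fun q => θ q • q.1) (parabolicEquiv n ht.1.ne' p) := by
  have h1 : ContDiffAt ℝ m (fun q => t ^ (m + 1) • Θ t q) p :=
    ((h.contDiffOn ⟨ht.1.le, ht.2⟩).contDiffAt ((isOpen_scalingDom n A).mem_nhds hp)).const_smul _
  have h2 := h1.congr_of_eventuallyEq (h.comp_eventuallyEq ht hp)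
  have h3 : ContDiffAt ℝ m (fun q => (fun q : Cn n × ℝ => θ q • q.1) (parabolicEquiv n ht.1.ne'
      ((parabolicEquiv n ht.1.ne').symm q))) (parabolicEquiv n ht.1.ne' p) := by
    refine ContDiffAt.comp (g := fun q => (fun q : Cn n × ℝ => θ q • q.1) (parabolicEquiv n ht.1.ne' q))
      _ ?_ (parabolicEquiv n ht.1.ne').symm.contDiff.contDiffAt
    rwa [ContinuousLinearEquiv.symm_apply_apply]
  simpa only [ContinuousLinearEquiv.apply_symm_apply] using h3

theorem mem_scalingDom {u : ℝ} (hu : 0 < u) {z : Cn n} (hz : ‖z‖ < A * Real.sqrt u) :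
    (((Real.sqrt u)⁻¹ • z, 1) : Cn n × ℝ) ∈ scalingDom n A := by
  have := Real.sqrt_pos.2 hu
  refine ⟨?_, by norm_num, by norm_num⟩
  rw [mem_ball_zero_iff, norm_smul, Real.norm_of_nonneg (by positivity), inv_mul_lt_iff₀ this, mul_comm]
  exact hz

theorem smul_inv_eq {u : ℝ} (hu : 0 < u) (z : Cn n) :
    ((Real.sqrt u • (Real.sqrt u)⁻¹ • z, Real.sqrt u ^ 2 * 1) : Cn n × ℝ) = (z, u) := by
  have := Real.sqrt_pos.2 hu
  rw [smul_smul, mul_inv_cancel₀ this.ne', one_smul, mul_one, Real.sq_sqrt hu.le]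

theorem contDiffAt' (h : IsParabolic m θ A δ Θ) {u : ℝ} (hu : 0 < u) (huδ : u ≤ δ ^ 2) {z : Cn n}
    (hz : ‖z‖ < A * Real.sqrt u) : ContDiffAt ℝ m (fun q => θ q • q.1) (z, u) := by
  have h1 : Real.sqrt u ∈ Ioc 0 δ := ⟨Real.sqrt_pos.2 hu, by
    rw [← Real.sqrt_sq h.pos.le]
    exact Real.sqrt_le_sqrt huδ⟩
  have h2 := h.contDiffAt h1 (mem_scalingDom hu hz)
  rwa [parabolicEquiv_apply, smul_inv_eq hu] at h2

theorem isCompact_slice (n : ℕ) (a : ℝ) :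
    IsCompact (Metric.closedBall (0 : Cn n) a ×ˢ ({1} : Set ℝ)) :=
  (isCompact_closedBall 0 a).prod isCompact_singleton

theorem slice_subset (haA : a < A) :
    Metric.closedBall (0 : Cn n) a ×ˢ ({1} : Set ℝ) ⊆ scalingDom n A := by
  rintro ⟨z, v⟩ ⟨hz, rfl⟩
  exact ⟨Metric.closedBall_subset_ball haA hz, by norm_num, by norm_num⟩

theorem exists_lipschitz (h : IsParabolic m θ A δ Θ) (hm : 1 ≤ m) (haA : a < A) :
    ∃ δ', 0 < δ' ∧ δ' ≤ δ ∧ ∀ u, 0 < u → u < δ' ^ 2 → ∀ z z' : Cn n, ‖z‖ < a * Real.sqrt u →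
    ‖z'‖ < a * Real.sqrt u → ‖θ (z, u) • z - θ (z', u) • z'‖ ≤ 1 / 2 * ‖z - z'‖ := by
  obtain ⟨C, hC0, hC⟩ := h.smoothFam.exists_bound_iteratedFDeriv (isOpen_scalingDom n A)
    (isCompact_slice n a) (slice_subset haA) hm
  have hm' : (m : WithTop ℕ∞) ≠ 0 := by exact_mod_cast (by omega : m ≠ 0)
  have hδ := h.pos
  refine ⟨min δ (min 1 (1 / (2 * (C + 1)))), by positivity, min_le_left _ _,
    fun u hu huδ z z' hz hz' => ?_⟩
  have ht0 := Real.sqrt_pos.2 hu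
  set t := Real.sqrt u with ht
  have htδ : t < min δ (min 1 (1 / (2 * (C + 1)))) := by
    rw [ht, Real.sqrt_lt' (by positivity)]
    exact huδ
  obtain ⟨ht1, ht2⟩ := lt_min_iff.1 htδ
  obtain ⟨ht2, ht3⟩ := lt_min_iff.1 ht2
  have hx : ∀ z : Cn n, ‖z‖ < a * t →
      ((t⁻¹ • z, 1) : Cn n × ℝ) ∈ Metric.closedBall (0 : Cn n) a ×ˢ ({1} : Set ℝ) := fun z hz =>
    ⟨Metric.ball_subset_closedBall (mem_scalingDom hu hz).1, rfl⟩
  have e1 : ∀ z : Cn n, ‖z‖ < a * t → θ (z, u) • z = t ^ (m + 1) • Θ t (t⁻¹ • z, 1) := fun z hz => by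
    have h1 := h.eq t ⟨ht0, ht1.le⟩ _ (slice_subset haA (hx z hz))
    have h2 := smul_inv_eq hu z
    rw [← ht] at h2
    simp only [h2] at h1
    rw [← h1, smul_smul t, mul_inv_cancel₀ ht0.ne', one_smul]
  rw [e1 z hz, e1 z' hz', ← smul_sub, norm_smul, Real.norm_of_nonneg (by positivity)]
  have hcd := h.contDiffOn ⟨ht0.le, ht1.le⟩
  have hb : ∀ p ∈ Metric.closedBall (0 : Cn n) a ×ˢ ({1} : Set ℝ), ‖fderiv ℝ (Θ t) p‖ ≤ C := by
    intro p hp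
    have h1 := hC p hp (⟨t / δ, div_nonneg ht0.le hδ.le, (div_le_one hδ).2 ht1.le⟩ : unitInterval)
    simp only [mul_div_cancel₀ t hδ.ne'] at h1
    rwa [norm_iteratedFDeriv_one] at h1
  have h3 := Convex.norm_image_sub_le_of_norm_fderiv_le (fun p hp =>
    (hcd.contDiffAt ((isOpen_scalingDom n A).mem_nhds (slice_subset haA hp))).differentiableAt hm') hb
    ((convex_closedBall (0 : Cn n) a).prod (convex_singleton (1 : ℝ))) (hx z' hz') (hx z hz)
  have h4 : ‖((t⁻¹ • z, 1) : Cn n × ℝ) - (t⁻¹ • z', 1)‖ = t⁻¹ * ‖z - z'‖ := by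
    rw [Prod.mk_sub_mk, ← smul_sub, sub_self, Prod.norm_mk, norm_zero, norm_smul,
      Real.norm_of_nonneg (by positivity)]
    exact max_eq_left (by positivity)
  rw [h4] at h3
  have h5 : t ^ m ≤ t := pow_le_of_le_one ht0.le ht2.le (by omega)
  have h6 : t * C ≤ 1 / 2 := by
    calc t * C ≤ 1 / (2 * (C + 1)) * (C + 1) := by gcongr; linarith
      _ = 1 / 2 := by field_simp
  calc t ^ (m + 1) * ‖Θ t (t⁻¹ • z, 1) - Θ t (t⁻¹ • z', 1)‖
      ≤ t ^ (m + 1) * (C * (t⁻¹ * ‖z - z'‖)) := by gcongr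
    _ = t ^ m * C * ‖z - z'‖ := by
      rw [pow_succ]
      field_simp
    _ ≤ 1 / 2 * ‖z - z'‖ := by
      gcongr
      exact (mul_le_mul_of_nonneg_right h5 hC0).trans h6

end IsParabolic

end ParabolicScaling

section Deformation

variable {n : ℕ} {lam : Fin n → ℝ} {μ : ℝ} {m : ℕ} {P E : Cn n → ℝ} {q₁ q₂ q₃ x : Cn n} {t ρ r : ℝ}

namespace SmoothPert

theorem isRadial_G (h : SmoothPert lam μ m P E) (r : ℝ) :
    IsRadial (fun x => quadModel lam x + P x) μ r where
  mu_pos := h.mu_pos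
  contDiffOn := (h.contDiff_G.of_le (by norm_num)).contDiffOn
  map_zero := by
    rw [h.vanish_P.apply_zero, quadModel_eq]
    simp
  le_fderiv z _ := by
    have h1 := h.fderiv_G_self_ge z
    have h2 := h.mu_pos
    have h3 : 0 ≤ μ * ‖z‖ ^ 2 := by positivity
    linarith

theorem quadModel_add_le (h : SmoothPert lam μ m P E) (x : Cn n) :
    quadModel lam x + P x ≤ 3 * ‖x‖ ^ 2 := by
  have h1 := (le_abs_self _).trans (abs_quadBilin_le h.lam_nonneg h.lam_le_half x x)
  have h2 : ‖P x - P 0‖ ≤ μ / 8 * ‖x‖ * ‖x - 0‖ := by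
    refine Convex.norm_image_sub_le_of_norm_fderiv_le (𝕜 := ℝ) (s := Metric.closedBall 0 ‖x‖)
      (fun y _ => (h.contDiff_P.differentiable (by norm_num)).differentiableAt) (fun y hy => ?_)
      (convex_closedBall _ _) (by simp) (by simp)
    refine (h.norm_fderiv_P_le y).trans ?_
    have := h.mu_pos
    have : ‖y‖ ≤ ‖x‖ := by simpa using hy
    gcongr
  rw [h.vanish_P.apply_zero, sub_zero, sub_zero, Real.norm_eq_abs] at h2
  have h3 := (le_abs_self _).trans h2
  have h4 := h.mu_le
  rw [quadModel_eq]
  nlinarith [sq_nonneg ‖x‖]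

theorem scaledG_le (h : SmoothPert lam μ m P E) (t : ℝ) (x : Cn n) :
    scaledG lam P t x ≤ 3 * ‖x‖ ^ 2 := by
  by_cases ht : t = 0
  · rw [ht, scaledG, dilate_zero _ h.vanish_P.apply_zero, quadModel_eq, add_zero]
    have h1 := (le_abs_self _).trans (abs_quadBilin_le h.lam_nonneg h.lam_le_half x x)
    nlinarith [sq_nonneg ‖x‖]
  · have h1 := h.quadModel_add_le (t • x)
    rw [← scaledG_one, scaledG_smul ht, norm_smul, mul_pow, Real.norm_eq_abs, sq_abs] at h1
    have h2 : 0 < t ^ 2 := by positivity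
    nlinarith

theorem exists_isRadial_leafFun (h : SmoothPert lam μ m P E) (hq : IsFrame q₁ q₂ q₃) (hρ : 0 < ρ)
    (hint : IsIntegrableOn (scaledOmega lam m P E 1) ρ) :
    ∃ r, 0 < r ∧ leafConst μ ^ 3 * r ≤ ρ ∧
      ContDiffOn ℝ m (leafFun lam m P E q₁ q₂) (Metric.ball 0 r) ∧
      IsRadial (leafFun lam m P E q₁ q₂) μ r := by
  obtain ⟨r, hr0, hrρ, hcd, C, hC0, hC⟩ := h.exists_leafRem_regular hq hρ hint
  have hμ := h.mu_pos
  have hm := h.m_pos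
  set r' := min r (min 1 (μ / 2 / (C + 1))) with hr'
  have hr'0 : 0 < r' := by positivity
  have hr'r : r' ≤ r := min_le_left _ _
  have hr'1 : r' ≤ 1 := (min_le_right _ _).trans (min_le_left _ _)
  have hr'C : C * r' ≤ μ / 2 := by
    calc C * r' ≤ (C + 1) * (μ / 2 / (C + 1)) := by
          gcongr
          · linarith
          · exact (min_le_right _ _).trans (min_le_right _ _)
      _ = μ / 2 := by field_simp
  have hL := leafConst_pos μ
  have hcd' : ContDiffOn ℝ m (leafFun lam m P E q₁ q₂) (Metric.ball 0 r') := by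
    refine ContDiffOn.add ?_ (hcd.mono (Metric.ball_subset_ball hr'r))
    exact ((contDiff_quadModel lam).add (h.smooth_P.of_le (by norm_cast; omega))).contDiffOn
  have hrem : ∀ z ∈ Metric.ball (0 : Cn n) r', HasFDerivAt (leafRem lam m P E q₁ q₂ 1)
      (fderiv ℝ (leafRem lam m P E q₁ q₂ 1) z) z := fun z hz =>
    ((hcd.contDiffAt (Metric.isOpen_ball.mem_nhds (Metric.ball_subset_ball hr'r hz))).differentiableAt
      (by exact_mod_cast (by omega : m ≠ 0))).hasFDerivAt
  refine ⟨r', hr'0, (mul_le_mul_of_nonneg_left hr'r (by positivity)).trans hrρ, hcd', hμ,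
    hcd'.of_le (by exact_mod_cast hm), ?_, fun z hz => ?_⟩
  · rw [leafFun, leafRem_apply_zero, add_zero]
    exact (h.isRadial_G 1).map_zero
  · have h1 : HasFDerivAt (leafFun lam m P E q₁ q₂) (fderiv ℝ (fun x => quadModel lam x + P x) z +
        fderiv ℝ (leafRem lam m P E q₁ q₂ 1) z) z :=
      ((h.contDiff_G.differentiable (by norm_num)).differentiableAt.hasFDerivAt).add (hrem z hz)
    rw [h1.fderiv, add_apply]
    have h2 := h.fderiv_G_self_ge z
    have h3 := (fderiv ℝ (leafRem lam m P E q₁ q₂ 1) z).le_of_opNorm_le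
      (hC z (Metric.ball_subset_ball hr'r hz)) z
    rw [Real.norm_eq_abs] at h3
    have hz' : ‖z‖ < r' := by simpa using hz
    have h4 : C * ‖z‖ ^ (m + 1) * ‖z‖ ≤ μ / 2 * ‖z‖ ^ 2 := by
      have h5 : ‖z‖ ^ m ≤ r' := (pow_le_of_le_one (norm_nonneg z) (hz'.le.trans hr'1) (by omega)).trans
        hz'.le
      calc C * ‖z‖ ^ (m + 1) * ‖z‖ = C * ‖z‖ ^ m * ‖z‖ ^ 2 := by ring
        _ ≤ C * r' * ‖z‖ ^ 2 := by gcongr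
        _ ≤ μ / 2 * ‖z‖ ^ 2 := by gcongr
    have h5 := (abs_le.1 h3).1
    have h6 : 0 ≤ μ * ‖z‖ ^ 2 := by positivity
    linarith

/-- The radial displacement that takes the level sets of `Q + P` to those of `leafFun`. -/
theorem exists_displacement (h : SmoothPert lam μ m P E) (hq : IsFrame q₁ q₂ q₃) (hρ : 0 < ρ)
    (hint : IsIntegrableOn (scaledOmega lam m P E 1) ρ) (hr : 0 < r)
    (hH : IsRadial (leafFun lam m P E q₁ q₂) μ r) {c A : ℝ} (hc : 0 < c) (hA : 0 < A) :
    ∃ δ : ℝ, 0 < δ ∧ δ * (2 * A) ≤ r ∧ ∃ κ : ℝ → Cn n → ℝ, ∃ k : Cn n → ℝ,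
      SmoothFam m {x | c < ‖x‖ ∧ ‖x‖ < A} (fun d : unitInterval => κ (δ * d)) ∧
      (∀ z, |k z| ≤ 1 / 4) ∧
      ∀ x, c < ‖x‖ → ‖x‖ < A → κ 0 x = 0 ∧ ∀ t ∈ Ioc 0 δ, k (t • x) = t ^ m * κ t x ∧
        leafFun lam m P E q₁ q₂ ((1 + k (t • x)) • t • x) = quadModel lam (t • x) + P (t • x) := by
  classical
  obtain ⟨δ₁, hδ₁0, -, hδ₁ρ, κ, hκ, hκ'⟩ := h.exists_rayShift hq hρ hint hc hA
  set δ := min δ₁ (r / (2 * A)) with hδ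
  have hδ0 : 0 < δ := by positivity
  have hδ₁ : δ ≤ δ₁ := min_le_left _ _
  have hδr : δ * (2 * A) ≤ r := by
    rw [← le_div_iff₀ (by positivity)]
    exact min_le_right _ _
  let S : Cn n → ℝ → Prop := fun z s =>
    |s| ≤ 1 / 4 ∧ leafFun lam m P E q₁ q₂ ((1 + s) • z) = quadModel lam z + P z
  let k : Cn n → ℝ := fun z => if hz : ∃ s, S z s then hz.choose else 0
  have hk : ∀ z s, S z s → S z (k z) := fun z s hs => by
    have hz : ∃ s, S z s := ⟨s, hs⟩
    simp only [k, dif_pos hz]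
    exact hz.choose_spec
  have huniq : ∀ z : Cn n, z ≠ 0 → 2 * ‖z‖ < r → ∀ s s', S z s → S z s' → s = s' := by
    intro z hz hzr s s' hs hs'
    have hmem : ∀ s, |s| ≤ 1 / 4 → 1 + s ∈ IsRadial.raySet z r := fun s hs => by
      have := abs_le.1 hs
      exact ⟨by linarith, by nlinarith [norm_nonneg z]⟩
    have h1 := (hH.strictMonoOn hz).injOn (hmem s hs.1) (hmem s' hs'.1) (hs.2.trans hs'.2.symm)
    linarith
  have hL := leafConst_pos μ
  have hex : ∀ x, c < ‖x‖ → ‖x‖ < A → ∀ t ∈ Ioc 0 δ, S (t • x) (t ^ m * κ t x) := by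
    intro x hx1 hx2 t ht
    obtain ⟨h1, h2⟩ := (hκ' x hx1 hx2).2 t ⟨ht.1.le, ht.2.trans hδ₁⟩
    have hx0 : x ≠ 0 := norm_pos_iff.1 (hc.trans hx1)
    refine ⟨h1, ?_⟩
    set s := t ^ m * κ t x with hs
    have hs' := abs_le.1 h1
    have hy0 : (1 + s) • x ≠ 0 := smul_ne_zero (by linarith) hx0
    have hyn : ‖(1 + s) • x‖ ≤ 2 * A := by
      rw [norm_smul, Real.norm_of_nonneg (by linarith)]
      nlinarith [norm_nonneg x]
    have hyρ : leafConst μ ^ 3 * (t * ‖(1 + s) • x‖) < ρ := by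
      refine lt_of_le_of_lt ?_ hδ₁ρ
      have := ht.1
      have := ht.2.trans hδ₁
      gcongr
    rw [smul_comm, leafFun, ← scaledG_one, scaledG_smul ht.1.ne', h.leafRem_smul hq hint ht.1 hy0 hyρ,
      ← scaledG_one, scaledG_smul ht.1.ne', ← h2]
    ring
  refine ⟨δ, hδ0, hδr, κ, k, ?_, fun z => ?_, fun x hx1 hx2 => ⟨(hκ' x hx1 hx2).1, fun t ht => ?_⟩⟩
  · have h1 : ∀ d : unitInterval, δ / δ₁ * d ∈ Icc (0 : ℝ) 1 := fun d => by
      have hd0 := d.2.1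
      have h2 := (div_le_one hδ₁0).2 hδ₁
      exact ⟨by positivity, mul_le_one₀ h2 hd0 d.2.2⟩
    let φ : C(unitInterval, unitInterval) := ⟨fun d => ⟨δ / δ₁ * d, h1 d⟩, by fun_prop⟩
    obtain ⟨Φ, hΦ, hΦ'⟩ := hκ.curry
    have hopen : IsOpen {x : Cn n | c < ‖x‖ ∧ ‖x‖ < A} :=
      (isOpen_lt continuous_const continuous_norm).inter (isOpen_lt continuous_norm continuous_const)
    refine SmoothFam.of_curry hopen (Φ := fun x => (Φ x).comp φ)
      ((ContinuousMap.compCLM (R := ℝ) ℝ φ : C(unitInterval, ℝ) →L[ℝ] C(unitInterval, ℝ)).contDiff.comp_contDiffOn hΦ)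
      fun x hx d => ?_
    rw [ContinuousMap.comp_apply, hΦ' x hx]
    change κ (δ₁ * (δ / δ₁ * d)) x = _
    rw [← mul_assoc, mul_div_cancel₀ _ hδ₁0.ne']
  · by_cases hz : ∃ s, S z s
    · exact (hk z _ hz.choose_spec).1
    · simp only [k, dif_neg hz]
      norm_num
  · have h1 := hex x hx1 hx2 t ht
    have h2 := hk _ _ h1
    have hx0 : x ≠ 0 := norm_pos_iff.1 (hc.trans hx1)
    refine ⟨huniq _ (smul_ne_zero ht.1.ne' hx0) ?_ _ _ h2 h1, h2.2⟩
    rw [norm_smul, Real.norm_of_nonneg ht.1.le]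
    calc 2 * (t * ‖x‖) < 2 * (t * A) := by have := ht.1; gcongr
      _ = t * (2 * A) := by ring
      _ ≤ δ * (2 * A) := by have := ht.2; gcongr
      _ ≤ r := hδr

end SmoothPert

end Deformation

section Deformation

variable {n : ℕ} {lam : Fin n → ℝ} {μ : ℝ} {m : ℕ} {P E : Cn n → ℝ} {q₁ q₂ q₃ x : Cn n} {t ρ r : ℝ}

/-- A bump function around `1`. -/
noncomputable def unitBump : ContDiffBump (1 : ℝ) := ⟨1 / 4, 1 / 2, by norm_num, by norm_num⟩

theorem unitBump_one : unitBump 1 = 1 :=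
  unitBump.one_of_mem_closedBall (Metric.mem_closedBall_self (by norm_num [unitBump]))

theorem unitBump_eq_zero {s : ℝ} (hs : s ≤ 1 / 2) : unitBump s = 0 := by
  refine unitBump.zero_of_le_dist ?_
  rw [Real.dist_eq, abs_of_nonpos (by linarith)]
  change 1 / 2 ≤ _
  linarith

namespace SmoothPert

theorem unitBump_scaledG (h : SmoothPert lam μ m P E) {v : ℝ} (hv : 1 / 2 < v) {x : Cn n}
    (hx : ‖x‖ < 1 / 4) : unitBump (scaledG lam P t x / v) = 0 := by
  refine unitBump_eq_zero ?_
  rw [div_le_iff₀ (by linarith)]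
  have h1 := h.scaledG_le t x
  nlinarith [norm_nonneg x]

theorem exists_deformation (h : SmoothPert lam μ m P E) (hq : IsFrame q₁ q₂ q₃) (hρ : 0 < ρ)
    (hint : IsIntegrableOn (scaledOmega lam m P E 1) ρ) (hr : 0 < r)
    (hH : IsRadial (leafFun lam m P E q₁ q₂) μ r) :
    ∃ θ : Cn n × ℝ → ℝ, ∃ a A δ δ' : ℝ, ∃ Θ : ℝ → Cn n × ℝ → Cn n, a < A ∧ δ ≤ δ' ∧
      IsParabolic m θ A δ' Θ ∧ IsRayDeformation m (fun x => quadModel lam x + P x)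
        (leafFun lam m P E q₁ q₂) μ r θ a δ := by
  have hm := h.m_pos
  set a := Real.sqrt (2 / μ) + 1 with ha
  have ha0 : 0 < a := by positivity
  obtain ⟨δ₁, hδ₁0, hδ₁r, κ, k, hκ, hk, hκk⟩ :=
    h.exists_displacement hq hρ hint hr hH (c := 1 / 8) (A := a + 1) (by norm_num) (by positivity)
  set G : Cn n → ℝ := fun x => quadModel lam x + P x with hG
  let θ : Cn n × ℝ → ℝ := fun p => unitBump (G p.1 / p.2) * k p.1
  let Θ : ℝ → Cn n × ℝ → Cn n := fun t p => (unitBump (scaledG lam P t p.1 / p.2) * κ t p.1) • p.1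
  have hcase : ∀ x : Cn n, 1 / 8 < ‖x‖ ∨ ‖x‖ < 1 / 4 := fun x => by
    by_contra! hx
    linarith [hx.1, hx.2]
  have hpar : IsParabolic m θ (a + 1) δ₁ Θ := by
    refine ⟨hδ₁0, ?_, fun p hp => ?_, fun t ht p hp => ?_⟩
    · have hO : IsOpen ({x : Cn n | 1 / 8 < ‖x‖ ∧ ‖x‖ < a + 1} ×ˢ Ioo (1 / 2 : ℝ) 2) :=
        ((isOpen_lt continuous_const continuous_norm).inter
          (isOpen_lt continuous_norm continuous_const)).prod isOpen_Ioo
      have hO' : IsOpen ({x : Cn n | ‖x‖ < 1 / 4} ×ˢ Ioo (1 / 2 : ℝ) 2) :=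
        (isOpen_lt continuous_norm continuous_const).prod isOpen_Ioo
      refine (SmoothFam.union hO hO' ?_ ?_).mono fun p hp => ?_
      · have e1 : SmoothFam m ({x : Cn n | 1 / 8 < ‖x‖ ∧ ‖x‖ < a + 1} ×ˢ Ioo (1 / 2 : ℝ) 2)
            (fun (_ : unitInterval) p => p) := SmoothFam.id
        have e2 := hκ.comp (e1.map_contDiff contDiff_fst) fun _ p hp => hp.1
        have e3 : SmoothFam m ({x : Cn n | 1 / 8 < ‖x‖ ∧ ‖x‖ < a + 1} ×ˢ Ioo (1 / 2 : ℝ) 2)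
            (fun (d : unitInterval) p => scaledG lam P (δ₁ * d) p.1) :=
          (h.smoothFam_scaledG (δ := ⟨fun d : unitInterval => δ₁ * d, by fun_prop⟩) fun d =>
            mul_nonneg hδ₁0.le d.2.1).comp (e1.map_contDiff contDiff_fst) fun _ _ _ => mem_univ _
        have e4 : ContDiffOn ℝ m (fun p : (ℝ × ℝ) × Cn n × ℝ =>
            (unitBump (p.1.1 / p.2.2) * p.1.2) • p.2.1) {p | 1 / 2 < p.2.2} := by
          have e5 : ContDiff ℝ m (fun p : (ℝ × ℝ) × Cn n × ℝ => p.1.2) := by fun_prop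
          have e6 : ContDiff ℝ m (fun p : (ℝ × ℝ) × Cn n × ℝ => p.2.1) := by fun_prop
          refine ContDiffOn.smul (ContDiffOn.mul ?_ e5.contDiffOn) e6.contDiffOn
          refine unitBump.contDiff.comp_contDiffOn
            (f := fun p : (ℝ × ℝ) × Cn n × ℝ => p.1.1 / p.2.2)
            (ContDiffOn.div (by fun_prop) (by fun_prop) ?_)
          intro p hp
          have : (1 / 2 : ℝ) < p.2.2 := hp
          linarith
        exact ((e3.prodMk e2).prodMk e1).map (isOpen_lt (by fun_prop) (by fun_prop)) e4
          fun _ p hp => hp.2.1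
      · have e1 : SmoothFam m ({x : Cn n | ‖x‖ < 1 / 4} ×ˢ Ioo (1 / 2 : ℝ) 2)
            (fun (_ : unitInterval) (_ : Cn n × ℝ) => (0 : Cn n)) :=
          SmoothFam.const hO' contDiffOn_const
        refine e1.congr fun d p hp => ?_
        simp only [Θ, h.unitBump_scaledG hp.2.1 hp.1, zero_mul, zero_smul]
      · have h1 : ‖p.1‖ < a + 1 := by simpa using hp.1
        exact (hcase p.1).imp (fun h2 => ⟨⟨h2, h1⟩, hp.2⟩) fun h2 => ⟨h2, hp.2⟩
    · have h1 : ‖p.1‖ < a + 1 := by simpa using hp.1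
      rcases hcase p.1 with h2 | h2
      · simp only [Θ, (hκk p.1 h2 h1).1, mul_zero, zero_smul]
      · simp only [Θ, h.unitBump_scaledG hp.2.1 h2, zero_mul, zero_smul]
    · have h1 : ‖p.1‖ < a + 1 := by simpa using hp.1
      have ht2 : t ^ 2 ≠ 0 := pow_ne_zero 2 ht.1.ne'
      have e1 : unitBump (G (t • p.1) / (t ^ 2 * p.2)) = unitBump (scaledG lam P t p.1 / p.2) := by
        simp only [hG]
        rw [← scaledG_one, scaledG_smul ht.1.ne', mul_div_mul_left _ _ ht2]
      simp only [θ, Θ, e1]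
      rcases hcase p.1 with h2 | h2
      · rw [((hκk p.1 h2 h1).2 t ht).1, smul_smul, smul_smul]
        congr 1
        ring
      · simp only [h.unitBump_scaledG hp.2.1 h2, zero_mul, zero_smul, smul_zero]
  obtain ⟨δ₂, hδ₂0, hδ₂, hlip⟩ := hpar.exists_lipschitz hm (a := a) (by linarith)
  refine ⟨θ, a, a + 1, δ₂, δ₁, Θ, by linarith, hδ₂, hpar, ?_⟩
  refine ⟨h.isRadial_G r, hH, by linarith, fun p hp0 hp1 hp2 => ?_, hlip, fun p => ?_,
    fun u hu0 hu1 z hz hGz => ?_, hδ₂0, ?_, by omega⟩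
  · refine hpar.contDiffAt' hp0 (hp1.le.trans (by gcongr)) (hp2.trans_le ?_)
    gcongr
    linarith
  · simp only [θ, abs_mul, abs_of_nonneg unitBump.nonneg]
    exact (mul_le_of_le_one_left (abs_nonneg _) unitBump.le_one).trans (hk _)
  · have ht0 := Real.sqrt_pos.2 hu0
    set t := Real.sqrt u with ht
    have ht2 : t ^ 2 = u := Real.sq_sqrt hu0.le
    have htδ : t ≤ δ₁ := by
      rw [ht, ← Real.sqrt_sq hδ₁0.le]
      exact Real.sqrt_le_sqrt (hu1.le.trans (by gcongr))
    have e1 : t • t⁻¹ • z = z := by rw [smul_smul, mul_inv_cancel₀ ht0.ne', one_smul]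
    have e2 : ‖t⁻¹ • z‖ = t⁻¹ * ‖z‖ := by rw [norm_smul, Real.norm_of_nonneg (by positivity)]
    have e3 : ‖t⁻¹ • z‖ < a + 1 := by
      rw [e2, inv_mul_lt_iff₀ ht0]
      nlinarith
    have e4 : 1 / 8 < ‖t⁻¹ • z‖ := by
      have h1 := h.scaledG_le t (t⁻¹ • z)
      have h2 := scaledG_smul (lam := lam) (P := P) ht0.ne' (t⁻¹ • z)
      rw [e1, scaledG_one] at h2
      have h3 : t ^ 2 * scaledG lam P t (t⁻¹ • z) = t ^ 2 * 1 := by rw [← h2, mul_one, ht2, ← hGz]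
      rw [mul_left_cancel₀ (pow_ne_zero 2 ht0.ne') h3] at h1
      by_contra! h4
      nlinarith [norm_nonneg (t⁻¹ • z)]
    have e5 := ((hκk _ e4 e3).2 t ⟨ht0, htδ⟩).2
    rw [e1] at e5
    have e6 : θ (z, u) = k z := by
      simp only [θ]
      rw [hGz, div_self hu0.ne', unitBump_one, one_mul]
    rw [e6]
    rw [add_smul, one_smul] at e5
    exact e5.trans hGz
  · calc 2 * a * δ₂ ≤ 2 * (a + 1) * δ₁ := by gcongr; linarith
      _ = δ₁ * (2 * (a + 1)) := by ring
      _ ≤ r := hδ₁r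

end SmoothPert

end Deformation

section Estimates

variable {n m : ℕ} {G H : Cn n → ℝ} {μ r ρ R : ℝ} {θ : Cn n × ℝ → ℝ} {a A δ δ' : ℝ}
  {Θ : ℝ → Cn n × ℝ → Cn n}

theorem IsRadial.uniqueDiffOn_sublevelRegion (h : IsRadial G μ r) (hρ : ρ ≤ r) :
    UniqueDiffOn ℝ (sublevelRegion G ρ R) := by
  rintro ⟨z, u⟩ ⟨hz, hu0, huR, hzu⟩
  have hsub := Metric.ball_subset_ball (x := (0 : Cn n)) hρ
  let Ψ : Cn n × ℝ → Cn n × ℝ := fun p => (p.1, G p.1 - p.2)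
  let O : Set (Cn n × ℝ) := (Metric.ball 0 ρ ×ˢ univ) ∩ (fun p => G p.1 - p.2) ⁻¹' Ioo 0 (R ^ 2)
  have hO : IsOpen O := by
    refine ContinuousOn.isOpen_inter_preimage ?_ (Metric.isOpen_ball.prod isOpen_univ) isOpen_Ioo
    exact ((h.continuousOn.mono hsub).comp continuousOn_fst fun p hp => hp.1).sub continuousOn_snd
  have himage : Ψ '' ((univ ×ˢ Iic 0) ∩ O) = sublevelRegion G ρ R := by
    ext ⟨w, s⟩
    constructor
    · rintro ⟨⟨w', s'⟩, ⟨⟨-, h1⟩, ⟨h2, -⟩, h3⟩, heq⟩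
      simp only [Ψ, Prod.mk.injEq] at heq
      obtain ⟨rfl, rfl⟩ := heq
      have h1' : s' ≤ 0 := h1
      refine ⟨h2, h3.1, h3.2, ?_⟩
      simp only
      linarith
    · rintro ⟨h1, h2, h3, h4⟩
      refine ⟨(w, G w - s), ⟨⟨mem_univ _, ?_⟩, ⟨h1, mem_univ _⟩, ?_⟩, ?_⟩
      · exact sub_nonpos.2 h4
      · simpa using And.intro h2 h3
      · simp [Ψ]
  have hp : ((z, G z - u) : Cn n × ℝ) ∈ (univ ×ˢ Iic (0 : ℝ)) ∩ O :=
    ⟨⟨mem_univ _, sub_nonpos.2 hzu⟩, ⟨hz, mem_univ _⟩, by simpa using And.intro hu0 huR⟩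
  have hu : UniqueDiffWithinAt ℝ ((univ ×ˢ Iic (0 : ℝ)) ∩ O) ((z, G z - u) : Cn n × ℝ) :=
    ((uniqueDiffOn_univ.prod (uniqueDiffOn_Iic 0)).inter hO) _ hp
  have hG : HasFDerivAt (fun p : Cn n × ℝ => G p.1) ((fderiv ℝ G z).comp
      (ContinuousLinearMap.fst ℝ (Cn n) ℝ)) (z, G z - u) :=
    HasFDerivAt.comp (g := G) (f := Prod.fst) ((z, G z - u) : Cn n × ℝ)
      (h.differentiableAt (hsub hz)).hasFDerivAt hasFDerivAt_fst
  have hΨ : HasFDerivAt Ψ ((ContinuousLinearMap.fst ℝ (Cn n) ℝ).prod ((fderiv ℝ G z).comp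
      (ContinuousLinearMap.fst ℝ (Cn n) ℝ) - ContinuousLinearMap.snd ℝ (Cn n) ℝ)) (z, G z - u) :=
    hasFDerivAt_fst.prodMk (hG.sub hasFDerivAt_snd)
  have h1 := hΨ.hasFDerivWithinAt.uniqueDiffWithinAt hu (Function.Surjective.denseRange
    fun ⟨w, s⟩ => ⟨(w, fderiv ℝ G z w - s), by simp⟩)
  rw [himage] at h1
  simpa [Ψ] using h1

theorem IsRayDeformation.mem_dom (h : IsRayDeformation m G H μ r θ a δ) (hρ : ρ ≤ r)
    (hRδ : R ≤ δ) (hR0 : 0 < R) {p : Cn n × ℝ} (hp : p ∈ sublevelRegion G ρ R) :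
    p ∈ IsRayDeformation.dom a δ :=
  h.mem_dom_of_le h.radial_left (Metric.ball_subset_ball hρ hp.1) hp.2.1
    (hp.2.2.1.trans_le (by gcongr)) hp.2.2.2

/-- The directions of a mixed derivative. -/
def mixedDir {j : ℕ} (v : Fin j → Cn n) (b : ℕ) : Fin (j + b) → Cn n × ℝ :=
  Fin.append (fun i => ((v i, 0) : Cn n × ℝ)) (fun _ : Fin b => ((0, 1) : Cn n × ℝ))

theorem parabolicEquiv_mixedDir {t : ℝ} (ht : t ≠ 0) {j : ℕ} (v : Fin j → Cn n) (b : ℕ)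
    (i : Fin (j + b)) : parabolicEquiv n ht (mixedDir v b i) =
      (Fin.append (fun _ : Fin j => t) (fun _ : Fin b => t ^ 2) i : ℝ) • mixedDir v b i := by
  rw [mixedDir, parabolicEquiv_apply]
  refine Fin.addCases (fun i => ?_) (fun i => ?_) i <;> simp

theorem IsParabolic.iteratedFDeriv_eq (h : IsParabolic m θ A δ' Θ) {u : ℝ} (hu : 0 < u)
    (huδ : u ≤ δ' ^ 2) {z : Cn n} (hz : ‖z‖ < A * Real.sqrt u) {j b : ℕ} (hjb : j + b ≤ m)
    (v : Fin j → Cn n) :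
    Real.sqrt u ^ (j + 2 * b) • iteratedFDeriv ℝ (j + b) (fun q => θ q • q.1) (z, u) (mixedDir v b) =
      Real.sqrt u ^ (m + 1) • iteratedFDeriv ℝ (j + b) (Θ (Real.sqrt u))
        ((Real.sqrt u)⁻¹ • z, 1) (mixedDir v b) := by
  have ht : Real.sqrt u ∈ Ioc 0 δ' := ⟨Real.sqrt_pos.2 hu, by
    rw [← Real.sqrt_sq h.pos.le]
    exact Real.sqrt_le_sqrt huδ⟩
  have hx := mem_scalingDom hu hz
  have h1 := iteratedFDeriv_of_comp_eq (f := fun q : Cn n × ℝ => θ q • q.1)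
    (Λ := parabolicEquiv n ht.1.ne') (h.comp_eventuallyEq ht hx)
    (((h.contDiffOn ⟨ht.1.le, ht.2⟩).contDiffAt ((isOpen_scalingDom n A).mem_nhds hx)).of_le
      (by exact_mod_cast hjb)) (mixedDir v b)
  simp only [parabolicEquiv_mixedDir] at h1
  rw [ContinuousMultilinearMap.map_smul_univ, Fin.prod_univ_add, parabolicEquiv_apply,
    smul_inv_eq hu] at h1
  simp only [Fin.append_left, Fin.append_right, Finset.prod_const, Finset.card_univ,
    Fintype.card_fin, ← pow_mul, ← pow_add] at h1
  exact h1

theorem IsRayDeformation.mixedDeriv_eq (h : IsRayDeformation m G H μ r θ a δ) (hρ : ρ ≤ r)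
    (hRδ : R ≤ δ) (hR0 : 0 < R) {p : Cn n × ℝ} (hp : p ∈ sublevelRegion G ρ R) {j b : ℕ}
    (hjb : j + b ≤ m) (v : Fin j → Cn n) :
    mixedDeriv (fun p => rayMap θ p - p) (sublevelRegion G ρ R) v b p =
      (iteratedFDeriv ℝ (j + b) (fun q => θ q • q.1) p (mixedDir v b), 0) := by
  have hjb' : ((j + b : ℕ) : WithTop ℕ∞) ≤ m := by exact_mod_cast hjb
  have hp' := h.mem_dom hρ hRδ hR0 hp
  have hcd := (h.smooth p hp'.1 hp'.2.1 hp'.2.2).of_le hjb'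
  have h1 : (fun p => rayMap θ p - p) =
      (ContinuousLinearMap.inl ℝ (Cn n) ℝ) ∘ (fun q : Cn n × ℝ => θ q • q.1) := by
    funext q
    simp [rayMap, Prod.ext_iff]
  rw [mixedDeriv, h1, iteratedFDerivWithin_eq_iteratedFDeriv
    (h.radial_left.uniqueDiffOn_sublevelRegion hρ)
    ((ContinuousLinearMap.inl ℝ (Cn n) ℝ).contDiff.contDiffAt.comp p hcd) hp,
    ContinuousLinearMap.iteratedFDeriv_comp_left _ hcd le_rfl]
  rfl

theorem IsRayDeformation.isLittleO (h : IsRayDeformation m G H μ r θ a δ)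
    (hpar : IsParabolic m θ A δ' Θ) (haA : a < A) (hδ : δ ≤ δ') (hρ : ρ ≤ r) (hRδ : R ≤ δ)
    (hR0 : 0 < R) {j b : ℕ} (hjb : j + b ≤ m) (v : Fin j → Cn n) :
    mixedDeriv (fun p => rayMap θ p - p) (sublevelRegion G ρ R) v b
      =o[𝓝[sublevelRegion G ρ R] (0 : Cn n × ℝ)]
        fun p => p.2 ^ (((m : ℝ) + 1 - j - 2 * b) / 2) := by
  rw [isLittleO_iff]
  intro ε hε
  have hδ' := hpar.pos
  have h1 := hpar.smoothFam.eventually_norm_iteratedFDeriv_lt (isOpen_scalingDom n A)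
    (IsParabolic.isCompact_slice n a) (IsParabolic.slice_subset haA) hjb (mixedDir v b)
    (y₀ := (0 : unitInterval)) (fun p hp => by simpa using hpar.zero p hp) hε
  have h2 : Tendsto (fun p : Cn n × ℝ => projIcc (0 : ℝ) 1 zero_le_one (Real.sqrt p.2 / δ'))
      (𝓝 0) (𝓝 (0 : unitInterval)) := by
    have h3 : Continuous (fun p : Cn n × ℝ => projIcc (0 : ℝ) 1 zero_le_one (Real.sqrt p.2 / δ')) :=
      continuous_projIcc.comp (by fun_prop)
    have h4 := h3.tendsto 0
    simp only [Prod.snd_zero, Real.sqrt_zero, zero_div] at h4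
    rwa [projIcc_left] at h4
  filter_upwards [nhdsWithin_le_nhds (h2.eventually h1), self_mem_nhdsWithin] with ⟨z, u⟩ hzu hp
  obtain ⟨hu0, huδ, hz⟩ := h.mem_dom hρ hRδ hR0 hp
  simp only at hu0 huδ hz hzu
  have ht0 := Real.sqrt_pos.2 hu0
  have huδ' : u ≤ δ' ^ 2 := huδ.le.trans (by have := h.delta_pos; gcongr)
  have hzA : ‖z‖ < A * Real.sqrt u := hz.trans (by gcongr)
  have h3 := hpar.iteratedFDeriv_eq hu0 huδ' hzA hjb v
  have htδ : Real.sqrt u ≤ δ' := by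
    rw [← Real.sqrt_sq hδ'.le]
    exact Real.sqrt_le_sqrt huδ'
  have h4 := hzu ((Real.sqrt u)⁻¹ • z, 1) ⟨Metric.ball_subset_closedBall (IsParabolic.mem_scalingDom hu0 hz).1, rfl⟩
  rw [projIcc_of_mem _ ⟨by positivity, (div_le_one hδ').2 htδ⟩] at h4
  simp only [mul_div_cancel₀ _ hδ'.ne'] at h4
  rw [h.mixedDeriv_eq hρ hRδ hR0 hp hjb v, Prod.norm_mk, norm_zero, max_eq_left (norm_nonneg _)]
  have h5 := congrArg norm h3
  rw [norm_smul, norm_smul, Real.norm_of_nonneg (by positivity),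
    Real.norm_of_nonneg (by positivity)] at h5
  set t := Real.sqrt u with ht
  have h6 : u ^ (((m : ℝ) + 1 - j - 2 * b) / 2) = t ^ (m + 1) / t ^ (j + 2 * b) := by
    have h7 : u = t ^ (2 : ℝ) := by
      rw [Real.rpow_two, Real.sq_sqrt hu0.le]
    rw [h7, ← Real.rpow_mul ht0.le, ← Real.rpow_natCast t (m + 1), ← Real.rpow_natCast t (j + 2 * b),
      ← Real.rpow_sub ht0]
    congr 1
    push_cast
    ring
  simp only [h6]
  rw [Real.norm_of_nonneg (by positivity), ← mul_div_assoc, le_div_iff₀ (by positivity), mul_comm, h5,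
    mul_comm ε]
  gcongr

end Estimates

section Boundary

variable {n m : ℕ} {H : Cn n → ℝ} {μ r ρ R : ℝ}

theorem IsRadial.isCkDomainWithBoundary (h : IsRadial H μ r) (hρr : ρ ≤ r) (hρ : 0 < ρ) (hR : 0 < R)
    {k : ℕ} (hk : k ≤ m) (hcd : ContDiffOn ℝ m H (Metric.ball 0 r)) :
    IsCkDomainWithBoundary k (insert 0 (sublevelRegion H ρ R)) := by
  intro p hp
  have hsub := Metric.ball_subset_ball (x := (0 : Cn n)) hρr
  have hR2 : 0 < R ^ 2 := by positivity
  refine Or.inr ⟨Metric.ball 0 ρ ×ˢ Iio (R ^ 2), Metric.isOpen_ball.prod isOpen_Iio, ?_,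
    fun q => H q.1 - q.2, ?_, fun q hq => ?_, ?_⟩
  · rcases hp with rfl | hp
    · exact ⟨Metric.mem_ball_self hρ, hR2⟩
    · exact ⟨hp.1, hp.2.2.1⟩
  · refine ContDiffOn.sub ?_ contDiffOn_snd
    exact ((hcd.mono hsub).of_le (by exact_mod_cast hk)).comp contDiffOn_fst fun q hq => hq.1
  · have h1 : HasFDerivAt (fun q : Cn n × ℝ => H q.1 - q.2) ((fderiv ℝ H q.1).comp
        (ContinuousLinearMap.fst ℝ (Cn n) ℝ) - ContinuousLinearMap.snd ℝ (Cn n) ℝ) q :=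
      (HasFDerivAt.comp (g := H) (f := Prod.fst) q
        (h.differentiableAt (hsub hq.1)).hasFDerivAt hasFDerivAt_fst).sub hasFDerivAt_snd
    rw [h1.fderiv]
    intro h2
    have h3 := DFunLike.congr_fun h2 ((0, 1) : Cn n × ℝ)
    simp at h3
  · ext ⟨z, u⟩
    constructor
    · rintro ⟨hA, hW⟩
      refine ⟨hW, ?_⟩
      rcases hA with h0 | hA
      · obtain ⟨rfl, rfl⟩ := Prod.mk.inj h0
        simp [h.map_zero]
      · exact sub_nonpos.2 hA.2.2.2
    · rintro ⟨hW, hf⟩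
      refine ⟨?_, hW⟩
      have hf' : H z ≤ u := sub_nonpos.1 hf
      have h1 := h.le_apply (hsub hW.1)
      have h2 := h.mu_pos
      have h3 : 0 ≤ μ / 2 * ‖z‖ ^ 2 := by positivity
      rcases (h3.trans (h1.trans hf')).eq_or_lt with h4 | h4
      · left
        have h5 : μ / 2 * ‖z‖ ^ 2 = 0 := le_antisymm (by linarith) h3
        have h6 : ‖z‖ = 0 := by
          rcases mul_eq_zero.1 h5 with h6 | h6
          · linarith
          · exact pow_eq_zero_iff two_ne_zero |>.1 h6
        rw [norm_eq_zero.1 h6, ← h4]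
        rfl
      · exact Or.inr ⟨hW.1, h4, hW.2, hf'⟩

end Boundary

section Orbits

variable {n : ℕ} {lam : Fin n → ℝ} {μ : ℝ} {m : ℕ} {P E : Cn n → ℝ} {q₁ q₂ q₃ x : Cn n} {t ρ r : ℝ}

namespace SmoothPert

theorem transport_smul_axis (h : SmoothPert lam μ m P E) (hq : IsFrame q₁ q₂ q₃) {s : ℝ} (hs : 0 < s) :
    transport (scaledOmega lam m P E 1) q₁ (s • q₁) = 0 := by
  obtain ⟨C, hC⟩ := h.exists_formBounds
  have hax := isAxis_reInner hq.norm₁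
  refine IsTransport.eq_transport (hC 1 zero_le_one) hax (κ := 3 / 4) (by norm_num) (by norm_num)
    ?_ fun σ => ?_
  · refine smul_mem_axisCone (κ := 3 / 4) ?_ hs
    change -(3 / 4 * ‖q₁‖) < reInner q₁ q₁
    rw [hax.apply_q, hq.norm₁]
    norm_num
  · have hd : segDir q₁ (s • q₁) = 0 := by
      rw [segDir, norm_smul, hq.norm₁, mul_one, Real.norm_of_nonneg hs.le, sub_self]
    simp [pathRhs, hd]

theorem leafFun_smul_axis (h : SmoothPert lam μ m P E) (hq : IsFrame q₁ q₂ q₃) {s : ℝ} (hs : 0 < s) :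
    leafFun lam m P E q₁ q₂ (s • q₁) = quadModel lam (s • q₁) + P (s • q₁) := by
  have hax := isAxis_reInner hq.norm₁
  have hmem : s • q₁ ∈ axisCone (reInner q₁) (3 / 4) := by
    refine smul_mem_axisCone (κ := 3 / 4) ?_ hs
    change -(3 / 4 * ‖q₁‖) < reInner q₁ q₁
    rw [hax.apply_q, hq.norm₁]
    norm_num
  have h1 := h.scaledG_add_leafRem₁ hq zero_le_one hmem
  rw [one_pow, one_mul, scaledG_one, transportEnd_eq, h.transport_smul_axis hq hs] at h1
  rw [leafFun, h1]
  simp [scaledG_one, norm_smul, hq.norm₁, abs_of_pos hs]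

end SmoothPert

/-- The actual orbits are the level sets of the first integral. -/
theorem actualOrbit_eq (h : SmoothPert lam μ m P E) (hq : IsFrame q₁ q₂ q₃)
    (hint : IsIntegrableOn (scaledOmega lam m P E 1) ρ) (hr : leafConst μ ^ 3 * r ≤ ρ)
    (hH : IsRadial (leafFun lam m P E q₁ q₂) μ r) {G₀ E₀ : Cn n → ℝ}
    (hG : ∀ z ∈ Metric.ball (0 : Cn n) r, G₀ z = quadModel lam z + P z)
    (hD : ∀ z ∈ Metric.ball (0 : Cn n) r \ {0}, ∀ v,
      v ∈ crDistribution G₀ E₀ z ↔ scaledOmega lam m P E 1 z v = 0)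
    {p₀ : Cn n} {c : ℝ} (hc : 0 < c) (hp₀ : p₀ = c • q₁) {ρ' R s : ℝ} (hρ' : 0 < ρ') (hρr : ρ' ≤ r)
    (hR : leafConst μ ^ 2 * (Real.sqrt (2 / μ) * R) < ρ') (hRρ : R ^ 2 ≤ μ / 2 * ρ' ^ 2)
    (hs0 : 0 < s) (hsR : s < R) :
    actualOrbit G₀ E₀ p₀ ρ' s =
      {z | z ∈ Metric.ball (0 : Cn n) ρ' ∧ leafFun lam m P E q₁ q₂ z = s ^ 2} := by
  have hμ := h.mu_pos
  have hL := one_le_leafConst hμ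
  have hsub := Metric.ball_subset_ball (x := (0 : Cn n)) hρr
  have hp0 : p₀ ≠ 0 := by
    rw [hp₀]
    refine smul_ne_zero hc.ne' (norm_pos_iff.1 ?_)
    rw [hq.norm₁]
    exact one_pos
  have hGrad := h.isRadial_G ρ'
  have hs2 : s ^ 2 < μ / 2 * ρ' ^ 2 := lt_of_lt_of_le (by gcongr) hRρ
  have hHp : ∀ ra : ℝ, 0 < ra → leafFun lam m P E q₁ q₂ (ra • p₀) =
      quadModel lam (ra • p₀) + P (ra • p₀) := fun ra hra => by
    rw [hp₀, smul_smul]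
    exact h.leafFun_smul_axis hq (mul_pos hra hc)
  ext z
  constructor
  · rintro ⟨ra, hra, ⟨hra1, hra2⟩, hz⟩
    refine ⟨hz.1.1, ?_⟩
    have h1 := apply_eq_of_mem_leaf (H := leafFun lam m P E q₁ q₂) (fun z hz => ?_) hz
    · rw [h1, hHp ra hra, ← hG _ (hsub hra1), hra2]
    · have hz' : z ∈ Metric.ball (0 : Cn n) r \ {0} := ⟨hsub hz.1, hz.2⟩
      have h2 := h.fderiv_leafFun_apply hq hint hz.2 (lt_of_lt_of_le
        (mul_lt_mul_of_pos_left (mem_ball_zero_iff.1 hz'.1) (by positivity)) hr)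
      exact ⟨h2.1, fun v hv => h2.2 v ((hD z hz' v).1 hv)⟩
  · rintro ⟨hz1, hz2⟩
    obtain ⟨ra, ⟨hra, hra1, hra2⟩, -⟩ := hGrad.existsUnique_smul hρ' (by positivity) hs2 hp0
    have hz0 : z ≠ 0 := by
      rintro rfl
      rw [hH.map_zero] at hz2
      exact (pow_pos hs0 2).ne hz2
    refine ⟨ra, hra, ⟨hra1, by rw [hG _ (hsub hra1), hra2]⟩, ⟨hz1, hz0⟩, ?_⟩
    have hb : ∀ {Φ : Cn n → ℝ} (_ : IsRadial Φ μ ρ') {x : Cn n},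
        x ∈ Metric.ball (0 : Cn n) ρ' → Φ x = s ^ 2 → ‖x‖ ≤ Real.sqrt (2 / μ) * R := by
      intro Φ hΦ x hx hxs
      refine (hΦ.norm_le_of_apply_le hx hxs.le).trans ?_
      rw [Real.sqrt_sq hs0.le]
      gcongr
    have hR0 : 0 < R := hs0.trans hsR
    refine h.reflTransGen_of_leafFun_eq hq hint (b := Real.sqrt (2 / μ) * R) ?_ (fun x hx0 hx => ?_)
      (fun x hx v hv => (hD x ⟨hsub hx.1, hx.2⟩ v).2 hv) (smul_ne_zero hra.ne' hp0) hz0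
      (hb hGrad hra1 hra2) (hb (hH.mono hρr) hz1 hz2) ?_
    · refine lt_of_lt_of_le ?_ hr
      have h1 : leafConst μ ^ 2 * (Real.sqrt (2 / μ) * R) < r := hR.trans_le hρr
      have h2 : r ≤ leafConst μ ^ 2 * r := le_mul_of_one_le_left (hρ'.le.trans hρr)
        (one_le_pow₀ hL)
      have h3 := mul_lt_mul_of_pos_left (h1.trans_le h2) (leafConst_pos μ)
      calc _ = leafConst μ * (leafConst μ ^ 2 * (Real.sqrt (2 / μ) * R)) := by ring
        _ < leafConst μ * (leafConst μ ^ 2 * r) := h3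
        _ = _ := by ring
    · exact ⟨mem_ball_zero_iff.2 (hx.trans_lt hR), hx0⟩
    · rw [hHp ra hra, hra2, hz2]

end Orbits

section Germs

variable {n : ℕ} {G G' E E' : Cn n → ℝ} {z : Cn n}

theorem levi_congr (hG : G =ᶠ[𝓝 z] G') (v : Cn n) : levi G z v = levi G' z v := by
  rw [levi, levi, hG.fderiv.fderiv_eq]

theorem wirtinger_congr (hG : G =ᶠ[𝓝 z] G') (k : Fin n) :
    wirtinger (fun x => (G x : ℂ)) k z = wirtinger (fun x => (G' x : ℂ)) k z := by
  have h1 : (fun x => (G x : ℂ)) =ᶠ[𝓝 z] fun x => (G' x : ℂ) := hG.fun_comp Complex.ofReal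
  rw [wirtinger, wirtinger, h1.fderiv_eq]

theorem fieldL_congr (hG : G =ᶠ[𝓝 z] G') (hE : E =ᶠ[𝓝 z] E') (j k : Fin n) :
    fieldL G E j k z = fieldL G' E' j k z := by
  simp only [fieldL, coeffA, wirtinger_congr hG, wirtinger_congr hE]

theorem omegaForm_congr (hG : G =ᶠ[𝓝 z] G') (hE : E =ᶠ[𝓝 z] E') :
    omegaForm G E z = omegaForm G' E' z := by
  simp only [omegaForm, slope', fieldL_congr hG hE, levi_congr hG, levi_congr hE, hG.fderiv_eq,
    hE.fderiv_eq]

end Germs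

section Setup

variable {n : ℕ}

theorem exists_smoothPert {N : ℕ} (hn : 2 ≤ n) (hN : 3 ≤ N) {lam : Fin n → ℝ}
    (hlam : ∀ j, 0 ≤ lam j ∧ lam j < 1 / 2) (hmono : Monotone lam)
    {U : Set (Cn n)} (hU : IsOpen U) (h0 : (0 : Cn n) ∈ U)
    {G E : Cn n → ℝ} (hG : ContDiffOn ℝ N G U) (hE : ContDiffOn ℝ N E U)
    (hGQ : (fun z => G z - quadModel lam z) =O[𝓝 (0 : Cn n)] fun z => ‖z‖ ^ 3)
    (hEo : E =o[𝓝 (0 : Cn n)] fun z => ‖z‖ ^ N) :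
    ∃ μ : ℝ, ∃ P E' : Cn n → ℝ, SmoothPert lam μ (N - 2) P E' ∧ ∃ r : ℝ, 0 < r ∧
      Metric.ball 0 r ⊆ U ∧ ∀ z ∈ Metric.ball (0 : Cn n) r, G z = quadModel lam z + P z ∧
        E z = E' z := by
  set μ : ℝ := 1 - 2 * lam ⟨n - 1, by omega⟩ with hμ
  have hμ0 : 0 < μ := by linarith [(hlam ⟨n - 1, by omega⟩).2]
  have hpow : ∀ {k : ℕ}, 2 < k → (fun z : Cn n => ‖z‖ ^ k) =o[𝓝 (0 : Cn n)] fun z => ‖z‖ ^ 2 :=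
    fun hk => isLittleO_norm_pow_norm_pow hk
  have hGo : (fun z => G z - quadModel lam z) =o[𝓝 (0 : Cn n)] fun z => ‖z‖ ^ 2 :=
    hGQ.trans_isLittleO (hpow (by norm_num))
  have hEo2 : E =o[𝓝 (0 : Cn n)] fun z => ‖z‖ ^ 2 := hEo.trans (hpow (by omega))
  obtain ⟨P, hP, hPG, hP0, hPb⟩ := exists_cutoff (by omega) (hU.mem_nhds h0)
    (hG.sub (contDiff_quadModel lam).contDiffOn) hGo (ε := μ / 8) (by positivity)
  obtain ⟨E', hE', hEE, hE0, hEb⟩ := exists_cutoff (by omega) (hU.mem_nhds h0) hE hEo2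
    (ε := μ / 8) (by positivity)
  have hN2 : ((N - 2 + 2 : ℕ) : WithTop ℕ∞) = N := by
    congr 1
    exact_mod_cast Nat.sub_add_cancel (by omega : 2 ≤ N)
  have hPv : VanishesTo 2 P := VanishesTo.of_isLittleO (hGo.congr' hPG.symm EventuallyEq.rfl)
  have hEv : VanishesTo N E' := VanishesTo.of_isLittleO (hEo.congr' hEE.symm EventuallyEq.rfl)
  have h2N : ((1 + 1 : ℕ) : WithTop ℕ∞) ≤ N := by exact_mod_cast (by omega : 1 + 1 ≤ N)
  have h2N' : (2 : WithTop ℕ∞) ≤ N := by exact_mod_cast (by omega : 2 ≤ N)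
  obtain ⟨r, hr, hrb⟩ := Metric.eventually_nhds_iff_ball.1
    ((hPG.and hEE).and (hU.mem_nhds h0))
  refine ⟨μ, P, E', ?_, r, hr, fun z hz => (hrb z hz).2, fun z hz => ?_⟩
  · exact
      { mu_pos := hμ0
        mu_le := by linarith [(hlam ⟨n - 1, by omega⟩).1]
        lam_nonneg := fun j => (hlam j).1
        lam_le := fun j => by
          have h1 : lam j ≤ lam ⟨n - 1, by omega⟩ := hmono (by
            rw [Fin.le_def]
            have := j.2
            simp only
            omega)
          rw [hμ]
          linarith
        contDiff_P := hP.of_le h2N'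
        contDiff_E := hE'.of_le h2N'
        fderiv_P := (hPv.fderiv (hP.of_le h2N)).apply_zero
        fderiv_E := ((hEv.of_le (by omega : 2 ≤ N)).fderiv (hE'.of_le h2N)).apply_zero
        bound_P := hPb
        bound_E := hEb
        two_le := hn
        m_pos := by omega
        smooth_P := by rw [hN2]; exact hP
        smooth_E := by rw [hN2]; exact hE'
        vanish_P := hPv
        vanish_E := by rwa [Nat.sub_add_cancel (by omega : 2 ≤ N)]
        zero_P := hP0
        zero_E := hE0 }
  · obtain ⟨⟨h1, h2⟩, -⟩ := hrb z hz
    refine ⟨?_, h2.symm⟩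
    rw [h1]
    ring

variable {lam : Fin n → ℝ} {μ : ℝ} {m : ℕ} {P E' : Cn n → ℝ} {r : ℝ} {G E : Cn n → ℝ}

theorem SmoothPert.scaledOmega_one_eq (h : SmoothPert lam μ m P E')
    (hGE : ∀ z ∈ Metric.ball (0 : Cn n) r, G z = quadModel lam z + P z ∧ E z = E' z) {z : Cn n}
    (hz : z ∈ Metric.ball (0 : Cn n) r) : scaledOmega lam m P E' 1 z = omegaForm G E z := by
  have hb := Metric.isOpen_ball.mem_nhds hz
  rw [h.scaledOmega_eq one_ne_zero, inv_one, one_smul, one_smul]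
  refine (omegaForm_congr ?_ ?_).symm
  · filter_upwards [hb] with w hw using (hGE w hw).1
  · filter_upwards [hb] with w hw using (hGE w hw).2

theorem SmoothPert.mem_crDistribution_and_isIntegrableOn (h : SmoothPert lam μ m P E') {U : Set (Cn n)}
    (hU : IsOpen U) (hG : ContDiffOn ℝ 2 G U) (hE : ContDiffOn ℝ 2 E U)
    (hM : ∀ q, IsCRPoint (graphManifold U G E) q → IsNonMinimalAt (graphManifold U G E) q)
    (hrU : Metric.ball 0 r ⊆ U)
    (hGE : ∀ z ∈ Metric.ball (0 : Cn n) r, G z = quadModel lam z + P z ∧ E z = E' z) :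
    (∀ z ∈ Metric.ball (0 : Cn n) r \ {0}, ∀ v,
      v ∈ crDistribution G E z ↔ scaledOmega lam m P E' 1 z v = 0) ∧
    IsIntegrableOn (scaledOmega lam m P E' 1) r := by
  have hgerm : ∀ z ∈ Metric.ball (0 : Cn n) r, G =ᶠ[𝓝 z] (fun z => quadModel lam z + P z) ∧
      E =ᶠ[𝓝 z] E' := fun z hz => by
    have hb := Metric.isOpen_ball.mem_nhds hz
    constructor
    · filter_upwards [hb] with w hw using (hGE w hw).1
    · filter_upwards [hb] with w hw using (hGE w hw).2
  have key : ∀ z ∈ Metric.ball (0 : Cn n) r \ {0}, _ := fun z hz =>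
    crDistribution_eq_ker_and_frobenius hU (Metric.isOpen_ball.sdiff isClosed_singleton)
      (sdiff_subset.trans hrU) hG hE (fun z hz => by
        rw [(hgerm z hz.1).1.fderiv_eq, (hgerm z hz.1).2.fderiv_eq]
        exact h.cForm_ne_zero hz.2) (fun z hz => by
        obtain ⟨e1, e2⟩ := hgerm z hz.1
        simp only [fieldL_congr e1 e2, levi_congr e1]
        exact (h.sum_levi_pos h.two_le hz.2).ne') hM hz
  refine ⟨fun z hz v => ?_, fun z hz0 hzr v w hv hw => ?_⟩
  · rw [(key z hz).1, h.scaledOmega_one_eq hGE hz.1]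
    rfl
  · have hzb : z ∈ Metric.ball (0 : Cn n) r := by simpa using hzr
    have heq : scaledOmega lam m P E' 1 =ᶠ[𝓝 z] omegaForm G E := by
      filter_upwards [Metric.isOpen_ball.mem_nhds hzb] with w hw using h.scaledOmega_one_eq hGE hw
    have hd : DifferentiableAt ℝ (scaledOmega lam m P E' 1) z :=
      ((h.contDiffOn_scaledOmega (zero_le_one (α := ℝ))).contDiffAt
        (isOpen_compl_singleton.mem_nhds hz0)).differentiableAt
        (by exact_mod_cast (by have := h.m_pos; omega : m ≠ 0))
    refine (key z ⟨hzb, hz0⟩).2.2 _ (hd.hasFDerivAt.congr_of_eventuallyEq heq.symm) v w ?_ ?_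
    · rwa [← h.scaledOmega_one_eq hGE hzb]
    · rwa [← h.scaledOmega_one_eq hGE hzb]

end Setup

section RayProjections

variable {n m : ℕ} {G H : Cn n → ℝ} {μ r ρ R s : ℝ}

theorem IsRadial.existsUnique_rayProjection (hH : IsRadial H μ ρ) (hρ : 0 < ρ) (hs : 0 < s)
    (hsρ : s ^ 2 < μ / 2 * ρ ^ 2) {z : Cn n} (hz : z ≠ 0) :
    ∃! z' : Cn n, IsRayProjection {z | z ∈ Metric.ball (0 : Cn n) ρ ∧ H z = s ^ 2} z z' := by
  obtain ⟨t, ⟨ht0, ht1, ht2⟩, huniq⟩ := hH.existsUnique_smul hρ (pow_pos hs 2) hsρ hz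
  refine ⟨t • z, ⟨⟨ht1, ht2⟩, t, ht0, rfl⟩, ?_⟩
  rintro z' ⟨⟨h1, h2⟩, t', ht', rfl⟩
  rw [huniq t' ⟨ht', h1, h2⟩]

theorem IsRadial.exists_rayProjection (hG : IsRadial G μ ρ) (hH : IsRadial H μ ρ) (hρ : 0 < ρ)
    (hs : 0 < s) (hsρ : s ^ 2 < μ / 2 * ρ ^ 2) {z' : Cn n}
    (hz' : z' ∈ {z | z ∈ Metric.ball (0 : Cn n) ρ ∧ H z = s ^ 2}) :
    ∃ z ∈ {z | z ∈ Metric.ball (0 : Cn n) ρ ∧ G z = s ^ 2},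
      IsRayProjection {z | z ∈ Metric.ball (0 : Cn n) ρ ∧ H z = s ^ 2} z z' := by
  have h0 : z' ≠ 0 := by
    rintro rfl
    have h1 := hz'.2
    rw [hH.map_zero] at h1
    exact (pow_pos hs 2).ne h1
  obtain ⟨t, ⟨ht0, ht1, ht2⟩, -⟩ := hG.existsUnique_smul hρ (pow_pos hs 2) hsρ h0
  refine ⟨t • z', ⟨ht1, ht2⟩, hz', t⁻¹, inv_pos.2 ht0, ?_⟩
  rw [smul_smul, inv_mul_cancel₀ ht0.ne', one_smul]

theorem IsRayDeformation.rayMap_eq_rayProjection {θ : Cn n × ℝ → ℝ} {a δ : ℝ}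
    (h : IsRayDeformation m G H μ r θ a δ) (hρ : 0 < ρ) (hρr : ρ ≤ r) (hRδ : R ≤ δ) (hR0 : 0 < R)
    (hR : R ^ 2 ≤ μ / 2 * ρ ^ 2) (hs : 0 < s) (hsR : s < R) {z z' : Cn n}
    (hz : z ∈ Metric.ball (0 : Cn n) ρ) (hzs : G z = s ^ 2)
    (hz' : IsRayProjection {z | z ∈ Metric.ball (0 : Cn n) ρ ∧ H z = s ^ 2} z z') :
    rayMap θ (z, s ^ 2) = (z', s ^ 2) := by
  have hs2 : s ^ 2 < R ^ 2 := by gcongr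
  have hmem : ((z, s ^ 2) : Cn n × ℝ) ∈ sublevelRegion G ρ R := ⟨hz, pow_pos hs 2, hs2, hzs.le⟩
  have hd := h.mem_dom hρr hRδ hR0 hmem
  have h1 := (h.mapsTo hρ hρr hRδ hR0 hR hmem).1
  have h2 := h.level (s ^ 2) hd.1 hd.2.1 z hd.2.2 hzs
  have hz0 : z ≠ 0 := by
    rintro rfl
    rw [h.radial_left.map_zero] at hzs
    exact (pow_pos hs 2).ne hzs
  have h3 : IsRayProjection {z | z ∈ Metric.ball (0 : Cn n) ρ ∧ H z = s ^ 2} z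
      (rayMap θ (z, s ^ 2)).1 :=
    ⟨⟨h1, h2⟩, 1 + θ (z, s ^ 2), h.one_add_pos _, by rw [IsRayDeformation.rayMap_eq]⟩
  exact Prod.ext ((((h.radial_right.mono hρr).existsUnique_rayProjection hρ hs (hs2.trans_le hR)
    hz0).unique h3 hz')) rfl

end RayProjections

theorem proposition2p2 (n N : ℕ) (hn : 2 ≤ n) (hN : 6 ≤ N)
    (lam : Fin n → ℝ) (hlam : ∀ j, 0 ≤ lam j ∧ lam j < 1 / 2) (hmono : Monotone lam)
    (U : Set (Cn n)) (hU : IsOpen U) (h0 : (0 : Cn n) ∈ U)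
    (G E : Cn n → ℝ) (hG : ContDiffOn ℝ N G U) (hE : ContDiffOn ℝ N E U)
    (hGQ : (fun z => G z - quadModel lam z) =O[𝓝 (0 : Cn n)] fun z => ‖z‖ ^ 3)
    (hEo : E =o[𝓝 (0 : Cn n)] fun z => ‖z‖ ^ N)
    (hM : ∀ q, IsCRPoint (graphManifold U G E) q → IsNonMinimalAt (graphManifold U G E) q) :
    ∃ ρ₀ : ℝ, 0 < ρ₀ ∧ ∀ ρ : ℝ, 0 < ρ → ρ ≤ ρ₀ →
    ∃ R₀ : ℝ, 0 < R₀ ∧ ∀ R : ℝ, 0 < R → R ≤ R₀ →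
    let p₀ : Cn n := basePoint (by omega : 0 < n) lam
    let S₀ : ℝ → Set (Cn n) := modelOrbit G ρ
    let S : ℝ → Set (Cn n) := actualOrbit G E p₀ ρ
    let M₀ : Set (Cn n × ℝ) := puncturedRegion S₀ R
    let Ma : Set (Cn n × ℝ) := puncturedRegion S R
    -- the ray projection from each `S₀ r` to `S r` is well defined and onto
    (∀ r : ℝ, 0 < r → r < R →
      (∃! ra : ℝ, 0 < ra ∧ ra • p₀ ∈ S₀ r) ∧
      (∀ z ∈ S₀ r, ∃! z' : Cn n, IsRayProjection (S r) z z') ∧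
      (∀ z' ∈ S r, ∃ z ∈ S₀ r, IsRayProjection (S r) z z')) ∧
    -- it extends to a diffeomorphism with the stated estimates
    (∃ F F' : Cn n × ℝ → Cn n × ℝ,
      IsCkDiffeo (N - 2) F F' M₀ Ma ∧
      (∀ p ∈ M₀, (F p).2 = p.2) ∧
      (∀ r : ℝ, 0 < r → r < R → ∀ z ∈ S₀ r, ∀ z' : Cn n, IsRayProjection (S r) z z' →
        F (z, r ^ 2) = (z', r ^ 2)) ∧
      (∀ a b : ℕ, a + b ≤ N - 2 → ∀ v : Fin a → Cn n,
        mixedDeriv (fun p => F p - p) M₀ v b =o[𝓝[M₀] (0 : Cn n × ℝ)]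
          fun p => p.2 ^ (((N : ℝ) - 1 - a - 2 * b) / 2))) ∧
    -- smoothness of the actual region, the origin included
    IsCkDomainWithBoundary ((N - 1) / 2) (insert 0 Ma) := by
  obtain ⟨μ, P, E', h, r₁, hr₁, hrU, hGE⟩ := exists_smoothPert hn (by omega) hlam hmono hU h0 hG hE
    hGQ hEo
  have h2N : (2 : WithTop ℕ∞) ≤ N := by exact_mod_cast (by omega : 2 ≤ N)
  obtain ⟨hD, hint⟩ := h.mem_crDistribution_and_isIntegrableOn hU (hG.of_le h2N) (hE.of_le h2N) hM
    hrU hGE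
  have hq := isFrame_single (i := (⟨n - 1, by omega⟩ : Fin n)) (j := ⟨0, by omega⟩)
    (by rw [Ne, Fin.mk.injEq]; omega)
  set q₁ : Cn n := EuclideanSpace.single ⟨n - 1, by omega⟩ 1
  set q₂ : Cn n := EuclideanSpace.single ⟨n - 1, by omega⟩ Complex.I
  obtain ⟨r, hr, hrr₁, hHcd, hH⟩ := h.exists_isRadial_leafFun hq hr₁ hint
  obtain ⟨θ, a, A, δ, δ', Θ, haA, hδδ', hpar, hdef⟩ := h.exists_deformation hq hr₁ hint hr hH
  have hμ := h.mu_pos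
  have hL := one_le_leafConst hμ
  have hr_le : r ≤ r₁ := (le_mul_of_one_le_left hr.le (one_le_pow₀ hL)).trans hrr₁
  have hsubr := Metric.ball_subset_ball (x := (0 : Cn n)) hr_le
  set H := leafFun lam (N - 2) P E' q₁ q₂ with hHdef
  set c : ℝ := (Real.sqrt (1 + 2 * lam ⟨n - 1, by omega⟩))⁻¹ with hc
  have hc0 : 0 < c := by
    have := (hlam ⟨n - 1, by omega⟩).1
    positivity
  have hp₀ : basePoint (by omega : 0 < n) lam = c • q₁ := by
    rw [basePoint, single_eq_smul, ← hc]
    exact (algebraMap_smul ℂ c q₁)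
  have hp₀0 : basePoint (by omega : 0 < n) lam ≠ 0 := by
    rw [hp₀]
    refine smul_ne_zero hc0.ne' (norm_pos_iff.1 ?_)
    rw [hq.norm₁]
    exact one_pos
  refine ⟨r, hr, fun ρ hρ hρr => ?_⟩
  have hsubρ := Metric.ball_subset_ball (x := (0 : Cn n)) hρr
  have hδ := hdef.delta_pos
  set K := leafConst μ ^ 2 * Real.sqrt (2 / μ) with hK
  have hK0 : 0 < K := by
    have := leafConst_pos μ
    positivity
  refine ⟨min δ (ρ / (2 * K)), by positivity, fun R hR hRR₀ => ?_⟩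
  have hRδ : R ≤ δ := hRR₀.trans (min_le_left _ _)
  have hRK : leafConst μ ^ 2 * (Real.sqrt (2 / μ) * R) < ρ := by
    rw [← mul_assoc, ← hK]
    have h1 : R * (2 * K) ≤ ρ := by
      rw [← le_div_iff₀ (by positivity)]
      exact hRR₀.trans (min_le_right _ _)
    nlinarith [mul_pos hR hK0]
  have hRρ : R ^ 2 ≤ μ / 2 * ρ ^ 2 := by
    have h1 : Real.sqrt (2 / μ) * R ≤ ρ := by
      refine le_trans ?_ hRK.le
      exact le_mul_of_one_le_left (by positivity) (one_le_pow₀ hL)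
    have h2 : (Real.sqrt (2 / μ) * R) ^ 2 ≤ ρ ^ 2 := by gcongr
    rw [mul_pow, Real.sq_sqrt (by positivity), div_mul_eq_mul_div, div_le_iff₀ hμ] at h2
    linarith
  have hGrad := h.isRadial_G ρ
  have hHrad := hH.mono hρr
  have hsρ : ∀ s, 0 < s → s < R → s ^ 2 < μ / 2 * ρ ^ 2 := fun s hs hsR =>
    lt_of_lt_of_le (by gcongr) hRρ
  have hS₀ : ∀ s, modelOrbit G ρ s =
      {z | z ∈ Metric.ball (0 : Cn n) ρ ∧ quadModel lam z + P z = s ^ 2} := fun s => by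
    ext z
    refine and_congr_right fun hz => ?_
    rw [(hGE z (hsubr (hsubρ hz))).1]
  have hS : ∀ s, 0 < s → s < R → actualOrbit G E (basePoint (by omega : 0 < n) lam) ρ s =
      {z | z ∈ Metric.ball (0 : Cn n) ρ ∧ H z = s ^ 2} := fun s hs hsR =>
    actualOrbit_eq h hq hint hrr₁ hH (fun z hz => (hGE z (hsubr hz)).1)
      (fun z hz => hD z ⟨hsubr hz.1, hz.2⟩) hc0 hp₀ hρ hρr hRK hRρ hs hsR
  have hM₀ : puncturedRegion (modelOrbit G ρ) R =
      sublevelRegion (fun z => quadModel lam z + P z) ρ R :=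
    hGrad.puncturedRegion_eq hρ hRρ hR fun s _ _ => hS₀ s
  have hMa : puncturedRegion (actualOrbit G E (basePoint (by omega : 0 < n) lam) ρ) R =
      sublevelRegion H ρ R := hHrad.puncturedRegion_eq hρ hRρ hR hS
  intro p₀ S₀ S M₀ Ma
  refine ⟨fun s hs hsR => ⟨?_, ?_, ?_⟩, ?_, ?_⟩
  · simp only [S₀, hS₀]
    exact hGrad.existsUnique_smul hρ (pow_pos hs 2) (hsρ s hs hsR) hp₀0
  · intro z hz
    simp only [S₀, hS₀] at hz
    simp only [S, p₀, hS s hs hsR]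
    refine hHrad.existsUnique_rayProjection hρ hs (hsρ s hs hsR) ?_
    rintro rfl
    have h1 := hz.2
    rw [hGrad.map_zero] at h1
    exact (pow_pos hs 2).ne h1
  · simp only [S, p₀, hS s hs hsR, S₀, hS₀]
    exact fun z' hz' => hGrad.exists_rayProjection hHrad hρ hs (hsρ s hs hsR) hz'
  · refine ⟨rayMap θ, Function.invFunOn (rayMap θ)
      (sublevelRegion (fun z => quadModel lam z + P z) ρ R), ?_, fun p _ => rfl, fun s hs hsR z hz z' hz' => ?_, fun j b hjb v => ?_⟩
    · simp only [M₀, S₀, Ma, S, p₀, hM₀, hMa]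
      exact hdef.isCkDiffeo hρ hρr hRδ hR hRρ
    · simp only [S₀, hS₀] at hz
      simp only [S, p₀, hS s hs hsR] at hz'
      exact hdef.rayMap_eq_rayProjection hρ hρr hRδ hR hRρ hs hsR hz.1 hz.2 hz'
    · simp only [M₀, S₀, hM₀]
      have h1 := hdef.isLittleO hpar haA hδδ' hρr hRδ hR hjb v
      have h2 : ((N - 2 : ℕ) : ℝ) + 1 = N - 1 := by
        rw [Nat.cast_sub (by omega)]
        push_cast
        ring
      rwa [h2] at h1
  · simp only [Ma, S, p₀, hMa]
    exact hH.isCkDomainWithBoundary hρr hρ hR (by omega) hHcd
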